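/- \textbf{Conventions.} A \emph{weighted graph} $G=(V,E,\mathsf{wt},\mathsf{wt}')$ is a finite directed graph with $V=\{0,\dots,n-1\}$, $n\ge 1$, $E\subseteq V\times V$, weights $\mathsf{wt}:E\to\mathbb Z$ and $\mathsf{wt}':E\to\mathbb N^{+}$, in which every node has an outgoing edge; $W$ is the largest absolute value of a weight. A simple cycle is a path $C=(u_1,\dots,u_j)$ with $j>1$, $u_1=u_j$ and $u_2,\dots,u_j$ distinct. The \emph{ratio value} of a node $u$ is $\nu^{*}(u)=\min_C \mathsf{wt}(C)/\mathsf{wt}'(C)$, where $C$ ranges over the simple cycles reachable from $u$. The \emph{minimum ratio cycle problem} is: given $G$, output $\nu^{*}(u)$ in lowest terms for every node $u$. Write $\nu^{*}(u)=a_u/b_u$ in lowest terms ($b_u>0$) and $\lambda=\max_u|a_u\cdot b_u|$ (with the convention $\log 0=0$). A rooted tree decomposition with $n'$ bags is \emph{binary} if every bag has at most two children, and \emph{balanced} with constant $c$ if every bag has distance at most $c\lfloor\log_2 n'\rfloor$ from the root. Programs run on a random access machine over integers with read-only input and write-only output. Time is the number of arithmetic operations, memory accesses, input/output operations and tests. Space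 is the number of memory words used (the input and the output are not counted). The graph is given as the numbers of nodes and edges followed by the list of its edges, sorted by source and then by target, with their weights. \textbf{Theorem.} Fix constants $k,w,c$. Let $D$ be any program that, for each weighted graph $G$ of treewidth at most $k$, with $n$ nodes, outputs a balanced (with constant $c$) binary tree decomposition of $G$ of width at most $w$ with at most $c\cdot n$ bags. Let $\mathcal T(G)$ and $\mathcal S(G)$ be the time and the space that $D$ uses on $G$, and $\mathcal M(G)$ the largest absolute value of an integer that $D$ stores on $G$. Then the minimum ratio cycle problem for the weighted graphs $G$ of treewidth at most $k$ can be solved \begin{enumerate} \item by a program that uses $O(\mathcal T(G)+n\cdot\log\lambda)$ time and $O(\mathcal S(G)+n)$ space; and \item by a program that uses $O(\mathcal S(G)+\log n)$ space. \end{enumerate} In both cases every integer that the program stores has absolute value at most $(n\cdot W+\mathcal M(G)+1)^{O(1)}$. The constants in $O(\cdot)$ depend only on $k$, $w$ and $c$. -/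

import Mathlib

namespace RatioCycle

/-! ## Weighted graphs, cycles and ratio values -/

/-- A finite directed graph on the nodes `0, …, n - 1` (self-loops allowed) with an integer weight
and a strictly positive integer weight on every edge, in which every node has an outgoing edge.
Only the weights of edges matter. -/
structure WGraph (n : ℕ) where
  edges : Finset (Fin n × Fin n)
  wt : Fin n × Fin n → ℤ
  wt' : Fin n × Fin n → ℕ+
  exists_out : ∀ u, ∃ v, (u, v) ∈ edges

namespace WGraph

variable {n : ℕ}

/-- `G.Adj u v`: there is an edge from `u` to `v`. -/
def Adj (G : WGraph n) (u v : Fin n) : Prop := (u, v) ∈ G.edges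

/-- A finite path `(u₁, …, u_j)`, `j ≥ 1`. -/
def IsPath (G : WGraph n) (p : List (Fin n)) : Prop := p ≠ [] ∧ p.IsChain G.Adj

/-- A simple cycle: a path `(u₁, …, u_j)` with `j > 1` and `u₁ = u_j` such that
`u₂, …, u_j` are distinct. -/
def IsSimpleCycle (G : WGraph n) (p : List (Fin n)) : Prop :=
  G.IsPath p ∧ 1 < p.length ∧ p.head? = p.getLast? ∧ p.tail.Nodup

/-- The list of edges `(u₁, u₂), (u₂, u₃), …` traversed by a path. -/
def steps (p : List (Fin n)) : List (Fin n × Fin n) := p.zip p.tail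

def pathWt (G : WGraph n) (p : List (Fin n)) : ℤ := ((steps p).map G.wt).sum

def pathWt' (G : WGraph n) (p : List (Fin n)) : ℕ := ((steps p).map fun e => (G.wt' e : ℕ)).sum

/-- The value `wt(p) / wt'(p)` of a path. -/
def pathValue (G : WGraph n) (p : List (Fin n)) : ℚ := (G.pathWt p : ℚ) / (G.pathWt' p : ℚ)

/-- The path `p` is reachable from `u` (some, equivalently for a cycle every, node of it is). -/
def Reaches (G : WGraph n) (u : Fin n) (p : List (Fin n)) : Prop :=
  ∃ v ∈ p, Relation.ReflTransGen G.Adj u v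

/-- `q` is the ratio value of `u`: the minimum of the values of the simple cycles reachable
from `u`. -/
def IsRatioValue (G : WGraph n) (u : Fin n) (q : ℚ) : Prop :=
  IsLeast {r | ∃ p, G.IsSimpleCycle p ∧ G.Reaches u p ∧ r = G.pathValue p} q

/-- The largest absolute value of a weight of an edge. -/
def maxWeight (G : WGraph n) : ℕ :=
  G.edges.sup fun e => max (G.wt e).natAbs (G.wt' e : ℕ)

/-- The edges, listed by source and then by target. -/
def edgeList (G : WGraph n) : List (Fin n × Fin n) :=
  ((List.finRange n) ×ˢ (List.finRange n)).filter (· ∈ G.edges)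

/-- The input words that present the graph to a program: the number of nodes, the number of edges,
and for each edge its source, its target and its two weights. -/
def encode (G : WGraph n) : List ℤ :=
  (n : ℤ) :: (G.edges.card : ℤ) ::
    G.edgeList.flatMap fun e => [(e.1.val : ℤ), (e.2.val : ℤ), G.wt e, ((G.wt' e : ℕ) : ℤ)]

end WGraph

/-- `λ`: the maximum over the nodes `u` of `|a_u * b_u|`, where `a_u / b_u` is `ν u` in lowest
terms. -/
def lam {n : ℕ} (ν : Fin n → ℚ) : ℕ :=
  Finset.univ.sup fun u => (ν u).num.natAbs * (ν u).den

/-- The output words that present a rational value for each node: numerator and denominator in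
lowest terms, node by node. -/
def encodeValues {n : ℕ} (ν : Fin n → ℚ) : List ℤ :=
  (List.finRange n).flatMap fun u => [(ν u).num, ((ν u).den : ℤ)]

/-! ## Tree decompositions -/

/-- A rooted tree (given by parent pointers, the root pointing to itself) with a list of nodes,
the bag, at each of its vertices. -/
structure BagTree (n : ℕ) where
  size : ℕ
  parent : Fin size → Fin size
  root : Fin size
  bag : Fin size → List (Fin n)

namespace BagTree

variable {n : ℕ}

def tree (T : BagTree n) : SimpleGraph (Fin T.size) :=
  SimpleGraph.fromRel fun i j => T.parent i = j

/-- The level of a bag: its distance from the root. -/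
noncomputable def level (T : BagTree n) (i : Fin T.size) : ℕ := T.tree.dist T.root i

def children (T : BagTree n) (i : Fin T.size) : Finset (Fin T.size) :=
  Finset.univ.filter fun j => j ≠ T.root ∧ T.parent j = i

/-- The width: the size of the largest bag minus one. -/
def width (T : BagTree n) : ℕ := (Finset.univ.sup fun i => (T.bag i).length) - 1

/-- `T` is a (rooted) tree decomposition of the graph `G`. -/
structure IsTreeDecomposition (T : BagTree n) (G : WGraph n) : Prop where
  isTree : T.tree.IsTree
  parent_root : T.parent T.root = T.root
  level_parent : ∀ i, i ≠ T.root → T.level (T.parent i) + 1 = T.level i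
  nodup : ∀ i, (T.bag i).Nodup
  node_covered : ∀ u, ∃ i, u ∈ T.bag i
  edge_covered : ∀ u v, G.Adj u v → ∃ i, u ∈ T.bag i ∧ v ∈ T.bag i
  contiguous : ∀ (i j : Fin T.size) (p : T.tree.Walk i j), p.IsPath → ∀ k ∈ p.support,
    ∀ u, u ∈ T.bag i → u ∈ T.bag j → u ∈ T.bag k

def IsBinary (T : BagTree n) : Prop := ∀ i, (T.children i).card ≤ 2

/-- Balanced with constant `c`: every level is at most `c` times the (binary) logarithm of the
number of bags. -/
def IsBalanced (T : BagTree n) (c : ℕ) : Prop := ∀ i, T.level i ≤ c * Nat.log 2 T.size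

/-- The output words that present `T`: the number of bags, and for each bag the index of its
parent, the number of its nodes, and its nodes. -/
def encode (T : BagTree n) : List ℤ :=
  (T.size : ℤ) :: (List.finRange T.size).flatMap fun i =>
    ((T.parent i).val : ℤ) :: ((T.bag i).length : ℤ) :: (T.bag i).map fun u => (u.val : ℤ)

end BagTree

/-- The treewidth: the smallest width of a tree decomposition. -/
noncomputable def WGraph.treewidth {n : ℕ} (G : WGraph n) : ℕ :=
  sInf {w | ∃ T : BagTree n, T.IsTreeDecomposition G ∧ T.width = w}

/-! ## The machine model

A random access machine with read-only input and write-only output. A program uses finitely many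
integer variables and finitely many integer arrays with random access. -/

inductive Op
  | add | sub | mul | div

/-- Arithmetic operations (`div` rounds down for a positive divisor, and division by `0`
returns `0`). -/
def Op.eval : Op → ℤ → ℤ → ℤ
  | .add, a, b => a + b
  | .sub, a, b => a - b
  | .mul, a, b => a * b
  | .div, a, b => a / b

/-- Programs; variables and arrays are named by natural numbers. -/
inductive Program
  /-- `x := z` -/
  | const (x : ℕ) (z : ℤ)
  /-- `x := y o z` -/
  | op (o : Op) (x y z : ℕ)
  /-- `x := a[i]` -/
  | load (x a i : ℕ)
  /-- `a[i] := y` -/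
  | store (a i y : ℕ)
  /-- `x :=` the input word number `i` -/
  | read (x i : ℕ)
  /-- append `x` to the output -/
  | write (x : ℕ)
  | seq (p q : Program)
  /-- if `x > 0` then `p` else `q` -/
  | cond (x : ℕ) (p q : Program)
  /-- while `x > 0` do `p` -/
  | loop (x : ℕ) (p : Program)

/-- The variables named in a program. -/
def Program.vars : Program → Finset ℕ
  | .const x _ => {x}
  | .op _ x y z => {x, y, z}
  | .load x _ i => {x, i}
  | .store _ i y => {i, y}
  | .read x i => {x, i}
  | .write x => {x}
  | .seq p q => p.vars ∪ q.vars
  | .cond x p q => {x} ∪ (p.vars ∪ q.vars)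
  | .loop x p => {x} ∪ p.vars

/-- The arrays named in a program. -/
def Program.arrays : Program → Finset ℕ
  | .const _ _ => ∅
  | .op _ _ _ _ => ∅
  | .load _ a _ => {a}
  | .store a _ _ => {a}
  | .read _ _ => ∅
  | .write _ => ∅
  | .seq p q => p.arrays ∪ q.arrays
  | .cond _ p q => p.arrays ∪ q.arrays
  | .loop _ p => p.arrays

/-- Configurations of the machine. Besides the contents of the memory and the output so far they
record, for each array, one more than the largest index accessed so far (`ext`), and the largest
absolute value of an integer put into the memory so far (`peak`). -/
structure Config where
  var : ℕ → ℤ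
  arr : ℕ → ℕ → ℤ
  out : List ℤ
  ext : ℕ → ℕ
  peak : ℕ

namespace Config

/-- Initially the memory is zero and the output is empty. -/
def init : Config := ⟨fun _ => 0, fun _ _ => 0, [], fun _ => 0, 0⟩

def setVar (s : Config) (x : ℕ) (z : ℤ) : Config :=
  { s with var := Function.update s.var x z, peak := max s.peak z.natAbs }

/-- Record an access to cell `k` of array `a`. -/
def touch (s : Config) (a k : ℕ) : Config :=
  { s with ext := Function.update s.ext a (max (s.ext a) (k + 1)) }

def setArr (s : Config) (a k : ℕ) (z : ℤ) : Config :=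
  { s with
    arr := Function.update s.arr a (Function.update (s.arr a) k z)
    peak := max s.peak z.natAbs }

end Config

/-- `Exec inp p s t s'`: on the input words `inp`, the program `p` started in `s` terminates in `s'`
after `t` operations. Every instruction and every test costs one operation. A program that uses
a negative index, or an index beyond the end of the input, gets stuck. -/
inductive Exec (inp : List ℤ) : Program → Config → ℕ → Config → Prop
  | const (s : Config) (x : ℕ) (z : ℤ) : Exec inp (.const x z) s 1 (s.setVar x z)
  | op (s : Config) (o : Op) (x y z : ℕ) :
      Exec inp (.op o x y z) s 1 (s.setVar x (o.eval (s.var y) (s.var z)))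
  | load (s : Config) (x a i k : ℕ) (hk : s.var i = (k : ℤ)) :
      Exec inp (.load x a i) s 1 ((s.touch a k).setVar x (s.arr a k))
  | store (s : Config) (a i y k : ℕ) (hk : s.var i = (k : ℤ)) :
      Exec inp (.store a i y) s 1 ((s.touch a k).setArr a k (s.var y))
  | read (s : Config) (x i k : ℕ) (v : ℤ) (hk : s.var i = (k : ℤ)) (hv : inp[k]? = some v) :
      Exec inp (.read x i) s 1 (s.setVar x v)
  | write (s : Config) (x : ℕ) :
      Exec inp (.write x) s 1 { s with out := s.out ++ [s.var x] }
  | seq (s s' s'' : Config) (p q : Program) (t t' : ℕ)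
      (hp : Exec inp p s t s') (hq : Exec inp q s' t' s'') :
      Exec inp (.seq p q) s (t + t') s''
  | cond_pos (s s' : Config) (x : ℕ) (p q : Program) (t : ℕ) (hx : 0 < s.var x)
      (hp : Exec inp p s t s') : Exec inp (.cond x p q) s (t + 1) s'
  | cond_neg (s s' : Config) (x : ℕ) (p q : Program) (t : ℕ) (hx : ¬ 0 < s.var x)
      (hq : Exec inp q s t s') : Exec inp (.cond x p q) s (t + 1) s'
  | loop_pos (s s' s'' : Config) (x : ℕ) (p : Program) (t t' : ℕ) (hx : 0 < s.var x)
      (hp : Exec inp p s t s') (hl : Exec inp (.loop x p) s' t' s'') :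
      Exec inp (.loop x p) s (t + t' + 1) s''
  | loop_neg (s : Config) (x : ℕ) (p : Program) (hx : ¬ 0 < s.var x) :
      Exec inp (.loop x p) s 1 s

/-- The program `p`, run on the input words `inp` from the initial configuration, terminates with
the output words `out` after `t` operations; it uses `s` words of memory (one per variable, and
for each array one word for its base and the cells up to the largest index accessed; the input and
the output are not counted), and no word ever holds an integer of absolute value above `m`
(`m` being the largest one that occurs). -/
def Runs (p : Program) (inp : List ℤ) (t s m : ℕ) (out : List ℤ) : Prop :=
  ∃ f : Config, Exec inp p Config.init t f ∧ f.out = out ∧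
    s = p.vars.card + ∑ a ∈ p.arrays, (f.ext a + 1) ∧ m = f.peak

/-- The program `D` constructs, for each graph of treewidth at most `k` with at least one node,
a balanced (with constant `c`) binary tree decomposition of width at most `w` with at most `c * n`
bags; on the graph `G` it needs time `T G`, space `S G`, and integers up to `M G` in absolute
value. -/
def ConstructsDecomposition (D : Program) (k w c : ℕ) (T S M : (n : ℕ) → WGraph n → ℕ) : Prop :=
  ∀ (n : ℕ) (G : WGraph n), 0 < n → G.treewidth ≤ k →
    ∃ B : BagTree n, B.IsTreeDecomposition G ∧ B.IsBinary ∧ B.IsBalanced c ∧ B.width ≤ w ∧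
      B.size ≤ c * n ∧ Runs D G.encode (T n G) (S n G) (M n G) B.encode

end RatioCycle

open RatioCycle

/-! Comparing a ratio value with a fraction `a / b`, `b > 0`, is a question about closed walks. Give
every edge the weight `b * wt - a * wt'`. Then `ν u < a / b` exactly when `u` reaches a closed walk
of negative weight, and, the weights being integers, `ν u ≤ a / b` exactly when `u` reaches one of
weight less than `1`. Both programs search for the ratio values with such a test as an oracle.

The fast program searches for all nodes at once, each node having its own threshold. The threshold
of `u` depends on `ν u` only. Ratio values are constant along a path from `u` to an optimal cycle of
`u` and on that cycle, so path and cycle survive when only edges between nodes with equal thresholds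
are kept; hence one run of the oracle compares every node with its own threshold
(`WGraph.bad_cw_iff`). The search descends the Stern-Brocot tree: the pair of numerator and
denominator is `α X + β Y` for a unimodular pair `X`, `Y`, and a maximal sequence of moves in one
direction is a division step of Euclid's algorithm on `(α, β)`. Its quotient is found by doubling a
step size and halving it again. The product of the two coefficients is at first `|num| * den`, and
each phase divides it by a power of two that pays for the comparisons made, so there are `O(log λ)`
rounds (`NS.inv_step`), and the last candidate is in lowest terms (`NS.Inv.cand_eq`).

The oracle takes linear time. The bags are visited parents first, the nodes are ranked by first
appearance and eliminated by decreasing rank. By connectedness of the bags that contain a node, the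
lower neighbours of `v` at its elimination lie in the bag where `v` was first seen
(`Visited.visit`), so each elimination costs a constant. Elimination keeps the least weights of
walks through eliminated nodes; a light closed walk shows on the diagonal. Such a node is excluded
as an inner vertex and its predecessors of lower rank are marked; a final pass by increasing rank
completes the set of nodes that reach a light closed walk (`elim_inv_step`, `elims_correct`). The
decomposition comes from a run of `D` whose output is redirected into an array.

The program for small space does not use the decomposition. The least weight of a walk with at most
`2 ^ (j + 1)` edges is a minimum over middle nodes of sums of two values for `2 ^ j` edges; this
recursion has logarithmic depth and constantly many words per level (`works`). A light closed walk
is an edge together with a walk back (`bad_iff_dist2`). Fractions are tried by increasing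
denominator, so the first hit is in lowest terms; the running time is irrelevant.

On the machine side, programs are written in a structured language. Its weakest preconditions count
time and enforce a bound `B` on the values and a bound `E` on the array extents (`Cmd.comp_exec`),
and what a program leaves alone is read off its text (`Cmd.wp_frame`). -/

namespace RatioCycle

/-! ## A small structured language on top of the machine -/

/-- Expressions over variables, arrays and the input. -/
inductive Ex
  | C (z : ℤ)
  | V (x : ℕ)
  | bin (o : Op) (e f : Ex)
  | lt (e f : Ex)
  | eq (e f : Ex)
  | and (e f : Ex)
  | or (e f : Ex)
  | A (a : ℕ) (e : Ex)
  | R (e : Ex)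

instance : Add Ex := ⟨.bin .add⟩
instance : Sub Ex := ⟨.bin .sub⟩
instance : Mul Ex := ⟨.bin .mul⟩
instance : Div Ex := ⟨.bin .div⟩

/-- Memory contents visible to structured programs. -/
@[ext]
structure St where
  var : ℕ → ℤ
  arr : ℕ → ℤ → ℤ
  out : List ℤ

namespace St

def set (s : St) (x : ℕ) (z : ℤ) : St := { s with var := Function.update s.var x z }

def put (s : St) (a : ℕ) (k z : ℤ) : St :=
  { s with arr := Function.update s.arr a (Function.update (s.arr a) k z) }

def emit (s : St) (z : ℤ) : St := { s with out := s.out ++ [z] }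

variable (s : St) (x a : ℕ) (k z : ℤ)

@[simp] theorem set_var (y : ℕ) : (s.set x z).var y = if y = x then z else s.var y := by
  simp [set, Function.update_apply]
@[simp] theorem set_arr : (s.set x z).arr = s.arr := rfl
@[simp] theorem set_out : (s.set x z).out = s.out := rfl
@[simp] theorem put_var : (s.put a k z).var = s.var := rfl
@[simp] theorem put_out : (s.put a k z).out = s.out := rfl
@[simp] theorem put_arr (b : ℕ) (j : ℤ) :
    (s.put a k z).arr b j = if b = a ∧ j = k then z else s.arr b j := by
  by_cases h : b = a
  · subst h; by_cases h' : j = k <;> simp [put, h']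
  · simp [put, h]
theorem put_arr_ne (b : ℕ) (h : b ≠ a) : (s.put a k z).arr b = s.arr b := by simp [put, h]
@[simp] theorem emit_var : (s.emit z).var = s.var := rfl
@[simp] theorem emit_arr : (s.emit z).arr = s.arr := rfl
@[simp] theorem emit_out : (s.emit z).out = s.out ++ [z] := rfl

end St

/-- The input, a bound on all values, a bound on the extent of the arrays below `100`, and the
extents of the other arrays. Variables from `100` on hold temporary values. -/
structure Ctx where
  inp : List ℤ
  B : ℤ
  E : ℤ
  ext0 : ℕ → ℕ
  one_le : 1 ≤ B

def Ctx.bd (Γ : Ctx) (z : ℤ) : Prop := -Γ.B ≤ z ∧ z ≤ Γ.B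

/-- A total version of reading the input. The default `0` and the truncation of negative indices
never matter, because `Ex.ok` demands an index inside the input. -/
def inAt (inp : List ℤ) (i : ℤ) : ℤ := inp.getD i.toNat 0

namespace Ex

variable (Γ : Ctx) (s : St)

def eval : Ex → ℤ
  | C z => z
  | V x => s.var x
  | bin o e f => o.eval e.eval f.eval
  | lt e f => if e.eval < f.eval then 1 else 0
  | eq e f => if e.eval = f.eval then 1 else 0
  | and e f => if 0 < e.eval ∧ 0 < f.eval then 1 else 0
  | or e f => if 0 < e.eval ∨ 0 < f.eval then 1 else 0
  | A a e => s.arr a e.eval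
  | R e => inAt Γ.inp e.eval

/-- Under these conditions the evaluation cannot get stuck. Comparisons carry no bound of their own:
their differences occur only in temporaries, which may reach `2 * B + 1`. -/
def ok : Ex → Prop
  | C z => Γ.bd z
  | V x => x < 100
  | bin o e f => e.ok ∧ f.ok ∧ Γ.bd (o.eval (e.eval Γ s) (f.eval Γ s))
  | lt e f => e.ok ∧ f.ok
  | eq e f => e.ok ∧ f.ok
  | and e f => e.ok ∧ f.ok
  | or e f => e.ok ∧ f.ok
  | A a e => a < 100 ∧ e.ok ∧ 0 ≤ e.eval Γ s ∧ e.eval Γ s < Γ.E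
  | R e => e.ok ∧ 0 ≤ e.eval Γ s ∧ e.eval Γ s < Γ.inp.length ∧ Γ.bd (inAt Γ.inp (e.eval Γ s))

/-- Counts the operations of `code`, along the longest branch for comparisons and connectives; hence
only an upper bound on the time. -/
def cost : Ex → ℕ
  | C _ => 1
  | V _ => 2
  | bin _ e f => e.cost + f.cost + 1
  | lt e f => e.cost + f.cost + 3
  | eq e f => e.cost + f.cost + 6
  | and e f => e.cost + f.cost + 3
  | or e f => e.cost + f.cost + 3
  | A _ e => e.cost + 1
  | R e => e.cost + 1

variable (e f : Ex) (x a : ℕ) (z : ℤ)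

@[simp] theorem eval_C : (C z).eval Γ s = z := rfl
@[simp] theorem eval_V : (V x).eval Γ s = s.var x := rfl
@[simp] theorem eval_add : (e + f).eval Γ s = e.eval Γ s + f.eval Γ s := rfl
@[simp] theorem eval_sub : (e - f).eval Γ s = e.eval Γ s - f.eval Γ s := rfl
@[simp] theorem eval_mul : (e * f).eval Γ s = e.eval Γ s * f.eval Γ s := rfl
@[simp] theorem eval_div : (e / f).eval Γ s = e.eval Γ s / f.eval Γ s := rfl
@[simp] theorem eval_lt : (lt e f).eval Γ s = if e.eval Γ s < f.eval Γ s then 1 else 0 := rfl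
@[simp] theorem eval_eq : (eq e f).eval Γ s = if e.eval Γ s = f.eval Γ s then 1 else 0 := rfl
@[simp] theorem eval_and :
    (and e f).eval Γ s = if 0 < e.eval Γ s ∧ 0 < f.eval Γ s then 1 else 0 := rfl
@[simp] theorem eval_or :
    (or e f).eval Γ s = if 0 < e.eval Γ s ∨ 0 < f.eval Γ s then 1 else 0 := rfl
@[simp] theorem eval_A : (A a e).eval Γ s = s.arr a (e.eval Γ s) := rfl
@[simp] theorem eval_R : (R e).eval Γ s = inAt Γ.inp (e.eval Γ s) := rfl

@[simp] theorem ok_C : (C z).ok Γ s ↔ -Γ.B ≤ z ∧ z ≤ Γ.B := Iff.rfl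
@[simp] theorem ok_V : (V x).ok Γ s ↔ x < 100 := Iff.rfl
@[simp] theorem ok_add : (e + f).ok Γ s ↔ e.ok Γ s ∧ f.ok Γ s ∧
    (-Γ.B ≤ e.eval Γ s + f.eval Γ s ∧ e.eval Γ s + f.eval Γ s ≤ Γ.B) := Iff.rfl
@[simp] theorem ok_sub : (e - f).ok Γ s ↔ e.ok Γ s ∧ f.ok Γ s ∧
    (-Γ.B ≤ e.eval Γ s - f.eval Γ s ∧ e.eval Γ s - f.eval Γ s ≤ Γ.B) := Iff.rfl
@[simp] theorem ok_mul : (e * f).ok Γ s ↔ e.ok Γ s ∧ f.ok Γ s ∧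
    (-Γ.B ≤ e.eval Γ s * f.eval Γ s ∧ e.eval Γ s * f.eval Γ s ≤ Γ.B) := Iff.rfl
@[simp] theorem ok_div : (e / f).ok Γ s ↔ e.ok Γ s ∧ f.ok Γ s ∧
    (-Γ.B ≤ e.eval Γ s / f.eval Γ s ∧ e.eval Γ s / f.eval Γ s ≤ Γ.B) := Iff.rfl
@[simp] theorem ok_lt : (lt e f).ok Γ s ↔ e.ok Γ s ∧ f.ok Γ s := Iff.rfl
@[simp] theorem ok_eq : (eq e f).ok Γ s ↔ e.ok Γ s ∧ f.ok Γ s := Iff.rfl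
@[simp] theorem ok_and : (and e f).ok Γ s ↔ e.ok Γ s ∧ f.ok Γ s := Iff.rfl
@[simp] theorem ok_or : (or e f).ok Γ s ↔ e.ok Γ s ∧ f.ok Γ s := Iff.rfl
@[simp] theorem ok_A : (A a e).ok Γ s ↔
    a < 100 ∧ e.ok Γ s ∧ 0 ≤ e.eval Γ s ∧ e.eval Γ s < Γ.E := Iff.rfl
@[simp] theorem ok_R : (R e).ok Γ s ↔ e.ok Γ s ∧ 0 ≤ e.eval Γ s ∧
    e.eval Γ s < Γ.inp.length ∧ Γ.bd (inAt Γ.inp (e.eval Γ s)) := Iff.rfl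

@[simp] theorem cost_C : (C z).cost = 1 := rfl
@[simp] theorem cost_V : (V x).cost = 2 := rfl
@[simp] theorem cost_add : (e + f).cost = e.cost + f.cost + 1 := rfl
@[simp] theorem cost_sub : (e - f).cost = e.cost + f.cost + 1 := rfl
@[simp] theorem cost_mul : (e * f).cost = e.cost + f.cost + 1 := rfl
@[simp] theorem cost_div : (e / f).cost = e.cost + f.cost + 1 := rfl
@[simp] theorem cost_lt : (lt e f).cost = e.cost + f.cost + 3 := rfl
@[simp] theorem cost_eq : (eq e f).cost = e.cost + f.cost + 6 := rfl
@[simp] theorem cost_and : (and e f).cost = e.cost + f.cost + 3 := rfl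
@[simp] theorem cost_or : (or e f).cost = e.cost + f.cost + 3 := rfl
@[simp] theorem cost_A : (A a e).cost = e.cost + 1 := rfl
@[simp] theorem cost_R : (R e).cost = e.cost + 1 := rfl

/-- Code that puts the value of the expression into variable `t`, using variables beyond `t`. -/
def code : Ex → ℕ → Program
  | C z, t => .const t z
  | V x, t => .seq (.const t 0) (.op .add t t x)
  | bin o e f, t => .seq (e.code t) (.seq (f.code (t + 1)) (.op o t t (t + 1)))
  | lt e f, t => .seq (e.code t) (.seq (f.code (t + 1)) (.seq (.op .sub t (t + 1) t)
      (.cond t (.const t 1) (.const t 0))))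
  -- A positive difference excludes equality; otherwise the difference plus one is positive exactly
  -- when the two values agree.
  | eq e f, t => .seq (e.code t) (.seq (f.code (t + 1)) (.seq (.op .sub t t (t + 1))
      (.cond t (.const t 0) (.seq (.const (t + 1) 1) (.seq (.op .add t t (t + 1))
        (.cond t (.const t 1) (.const t 0)))))))
  | and e f, t => .seq (e.code t) (.seq (f.code (t + 1))
      (.cond t (.cond (t + 1) (.const t 1) (.const t 0)) (.const t 0)))
  | or e f, t => .seq (e.code t) (.seq (f.code (t + 1))
      (.cond t (.const t 1) (.cond (t + 1) (.const t 1) (.const t 0))))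
  | A a e, t => .seq (e.code t) (.load t a t)
  | R e, t => .seq (e.code t) (.read t t)

end Ex

@[simp] theorem zero_lt_ite_one (p : Prop) [Decidable p] : 0 < (if p then (1 : ℤ) else 0) ↔ p := by
  split_ifs <;> simp_all

/-- The machine configuration `c` represents the state `s`. -/
structure Sim (Γ : Ctx) (c : Config) (s : St) : Prop where
  var : ∀ x < 100, c.var x = s.var x
  arr : ∀ a < 100, ∀ k : ℕ, c.arr a k = s.arr a k
  out : c.out = s.out
  bvar : ∀ x < 100, Γ.bd (s.var x)
  barr : ∀ a < 100, ∀ k : ℕ, Γ.bd (s.arr a k)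
  peak : (c.peak : ℤ) ≤ 2 * Γ.B + 1
  ext : ∀ a < 100, (c.ext a : ℤ) ≤ Γ.E
  ext0 : ∀ a, 100 ≤ a → c.ext a = Γ.ext0 a

/-- Temporaries are invisible in the abstract state and count only for the peak. The bound `2 * B +
1` covers a difference of two values within `B` and the `+ 1` of the equality test. -/
theorem Sim.setTmp {Γ : Ctx} {c : Config} {s : St} (h : Sim Γ c s) {t : ℕ} (ht : 100 ≤ t) {z : ℤ}
    (hz : -(2 * Γ.B + 1) ≤ z ∧ z ≤ 2 * Γ.B + 1) : Sim Γ (c.setVar t z) s where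
  var x hx := by
    have : x ≠ t := by omega
    simp [Config.setVar, this, h.var x hx]
  arr := h.arr
  out := h.out
  bvar := h.bvar
  barr := h.barr
  peak := by have := h.peak; have := abs_le.2 hz; simp [Config.setVar]; omega
  ext := h.ext
  ext0 := h.ext0

theorem Sim.touch {Γ : Ctx} {c : Config} {s : St} (h : Sim Γ c s) {a k : ℕ} (ha : a < 100)
    (hk : (k : ℤ) < Γ.E) : Sim Γ (c.touch a k) s where
  var := h.var
  arr := h.arr
  out := h.out
  bvar := h.bvar
  barr := h.barr
  peak := h.peak
  ext b hb := by
    have := h.ext b hb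
    have h2 := h.ext a ha
    simp only [Config.touch, Function.update_apply]
    split_ifs <;> push_cast <;> omega
  ext0 b hb := by
    have : b ≠ a := by omega
    simp [Config.touch, this, h.ext0 b hb]

/-! ### Correctness of the code for expressions. -/

namespace Ex

/-- The last clause makes the induction work: the right operand is evaluated with temporaries from
`t + 1` on, so the left value in `t` survives. -/
theorem code_exec {Γ : Ctx} {s : St} (e : Ex) : ∀ {c : Config} {t : ℕ}, Sim Γ c s → 100 ≤ t →
    e.ok Γ s → ∃ τ c', Exec Γ.inp (e.code t) c τ c' ∧ τ ≤ e.cost ∧ Sim Γ c' s ∧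
      c'.var t = e.eval Γ s ∧ Γ.bd (e.eval Γ s) ∧ ∀ x < t, c'.var x = c.var x := by
  have hone := Γ.one_le
  induction e with
  | C z =>
    intro c t h ht hok
    refine ⟨1, _, .const _ _ _, le_rfl, h.setTmp ht ?_, by simp [Config.setVar], hok, ?_⟩
    · obtain ⟨h1, h2⟩ := hok; constructor <;> omega
    · intro x hx
      have : x ≠ t := by omega
      simp [Config.setVar, this]
  | V x =>
    intro c t h ht hok
    have hx : x < 100 := hok
    have hxt : x ≠ t := by omega
    have hb := h.bvar x hok
    refine ⟨2, _, .seq _ _ _ _ _ 1 1 (.const _ _ _) (.op _ _ _ _ _), le_rfl,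
      (h.setTmp ht (z := 0) ⟨by omega, by omega⟩).setTmp ht ?_, ?_, hb, ?_⟩
    · obtain ⟨h1, h2⟩ := hb
      simp [Config.setVar, Op.eval, hxt, h.var x hx]; constructor <;> omega
    · simp [Config.setVar, Op.eval, hxt, h.var x hx]
    · intro y hy
      have : y ≠ t := by omega
      simp [Config.setVar, this]
  | bin o e f ihe ihf =>
    intro c t h ht ⟨he, hf, hb⟩
    obtain ⟨τ1, c1, x1, l1, s1, v1, b1, k1⟩ := ihe h ht he
    obtain ⟨τ2, c2, x2, l2, s2, v2, b2, k2⟩ := ihf s1 (t := t + 1) (by omega) hf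
    refine ⟨_, _, .seq _ _ _ _ _ _ _ x1 (.seq _ _ _ _ _ _ _ x2 (.op _ _ _ _ _)), ?_,
      s2.setTmp ht ?_, ?_, hb, ?_⟩
    · simp only [cost]; omega
    · rw [k2 t (by omega), v1, v2]; obtain ⟨h1, h2⟩ := hb; constructor <;> omega
    · simp [Config.setVar, k2 t (by omega), v1, v2, eval]
    · intro y hy
      have : y ≠ t := by omega
      simp [Config.setVar, this, k2 y (by omega), k1 y hy]
  | lt e f ihe ihf =>
    intro c t h ht ⟨he, hf⟩
    obtain ⟨τ1, c1, x1, l1, s1, v1, b1, k1⟩ := ihe h ht he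
    obtain ⟨τ2, c2, x2, l2, s2, v2, b2, k2⟩ := ihf s1 (t := t + 1) (by omega) hf
    have w1 := k2 t (by omega)
    have s3 : Sim Γ (c2.setVar t (Op.sub.eval (c2.var (t + 1)) (c2.var t))) s := by
      refine s2.setTmp ht ?_
      rw [w1, v1, v2]; obtain ⟨h1, h2⟩ := b1; obtain ⟨h3, h4⟩ := b2
      simp only [Op.eval]; constructor <;> omega
    by_cases hlt : e.eval Γ s < f.eval Γ s
    · refine ⟨_, _, .seq _ _ _ _ _ _ _ x1 (.seq _ _ _ _ _ _ _ x2 (.seq _ _ _ _ _ _ _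
        (.op _ _ _ _ _) (.cond_pos _ _ _ _ _ _ ?_ (.const _ _ _)))), ?_,
        s3.setTmp ht (z := 1) ⟨by omega, by omega⟩, ?_, ?_, ?_⟩
      · simp [Config.setVar, Op.eval, w1, v1, v2, hlt]
      · simp only [cost]; omega
      · simp [Config.setVar, hlt]
      · simp [hlt, Ctx.bd]; omega
      · intro y hy
        have : y ≠ t := by omega
        simp [Config.setVar, this, k2 y (by omega), k1 y hy]
    · refine ⟨_, _, .seq _ _ _ _ _ _ _ x1 (.seq _ _ _ _ _ _ _ x2 (.seq _ _ _ _ _ _ _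
        (.op _ _ _ _ _) (.cond_neg _ _ _ _ _ _ ?_ (.const _ _ _)))), ?_,
        s3.setTmp ht (z := 0) ⟨by omega, by omega⟩, ?_, ?_, ?_⟩
      · simp [Config.setVar, Op.eval, w1, v1, v2] at hlt ⊢; omega
      · simp only [cost]; omega
      · simp [Config.setVar, hlt]
      · simp [hlt, Ctx.bd]; omega
      · intro y hy
        have : y ≠ t := by omega
        simp [Config.setVar, this, k2 y (by omega), k1 y hy]
  | eq e f ihe ihf =>
    intro c t h ht ⟨he, hf⟩
    obtain ⟨τ1, c1, x1, l1, s1, v1, b1, k1⟩ := ihe h ht he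
    obtain ⟨τ2, c2, x2, l2, s2, v2, b2, k2⟩ := ihf s1 (t := t + 1) (by omega) hf
    have w1 := k2 t (by omega)
    obtain ⟨h1, h2⟩ := b1; obtain ⟨h3, h4⟩ := b2
    have s3 : Sim Γ (c2.setVar t (Op.sub.eval (c2.var t) (c2.var (t + 1)))) s := by
      refine s2.setTmp ht ?_
      rw [w1, v1, v2]
      simp only [Op.eval]; constructor <;> omega
    by_cases hlt : f.eval Γ s < e.eval Γ s
    · have hne : e.eval Γ s ≠ f.eval Γ s := by omega
      refine ⟨_, _, .seq _ _ _ _ _ _ _ x1 (.seq _ _ _ _ _ _ _ x2 (.seq _ _ _ _ _ _ _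
        (.op _ _ _ _ _) (.cond_pos _ _ _ _ _ _ ?_ (.const _ _ _)))), ?_,
        s3.setTmp ht (z := 0) ⟨by omega, by omega⟩, ?_, ?_, ?_⟩
      · simp [Config.setVar, Op.eval, w1, v1, v2, hlt]
      · simp only [cost]; omega
      · simp [Config.setVar, hne]
      · simp [hne, Ctx.bd]; omega
      · intro y hy
        have : y ≠ t := by omega
        simp [Config.setVar, this, k2 y (by omega), k1 y hy]
    · have s4 := s3.setTmp (t := t + 1) (by omega) (z := 1) ⟨by omega, by omega⟩
      have s5 := s4.setTmp ht (z := Op.add.eval (Config.var (Config.setVar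
        (c2.setVar t (Op.sub.eval (c2.var t) (c2.var (t + 1)))) (t + 1) 1) t)
        (Config.var (Config.setVar (c2.setVar t (Op.sub.eval (c2.var t) (c2.var (t + 1))))
          (t + 1) 1) (t + 1))) (by
        simp [Config.setVar, Op.eval, w1, v1, v2]; constructor <;> omega)
      by_cases hlt' : e.eval Γ s < f.eval Γ s
      · have hne : e.eval Γ s ≠ f.eval Γ s := by omega
        refine ⟨_, _, .seq _ _ _ _ _ _ _ x1 (.seq _ _ _ _ _ _ _ x2 (.seq _ _ _ _ _ _ _
          (.op _ _ _ _ _) (.cond_neg _ _ _ _ _ _ ?_ (.seq _ _ _ _ _ _ _ (.const _ _ _)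
          (.seq _ _ _ _ _ _ _ (.op _ _ _ _ _) (.cond_neg _ _ _ _ _ _ ?_ (.const _ _ _))))))), ?_,
          s5.setTmp ht (z := 0) ⟨by omega, by omega⟩, ?_, ?_, ?_⟩
        · simp [Config.setVar, Op.eval, w1, v1, v2]; omega
        · simp [Config.setVar, Op.eval, w1, v1, v2]; omega
        · simp only [cost]; omega
        · simp [Config.setVar, hne]
        · simp [hne, Ctx.bd]; omega
        · intro y hy
          have : y ≠ t := by omega
          have : y ≠ t + 1 := by omega
          simp [Config.setVar, *, k2 y (by omega), k1 y hy]
      · have heq : e.eval Γ s = f.eval Γ s := by omega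
        refine ⟨_, _, .seq _ _ _ _ _ _ _ x1 (.seq _ _ _ _ _ _ _ x2 (.seq _ _ _ _ _ _ _
          (.op _ _ _ _ _) (.cond_neg _ _ _ _ _ _ ?_ (.seq _ _ _ _ _ _ _ (.const _ _ _)
          (.seq _ _ _ _ _ _ _ (.op _ _ _ _ _) (.cond_pos _ _ _ _ _ _ ?_ (.const _ _ _))))))), ?_,
          s5.setTmp ht (z := 1) ⟨by omega, by omega⟩, ?_, ?_, ?_⟩
        · simp [Config.setVar, Op.eval, w1, v1, v2]; omega
        · simp [Config.setVar, Op.eval, w1, v1, v2]; omega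
        · simp only [cost]; omega
        · simp [Config.setVar, heq]
        · simp [heq, Ctx.bd]; omega
        · intro y hy
          have : y ≠ t := by omega
          have : y ≠ t + 1 := by omega
          simp [Config.setVar, *, k2 y (by omega), k1 y hy]
  | and e f ihe ihf =>
    intro c t h ht ⟨he, hf⟩
    obtain ⟨τ1, c1, x1, l1, s1, v1, b1, k1⟩ := ihe h ht he
    obtain ⟨τ2, c2, x2, l2, s2, v2, b2, k2⟩ := ihf s1 (t := t + 1) (by omega) hf
    have w1 := k2 t (by omega)
    have fr : ∀ z, ∀ x < t, (c2.setVar t z).var x = c.var x := by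
      intro z y hy
      have : y ≠ t := by omega
      simp [Config.setVar, this, k2 y (by omega), k1 y hy]
    by_cases h1 : 0 < e.eval Γ s
    · by_cases h2 : 0 < f.eval Γ s
      · refine ⟨_, _, .seq _ _ _ _ _ _ _ x1 (.seq _ _ _ _ _ _ _ x2
          (.cond_pos _ _ _ _ _ _ (by rwa [w1, v1])
          (.cond_pos _ _ _ _ _ _ (by rwa [v2]) (.const _ _ _)))), ?_,
          s2.setTmp ht (z := 1) ⟨by omega, by omega⟩, ?_, ?_, fr _⟩
        · simp only [cost]; omega
        · simp [Config.setVar, h1, h2]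
        · simp [h1, h2, Ctx.bd]; omega
      · refine ⟨_, _, .seq _ _ _ _ _ _ _ x1 (.seq _ _ _ _ _ _ _ x2
          (.cond_pos _ _ _ _ _ _ (by rwa [w1, v1])
          (.cond_neg _ _ _ _ _ _ (by rwa [v2]) (.const _ _ _)))), ?_,
          s2.setTmp ht (z := 0) ⟨by omega, by omega⟩, ?_, ?_, fr _⟩
        · simp only [cost]; omega
        · simp [Config.setVar, h2]
        · simp [h2, Ctx.bd]; omega
    · refine ⟨_, _, .seq _ _ _ _ _ _ _ x1 (.seq _ _ _ _ _ _ _ x2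
          (.cond_neg _ _ _ _ _ _ (by rwa [w1, v1]) (.const _ _ _))), ?_,
          s2.setTmp ht (z := 0) ⟨by omega, by omega⟩, ?_, ?_, fr _⟩
      · simp only [cost]; omega
      · simp [Config.setVar, h1]
      · simp [h1, Ctx.bd]; omega
  | or e f ihe ihf =>
    intro c t h ht ⟨he, hf⟩
    obtain ⟨τ1, c1, x1, l1, s1, v1, b1, k1⟩ := ihe h ht he
    obtain ⟨τ2, c2, x2, l2, s2, v2, b2, k2⟩ := ihf s1 (t := t + 1) (by omega) hf
    have w1 := k2 t (by omega)
    have fr : ∀ z, ∀ x < t, (c2.setVar t z).var x = c.var x := by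
      intro z y hy
      have : y ≠ t := by omega
      simp [Config.setVar, this, k2 y (by omega), k1 y hy]
    by_cases h1 : 0 < e.eval Γ s
    · refine ⟨_, _, .seq _ _ _ _ _ _ _ x1 (.seq _ _ _ _ _ _ _ x2
          (.cond_pos _ _ _ _ _ _ (by rwa [w1, v1]) (.const _ _ _))), ?_,
          s2.setTmp ht (z := 1) ⟨by omega, by omega⟩, ?_, ?_, fr _⟩
      · simp only [cost]; omega
      · simp [Config.setVar, h1]
      · simp [h1, Ctx.bd]; omega
    · by_cases h2 : 0 < f.eval Γ s
      · refine ⟨_, _, .seq _ _ _ _ _ _ _ x1 (.seq _ _ _ _ _ _ _ x2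
          (.cond_neg _ _ _ _ _ _ (by rwa [w1, v1])
          (.cond_pos _ _ _ _ _ _ (by rwa [v2]) (.const _ _ _)))), ?_,
          s2.setTmp ht (z := 1) ⟨by omega, by omega⟩, ?_, ?_, fr _⟩
        · simp only [cost]; omega
        · simp [Config.setVar, h2]
        · simp [h2, Ctx.bd]; omega
      · refine ⟨_, _, .seq _ _ _ _ _ _ _ x1 (.seq _ _ _ _ _ _ _ x2
          (.cond_neg _ _ _ _ _ _ (by rwa [w1, v1])
          (.cond_neg _ _ _ _ _ _ (by rwa [v2]) (.const _ _ _)))), ?_,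
          s2.setTmp ht (z := 0) ⟨by omega, by omega⟩, ?_, ?_, fr _⟩
        · simp only [cost]; omega
        · simp [Config.setVar, h1, h2]
        · simp [h1, h2, Ctx.bd]; omega
  | A a e ihe =>
    intro c t h ht ⟨ha, he, h0, hE⟩
    obtain ⟨τ1, c1, x1, l1, s1, v1, b1, k1⟩ := ihe h ht he
    obtain ⟨k, hk⟩ := Int.eq_ofNat_of_zero_le h0
    have hv := s1.arr a ha k
    have hb := h.barr a ha k
    rw [← hk] at hv hb
    refine ⟨_, _, .seq _ _ _ _ _ _ _ x1 (.load _ _ _ _ k (by rw [v1, hk])), ?_,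
      (s1.touch ha (by rwa [← hk])).setTmp ht ?_, ?_, hb, ?_⟩
    · simp only [cost]; omega
    · rw [hv]; obtain ⟨h1, h2⟩ := hb; constructor <;> omega
    · simp [Config.setVar, hv]
    · intro y hy
      have : y ≠ t := by omega
      simp [Config.setVar, Config.touch, this, k1 y hy]
  | R e ihe =>
    intro c t h ht ⟨he, h0, hE, hb⟩
    obtain ⟨τ1, c1, x1, l1, s1, v1, b1, k1⟩ := ihe h ht he
    obtain ⟨k, hk⟩ := Int.eq_ofNat_of_zero_le h0
    have hv : Γ.inp[k]? = some (inAt Γ.inp (e.eval Γ s)) := by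
      rw [hk] at hE
      have : k < Γ.inp.length := by exact_mod_cast hE
      simp [inAt, hk, this]
    refine ⟨_, _, .seq _ _ _ _ _ _ _ x1 (.read _ _ _ k _ (by rw [v1, hk]) hv), ?_,
      s1.setTmp ht ?_, ?_, hb, ?_⟩
    · simp only [cost]; omega
    · obtain ⟨h1, h2⟩ := hb; constructor <;> omega
    · simp [Config.setVar]
    · intro y hy
      have : y ≠ t := by omega
      simp [Config.setVar, this, k1 y hy]

end Ex

/-! ### Structured programs and weakest preconditions. -/

/-- Structured programs. -/
inductive Cmd
  | skip
  | asg (x : ℕ) (e : Ex)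
  | sto (a : ℕ) (e f : Ex)
  | wr (e : Ex)
  | seq (p q : Cmd)
  | ite (e : Ex) (p q : Cmd)
  | whl (e : Ex) (p : Cmd)

infixr:65 " ;; " => Cmd.seq

namespace Cmd

def comp : Cmd → Program
  | skip => .const 100 0
  -- Copying is clearing followed by adding, as there is no copy instruction.
  | asg x e => .seq (e.code 100) (.seq (.const x 0) (.op .add x x 100))
  | sto a e f => .seq (e.code 100) (.seq (f.code 101) (.store a 100 101))
  | wr e => .seq (e.code 100) (.write 100)
  | seq p q => .seq p.comp q.comp
  | ite e p q => .seq (e.code 100) (.cond 100 p.comp q.comp)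
  -- The condition is evaluated before the loop and again after every iteration, so variable `100`
  -- is up to date at each test.
  | whl e p => .seq (e.code 100) (.loop 100 (.seq p.comp (e.code 100)))

/-- Weakest precondition of at most `k` iterations of a loop. -/
def iter (Γ : Ctx) (e : Ex) (w : (ℕ → St → Prop) → St → Prop) : ℕ → (ℕ → St → Prop) → St → Prop
  | 0, Q, s => e.ok Γ s ∧ ¬ 0 < e.eval Γ s ∧ Q (e.cost + 1) s
  | k + 1, Q, s => e.ok Γ s ∧ (¬ 0 < e.eval Γ s → Q (e.cost + 1) s) ∧
      (0 < e.eval Γ s → w (fun t s' => iter Γ e w k (fun t' => Q (e.cost + 1 + t + t')) s') s)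

/-- Weakest precondition: from `s`, the program terminates in some state `s'` after at most `t`
operations with `Q t s'`, without exceeding the bounds in `Γ`. -/
def wp (Γ : Ctx) : Cmd → (ℕ → St → Prop) → St → Prop
  | skip, Q, s => Q 1 s
  | asg x e, Q, s => x < 100 ∧ e.ok Γ s ∧ Q (e.cost + 2) (s.set x (e.eval Γ s))
  | sto a e f, Q, s => a < 100 ∧ e.ok Γ s ∧ f.ok Γ s ∧ 0 ≤ e.eval Γ s ∧ e.eval Γ s < Γ.E ∧
      Q (e.cost + f.cost + 1) (s.put a (e.eval Γ s) (f.eval Γ s))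
  | wr e, Q, s => e.ok Γ s ∧ Q (e.cost + 1) (s.emit (e.eval Γ s))
  | seq p q, Q, s => p.wp Γ (fun t s' => q.wp Γ (fun t' => Q (t + t')) s') s
  | ite e p q, Q, s => e.ok Γ s ∧ (0 < e.eval Γ s → p.wp Γ (fun t => Q (e.cost + 1 + t)) s) ∧
      (¬ 0 < e.eval Γ s → q.wp Γ (fun t => Q (e.cost + 1 + t)) s)
  | whl e p, Q, s => ∃ k, iter Γ e (p.wp Γ) k Q s

section wp

variable (Γ : Ctx) (Q : ℕ → St → Prop) (s : St)

@[simp] theorem wp_skip : skip.wp Γ Q s ↔ Q 1 s := Iff.rfl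
@[simp] theorem wp_asg (x : ℕ) (e : Ex) : (asg x e).wp Γ Q s ↔
    x < 100 ∧ e.ok Γ s ∧ Q (e.cost + 2) (s.set x (e.eval Γ s)) := Iff.rfl
@[simp] theorem wp_sto (a : ℕ) (e f : Ex) : (sto a e f).wp Γ Q s ↔
    a < 100 ∧ e.ok Γ s ∧ f.ok Γ s ∧ 0 ≤ e.eval Γ s ∧ e.eval Γ s < Γ.E ∧
      Q (e.cost + f.cost + 1) (s.put a (e.eval Γ s) (f.eval Γ s)) := Iff.rfl
@[simp] theorem wp_wr (e : Ex) : (wr e).wp Γ Q s ↔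
    e.ok Γ s ∧ Q (e.cost + 1) (s.emit (e.eval Γ s)) := Iff.rfl
@[simp] theorem wp_seq (p q : Cmd) : (p ;; q).wp Γ Q s ↔
    p.wp Γ (fun t s' => q.wp Γ (fun t' => Q (t + t')) s') s := Iff.rfl
@[simp] theorem wp_ite (e : Ex) (p q : Cmd) : (ite e p q).wp Γ Q s ↔
    e.ok Γ s ∧ (0 < e.eval Γ s → p.wp Γ (fun t => Q (e.cost + 1 + t)) s) ∧
      (¬ 0 < e.eval Γ s → q.wp Γ (fun t => Q (e.cost + 1 + t)) s) := Iff.rfl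

end wp

theorem iter_mono {Γ : Ctx} {e : Ex} {w : (ℕ → St → Prop) → St → Prop}
    (hw : ∀ Q Q' : ℕ → St → Prop, (∀ t s, Q t s → Q' t s) → ∀ s, w Q s → w Q' s) (k : ℕ) :
    ∀ Q Q' : ℕ → St → Prop, (∀ t s, Q t s → Q' t s) → ∀ s, iter Γ e w k Q s →
      iter Γ e w k Q' s := by
  induction k with
  | zero => exact fun Q Q' h s hs => ⟨hs.1, hs.2.1, h _ _ hs.2.2⟩
  | succ k ih =>
    exact fun Q Q' h s hs => ⟨hs.1, fun hn => h _ _ (hs.2.1 hn), fun hp =>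
      hw _ _ (fun t s' => ih _ _ (fun t' s'' => h _ _) _) _ (hs.2.2 hp)⟩

theorem wp_mono {Γ : Ctx} (c : Cmd) : ∀ {Q Q' : ℕ → St → Prop} {s : St}, c.wp Γ Q s →
    (∀ t s, Q t s → Q' t s) → c.wp Γ Q' s := by
  induction c with
  | skip => exact fun h hQ => hQ _ _ h
  | asg x e => exact fun h hQ => ⟨h.1, h.2.1, hQ _ _ h.2.2⟩
  | sto a e f =>
    exact fun h hQ => ⟨h.1, h.2.1, h.2.2.1, h.2.2.2.1, h.2.2.2.2.1, hQ _ _ h.2.2.2.2.2⟩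
  | wr e => exact fun h hQ => ⟨h.1, hQ _ _ h.2⟩
  | seq p q ihp ihq => exact fun h hQ => ihp h fun t s' h' => ihq h' fun t' s'' => hQ _ _
  | ite e p q ihp ihq =>
    exact fun h hQ => ⟨h.1, fun hp => ihp (h.2.1 hp) fun t => hQ _,
      fun hp => ihq (h.2.2 hp) fun t => hQ _⟩
  | whl e p ihp =>
    rintro Q Q' s ⟨k, hk⟩ hQ
    exact ⟨k, iter_mono (w := p.wp Γ) (fun Q Q' h s hs => ihp hs h) k _ _ hQ _ hk⟩

/-- A program computes what its weakest precondition promises. -/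
theorem comp_exec {Γ : Ctx} (p : Cmd) : ∀ {Q : ℕ → St → Prop} {s : St} {c : Config}, p.wp Γ Q s →
    Sim Γ c s → ∃ τ t c' s', Exec Γ.inp p.comp c τ c' ∧ τ ≤ t ∧ Sim Γ c' s' ∧ Q t s' := by
  have hone := Γ.one_le
  induction p with
  | skip =>
    exact fun {Q s c} h hc => ⟨1, 1, _, s, .const _ _ _, le_rfl,
      hc.setTmp le_rfl ⟨by omega, by omega⟩, h⟩
  | asg x e =>
    intro Q s c ⟨hx, he, hQ⟩ hc
    obtain ⟨τ, c1, x1, l1, s1, v1, b1, -⟩ := e.code_exec hc le_rfl he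
    have hxt : 100 ≠ x := by omega
    refine ⟨_, _, _, _, .seq _ _ _ _ _ _ _ x1 (.seq _ _ _ _ _ _ _ (.const _ _ _)
      (.op _ _ _ _ _)), ?_, ?_, hQ⟩
    · omega
    · obtain ⟨hb1, hb2⟩ := b1
      have hpk := s1.peak
      refine ⟨fun y hy => ?_, s1.arr, s1.out, fun y hy => ?_, s1.barr, ?_, s1.ext, s1.ext0⟩
      · by_cases hyx : y = x
        · subst hyx; simp [Config.setVar, Op.eval, v1, hxt]
        · simp [Config.setVar, hyx, s1.var y hy]
      · simp only [St.set_var]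
        split_ifs
        · exact ⟨hb1, hb2⟩
        · exact s1.bvar y hy
      · have := abs_le.2 ⟨hb1, hb2⟩
        simp [Config.setVar, Op.eval, v1, hxt]; omega
  | sto a e f =>
    intro Q s c ⟨ha, he, hf, h0, hE, hQ⟩ hc
    obtain ⟨τ, c1, x1, l1, s1, v1, b1, -⟩ := e.code_exec hc le_rfl he
    obtain ⟨τ2, c2, x2, l2, s2, v2, b2, k2⟩ := f.code_exec s1 (t := 100 + 1) (by omega) hf
    obtain ⟨k, hk⟩ := Int.eq_ofNat_of_zero_le h0
    refine ⟨_, _, _, _, .seq _ _ _ _ _ _ _ x1 (.seq _ _ _ _ _ _ _ x2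
      (.store _ _ _ _ k ?_)), ?_, ?_, hQ⟩
    · rw [k2 _ (by omega), v1, hk]
    · omega
    · have s3 := s2.touch ha (k := k) (by rwa [← hk])
      have hpk := s3.peak
      refine ⟨s3.var, fun b hb j => ?_, s3.out, s3.bvar, fun b hb j => ?_, ?_, s3.ext, s3.ext0⟩
      · rw [hk]
        by_cases hba : b = a
        · subst hba
          by_cases hj : j = k
          · simp [Config.setArr, v2, hj]
          · have := s2.arr b hb j
            simp [Config.setArr, Config.touch, hj, this]
        · have := s2.arr b hb j
          simp [Config.setArr, Config.touch, hba, this]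
      · rw [St.put_arr]
        split_ifs
        · exact b2
        · exact s3.barr b hb j
      · have := abs_le.2 b2
        simp [Config.setArr, v2] at hpk ⊢; omega
  | wr e =>
    intro Q s c ⟨he, hQ⟩ hc
    obtain ⟨τ, c1, x1, l1, s1, v1, b1, -⟩ := e.code_exec hc le_rfl he
    refine ⟨_, _, _, _, .seq _ _ _ _ _ _ _ x1 (.write _ _), ?_, ?_, hQ⟩
    · omega
    · exact ⟨s1.var, s1.arr, by simp [s1.out, v1], s1.bvar, s1.barr, s1.peak, s1.ext, s1.ext0⟩
  | seq p q ihp ihq =>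
    intro Q s c h hc
    obtain ⟨τ, t, c1, s1, x1, l1, m1, h1⟩ := ihp h hc
    obtain ⟨τ', t', c2, s2, x2, l2, m2, h2⟩ := ihq h1 m1
    exact ⟨_, _, c2, s2, .seq _ _ _ _ _ _ _ x1 x2, by omega, m2, h2⟩
  | ite e p q ihp ihq =>
    intro Q s c ⟨he, hp, hq⟩ hc
    obtain ⟨τ, c1, x1, l1, s1, v1, b1, -⟩ := e.code_exec hc le_rfl he
    by_cases h : 0 < e.eval Γ s
    · obtain ⟨τ, t, c2, s2, x2, l2, m2, h2⟩ := ihp (hp h) s1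
      exact ⟨_, _, c2, s2, .seq _ _ _ _ _ _ _ x1 (.cond_pos _ _ _ _ _ _ (by rwa [v1]) x2),
        by omega, m2, h2⟩
    · obtain ⟨τ, t, c2, s2, x2, l2, m2, h2⟩ := ihq (hq h) s1
      exact ⟨_, _, c2, s2, .seq _ _ _ _ _ _ _ x1 (.cond_neg _ _ _ _ _ _ (by rwa [v1]) x2),
        by omega, m2, h2⟩
  | whl e p ihp =>
    intro Q s c ⟨k, hk⟩ hc
    -- `τ0` is the time of the evaluation of the condition that has just taken place: `iter` charges
    -- it to the coming iteration, while the machine has already spent it.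
    have key : ∀ (k : ℕ) (Q : ℕ → St → Prop) (s : St) (c : Config) (τ0 : ℕ),
        iter Γ e (p.wp Γ) k Q s → Sim Γ c s → c.var 100 = e.eval Γ s → τ0 ≤ e.cost →
        ∃ τ t c' s', Exec Γ.inp (.loop 100 (.seq p.comp (e.code 100))) c τ c' ∧ τ0 + τ ≤ t ∧
          Sim Γ c' s' ∧ Q t s' := by
      intro k
      induction k with
      | zero =>
        intro Q s c τ0 h hc hv hτ
        exact ⟨_, _, c, s, .loop_neg _ _ _ (by rw [hv]; exact h.2.1), by omega, hc, h.2.2⟩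
      | succ k ih =>
        intro Q s c τ0 h hc hv hτ
        by_cases hpos : 0 < e.eval Γ s
        · obtain ⟨τ, t, c1, s1, x1, l1, m1, h1⟩ := ihp (h.2.2 hpos) hc
          have hok : e.ok Γ s1 := by cases k <;> exact h1.1
          obtain ⟨τ2, c2, x2, l2, m2, v2, b2, -⟩ := e.code_exec m1 (t := 100) le_rfl hok
          obtain ⟨τ3, t3, c3, s3, x3, l3, m3, h3⟩ := ih _ s1 c2 τ2 h1 m2 v2 l2
          exact ⟨_, _, c3, s3, .loop_pos _ _ _ _ _ _ _ (by rwa [hv])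
            (.seq _ _ _ _ _ _ _ x1 x2) x3, by omega, m3, h3⟩
        · exact ⟨_, _, c, s, .loop_neg _ _ _ (by rwa [hv]), by omega, hc, h.2.1 hpos⟩
    have hok : e.ok Γ s := by cases k <;> exact hk.1
    obtain ⟨τ, c1, x1, l1, s1, v1, b1, -⟩ := e.code_exec hc le_rfl hok
    obtain ⟨τ3, t3, c3, s3, x3, l3, m3, h3⟩ := key k Q s c1 τ hk s1 v1 l1
    exact ⟨_, _, c3, s3, .seq _ _ _ _ _ _ _ x1 x3, l3, m3, h3⟩

/-! ### Frames -/

/-- `p.keeps x`: the program does not assign the variable `x`. -/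
def keeps (x : ℕ) : Cmd → Bool
  | asg y _ => Nat.blt x y || Nat.blt y x
  | seq p q => p.keeps x && q.keeps x
  | ite _ p q => p.keeps x && q.keeps x
  | whl _ p => p.keeps x
  | _ => true

/-- `p.keepsA a`: the program does not write into the array `a`. -/
def keepsA (a : ℕ) : Cmd → Bool
  | sto b _ _ => Nat.blt a b || Nat.blt b a
  | seq p q => p.keepsA a && q.keepsA a
  | ite _ p q => p.keepsA a && q.keepsA a
  | whl _ p => p.keepsA a
  | _ => true

/-- The program produces no output. -/
def quiet : Cmd → Bool
  | wr _ => false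
  | seq p q => p.quiet && q.quiet
  | ite _ p q => p.quiet && q.quiet
  | whl _ p => p.quiet
  | _ => true

/-- `s'` agrees with `s` on everything that `p` does not modify. -/
structure Fr (p : Cmd) (s s' : St) : Prop where
  var : ∀ x, p.keeps x = true → s'.var x = s.var x
  arr : ∀ a, p.keepsA a = true → s'.arr a = s.arr a
  out : p.quiet = true → s'.out = s.out

theorem Fr.refl (p : Cmd) (s : St) : Fr p s s := ⟨fun _ _ => rfl, fun _ _ => rfl, fun _ => rfl⟩

theorem Fr.trans {p : Cmd} {s s' s'' : St} (h : Fr p s s') (h' : Fr p s' s'') : Fr p s s'' :=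
  ⟨fun x hx => (h'.var x hx).trans (h.var x hx), fun a ha => (h'.arr a ha).trans (h.arr a ha),
    fun ho => (h'.out ho).trans (h.out ho)⟩

theorem iter_frame {Γ : Ctx} {e : Ex} {p : Cmd}
    (ihp : ∀ {Q : ℕ → St → Prop} {s : St}, p.wp Γ Q s → p.wp Γ (fun t s' => Q t s' ∧ Fr p s s') s)
    (k : ℕ) : ∀ {Q : ℕ → St → Prop} {s : St}, iter Γ e (p.wp Γ) k Q s →
      iter Γ e (p.wp Γ) k (fun t s' => Q t s' ∧ Fr p s s') s := by
  have hm : ∀ Q Q' : ℕ → St → Prop, (∀ t s, Q t s → Q' t s) → ∀ s, p.wp Γ Q s → p.wp Γ Q' s :=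
    fun _ _ h _ hs => wp_mono p hs h
  induction k with
  | zero => exact fun h => ⟨h.1, h.2.1, h.2.2, Fr.refl _ _⟩
  | succ k ih =>
    intro Q s h
    refine ⟨h.1, fun hn => ⟨h.2.1 hn, Fr.refl _ _⟩, fun hp => ?_⟩
    refine wp_mono p (ihp (h.2.2 hp)) fun t s1 h1 => ?_
    exact iter_mono hm k _ _ (fun t s2 h2 => ⟨h2.1, h1.2.trans h2.2⟩) _ (ih h1.1)

/-- Frame rule: a specification need only mention what changes; everything else follows from the
syntactic checks `keeps`, `keepsA` and `quiet`. -/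
theorem wp_frame {Γ : Ctx} (p : Cmd) : ∀ {Q : ℕ → St → Prop} {s : St}, p.wp Γ Q s →
    p.wp Γ (fun t s' => Q t s' ∧ Fr p s s') s := by
  induction p with
  | skip => exact fun h => ⟨h, Fr.refl _ _⟩
  | asg y e =>
    refine fun h => ⟨h.1, h.2.1, h.2.2, fun x hx => ?_, fun _ _ => rfl, fun _ => rfl⟩
    have : x ≠ y := by simp [keeps] at hx; omega
    simp [this]
  | sto b e f =>
    refine fun h => ⟨h.1, h.2.1, h.2.2.1, h.2.2.2.1, h.2.2.2.2.1, h.2.2.2.2.2, fun x hx => rfl,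
      fun a ha => ?_, fun _ => rfl⟩
    have : a ≠ b := by simp [keepsA] at ha; omega
    exact St.put_arr_ne _ _ _ _ _ this
  | wr e => exact fun h => ⟨h.1, h.2, fun _ _ => rfl, fun _ _ => rfl, fun h => by simp [quiet] at h⟩
  | seq p q ihp ihq =>
    refine fun h => wp_mono p (ihp h) fun t s1 h1 => ?_
    refine wp_mono q (ihq h1.1) fun t s2 h2 => ⟨h2.1, fun x hx => ?_, fun x hx => ?_, fun hx => ?_⟩
    · simp [keeps] at hx; rw [h2.2.var x hx.2, h1.2.var x hx.1]
    · simp [keepsA] at hx; rw [h2.2.arr x hx.2, h1.2.arr x hx.1]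
    · simp [quiet] at hx; rw [h2.2.out hx.2, h1.2.out hx.1]
  | ite e p q ihp ihq =>
    refine fun h => ⟨h.1, fun hp => ?_, fun hp => ?_⟩
    · refine wp_mono p (ihp (h.2.1 hp)) fun t s1 h1 =>
        ⟨h1.1, fun x hx => ?_, fun x hx => ?_, fun hx => ?_⟩
      · simp [keeps] at hx; rw [h1.2.var x hx.1]
      · simp [keepsA] at hx; rw [h1.2.arr x hx.1]
      · simp [quiet] at hx; rw [h1.2.out hx.1]
    · refine wp_mono q (ihq (h.2.2 hp)) fun t s1 h1 =>
        ⟨h1.1, fun x hx => ?_, fun x hx => ?_, fun hx => ?_⟩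
      · simp [keeps] at hx; rw [h1.2.var x hx.2]
      · simp [keepsA] at hx; rw [h1.2.arr x hx.2]
      · simp [quiet] at hx; rw [h1.2.out hx.2]
  | whl e p ihp =>
    rintro Q s ⟨k, hk⟩
    refine ⟨k, iter_mono (w := p.wp Γ) (fun _ _ h _ hs => wp_mono p hs h) k _ _ (fun t s' h => ?_) _
      (iter_frame ihp k hk)⟩
    exact ⟨h.1, h.2.var, h.2.arr, h.2.out⟩

/-- Use a specification of `p`, together with the frame property of `p`. -/
theorem wp_use {Γ : Ctx} {p : Cmd} {Q Q' : ℕ → St → Prop} {s : St} (h : p.wp Γ Q s)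
    (hQ : ∀ t s', Q t s' → Fr p s s' → Q' t s') : p.wp Γ Q' s :=
  wp_mono p (wp_frame p h) fun t s' h => hQ t s' h.1 h.2

/-! ### Loops -/

/-- A loop with an invariant `I i τ s` of the number `i` of iterations left at most and the time
`τ` used so far. -/
theorem wp_whl {Γ : Ctx} {e : Ex} {p : Cmd} (I : ℕ → ℕ → St → Prop) {Q : ℕ → St → Prop} {s0 : St}
    (m : ℕ) (h0 : I m 0 s0)
    (step : ∀ i τ s, Fr p s0 s → I i τ s → e.ok Γ s ∧ (0 < e.eval Γ s → ∃ j, i = j + 1 ∧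
      p.wp Γ (fun t s' => I j (τ + (e.cost + 1 + t)) s') s))
    (post : ∀ i τ s, Fr p s0 s → I i τ s → ¬ 0 < e.eval Γ s → Q (τ + (e.cost + 1)) s) :
    (whl e p).wp Γ Q s0 := by
  have key : ∀ i τ s, Fr p s0 s → I i τ s →
      iter Γ e (p.wp Γ) i (fun t s' => Q (τ + t) s') s := by
    intro i
    induction i with
    | zero =>
      intro τ s hf hI
      obtain ⟨hok, hstep⟩ := step 0 τ s hf hI
      by_cases hp : 0 < e.eval Γ s
      · obtain ⟨j, hj, -⟩ := hstep hp; omega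
      · exact ⟨hok, hp, post _ _ _ hf hI hp⟩
    | succ i ih =>
      intro τ s hf hI
      obtain ⟨hok, hstep⟩ := step _ τ s hf hI
      refine ⟨hok, post _ _ _ hf hI, fun hp => ?_⟩
      obtain ⟨j, hj, hw⟩ := hstep hp
      obtain rfl : i = j := by omega
      refine wp_use hw fun t s' hI' hf' => ?_
      have := ih _ s' (hf.trans hf') hI'
      simpa only [Nat.add_assoc] using this
  exact ⟨m, by simpa using key m 0 s0 (Fr.refl _ _) h0⟩

/-- `for x < e do p`. -/
def loopTo (x : ℕ) (e : Ex) (p : Cmd) : Cmd :=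
  asg x (.C 0) ;; whl (.lt (.V x) e) (p ;; asg x (.V x + .C 1))

/-- A `for` loop with an invariant `I i τ s` of the iteration number `i` and the time `τ`. -/
theorem wp_loopTo' {Γ : Ctx} {x : ℕ} {e : Ex} {p : Cmd} (N : ℕ) (I : ℕ → ℕ → St → Prop)
    {Q : ℕ → St → Prop} {s0 : St} (hx : x < 100) (hk : p.keeps x = true) (hN : (N : ℤ) ≤ Γ.B)
    (he : ∀ s, Fr (loopTo x e p) s0 s → e.ok Γ s ∧ e.eval Γ s = N)
    (h0 : I 0 0 (s0.set x 0))
    (step : ∀ i τ s, i < N → Fr (loopTo x e p) s0 s → s.var x = i → I i τ s →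
      -- An iteration costs `e.cost + 6` for the test and `6` for the increment, besides the body;
      -- the final `e.cost + 9` is the initialisation, `3`, and the failing test.
      p.wp Γ (fun t s' => I (i + 1) (τ + (t + e.cost + 12)) (s'.set x (i + 1))) s)
    (post : ∀ τ s, Fr (loopTo x e p) s0 s → s.var x = N → I N τ s → Q (τ + (e.cost + 9)) s) :
    (loopTo x e p).wp Γ Q s0 := by
  have hone := Γ.one_le
  have hfr : ∀ {s}, Fr (p ;; asg x (.V x + .C 1)) (s0.set x 0) s → Fr (loopTo x e p) s0 s := by
    intro s h
    refine ⟨fun y hy => ?_, fun a ha => ?_, fun ho => ?_⟩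
    · simp only [loopTo, keeps] at hy
      rw [h.var y (by simp [keeps] at hy ⊢; tauto)]
      have : y ≠ x := by simp at hy; omega
      simp [this]
    · rw [h.arr a (by simpa [loopTo, keepsA] using ha)]; rfl
    · rw [h.out (by simpa [loopTo, quiet] using ho)]; rfl
  rw [loopTo, wp_seq, wp_asg]
  refine ⟨hx, by simp; omega, ?_⟩
  refine wp_whl (fun i τ s => ∃ k, i + k = N ∧ s.var x = k ∧ I k τ s) N
    ⟨0, rfl, by simp, h0⟩ ?_ ?_
  · rintro i τ s hf ⟨k, hik, hxk, hI⟩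
    obtain ⟨hok, hev⟩ := he s (hfr hf)
    refine ⟨⟨hx, hok⟩, fun hpos => ?_⟩
    simp only [Ex.eval_lt, Ex.eval_V, hxk, hev, zero_lt_ite_one, Nat.cast_lt] at hpos
    refine ⟨i - 1, by omega, ?_⟩
    rw [wp_seq]
    refine wp_use (step k τ s hpos (hfr hf) hxk hI) fun t s' h' hf' => ?_
    have hx' : s'.var x = k := by rw [hf'.var x hk, hxk]
    rw [wp_asg]
    refine ⟨hx, ?_, k + 1, by omega, by simp [hx'], ?_⟩
    · simp [hx, hx']; omega
    · have : τ + ((Ex.lt (.V x) e).cost + 1 + (t + ((Ex.V x + Ex.C 1).cost + 2)))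
          = τ + (t + e.cost + 12) := by simp; omega
      rw [this]
      simpa [hx'] using h'
  · rintro i τ s hf ⟨k, hik, hxk, hI⟩ hneg
    obtain ⟨hok, hev⟩ := he s (hfr hf)
    simp only [Ex.eval_lt, Ex.eval_V, hxk, hev, zero_lt_ite_one, Nat.cast_lt] at hneg
    obtain rfl : k = N := by omega
    have h9 : 3 + (τ + ((Ex.lt (.V x) e).cost + 1)) = τ + (e.cost + 9) := by simp; omega
    have := post τ s (hfr hf) hxk hI
    rw [← h9] at this
    simpa using this

/-- A `for` loop whose body takes time at most `T`. -/
theorem wp_loopTo {Γ : Ctx} {x : ℕ} {e : Ex} {p : Cmd} (N T : ℕ) (I : ℕ → St → Prop)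
    {Q : ℕ → St → Prop} {s0 : St} (hx : x < 100) (hk : p.keeps x = true) (hN : (N : ℤ) ≤ Γ.B)
    (he : ∀ s, Fr (loopTo x e p) s0 s → e.ok Γ s ∧ e.eval Γ s = N)
    (h0 : I 0 (s0.set x 0))
    (step : ∀ i s, i < N → Fr (loopTo x e p) s0 s → s.var x = i → I i s →
      p.wp Γ (fun t s' => t ≤ T ∧ I (i + 1) (s'.set x (i + 1))) s)
    (post : ∀ τ s, Fr (loopTo x e p) s0 s → s.var x = N → I N s →
      τ ≤ N * (T + e.cost + 12) + e.cost + 9 → Q τ s) :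
    (loopTo x e p).wp Γ Q s0 := by
  refine wp_loopTo' N (fun i τ s => τ ≤ i * (T + e.cost + 12) ∧ I i s) hx hk hN he
    ⟨by simp, h0⟩ ?_ ?_
  · rintro i τ s hi hf hxi ⟨hτ, hI⟩
    refine wp_mono p (step i s hi hf hxi hI) fun t s' h => ⟨?_, h.2⟩
    have := h.1
    rw [Nat.add_mul, Nat.one_mul]; omega
  · rintro τ s hf hxN ⟨hτ, hI⟩
    exact post _ s hf hxN hI (by omega)

end Cmd

/-! ## Running a program with captured output -/

/-- The program `p` with its variables and arrays renamed, writing into array `0` instead of the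
output; variable `0` counts the words written. -/
def Program.capture : Program → Program
  | .const x z => .const (x + 1000) z
  | .op o x y z => .op o (x + 1000) (y + 1000) (z + 1000)
  | .load x a i => .load (x + 1000) (a + 1000) (i + 1000)
  | .store a i y => .store (a + 1000) (i + 1000) (y + 1000)
  | .read x i => .read (x + 1000) (i + 1000)
  | .write x => .seq (.store 0 0 (x + 1000)) (.seq (.const 1 1) (.op .add 0 0 1))
  | .seq p q => .seq p.capture q.capture
  | .cond x p q => .cond (x + 1000) p.capture q.capture
  | .loop x p => .loop (x + 1000) p.capture

/-- `c'` is the configuration of the capturing program that corresponds to `c`. -/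
structure Captures (c c' : Config) : Prop where
  var : ∀ x, c'.var (x + 1000) = c.var x
  cnt : c'.var 0 = c.out.length
  low : ∀ x < 1000, 2 ≤ x → c'.var x = 0
  one : c'.var 1 = 0 ∨ c'.var 1 = 1
  arr : ∀ a, c'.arr (a + 1000) = c.arr a
  buf : ∀ k, c'.arr 0 k = c.out.getD k 0
  lowA : ∀ a < 1000, 1 ≤ a → ∀ k, c'.arr a k = 0
  ext : ∀ a, c'.ext (a + 1000) = c.ext a
  extBuf : c'.ext 0 ≤ c.out.length
  lowE : ∀ a < 1000, 1 ≤ a → c'.ext a = 0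
  out : c'.out = []
  -- The counter and the copies of the output words enter the memory too, whence the two extra
  -- premises.
  peak : ∀ Z, c.peak ≤ Z → c.out.length + 1 ≤ Z → (∀ z ∈ c.out, z.natAbs ≤ Z) → c'.peak ≤ Z

theorem Captures.init : Captures Config.init Config.init := by
  constructor <;> simp [Config.init]

theorem Captures.setVar {c c' : Config} (h : Captures c c') (x : ℕ) (z : ℤ) :
    Captures (c.setVar x z) (c'.setVar (x + 1000) z) where
  var y := by simp [Config.setVar, Function.update_apply, h.var]
  cnt := by simp [Config.setVar, Function.update_apply, h.cnt]
  low y hy h2 := by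
    have : y ≠ x + 1000 := by omega
    simp [Config.setVar, this, h.low y hy h2]
  one := by simpa [Config.setVar, Function.update_apply] using h.one
  arr := h.arr
  buf := h.buf
  lowA := h.lowA
  ext := h.ext
  extBuf := h.extBuf
  lowE := h.lowE
  out := h.out
  peak Z h1 h2 h3 := by
    simp only [Config.setVar] at h1 h2 h3 ⊢
    have := h.peak Z (by omega) h2 h3
    omega

theorem Captures.touch {c c' : Config} (h : Captures c c') (a k : ℕ) :
    Captures (c.touch a k) (c'.touch (a + 1000) k) where
  var := h.var
  cnt := h.cnt
  low := h.low
  one := h.one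
  arr := h.arr
  buf := h.buf
  lowA := h.lowA
  ext b := by simp [Config.touch, Function.update_apply, h.ext]
  extBuf := by simpa [Config.touch, Function.update_apply] using h.extBuf
  lowE b hb h1 := by
    have : b ≠ a + 1000 := by omega
    simp [Config.touch, this, h.lowE b hb h1]
  out := h.out
  peak := h.peak

theorem Captures.setArr {c c' : Config} (h : Captures c c') (a k : ℕ) (z : ℤ) :
    Captures (c.setArr a k z) (c'.setArr (a + 1000) k z) where
  var := h.var
  cnt := h.cnt
  low := h.low
  one := h.one
  arr b := by simp [Config.setArr, Function.update_apply, h.arr]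
  buf := by simpa [Config.setArr, Function.update_apply] using h.buf
  lowA b hb h1 := by
    have : b ≠ a + 1000 := by omega
    simpa [Config.setArr, this] using h.lowA b hb h1
  ext := h.ext
  extBuf := h.extBuf
  lowE := h.lowE
  out := h.out
  peak Z h1 h2 h3 := by
    simp only [Config.setArr] at h1 h2 h3 ⊢
    have := h.peak Z (by omega) h2 h3
    omega

/-- The factor `3` comes from `write`, which becomes a store and the two operations that advance the
counter; every other operation is merely renamed. -/
theorem Exec.capture {inp : List ℤ} {p : Program} {c d : Config} {t : ℕ} (h : Exec inp p c t d) :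
    ∀ {c' : Config}, Captures c c' →
      ∃ t' d', Exec inp p.capture c' t' d' ∧ t' ≤ 3 * t ∧ Captures d d' := by
  induction h with
  | const s x z => exact fun hc => ⟨_, _, .const _ _ _, by omega, hc.setVar _ _⟩
  | op s o x y z =>
    refine fun hc => ⟨_, _, .op _ _ _ _ _, by omega, ?_⟩
    rw [hc.var, hc.var]; exact hc.setVar _ _
  | load s x a i k hk =>
    refine fun hc => ⟨_, _, .load _ _ _ _ k (by rw [hc.var, hk]), by omega, ?_⟩
    rw [hc.arr]; exact (hc.touch _ _).setVar _ _
  | store s a i y k hk =>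
    refine fun hc => ⟨_, _, .store _ _ _ _ k (by rw [hc.var, hk]), by omega, ?_⟩
    rw [hc.var]; exact (hc.touch _ _).setArr _ _ _
  | read s x i k v hk hv =>
    exact fun hc => ⟨_, _, .read _ _ _ k v (by rw [hc.var, hk]) hv, by omega, hc.setVar _ _⟩
  | write s x =>
    intro c' hc
    refine ⟨_, _, .seq _ _ _ _ _ _ _ (.store _ _ _ _ s.out.length hc.cnt)
      (.seq _ _ _ _ _ _ _ (.const _ _ _) (.op _ _ _ _ _)), le_rfl, ?_⟩
    refine ⟨fun y => ?_, ?_, fun y hy h2 => ?_, ?_, fun a => ?_, fun k => ?_, fun a ha h1 => ?_,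
      fun a => ?_, ?_, fun a ha h1 => ?_, hc.out, ?_⟩
    · simp [Config.setVar, Config.setArr, Config.touch, Function.update_apply, hc.var]
    · simp [Config.setVar, Config.setArr, Config.touch, Function.update_apply, hc.cnt, Op.eval]
    · have h0 : y ≠ 0 := by omega
      have h1 : y ≠ 1 := by omega
      simp [Config.setVar, Config.setArr, Config.touch, h0, h1, hc.low y hy h2]
    · simp [Config.setVar, Config.setArr, Config.touch, Function.update_apply]
    · simp [Config.setVar, Config.setArr, Config.touch, Function.update_apply, hc.arr]
    · simp only [Config.setVar, Config.setArr, Config.touch, Function.update_self,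
        Function.update_apply, hc.var]
      split_ifs with hk
      · subst hk; simp
      · rw [hc.buf]
        rcases lt_or_ge k s.out.length with h | h
        · simp [h, List.getElem?_append_left]
        · simp [List.getElem?_append_right, h]
          rw [List.getElem?_eq_none] <;> simp; omega
    · have h0 : a ≠ 0 := by omega
      simpa [Config.setVar, Config.setArr, Config.touch, h0] using hc.lowA a ha h1
    · simp [Config.setVar, Config.setArr, Config.touch, Function.update_apply, hc.ext]
    · have := hc.extBuf
      simp [Config.setVar, Config.setArr, Config.touch]; omega
    · have h0 : a ≠ 0 := by omega
      simpa [Config.setVar, Config.setArr, Config.touch, h0] using hc.lowE a ha h1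
    · intro Z h1 h2 h3
      simp only [List.length_append, List.length_singleton, List.mem_append, List.mem_singleton]
        at h1 h2 h3
      have h4 := hc.peak Z h1 (by omega) fun z hz => h3 z (Or.inl hz)
      have h5 := h3 _ (Or.inr rfl)
      simp [Config.setVar, Config.setArr, Config.touch, Op.eval, hc.var, hc.cnt, h4, h5]
      omega
  | seq s s' s'' p q t t' hp hq ihp ihq =>
    intro c' hc
    obtain ⟨t1, d1, x1, l1, m1⟩ := ihp hc
    obtain ⟨t2, d2, x2, l2, m2⟩ := ihq m1
    exact ⟨_, _, .seq _ _ _ _ _ _ _ x1 x2, by omega, m2⟩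
  | cond_pos s s' x p q t hx hp ih =>
    intro c' hc
    obtain ⟨t1, d1, x1, l1, m1⟩ := ih hc
    exact ⟨_, _, .cond_pos _ _ _ _ _ _ (by rwa [hc.var]) x1, by omega, m1⟩
  | cond_neg s s' x p q t hx hp ih =>
    intro c' hc
    obtain ⟨t1, d1, x1, l1, m1⟩ := ih hc
    exact ⟨_, _, .cond_neg _ _ _ _ _ _ (by rwa [hc.var]) x1, by omega, m1⟩
  | loop_pos s s' s'' x p t t' hx hp hl ihp ihl =>
    intro c' hc
    obtain ⟨t1, d1, x1, l1, m1⟩ := ihp hc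
    obtain ⟨t2, d2, x2, l2, m2⟩ := ihl m1
    exact ⟨_, _, .loop_pos _ _ _ _ _ _ _ (by rwa [hc.var]) x1 x2, by omega, m2⟩
  | loop_neg s x p hx =>
    exact fun {c'} hc => ⟨_, _, .loop_neg _ _ _ (by rwa [hc.var]), by omega, hc⟩

theorem Program.capture_vars (p : Program) :
    p.capture.vars ⊆ Finset.range 2 ∪ p.vars.image (· + 1000) := by
  induction p with
  | seq p q ihp ihq =>
    simp only [capture, vars, Finset.image_union]
    exact Finset.union_subset (ihp.trans (by grind)) (ihq.trans (by grind))
  | cond x p q ihp ihq =>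
    simp only [capture, vars, Finset.image_union, Finset.image_singleton]
    exact Finset.union_subset (by grind)
      (Finset.union_subset (ihp.trans (by grind)) (ihq.trans (by grind)))
  | loop x p ihp =>
    simp only [capture, vars, Finset.image_union, Finset.image_singleton]
    exact Finset.union_subset (by grind) (ihp.trans (by grind))
  | _ => intro y hy; simp [capture, vars] at hy ⊢; omega

theorem Program.capture_arrays (p : Program) :
    p.capture.arrays ⊆ Finset.range 1 ∪ p.arrays.image (· + 1000) := by
  induction p with
  | seq p q ihp ihq =>
    simp only [capture, arrays, Finset.image_union]
    exact Finset.union_subset (ihp.trans (by grind)) (ihq.trans (by grind))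
  | cond x p q ihp ihq =>
    simp only [capture, arrays, Finset.image_union]
    exact Finset.union_subset (ihp.trans (by grind)) (ihq.trans (by grind))
  | loop x p ihp => simpa only [capture, arrays] using ihp
  | _ => intro y hy; simp [capture, arrays] at hy ⊢ <;> omega

/-- All variables are below `l` and all arrays below `m`. -/
def Program.small (l m : ℕ) : Program → Bool
  | .const x _ => Nat.blt x l
  | .op _ x y z => Nat.blt x l && Nat.blt y l && Nat.blt z l
  | .load x a i => Nat.blt x l && Nat.blt a m && Nat.blt i l
  | .store a i y => Nat.blt a m && Nat.blt i l && Nat.blt y l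
  | .read x i => Nat.blt x l && Nat.blt i l
  | .write x => Nat.blt x l
  | .seq p q => p.small l m && q.small l m
  | .cond x p q => Nat.blt x l && p.small l m && q.small l m
  | .loop x p => Nat.blt x l && p.small l m

theorem Program.vars_subset {l m : ℕ} (p : Program) (h : p.small l m = true) :
    p.vars ⊆ Finset.range l := by
  induction p <;> simp [small] at h <;> simp [vars, Finset.union_subset_iff,
    Finset.insert_subset_iff] <;> tauto

theorem Program.arrays_subset {l m : ℕ} (p : Program) (h : p.small l m = true) :
    p.arrays ⊆ Finset.range m := by
  induction p <;> simp [small] at h <;> simp [arrays, Finset.union_subset_iff,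
    Finset.insert_subset_iff] <;> tauto

theorem sum_ext_le (f : ℕ → ℕ) (s : Finset ℕ) (m E : ℕ) (hs : s ⊆ Finset.range m)
    (hf : ∀ a < m, f a ≤ E) : ∑ a ∈ s, (f a + 1) ≤ m * (E + 1) := by
  calc ∑ a ∈ s, (f a + 1) ≤ ∑ a ∈ Finset.range m, (f a + 1) :=
        Finset.sum_le_sum_of_subset hs
    _ ≤ ∑ a ∈ Finset.range m, (E + 1) :=
        Finset.sum_le_sum fun a ha => by have := hf a (Finset.mem_range.1 ha); omega
    _ = m * (E + 1) := by simp

/-- Run a structured program from the initial configuration. -/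
theorem runs_of_wp {inp O : List ℤ} {main : Cmd} {m T : ℕ} (hm : m ≤ 100)
    (hs : main.comp.small 120 m = true) {B E : ℤ} (hB : 1 ≤ B) (hE : 0 ≤ E)
    (h : main.wp ⟨inp, B, E, fun _ => 0, hB⟩ (fun t s => t ≤ T ∧ s.out = O)
      ⟨fun _ => 0, fun _ _ => 0, []⟩) :
    ∃ t s mm, Runs main.comp inp t s mm O ∧ t ≤ T ∧ s ≤ 120 + m * (E.toNat + 1) ∧
      (mm : ℤ) ≤ 2 * B + 1 := by
  have hsim : Sim ⟨inp, B, E, fun _ => 0, hB⟩ Config.init ⟨fun _ => 0, fun _ _ => 0, []⟩ := by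
    constructor <;> simp [Config.init, Ctx.bd] <;> omega
  obtain ⟨τ, t, c', s', hx, hτ, hs', ht, ho⟩ := Cmd.comp_exec main h hsim
  refine ⟨τ, _, _, ⟨c', hx, ?_, rfl, rfl⟩, by omega, ?_, hs'.peak⟩
  · rw [hs'.out, ho]
  · refine Nat.add_le_add ?_ (sum_ext_le _ _ _ _ (Program.arrays_subset _ hs) fun a ha => ?_)
    · simpa using Finset.card_le_card (Program.vars_subset _ hs)
    · have := hs'.ext a (by omega)
      simp only at this; omega

/-- Run a structured program on the captured output of another program. -/
theorem runs_capture_of_wp {D : Program} {inp O L : List ℤ} {tD sD mD : ℕ}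
    (hD : Runs D inp tD sD mD L) {main : Cmd} {m T : ℕ} (hm : m ≤ 100) (hm1 : 1 ≤ m)
    (hs : main.comp.small 120 m = true) {B E : ℤ} (hB : 1 ≤ B)
    (hL : (L.length : ℤ) + 1 ≤ B) (hLB : ∀ z ∈ L, -B ≤ z ∧ z ≤ B) (hmD : (mD : ℤ) ≤ B)
    (hLE : (L.length : ℤ) ≤ E)
    (h : ∀ ext0 (s : St), s.var 0 = L.length → (∀ x, 2 ≤ x → s.var x = 0) →
      (∀ k : ℕ, s.arr 0 k = L.getD k 0) → (∀ a, 1 ≤ a → ∀ k, s.arr a k = 0) → s.out = [] →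
      main.wp ⟨inp, B, E, ext0, hB⟩ (fun t s => t ≤ T ∧ s.out = O) s) :
    ∃ t s mm, Runs (.seq D.capture main.comp) inp t s mm O ∧ t ≤ 3 * tD + T ∧
      s ≤ sD + 120 + m * (E.toNat + 1) ∧ (mm : ℤ) ≤ 2 * B + 1 := by
  obtain ⟨f, hx, hout, hsD, hmD'⟩ := hD
  obtain ⟨t1, d, hx1, ht1, hd⟩ := hx.capture Captures.init
  have hpk : d.peak ≤ B.toNat := by
    refine hd.peak _ (by omega) (by rw [hout]; omega) fun z hz => ?_
    rw [hout] at hz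
    have := hLB z hz; omega
  -- The capturing run uses names from `1000` on, apart from variables `0`, `1` and array `0`; the
  -- structured program finds everything else zero.
  let s0 : St := ⟨fun x => if x < 2 then d.var x else 0, fun a k => if a = 0 then d.arr 0 k.toNat
    else 0, []⟩
  have hgetD : ∀ k : ℕ, -B ≤ L.getD k 0 ∧ L.getD k 0 ≤ B := by
    intro k
    rcases lt_or_ge k L.length with h | h
    · rw [List.getD_eq_getElem _ _ h]; exact hLB _ (List.getElem_mem h)
    · rw [List.getD_eq_default _ _ h]; omega
  have hsim : Sim ⟨inp, B, E, d.ext, hB⟩ d s0 := by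
    refine ⟨fun x hx => ?_, fun a ha k => ?_, hd.out, fun x hx => ?_, fun a ha k => ?_, ?_,
      fun a ha => ?_, fun a _ => rfl⟩
    · simp only [s0]
      split_ifs with h2
      · rfl
      · exact hd.low x (by omega) (by omega)
    · simp only [s0]
      split_ifs with h2
      · simp [h2]
      · exact hd.lowA a (by omega) (by omega) k
    · simp only [s0, Ctx.bd]
      split_ifs with h2
      · interval_cases x
        · rw [hd.cnt, hout]; omega
        · rcases hd.one with h | h <;> rw [h] <;> omega
      · omega
    · simp only [s0, Ctx.bd]
      split_ifs with h2
      · rw [hd.buf, hout]; exact hgetD _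
      · omega
    · simp only; omega
    · simp only
      by_cases h0 : a = 0
      · subst h0; have := hd.extBuf; rw [hout] at this; omega
      · rw [hd.lowE a (by omega) (by omega)]; simp only [Nat.cast_zero]; omega
  obtain ⟨τ, t, c', s', hx', hτ, hs', ht, ho⟩ := Cmd.comp_exec main (h d.ext s0
    (by simp [s0, hd.cnt, hout]) (fun x hx => by simp only [s0]; rw [if_neg (by omega)])
    (fun k => by simp [s0, hd.buf, hout])
    (fun a ha k => by simp only [s0]; rw [if_neg (by omega)]) rfl) hsim
  refine ⟨_, _, _, ⟨c', .seq _ _ _ _ _ _ _ hx1 hx', ?_, rfl, rfl⟩, by omega, ?_, hs'.peak⟩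
  · rw [hs'.out, ho]
  · have hv : (Program.seq D.capture main.comp).vars.card ≤ 120 + D.vars.card := by
      refine (Finset.card_le_card (t := Finset.range 120 ∪ D.vars.image (· + 1000)) ?_).trans ?_
      · refine Finset.union_subset (D.capture_vars.trans ?_)
          ((Program.vars_subset _ hs).trans Finset.subset_union_left)
        exact Finset.union_subset_union_left (by simp)
      · refine (Finset.card_union_le _ _).trans ?_
        have := Finset.card_image_le (s := D.vars) (f := (· + 1000))
        simp only [Finset.card_range]; omega
    have ha : ∑ a ∈ (Program.seq D.capture main.comp).arrays, (c'.ext a + 1) ≤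
        m * (E.toNat + 1) + ∑ a ∈ D.arrays, (f.ext a + 1) := by
      have hsub : (Program.seq D.capture main.comp).arrays ⊆
          Finset.range m ∪ D.arrays.image (· + 1000) := by
        refine Finset.union_subset (D.capture_arrays.trans ?_)
          ((Program.arrays_subset _ hs).trans Finset.subset_union_left)
        exact Finset.union_subset_union_left (by simp; omega)
      refine (Finset.sum_le_sum_of_subset hsub).trans ?_
      refine (Finset.sum_union_inter (s₁ := Finset.range m) (s₂ := D.arrays.image (· + 1000))
        (f := fun a => c'.ext a + 1)).le.trans' (Nat.le_add_right _ _) |>.trans ?_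
      refine Nat.add_le_add (sum_ext_le _ _ _ _ subset_rfl fun a ha => ?_) ?_
      · have := hs'.ext a (by omega)
        simp only at this; omega
      -- The structured program does not touch the renamed arrays of `D`, so their extents are still
      -- those of the captured run.
      · rw [Finset.sum_image (by intro x _ y _ h; simpa using h)]
        refine Finset.sum_le_sum fun a _ => ?_
        rw [hs'.ext0 _ (by omega)]; simp only; rw [hd.ext]
    omega

/-! ## Walks in weighted graphs -/

section Walks

variable {V : Type*}

/-- `Wk w x l y z`: a walk from `x` to `y` with at least one edge, inner vertices `l` and
weight `z`; `w x y` is the weight of the edge from `x` to `y`, `⊤` if there is none. -/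
inductive Wk (w : V → V → WithTop ℤ) : V → List V → V → ℤ → Prop
  | edge {x y : V} {z : ℤ} (h : w x y = z) : Wk w x [] y z
  | cons {x a y : V} {l : List V} {z z' : ℤ} (h : w x a = z) (h' : Wk w a l y z') :
      Wk w x (a :: l) y (z + z')

/-- Reachability along edges of finite weight. -/
def Rch (w : V → V → WithTop ℤ) : V → V → Prop := Relation.ReflTransGen fun x y => w x y ≠ ⊤

/-- The vertex `u` reaches a closed walk of weight less than `θ`. -/
def Bad (w : V → V → WithTop ℤ) (θ : ℤ) (u : V) : Prop :=
  ∃ y l z, Rch w u y ∧ Wk w y l y z ∧ z < θ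

variable {w : V → V → WithTop ℤ}

theorem Wk.append {x a y : V} {p q : List V} {z z' : ℤ} (h : Wk w x p a z) (h' : Wk w a q y z') :
    Wk w x (p ++ a :: q) y (z + z') := by
  induction h with
  | edge h => exact .cons h h'
  | cons h _ ih => rw [add_assoc]; exact .cons h (ih h')

theorem Wk.split {x a y : V} {p q : List V} {z : ℤ} (h : Wk w x (p ++ a :: q) y z) :
    ∃ z1 z2, Wk w x p a z1 ∧ Wk w a q y z2 ∧ z = z1 + z2 := by
  induction p generalizing x z with
  | nil =>
    cases h with
    | cons h h' => exact ⟨_, _, .edge h, h', rfl⟩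
  | cons b p ih =>
    cases h with
    | cons h h' =>
      obtain ⟨z1, z2, h1, h2, rfl⟩ := ih h'
      exact ⟨_, _, .cons h h1, h2, by ring⟩

theorem Wk.rch {x y : V} {l : List V} {z : ℤ} (h : Wk w x l y z) : Rch w x y := by
  induction h with
  | edge h => exact .single (by simp [h])
  | cons h _ ih => exact .head (by simp [h]) ih

theorem Wk.rch_mem {x y a : V} {l : List V} {z : ℤ} (h : Wk w x l y z) (ha : a ∈ l) :
    Rch w x a ∧ Rch w a y := by
  obtain ⟨p, q, rfl⟩ := List.append_of_mem ha
  obtain ⟨z1, z2, h1, h2, -⟩ := h.split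
  exact ⟨h1.rch, h2.rch⟩

theorem Wk.abs_le {M : ℤ} (hM : ∀ x y z, w x y = (z : ℤ) → |z| ≤ M) {x y : V} {l : List V} {z : ℤ}
    (h : Wk w x l y z) : |z| ≤ (l.length + 1) * M := by
  induction h with
  | edge h => simpa using hM _ _ _ h
  | cons h _ ih =>
    have h1 := hM _ _ _ h
    refine (abs_add_le _ _).trans ?_
    simp only [List.length_cons]; push_cast
    linarith

/-- Cut out closed walks of nonnegative weight. -/
theorem Wk.exists_nodup {A : Set V} (hA : ∀ a l z, a ∈ A → (∀ b ∈ l, b ∈ A) → Wk w a l a z → 0 ≤ z)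
    {x y : V} {l : List V} {z : ℤ} (h : Wk w x l y z) (hl : ∀ b ∈ l, b ∈ A) :
    ∃ l' z', Wk w x l' y z' ∧ z' ≤ z ∧ l'.Nodup ∧ ∀ b ∈ l', b ∈ A := by
  induction h with
  | edge h => exact ⟨[], _, .edge h, le_rfl, List.nodup_nil, by simp⟩
  | @cons x a y l z z' h h' ih =>
    obtain ⟨l', z'', h1, h2, h3, h4⟩ := ih fun b hb => hl b (List.mem_cons_of_mem _ hb)
    have haA := hl a List.mem_cons_self
    by_cases ha : a ∈ l'
    · obtain ⟨p, q, rfl⟩ := List.append_of_mem ha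
      obtain ⟨z1, z2, h5, h6, rfl⟩ := h1.split
      have := hA a p z1 haA (fun b hb => h4 b (by simp [hb])) h5
      exact ⟨a :: q, z + z2, .cons h h6, by linarith, h3.of_append_right,
        fun b hb => h4 b (List.mem_append_right _ hb)⟩
    · exact ⟨a :: l', z + z'', .cons h h1, by linarith, List.nodup_cons.2 ⟨ha, h3⟩, by
        simpa [haA] using h4⟩

theorem exists_dup_of_not_nodup {l : List V} (h : ¬ l.Nodup) :
    ∃ a p q r, l = p ++ a :: (q ++ a :: r) := by
  induction l with
  | nil => simp at h
  | cons b l ih =>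
    by_cases hb : b ∈ l
    · obtain ⟨q, r, rfl⟩ := List.append_of_mem hb
      exact ⟨b, [], q, r, rfl⟩
    · obtain ⟨a, p, q, r, rfl⟩ := ih (fun hl => h (List.nodup_cons.2 ⟨hb, hl⟩))
      exact ⟨a, b :: p, q, r, rfl⟩

/-- A closed walk of weight less than `θ` contains a simple cycle of weight less than `θ`. -/
theorem Wk.exists_cycle {θ : ℤ} (hθ : 0 ≤ θ) (k : ℕ) : ∀ {y : V} {l : List V} {z : ℤ},
    l.length = k → Wk w y l y z → z < θ →
    ∃ y' l' z', y' ∈ y :: l ∧ Wk w y' l' y' z' ∧ z' < θ ∧ (l' ++ [y']).Nodup := by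
  induction k using Nat.strong_induction_on with
  | _ k ih =>
    intro y l z hk h hz
    by_cases hy : y ∈ l
    · obtain ⟨p, q, rfl⟩ := List.append_of_mem hy
      obtain ⟨z1, z2, h1, h2, rfl⟩ := h.split
      simp at hk
      -- If the first part has weight at least `θ ≥ 0`, what remains has weight below `0`, hence
      -- below `θ`. The same argument applies to a loop in the middle.
      by_cases hz1 : z1 < θ
      · obtain ⟨y', l', z', hy', h'⟩ := ih _ (by omega) rfl h1 hz1
        exact ⟨y', l', z', by simp at hy' ⊢; tauto, h'⟩
      · obtain ⟨y', l', z', hy', h'⟩ := ih _ (by omega) rfl h2 (by omega)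
        exact ⟨y', l', z', by simp at hy' ⊢; tauto, h'⟩
    by_cases hl : l.Nodup
    · exact ⟨y, l, z, by simp, h, hz, by
        rw [List.nodup_append]
        exact ⟨hl, by simp, fun a ha b hb => by rintro rfl; simp at hb; exact hy (hb ▸ ha)⟩⟩
    · obtain ⟨a, p, q, r, rfl⟩ := exists_dup_of_not_nodup hl
      obtain ⟨z1, z2, h1, h2, rfl⟩ := h.split
      obtain ⟨z3, z4, h3, h4, rfl⟩ := h2.split
      simp at hk
      by_cases hz1 : z3 < θ
      · obtain ⟨y', l', z', hy', h'⟩ := ih _ (by omega) rfl h3 hz1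
        exact ⟨y', l', z', by simp at hy' ⊢; tauto, h'⟩
      · obtain ⟨y', l', z', hy', h'⟩ := ih _ (by simp; omega) rfl (h1.append h4) (by omega)
        exact ⟨y', l', z', by simp at hy' ⊢; tauto, h'⟩

end Walks

/-! ## Ratio values -/

namespace WGraph

variable {n : ℕ} (G : WGraph n)

@[simp] theorem pathWt_cons (x y : Fin n) (l : List (Fin n)) :
    G.pathWt (x :: y :: l) = G.wt (x, y) + G.pathWt (y :: l) := rfl
@[simp] theorem pathWt'_cons (x y : Fin n) (l : List (Fin n)) :
    G.pathWt' (x :: y :: l) = G.wt' (x, y) + G.pathWt' (y :: l) := rfl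
@[simp] theorem pathWt_single (x : Fin n) : G.pathWt [x] = 0 := rfl
@[simp] theorem pathWt'_single (x : Fin n) : G.pathWt' [x] = 0 := rfl

open Classical in
/-- Edge weights with respect to thresholds `(th u).1 / (th u).2` at the nodes; only edges between
nodes with equal thresholds remain. -/
noncomputable def cw (th : Fin n → ℤ × ℤ) (x y : Fin n) : WithTop ℤ :=
  if G.Adj x y ∧ th x = th y then
    (((th x).2 * G.wt (x, y) - (th x).1 * (G.wt' (x, y) : ℕ) : ℤ) : WithTop ℤ) else ⊤

variable {G}

theorem cw_eq {th : Fin n → ℤ × ℤ} {x y : Fin n} {z : ℤ} : G.cw th x y = z ↔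
    G.Adj x y ∧ th x = th y ∧ z = (th x).2 * G.wt (x, y) - (th x).1 * (G.wt' (x, y) : ℕ) := by
  unfold cw
  split_ifs with h
  · rw [WithTop.coe_eq_coe]; constructor
    · rintro rfl; exact ⟨h.1, h.2, rfl⟩
    · exact fun h' => h'.2.2.symm
  · simp only [WithTop.top_ne_coe, false_iff]; tauto

theorem cw_ne_top {th : Fin n → ℤ × ℤ} {x y : Fin n} :
    G.cw th x y ≠ ⊤ ↔ G.Adj x y ∧ th x = th y := by
  unfold cw
  split_ifs with h
  · simpa only [ne_eq, WithTop.coe_ne_top, not_false_eq_true, true_iff] using h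
  · simpa using h

theorem wk_of_chain {th : Fin n → ℤ × ℤ} {a b : ℤ} {x : Fin n} (l : List (Fin n)) :
    ∀ {y : Fin n}, (y :: (l ++ [x])).IsChain G.Adj → (∀ v ∈ y :: (l ++ [x]), th v = (a, b)) →
      Wk (G.cw th) y l x (b * G.pathWt (y :: (l ++ [x])) - a * G.pathWt' (y :: (l ++ [x]))) := by
  induction l with
  | nil =>
    intro y h ht
    refine .edge (cw_eq.2 ⟨by simpa using h, ?_, ?_⟩)
    · rw [ht y (by simp), ht x (by simp)]
    · rw [ht y (by simp)]; simp
  | cons v l ih =>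
    intro y h ht
    rw [List.cons_append, List.isChain_cons_cons] at h
    have h1 := ih h.2 fun u hu => ht u (List.mem_cons_of_mem _ hu)
    have h2 : G.cw th y v = ((b * G.wt (y, v) - a * (G.wt' (y, v) : ℕ) : ℤ) : WithTop ℤ) :=
      cw_eq.2 ⟨h.1, by rw [ht y (by simp), ht v (by simp)], by rw [ht y (by simp)]⟩
    convert Wk.cons h2 h1 using 1
    simp; ring

theorem chain_of_wk {th : Fin n → ℤ × ℤ} {x y : Fin n} {l : List (Fin n)} {z : ℤ}
    (h : Wk (G.cw th) y l x z) : (y :: (l ++ [x])).IsChain G.Adj ∧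
      th x = th y ∧
      z = (th y).2 * G.pathWt (y :: (l ++ [x])) - (th y).1 * G.pathWt' (y :: (l ++ [x])) := by
  induction h with
  | edge h => obtain ⟨h1, h2, rfl⟩ := cw_eq.1 h; simp [h1, h2]
  | cons h h' ih =>
    obtain ⟨h1, h2, rfl⟩ := cw_eq.1 h
    obtain ⟨h3, h4, rfl⟩ := ih
    refine ⟨by simpa [h1] using h3, by rw [h4, h2], ?_⟩
    rw [← h2]; simp; ring

theorem rch_of_chain {x : Fin n} (l : List (Fin n)) : ∀ {y : Fin n},
    (y :: (l ++ [x])).IsChain G.Adj → ∀ v ∈ y :: (l ++ [x]),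
      Relation.ReflTransGen G.Adj y v ∧ Relation.ReflTransGen G.Adj v x := by
  induction l with
  | nil =>
    intro y h v hv
    have : G.Adj y x := by simpa using h
    simp at hv
    rcases hv with rfl | rfl
    · exact ⟨.refl, .single this⟩
    · exact ⟨.single this, .refl⟩
  | cons a l ih =>
    intro y h v hv
    rw [List.cons_append, List.isChain_cons_cons] at h
    rw [List.mem_cons] at hv
    rcases hv with rfl | hv
    · exact ⟨.refl, .head h.1 (ih h.2 a (by simp)).2⟩
    · exact ⟨.head h.1 (ih h.2 v hv).1, (ih h.2 v hv).2⟩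

theorem isSimpleCycle_iff {p : List (Fin n)} : G.IsSimpleCycle p ↔
    ∃ y l, p = y :: (l ++ [y]) ∧ p.IsChain G.Adj ∧ (l ++ [y]).Nodup := by
  constructor
  · rintro ⟨⟨hne, hc⟩, hlen, hh, hnd⟩
    obtain ⟨y, q, rfl⟩ := List.exists_cons_of_ne_nil hne
    have hq : q ≠ [] := by rintro rfl; simp at hlen
    refine ⟨y, q.dropLast, ?_, hc, ?_⟩
    · have h1 : q.getLast hq = y := by
        rw [List.getLast?_eq_getLast_of_ne_nil (by simp), List.getLast_cons hq] at hh
        simpa using hh.symm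
      conv_lhs => rw [← List.dropLast_append_getLast hq, h1]
    · have h1 : q.getLast hq = y := by
        rw [List.getLast?_eq_getLast_of_ne_nil (by simp), List.getLast_cons hq] at hh
        simpa using hh.symm
      rw [← h1, List.dropLast_append_getLast hq]; exact hnd
  · rintro ⟨y, l, rfl, hc, hnd⟩
    refine ⟨⟨by simp, hc⟩, by simp, ?_, hnd⟩
    rw [List.getLast?_eq_getLast_of_ne_nil (by simp)]
    simp

theorem pathWt'_pos {x : Fin n} (l : List (Fin n)) : ∀ y : Fin n,
    0 < G.pathWt' (y :: (l ++ [x])) := by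
  induction l with
  | nil => intro y; simp
  | cons a l ih => intro y; have := ih a; simp at this ⊢

/-- The minimum is over a finite set, because simple cycles have at most `n + 1` entries, and it is
nonempty, because following chosen outgoing edges from `u` must repeat a node. -/
theorem exists_isRatioValue (G : WGraph n) (u : Fin n) : ∃ q, G.IsRatioValue u q := by
  have hfin : {r | ∃ p, G.IsSimpleCycle p ∧ G.Reaches u p ∧ r = G.pathValue p}.Finite := by
    have : {p : List (Fin n) | p.length ≤ n + 1}.Finite := List.finite_length_le _ _
    refine (this.image G.pathValue).subset ?_
    rintro r ⟨p, hp, -, rfl⟩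
    refine ⟨p, ?_, rfl⟩
    have h1 := hp.2.2.2.length_le_card
    simp at h1 ⊢; omega
  have hne : {r | ∃ p, G.IsSimpleCycle p ∧ G.Reaches u p ∧ r = G.pathValue p}.Nonempty := by
    choose f hf using G.exists_out
    have hreach : ∀ i, Relation.ReflTransGen G.Adj u (f^[i] u) := by
      intro i
      induction i with
      | zero => exact .refl
      | succ i ih => rw [Function.iterate_succ_apply']; exact ih.tail (hf _)
    obtain ⟨i, j, hij, hfe⟩ : ∃ i j, i < j ∧ f^[i] u = f^[j] u := by
      obtain ⟨i, j, hne, he⟩ := Finite.exists_ne_map_eq_of_infinite fun i => f^[i] u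
      rcases lt_or_gt_of_ne hne with h | h
      · exact ⟨i, j, h, he⟩
      · exact ⟨j, i, h, he.symm⟩
    -- With thresholds `(0, 0)` every edge has weight `0`, so `Wk.exists_cycle` with `θ = 1` just
    -- extracts a simple cycle from a closed walk.
    have hwk : ∀ d i, ∃ l z, Wk (G.cw fun _ => (0, 0)) (f^[i] u) l (f^[i + d + 1] u) z := by
      intro d
      induction d with
      | zero =>
        intro i
        refine ⟨[], 0, .edge (cw_eq.2 ⟨?_, rfl, by simp⟩)⟩
        rw [Nat.add_zero, Function.iterate_succ_apply']; exact hf _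
      | succ d ih =>
        intro i
        obtain ⟨l, z, h⟩ := ih (i + 1)
        refine ⟨_, 0 + z, .cons (a := f^[i + 1] u) (cw_eq.2 ⟨?_, rfl, by simp⟩)
          (by rwa [show i + (d + 1) + 1 = i + 1 + d + 1 by omega])⟩
        rw [Function.iterate_succ_apply']; exact hf _
    obtain ⟨l, z, h⟩ := hwk (j - i - 1) i
    rw [show i + (j - i - 1) + 1 = j by omega, ← hfe] at h
    have hz : z < 1 := by rw [(chain_of_wk h).2.2]; simp
    obtain ⟨y, l', z', hy, h1, h2, h3⟩ := Wk.exists_cycle (by simp) _ rfl h hz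
    have hc := (chain_of_wk h).1
    refine ⟨_, y :: (l' ++ [y]), isSimpleCycle_iff.2 ⟨y, l', rfl, (chain_of_wk h1).1, h3⟩,
      ⟨y, by simp, (hreach i).trans ((rch_of_chain l hc y ?_).1)⟩, rfl⟩
    simp at hy ⊢; tauto
  exact hfin.isCompact.exists_isLeast hne

section Value

variable {ν : Fin n → ℚ} (hν : ∀ u, G.IsRatioValue u (ν u))

include hν in
theorem value_mono {u v : Fin n} (h : Relation.ReflTransGen G.Adj u v) : ν u ≤ ν v := by
  obtain ⟨p, hp, ⟨x, hx, hvx⟩, he⟩ := (hν v).1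
  exact (hν u).2 ⟨p, hp, ⟨x, hx, h.trans hvx⟩, he⟩

end Value

/-- Clearing denominators; since the left side is an integer, being less than `1` means being at
most `0`. Thus the two values of `θ` encode strict and weak comparison. -/
theorem value_lt_iff {a b : ℤ} (hb : 0 < b) {y x : Fin n} {l : List (Fin n)} {θ : ℤ} {R : ℚ → ℚ → Prop}
    (hR : (θ = 0 ∧ R = (· < ·)) ∨ (θ = 1 ∧ R = (· ≤ ·))) :
    b * G.pathWt (y :: (l ++ [x])) - a * G.pathWt' (y :: (l ++ [x])) < θ ↔
      R (G.pathValue (y :: (l ++ [x]))) ((a : ℚ) / b) := by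
  have h1 := pathWt'_pos (G := G) (x := x) l y
  have h2 : (0 : ℚ) < G.pathWt' (y :: (l ++ [x])) := by exact_mod_cast h1
  have h3 : (0 : ℚ) < b := by exact_mod_cast hb
  unfold pathValue
  rcases hR with ⟨rfl, rfl⟩ | ⟨rfl, rfl⟩
  · simp only
    rw [div_lt_div_iff₀ h2 h3, sub_neg, mul_comm b]; norm_cast
  · simp only
    rw [div_le_div_iff₀ h2 h3, mul_comm b, Int.lt_iff_add_one_le]
    have : ∀ s t : ℤ, s - t + 1 ≤ 1 ↔ s ≤ t := fun s t => by omega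
    rw [this]; norm_cast

/-- Thresholds that depend on the ratio values only can be compared with the ratio values by
looking for negative closed walks between nodes with equal thresholds. -/
theorem bad_cw_iff {ν : Fin n → ℚ} (hν : ∀ u, G.IsRatioValue u (ν u)) {th : Fin n → ℤ × ℤ}
    {f : ℚ → ℤ × ℤ} (hf : ∀ u, th u = f (ν u)) (hpos : ∀ u, 0 < (th u).2) {θ : ℤ}
    {R : ℚ → ℚ → Prop} (hR : (θ = 0 ∧ R = (· < ·)) ∨ (θ = 1 ∧ R = (· ≤ ·))) (u : Fin n) :
    Bad (G.cw th) θ u ↔ R (ν u) (((th u).1 : ℚ) / (th u).2) := by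
  have hadj : ∀ {x y}, Rch (G.cw th) x y → Relation.ReflTransGen G.Adj x y := by
    intro x y h
    induction h with
    | refl => exact .refl
    | tail _ h ih => exact ih.tail (cw_ne_top.1 h).1
  have hth : ∀ {x y}, Rch (G.cw th) x y → th y = th x := by
    intro x y h
    induction h with
    | refl => rfl
    | tail _ h ih => rw [← (cw_ne_top.1 h).2, ih]
  constructor
  · rintro ⟨y, l, z, hy, hw, hz⟩
    obtain ⟨y', l', z', hy', h1, h2, h3⟩ := Wk.exists_cycle
      (by rcases hR with h | h <;> omega) _ rfl hw hz
    have hyy' : Rch (G.cw th) y y' := by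
      rcases List.mem_cons.1 hy' with rfl | h
      · exact .refl
      · exact (hw.rch_mem h).1
    have huy' := hy.trans hyy'
    obtain ⟨hc, -, rfl⟩ := chain_of_wk h1
    rw [value_lt_iff (hpos _) hR, hth huy'] at h2
    have h4 : ν u ≤ G.pathValue (y' :: (l' ++ [y'])) :=
      (hν u).2 ⟨_, isSimpleCycle_iff.2 ⟨y', l', rfl, hc, h3⟩, ⟨y', by simp, hadj huy'⟩, rfl⟩
    rcases hR with ⟨-, rfl⟩ | ⟨-, rfl⟩
    · exact h4.trans_lt h2
    · exact h4.trans h2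
  · intro h
    obtain ⟨p, hp, ⟨v, hv, huv⟩, he⟩ := (hν u).1
    have hrp := hp
    obtain ⟨y, l, rfl, hc, hnd⟩ := isSimpleCycle_iff.1 hp
    -- Nodes between `u` and an optimal cycle of `u` have the value of `u`: they reach that cycle,
    -- and values do not decrease along edges. So they share the threshold of `u`, and the path to
    -- the cycle and the cycle itself survive in `cw`.
    have hval : ∀ x, Relation.ReflTransGen G.Adj u x → Relation.ReflTransGen G.Adj x v →
        ν x = ν u := by
      intro x h1 h2
      refine le_antisymm ?_ (value_mono hν h1)
      rw [he]; exact (hν x).2 ⟨_, hp, ⟨v, hv, h2⟩, rfl⟩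
    have hpath : ∀ x, Relation.ReflTransGen G.Adj u x → Relation.ReflTransGen G.Adj x v →
        Rch (G.cw th) x v := by
      intro x h1 h2
      induction h2 using Relation.ReflTransGen.head_induction_on with
      | refl => exact .refl
      | head h h' ih =>
        refine .head (cw_ne_top.2 ⟨h, ?_⟩) (ih (h1.tail h))
        rw [hf, hf, hval _ h1 (.head h h'), hval _ (h1.tail h) h']
    have hcv := rch_of_chain l hc
    have huy : Relation.ReflTransGen G.Adj u y := huv.trans (hcv v hv).2
    have hcy : ∀ x ∈ y :: (l ++ [y]), th x = ((th u).1, (th u).2) := by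
      intro x hx
      rw [hf, hval x (huy.trans (hcv x hx).1) ((hcv x hx).2.trans (hcv v hv).1), ← hf]
    have hw := wk_of_chain (th := th) l hc hcy
    refine ⟨y, l, _, ?_, hw, ?_⟩
    · refine (hpath u .refl huv).trans ?_
      rcases List.mem_cons.1 hv with rfl | hv'
      · exact .refl
      · rcases List.mem_append.1 hv' with h' | h'
        · exact (hw.rch_mem h').2
        · rw [List.mem_singleton.1 h']
    · rw [value_lt_iff (hpos u) hR, ← he]; exact h

theorem weight_le {e : Fin n × Fin n} (he : e ∈ G.edges) :
    |G.wt e| ≤ G.maxWeight ∧ (G.wt' e : ℕ) ≤ G.maxWeight := by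
  have : max (G.wt e).natAbs (G.wt' e : ℕ) ≤ G.maxWeight :=
    Finset.le_sup (f := fun e => max (G.wt e).natAbs (G.wt' e : ℕ)) he
  rw [Int.abs_eq_natAbs]
  constructor <;> omega

theorem pathWt_le {x : Fin n} (l : List (Fin n)) : ∀ {y : Fin n},
    (y :: (l ++ [x])).IsChain G.Adj →
      |G.pathWt (y :: (l ++ [x]))| ≤ (l.length + 1) * G.maxWeight ∧
      G.pathWt' (y :: (l ++ [x])) ≤ (l.length + 1) * G.maxWeight := by
  induction l with
  | nil =>
    intro y h
    have : G.Adj y x := by simpa using h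
    simpa using weight_le this
  | cons a l ih =>
    intro y h
    rw [List.cons_append, List.isChain_cons_cons] at h
    obtain ⟨h1, h2⟩ := ih h.2
    obtain ⟨h3, h4⟩ := weight_le h.1
    rw [List.cons_append, pathWt_cons, pathWt'_cons, List.length_cons]
    constructor
    · refine (abs_add_le _ _).trans ?_
      push_cast; linarith
    · linarith

/-- A simple cycle has at most `n` edges, so both of its sums are at most `n * maxWeight` in
absolute value, and cancelling a common factor only decreases them. -/
theorem IsRatioValue.bounds {u : Fin n} {q : ℚ} (h : G.IsRatioValue u q) :
    |q.num| ≤ n * G.maxWeight ∧ q.den ≤ n * G.maxWeight := by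
  obtain ⟨p, hp, -, he⟩ := h.1
  obtain ⟨y, l, rfl, hc, hnd⟩ := isSimpleCycle_iff.1 hp
  obtain ⟨h1, h2⟩ := pathWt_le l hc
  have h3 := pathWt'_pos (G := G) (x := y) l y
  have h4 : l.length + 1 ≤ n := by simpa using hnd.length_le_card
  obtain ⟨c, hc1, hc2⟩ := Rat.exists_eq_mul_div_num_and_eq_mul_div_den
    (G.pathWt (y :: (l ++ [y]))) (d := (G.pathWt' (y :: (l ++ [y])) : ℤ)) (by exact_mod_cast h3.ne')
  have hq : ((G.pathWt (y :: (l ++ [y])) : ℚ) / ((G.pathWt' (y :: (l ++ [y])) : ℤ) : ℚ)) = q := by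
    rw [he]; rfl
  rw [hq] at hc1 hc2
  have h5 : (l.length + 1) * G.maxWeight ≤ n * G.maxWeight := Nat.mul_le_mul_right _ h4
  have h6 : ((l.length : ℤ) + 1) * G.maxWeight ≤ n * G.maxWeight := by exact_mod_cast h5
  have hcpos : 0 < c := by
    by_contra hneg
    have : (q.den : ℤ) > 0 := by exact_mod_cast q.den_pos
    have : (G.pathWt' (y :: (l ++ [y])) : ℤ) > 0 := by exact_mod_cast h3
    nlinarith
  constructor
  · refine le_trans ?_ (h1.trans h6)
    rw [hc1, abs_mul, abs_of_pos hcpos]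
    nlinarith [abs_nonneg q.num]
  · have : (q.den : ℤ) ≤ G.pathWt' (y :: (l ++ [y])) := by
      have : (q.den : ℤ) > 0 := by exact_mod_cast q.den_pos
      rw [hc2]; nlinarith
    have : q.den ≤ G.pathWt' (y :: (l ++ [y])) := by exact_mod_cast this
    omega

end WGraph

/-! ## Search for a rational number in the Stern-Brocot tree -/

/-- State of the search for a rational number: it lies strictly between the fractions
`xp / xq` and `yp / yq`, and is compared with `(xp + g * yp) / (xq + g * yq)`. The step `g` doubles
while `md = 1` and is halved while `md = 0`; `md = 2` initially. -/
structure NS where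
  xp : ℤ
  xq : ℤ
  yp : ℤ
  yq : ℤ
  g : ℤ
  md : ℤ
  sg : ℤ

namespace NS

/-- `X` is `0 / 1` and `Y` a placeholder, so the first candidate is `0`. That comparison yields the
sign, after which `Y` becomes `1 / 0` or `-1 / 0`. -/
def init : NS := ⟨0, 1, 0, 0, 1, 2, 0⟩

def cand (s : NS) : ℤ × ℤ := (s.xp + s.g * s.yp, s.xq + s.g * s.yq)

/-- The search step after the phase is checked for completion. -/
def turn (s : NS) : NS := if s.g = 0 then ⟨s.yp, s.yq, s.xp, s.xq, 1, 1, 2 - s.sg⟩ else s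

/-- The search step, where `c` is the result of the comparison. -/
def step (s : NS) (c : ℤ) : NS :=
  if c = 1 then s
  else if s.md = 2 then
    if c = 0 then { s with yp := 1, md := 1, sg := 0 } else { s with yp := -1, md := 1, sg := 2 }
  -- `sg` is the outcome that places the number between the candidate and `Y`; then `X` may advance
  -- to the candidate.
  else if c = s.sg then
    turn { s with xp := s.xp + s.g * s.yp, xq := s.xq + s.g * s.yq,
                  g := if s.md = 1 then 2 * s.g else s.g / 2 }
  else turn { s with md := 0, g := s.g / 2 }

/-- Comparison of `ν` with the fraction `c`: `0` if it is larger, `1` if equal, `2` if smaller. -/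
def cmp (ν : ℚ) (c : ℤ × ℤ) : ℤ :=
  (if ν < (c.1 : ℚ) / c.2 then 1 else 0) + (if ν ≤ (c.1 : ℚ) / c.2 then 1 else 0)

def run (ν : ℚ) : ℕ → NS
  | 0 => init
  | r + 1 => (run ν r).step (cmp ν (run ν r).cand)

theorem cmp_eq (ν : ℚ) {c : ℤ × ℤ} (hc : 0 < c.2) :
    cmp ν c = if 0 < ν.num * c.2 - ν.den * c.1 then 0
      else if ν.num * c.2 - ν.den * c.1 = 0 then 1 else 2 := by
  have h1 : (0 : ℚ) < c.2 := by exact_mod_cast hc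
  have h2 : (0 : ℚ) < ν.den := by exact_mod_cast ν.den_pos
  have e1 : ν < (c.1 : ℚ) / c.2 ↔ ν.num * c.2 - ν.den * c.1 < 0 := by
    conv_lhs => rw [← Rat.num_div_den ν]
    rw [div_lt_div_iff₀ h2 h1, sub_neg, mul_comm (c.1 : ℚ)]; norm_cast
  have e2 : ν ≤ (c.1 : ℚ) / c.2 ↔ ν.num * c.2 - ν.den * c.1 ≤ 0 := by
    conv_lhs => rw [← Rat.num_div_den ν]
    rw [div_le_div_iff₀ h2 h1, sub_nonpos, mul_comm (c.1 : ℚ)]; norm_cast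
  unfold cmp
  simp only [e1, e2]
  split_ifs <;> omega

/-- `(a, b)` is the combination of `X` and `Y` with positive coefficients `α`, `β`. -/
structure Core (a b N : ℤ) (s : NS) (α β : ℤ) : Prop where
  ha : a = α * s.xp + β * s.yp
  hb : b = α * s.xq + β * s.yq
  hα : 1 ≤ α
  hβ : 1 ≤ β
  det : s.xq * s.yp - s.xp * s.yq = 1 - s.sg
  hsg : s.sg = 0 ∨ s.sg = 2
  hxq : 0 ≤ s.xq
  hyq : 0 ≤ s.yq
  sign : (0 ≤ s.xp ∧ 0 ≤ s.yp) ∨ (s.xp ≤ 0 ∧ s.yp ≤ 0)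

variable {a b N : ℤ} {s : NS} {α β : ℤ}

/-- In `α X + β Y` nothing cancels: the coefficients are at least `1`, the denominators nonnegative
and the numerators of equal sign. So each component of `X` and `Y` is dominated by the target. -/
theorem Core.bounds (h : Core a b N s α β) (ha : |a| ≤ N) (hb : b ≤ N) :
    |s.xp| ≤ N ∧ s.xq ≤ N ∧ |s.yp| ≤ N ∧ s.yq ≤ N := by
  obtain ⟨h1, h2, h3, h4, -, -, h7, h8, h9⟩ := h
  have h5 : s.xq ≤ b := by nlinarith
  have h6 : s.yq ≤ b := by nlinarith
  rw [abs_le] at ha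
  refine ⟨?_, by linarith, ?_, by linarith⟩ <;> rw [abs_le] <;>
    rcases h9 with ⟨h10, h11⟩ | ⟨h10, h11⟩ <;> constructor <;> nlinarith

/-- The determinant is `1` or `-1`, so the denominators of `X` and `Y` cannot both vanish. -/
theorem Core.pos (h : Core a b N s α β) (hg : 1 ≤ s.g) : 0 < s.xq + s.g * s.yq := by
  have h1 := h.hxq
  have h2 := h.hyq
  have h3 : 0 ≤ s.g * s.yq := by positivity
  by_contra hneg
  have h4 : s.xq = 0 := by omega
  have h5 : s.yq = 0 := by nlinarith
  have h6 := h.det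
  rw [h4, h5] at h6
  rcases h.hsg with h | h <;> rw [h] at h6 <;> simp at h6

/-- `α X + β Y = α (X + g Y) + (β - α g) Y`, and the determinant is unchanged. -/
theorem Core.move (h : Core a b N s α β) {g : ℤ} (hg : 1 ≤ g) (hlt : α * g < β) (g' md' : ℤ) :
    Core a b N ⟨s.xp + g * s.yp, s.xq + g * s.yq, s.yp, s.yq, g', md', s.sg⟩ α (β - α * g) where
  ha := by simp only; rw [h.ha]; ring
  hb := by simp only; rw [h.hb]; ring
  hα := h.hα
  hβ := by omega
  det := by simp only; rw [← h.det]; ring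
  hsg := h.hsg
  hxq := by have := h.hxq; have := h.hyq; simp only; positivity
  hyq := h.hyq
  sign := by
    rcases h.sign with ⟨h1, h2⟩ | ⟨h1, h2⟩
    · left; simp only; exact ⟨by positivity, h2⟩
    · right; simp only; exact ⟨by nlinarith, h2⟩

theorem Core.swap (h : Core a b N s α β) :
    Core a b N ⟨s.yp, s.yq, s.xp, s.xq, 1, 1, 2 - s.sg⟩ β α where
  ha := by simp only; rw [h.ha]; ring
  hb := by simp only; rw [h.hb]; ring
  hα := h.hβ
  hβ := h.hα
  det := by have := h.det; simp only; linarith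
  hsg := by have := h.hsg; simp only; omega
  hxq := h.hyq
  hyq := h.hxq
  sign := by have := h.sign; simp only; tauto

theorem Core.congr (h : Core a b N s α β) (g' md' : ℤ) :
    Core a b N { s with g := g', md := md' } α β :=
  ⟨h.ha, h.hb, h.hα, h.hβ, h.det, h.hsg, h.hxq, h.hyq, h.sign⟩

/-- The step size does not overshoot by much. -/
def Tame (N : ℤ) (s : NS) : Prop := |s.g * s.yp| ≤ 2 * N ∧ s.g * s.yq ≤ 2 * N

/-- At most `r` more steps are needed. -/
def Inv (a b N : ℤ) (r : ℕ) (s : NS) : Prop :=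
  (s = init ∧ ∃ e : ℕ, |a| * b < 2 ^ e ∧ 3 * e + 2 ≤ r) ∨
  ∃ (α β : ℤ) (k : ℕ), Core a b N s α β ∧ s.g = 2 ^ k ∧ Tame N s ∧
    -- While doubling, the steps `1, 2, …, 2 ^ (k - 1)` have been subtracted, so `β + (2 ^ k - 1) *
    -- α` is the coefficient `β` at the start of the phase. The budget `3 * e` of the phase has been
    -- drawn on `k` times. Only the very first phase can start with `β ≤ α`; it costs one extra
    -- comparison.
    ((s.md = 1 ∧ ∃ e : ℕ, α * (β + (2 ^ k - 1) * α) < 2 ^ e ∧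
        ((3 * e ≤ r + k ∧ (1 ≤ k ∨ α < β)) ∨ (k = 0 ∧ β ≤ α ∧ 3 * e + 1 ≤ r))) ∨
      -- While halving, `k + 1` comparisons finish the binary search for the quotient; after that
      -- the coefficients are `α` and `β % α`.
      (s.md = 0 ∧ β < 2 ^ (k + 1) * α ∧ ∃ e : ℕ, α * (β % α) < 2 ^ e ∧ k + 1 + 3 * e ≤ r))

/-- The cross product with the candidate `X + g Y` is `β - α g` up to the orientation sign, so a
comparison of fractions decides whether `g` is below the quotient `β / α`. -/
theorem Core.diff (h : Core a b N s α β) :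
    a * s.cand.2 - b * s.cand.1 = (β - α * s.g) * (1 - s.sg) := by
  rw [← h.det, h.ha, h.hb]; simp only [cand]; ring

theorem Core.tame_one (h : Core a b N s α β) (ha : |a| ≤ N) (hb : b ≤ N) (hN : 0 ≤ N)
    (hg : s.g = 1) : Tame N s := by
  obtain ⟨-, -, h1, h2⟩ := h.bounds ha hb
  constructor <;> rw [hg, one_mul] <;> linarith

/-- End of a phase: `β` has been reduced below `α`, so after the exchange the next quotient is at
least `1` and the next phase begins with a successful step or with equality. -/
theorem inv_swap {r : ℕ} (h : Core a b N s α β) (ha : |a| ≤ N) (hb : b ≤ N) (hN : 0 ≤ N)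
    (hlt : β < α) {e : ℕ} (he : α * β < 2 ^ e) (hr : 3 * e ≤ r) :
    Inv a b N r ⟨s.yp, s.yq, s.xp, s.xq, 1, 1, 2 - s.sg⟩ := by
  refine Or.inr ⟨β, α, 0, h.swap, rfl, h.swap.tame_one ha hb hN rfl, Or.inl ⟨rfl, e, ?_,
    Or.inl ⟨by omega, Or.inr hlt⟩⟩⟩
  simpa [mul_comm] using he

theorem two_pow_half (k : ℕ) : (2 : ℤ) ^ (k + 1) / 2 = 2 ^ k := by
  rw [pow_succ]; simp

-- One comparison of Euclid's algorithm with galloping search for the quotients. If doubling stops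
-- at step size `2 ^ (k + 1)`, the product of the coefficients will drop by a factor `2 ^ (k + 1)`
-- until the end of the phase; the corresponding `3 * (k + 1)` units of the budget pay for the
-- doublings made and the halvings to come.
set_option maxHeartbeats 1000000 in
theorem inv_step {ν : ℚ} {r : ℕ} (hN1 : |ν.num| ≤ N) (hN2 : (ν.den : ℤ) ≤ N)
    (h : Inv ν.num ν.den N r s) (hc : cmp ν s.cand ≠ 1) :
    ∃ r', r = r' + 1 ∧ Inv ν.num ν.den N r' (s.step (cmp ν s.cand)) := by
  have hden : (1 : ℤ) ≤ ν.den := by exact_mod_cast ν.den_pos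
  have hN : 0 ≤ N := by linarith
  rcases h with ⟨rfl, e, he, hr⟩ | ⟨α, β, k, hC, hg, ht, h⟩
  · have hcmp := cmp_eq ν (c := init.cand) (by simp [init, cand])
    have hcand : init.cand = (0, 1) := rfl
    rw [hcand] at hcmp hc ⊢
    simp only [mul_one, mul_zero, sub_zero] at hcmp
    refine ⟨r - 1, by omega, Or.inr ?_⟩
    have hb2 : 2 * N ≥ 1 := by linarith
    by_cases h1 : 0 < ν.num
    · rw [if_pos h1] at hcmp
      rw [hcmp]
      refine ⟨ν.den, ν.num, 0, ?_⟩
      simp only [step, init, Tame]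
      rw [abs_of_pos h1] at he
      refine ⟨⟨by simp, by simp, hden, h1, by simp, by simp, by simp, by simp, by simp⟩, by simp,
        by simp; omega, Or.inl ⟨by simp, e, ?_, ?_⟩⟩
      · simpa [mul_comm] using he
      · rcases lt_or_ge (ν.den : ℤ) ν.num with h | h
        · exact Or.inl ⟨by omega, Or.inr h⟩
        · exact Or.inr ⟨trivial, h, by omega⟩
    · rw [if_neg h1] at hcmp
      have h2 : ν.num ≠ 0 := by intro h0; rw [if_pos h0] at hcmp; exact hc hcmp
      rw [if_neg h2] at hcmp
      rw [hcmp]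
      refine ⟨ν.den, -ν.num, 0, ?_⟩
      simp only [step, init, Tame]
      rw [abs_of_neg (by omega)] at he
      refine ⟨⟨by simp, by simp, hden, by omega, by simp, by simp, by simp, by simp, by simp⟩,
        by simp, by simp; omega, Or.inl ⟨by simp, e, ?_, ?_⟩⟩
      · simpa [mul_comm] using he
      · rcases lt_or_ge (ν.den : ℤ) (-ν.num) with h | h
        · exact Or.inl ⟨by omega, Or.inr h⟩
        · exact Or.inr ⟨trivial, h, by omega⟩
  · have hg1 : 1 ≤ s.g := by rw [hg]; exact one_le_pow₀ (by norm_num)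
    have hmd : s.md ≠ 2 := by rcases h with h | h <;> rw [h.1] <;> norm_num
    have hα := hC.hα
    have hβ := hC.hβ
    have hcmp := cmp_eq ν (c := s.cand) (hC.pos hg1)
    rw [hC.diff] at hcmp
    have hd : β - α * s.g ≠ 0 := by
      intro h0; rw [h0] at hcmp; simp at hcmp; exact hc hcmp
    have hsucc : cmp ν s.cand = s.sg ↔ 0 < β - α * s.g := by
      rw [hcmp]
      rcases hC.hsg with h0 | h0 <;> rw [h0]
      · norm_num; split_ifs <;> simp_all
      · norm_num; split_ifs <;> simp_all <;> omega
    simp only [step, if_neg hc, if_neg hmd]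
    by_cases hs : cmp ν s.cand = s.sg
    · rw [if_pos hs]
      have hpos := hsucc.1 hs
      have hlt : α * s.g < β := by linarith
      rcases h with ⟨hm, e, he, hr⟩ | ⟨hm, hlt2, e, he, hr⟩
      · -- doubling, success
        simp only [hm, if_true, turn]
        rw [if_neg (by omega)]
        have hα2 : α ≤ α * s.g := by nlinarith
        have hr1 : 3 * e ≤ r + k := by
          rcases hr with hr | hr
          · exact hr.1
          · omega
        -- Since `α * 2 ^ k < β`, the product in the invariant exceeds `2 ^ k`; hence the budget is
        -- not exhausted.
        have hk : k < e := by
          by_contra hk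
          have h1 : (2 : ℤ) ^ e ≤ 2 ^ k := pow_le_pow_right₀ (by norm_num) (by omega)
          rw [hg] at hlt
          have hp : (1 : ℤ) ≤ 2 ^ k := one_le_pow₀ (by norm_num)
          have h2 : (2 : ℤ) ^ k ≤ α * 2 ^ k := by nlinarith
          have h3 : 0 ≤ ((2 : ℤ) ^ k - 1) * α := mul_nonneg (by omega) (by omega)
          have h4 := mul_le_mul_of_nonneg_right hα (show 0 ≤ β + ((2 : ℤ) ^ k - 1) * α by omega)
          omega
        have hC' := hC.move hg1 hlt (2 * s.g) 1
        refine ⟨r - 1, by omega, Or.inr ⟨α, β - α * s.g, k + 1, hC', ?_, ?_, Or.inl ⟨rfl, e, ?_,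
          Or.inl ⟨by omega, Or.inl (by omega)⟩⟩⟩⟩
        · simp only; rw [hg]; ring
        · obtain ⟨h1, h2, h3, h4⟩ := hC'.bounds hN1 hN2
          simp only at h1 h2 h3 h4
          have hxq := hC.hxq
          constructor
          · simp only
            rw [abs_le] at h1 ⊢
            rcases hC.sign with ⟨h5, h6⟩ | ⟨h5, h6⟩
            · have : 0 ≤ s.g * s.yp := by positivity
              constructor <;> nlinarith
            · have : s.g * s.yp ≤ 0 := by nlinarith
              constructor <;> nlinarith
          · simp only; nlinarith
        · convert he using 1; rw [hg]; ring
      · -- halving, success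
        obtain ⟨h5, h6⟩ := ht
        rcases k with _ | k
        · have hg' : s.g = 1 := by simpa using hg
          have hhalf : s.g / 2 = 0 := by rw [hg']; rfl
          simp only [hm, hhalf, turn]
          rw [if_pos (by norm_num)]
          have hC' := hC.move hg1 hlt 0 0
          refine ⟨r - 1, by omega, inv_swap hC' hN1 hN2 hN ?_ (e := e) ?_ (by omega)⟩
          · rw [hg']; simp at hlt2; linarith
          · convert he using 2
            -- At `g = 1` the quotient is complete: `α < β < 2 * α`, so `β - α` is the remainder.
            rw [← Int.sub_emod_right β α, hg', mul_one, Int.emod_eq_of_lt (by rw [hg'] at hlt; linarith)]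
            simp at hlt2; linarith
        · have hhalf : s.g / 2 = 2 ^ k := by rw [hg]; exact two_pow_half k
          have hp : (1 : ℤ) ≤ 2 ^ k := one_le_pow₀ (by norm_num)
          simp only [hm, turn]
          rw [hhalf, if_neg (by norm_num)]
          rw [if_neg (by omega)]
          have hC' := hC.move hg1 hlt (2 ^ k) 0
          refine ⟨r - 1, by omega, Or.inr ⟨α, β - α * s.g, k, hC', rfl, ⟨?_, ?_⟩,
            Or.inr ⟨rfl, ?_, e, ?_, by omega⟩⟩⟩
          · simp only
            rw [hg, pow_succ, abs_mul, abs_mul, abs_of_pos (by linarith), abs_two] at h5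
            rw [abs_mul, abs_of_pos (by linarith)]
            nlinarith [abs_nonneg s.yp]
          · simp only
            rw [hg, pow_succ] at h6
            nlinarith [hC.hyq]
          · rw [hg]; rw [pow_succ] at hlt2; nlinarith
          · rwa [Int.sub_mul_emod_self_left]
    · rw [if_neg hs]
      have hlt : β < α * s.g := by
        have := mt hsucc.2 hs
        omega
      rcases k with _ | k
      · have hg' : s.g = 1 := by simpa using hg
        have hhalf : s.g / 2 = 0 := by rw [hg']; rfl
        rw [hg', mul_one] at hlt
        simp only [hhalf, turn, if_true]
        rcases h with ⟨hm, e, he, hr⟩ | ⟨hm, hlt2, e, he, hr⟩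
        · refine ⟨r - 1, by omega, inv_swap hC hN1 hN2 hN hlt (e := e) ?_ (by omega)⟩
          simpa using he
        · refine ⟨r - 1, by omega, inv_swap hC hN1 hN2 hN hlt (e := e) ?_ (by omega)⟩
          rwa [Int.emod_eq_of_lt (by linarith) hlt] at he
      · have hhalf : s.g / 2 = 2 ^ k := by rw [hg]; exact two_pow_half k
        have hp : (1 : ℤ) ≤ 2 ^ k := one_le_pow₀ (by norm_num)
        simp only [turn]
        rw [hhalf, if_neg (by omega)]
        obtain ⟨h5, h6⟩ := ht
        have ht' : Tame N { s with g := 2 ^ k, md := 0 } := by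
          constructor
          · simp only
            rw [hg, pow_succ, abs_mul, abs_mul, abs_of_pos (by linarith), abs_two] at h5
            rw [abs_mul, abs_of_pos (by linarith)]
            nlinarith [abs_nonneg s.yp]
          · simp only
            rw [hg, pow_succ] at h6
            nlinarith [hC.hyq]
        rw [hg] at hlt
        rcases h with ⟨hm, e, he, hr⟩ | ⟨hm, hlt2, e, he, hr⟩
        · have hr1 : 3 * e ≤ r + (k + 1) := by omega
          have h0 := Int.emod_nonneg β (show α ≠ 0 by omega)
          have h1 := Int.emod_lt_of_pos β (show 0 < α by omega)
          have h2 : β % α ≤ β := by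
            have h3 := Int.mul_ediv_add_emod β α
            have h4 := mul_nonneg (show 0 ≤ α by omega)
              (Int.ediv_nonneg (show 0 ≤ β by omega) (show 0 ≤ α by omega))
            omega
          -- The product is at least `β + (2 ^ (k + 1) - 1) * α ≥ 2 ^ (k + 1)`.
          have hke : k + 1 ≤ e := by
            by_contra hk
            have h3 : (2 : ℤ) ^ e ≤ 2 ^ k := pow_le_pow_right₀ (by norm_num) (by omega)
            have h4 : (2 : ℤ) ^ (k + 1) = 2 ^ k * 2 := pow_succ _ _
            have h5 : 1 * ((2 : ℤ) ^ (k + 1) - 1) ≤ α * (2 ^ (k + 1) - 1) :=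
              mul_le_mul_of_nonneg_right hα (by omega)
            have h6 := mul_le_mul_of_nonneg_right hα
              (show 0 ≤ β + ((2 : ℤ) ^ (k + 1) - 1) * α by rw [mul_comm _ α]; omega)
            rw [mul_comm (2 ^ (k + 1) - 1 : ℤ) α] at h6 he
            omega
          obtain ⟨e', rfl⟩ := Nat.exists_eq_add_of_le hke
          refine ⟨r - 1, by omega, Or.inr ⟨α, β, k, hC.congr _ _, rfl, ht',
            Or.inr ⟨rfl, by linarith, e', ?_, by omega⟩⟩⟩
          -- The remainder is at most `β` and at most `α`; adding the first inequality once and the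
          -- second `2 ^ (k + 1) - 1` times gives the drop of the product.
          have h3 : (2 : ℤ) ^ (k + 1) * (β % α) ≤ β + (2 ^ (k + 1) - 1) * α := by
            have : (0 : ℤ) ≤ 2 ^ (k + 1) - 1 := by rw [pow_succ]; linarith
            nlinarith
          have h4 : (2 : ℤ) ^ (k + 1) * (α * (β % α)) < 2 ^ (k + 1) * 2 ^ e' := by
            rw [← pow_add]
            refine lt_of_le_of_lt ?_ he
            calc (2 : ℤ) ^ (k + 1) * (α * (β % α)) = α * (2 ^ (k + 1) * (β % α)) := by ring
              _ ≤ _ := mul_le_mul_of_nonneg_left h3 (by omega)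
          exact lt_of_mul_lt_mul_left h4 (by positivity)
        · exact ⟨r - 1, by omega, Or.inr ⟨α, β, k, hC.congr _ _, rfl, ht',
            Or.inr ⟨rfl, by linarith, e, he, by omega⟩⟩⟩

/-- Bounds on the numbers that occur in the search. -/
structure Small (N : ℤ) (s : NS) : Prop where
  xp : |s.xp| ≤ N
  xq : 0 ≤ s.xq ∧ s.xq ≤ N
  yp : |s.yp| ≤ N
  yq : 0 ≤ s.yq ∧ s.yq ≤ N
  gyp : |s.g * s.yp| ≤ 2 * N
  gyq : 0 ≤ s.g * s.yq ∧ s.g * s.yq ≤ 2 * N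
  g : 1 ≤ s.g ∧ s.g ≤ 2 * N
  md : 0 ≤ s.md ∧ s.md ≤ 2
  sg : 0 ≤ s.sg ∧ s.sg ≤ 2
  pos : 0 < s.cand.2

theorem Inv.small {r : ℕ} (h : Inv a b N r s) (ha : |a| ≤ N) (hb : b ≤ N) (hN : 1 ≤ N) :
    Small N s := by
  rcases h with ⟨rfl, -⟩ | ⟨α, β, k, hC, hg, ⟨ht1, ht2⟩, h⟩
  · constructor <;> simp [init, cand] <;> omega
  · have hg1 : 1 ≤ s.g := by rw [hg]; exact one_le_pow₀ (by norm_num)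
    obtain ⟨h1, h2, h3, h4⟩ := hC.bounds ha hb
    have hyq := hC.hyq
    refine ⟨h1, ⟨hC.hxq, h2⟩, h3, ⟨hC.hyq, h4⟩, ht1, ⟨by positivity, ht2⟩, ⟨hg1, ?_⟩, ?_, ?_,
      hC.pos hg1⟩
    -- `Y` is not zero because of the determinant, so the bounds on `g * yp` and `g * yq` bound `g`
    -- itself.
    · rcases hC.hyq.eq_or_lt with h0 | h0
      · have : s.yp ≠ 0 := by
          intro h5
          have := hC.det
          rw [← h0, h5] at this
          rcases hC.hsg with h | h <;> rw [h] at this <;> simp at this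
        rw [abs_mul, abs_of_pos (by omega : 0 < s.g)] at ht1
        have := Int.one_le_abs this
        nlinarith
      · nlinarith
    · rcases h with h | h <;> rw [h.1] <;> norm_num
    · rcases hC.hsg with h | h <;> rw [h] <;> norm_num

/-- Equality of values gives `β = α g`, so numerator and denominator of `ν` are `α` times those of
the candidate. As they are coprime, `α = 1`: the candidate needs no reduction. -/
theorem Inv.cand_eq {ν : ℚ} {r : ℕ} (h : Inv ν.num ν.den N r s) (hc : cmp ν s.cand = 1) :
    s.cand = (ν.num, (ν.den : ℤ)) := by
  rcases h with ⟨rfl, -⟩ | ⟨α, β, k, hC, hg, -, -⟩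
  · have hcmp := cmp_eq ν (c := init.cand) (by simp [init, cand])
    have hcand : init.cand = (0, 1) := rfl
    rw [hcand] at hcmp hc ⊢
    simp only [mul_one, mul_zero, sub_zero, hc] at hcmp
    have : ν.num = 0 := by split_ifs at hcmp <;> omega
    rw [this, Rat.zero_of_num_zero this]; simp
  · have hg1 : 1 ≤ s.g := by rw [hg]; exact one_le_pow₀ (by norm_num)
    have hcmp := cmp_eq ν (c := s.cand) (hC.pos hg1)
    rw [hC.diff, hc] at hcmp
    have h0 : (β - α * s.g) * (1 - s.sg) = 0 := by
      split_ifs at hcmp <;> first | assumption | omega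
    have hd : β = α * s.g := by
      rcases mul_eq_zero.1 h0 with h | h
      · linarith
      · rcases hC.hsg with h' | h' <;> rw [h'] at h <;> norm_num at h
    have h1 : ν.num = α * s.cand.1 := by rw [hC.ha, hd]; simp only [cand]; ring
    have h2 : (ν.den : ℤ) = α * s.cand.2 := by rw [hC.hb, hd]; simp only [cand]; ring
    have h3 : α ∣ (1 : ℤ) := by
      have h4 : IsCoprime ν.num (ν.den : ℤ) := by
        rw [Int.isCoprime_iff_gcd_eq_one]; simpa [Int.gcd] using ν.reduced
      exact (h4.isUnit_of_dvd' ⟨_, h1⟩ ⟨_, h2⟩).dvd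
    have h5 : α = 1 := by
      have := Int.le_of_dvd one_pos h3
      have := hC.hα
      omega
    rw [h5, one_mul] at h1 h2
    rw [h1, h2]

/-- Until the number is found, remaining budget and rounds made add up to the initial budget.
Afterwards the state no longer changes. -/
theorem run_inv {ν : ℚ} (hN1 : |ν.num| ≤ N) (hN2 : (ν.den : ℤ) ≤ N) (r : ℕ) :
    ∃ r', Inv ν.num ν.den N r' (run ν r) ∧ (cmp ν (run ν r).cand ≠ 1 →
      r' + r = 3 * (Nat.log 2 (ν.num.natAbs * ν.den) + 1) + 2) := by
  induction r with
  | zero =>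
    refine ⟨_, Or.inl ⟨rfl, Nat.log 2 (ν.num.natAbs * ν.den) + 1, ?_, le_rfl⟩, fun _ => rfl⟩
    have := Nat.lt_pow_succ_log_self (b := 2) (by norm_num) (ν.num.natAbs * ν.den)
    rw [Int.abs_eq_natAbs]
    exact_mod_cast this
  | succ r ih =>
    obtain ⟨r', h1, h2⟩ := ih
    by_cases hc : cmp ν (run ν r).cand = 1
    · have : run ν (r + 1) = run ν r := by simp [run, hc, step]
      rw [this]
      exact ⟨r', h1, fun h => absurd hc h⟩
    · obtain ⟨r'', hr, h⟩ := inv_step hN1 hN2 h1 hc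
      exact ⟨r'', h, fun _ => by have := h2 hc; omega⟩

theorem run_small {ν : ℚ} (hN1 : |ν.num| ≤ N) (hN2 : (ν.den : ℤ) ≤ N) (r : ℕ) :
    Small N (run ν r) := by
  obtain ⟨r', h, -⟩ := run_inv hN1 hN2 r
  have hden : (1 : ℤ) ≤ ν.den := by exact_mod_cast ν.den_pos
  exact h.small hN1 hN2 (by omega)

theorem run_cand {ν : ℚ} {r : ℕ} (hc : cmp ν (run ν r).cand = 1) :
    (run ν r).cand = (ν.num, (ν.den : ℤ)) := by
  obtain ⟨r', h, -⟩ := run_inv (N := max |ν.num| ν.den) (le_max_left _ _) (le_max_right _ _) r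
  exact h.cand_eq hc

/-- By then the budget would be `0`, whereas `inv_step` needs a positive one for any comparison that
fails to hit. -/
theorem run_cmp {ν : ℚ} {r : ℕ} (hr : 3 * Nat.log 2 (ν.num.natAbs * ν.den) + 5 ≤ r) :
    cmp ν (run ν r).cand = 1 := by
  by_contra hc
  obtain ⟨r', h, h2⟩ := run_inv (N := max |ν.num| ν.den) (le_max_left _ _) (le_max_right _ _) r
  obtain ⟨r'', h3, -⟩ := inv_step (le_max_left _ _) (le_max_right _ _) h hc
  have := h2 hc
  omega

end NS

/-! ## Vertex elimination -/

section Elim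

variable {n : ℕ}

/-- Distances found so far, and the vertices known to reach a closed walk of weight below `θ`. -/
structure EL (n : ℕ) where
  d : Fin n → Fin n → WithTop ℤ
  bad : Fin n → Prop

/-- The vertex `v` is bad when it is eliminated. -/
def EL.at (E : EL n) (θ : ℤ) (v : Fin n) : Prop := E.bad v ∨ E.d v v < θ

open Classical in
/-- Eliminate the vertex `v`. -/
noncomputable def EL.elim (rk : Fin n → ℕ) (θ : ℤ) (v : Fin n) (E : EL n) : EL n where
  -- Walks are led through `v` only if `v` is not bad. Predecessors of a bad `v` are marked instead,
  -- so light closed walks never enter the distances.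
  d x y := if ¬ E.at θ v ∧ rk x < rk v ∧ rk y < rk v then min (E.d x y) (E.d x v + E.d v y)
    else E.d x y
  bad x := E.bad x ∨ (x = v ∧ E.at θ v) ∨ (E.at θ v ∧ rk x < rk v ∧ E.d x v ≠ ⊤)

/-- The first `k` vertices, by decreasing rank, have been eliminated. -/
noncomputable def elims (rk : Fin n → ℕ) (ord : ℕ → Fin n) (θ : ℤ) (w : Fin n → Fin n → WithTop ℤ) :
    ℕ → EL n
  | 0 => ⟨w, fun _ => False⟩
  | k + 1 => (elims rk ord θ w k).elim rk θ (ord (n - 1 - k))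

/-- Loops at `v` do not decrease the weight, so a lightest walk through `A` and `v` need visit `v`
only once. This is why a single relaxation over `v` suffices. -/
theorem Wk.insert {V : Type*} {w : V → V → WithTop ℤ} {A : V → Prop} {v : V}
    (hloop : ∀ l z, (∀ b ∈ l, A b) → Wk w v l v z → 0 ≤ z) {x y : V} {l : List V} {z : ℤ}
    (h : Wk w x l y z) (hl : ∀ b ∈ l, A b ∨ b = v) :
    (∃ l' z', (∀ b ∈ l', A b) ∧ z' ≤ z ∧ Wk w x l' y z') ∨
    ∃ l1 l2 z1 z2, (∀ b ∈ l1, A b) ∧ (∀ b ∈ l2, A b) ∧ z1 + z2 ≤ z ∧ Wk w x l1 v z1 ∧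
      Wk w v l2 y z2 := by
  induction h with
  | edge h => exact Or.inl ⟨[], _, by simp, le_rfl, .edge h⟩
  | @cons x a y l z z' h h' ih =>
    have ih' := ih fun b hb => hl b (List.mem_cons_of_mem _ hb)
    by_cases hav : a = v
    · subst hav
      rcases ih' with ⟨l', z'', h1, h2, h3⟩ | ⟨l1, l2, z1, z2, h1, h2, h3, h4, h5⟩
      · exact Or.inr ⟨[], l', z, z'', by simp, h1, by omega, .edge h, h3⟩
      · have := hloop l1 z1 h1 h4
        exact Or.inr ⟨[], l2, z, z2, by simp, h2, by omega, .edge h, h5⟩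
    · have haA : A a := (hl a List.mem_cons_self).resolve_right hav
      rcases ih' with ⟨l', z'', h1, h2, h3⟩ | ⟨l1, l2, z1, z2, h1, h2, h3, h4, h5⟩
      · exact Or.inl ⟨a :: l', z + z'', by simpa [haA] using h1, by omega, .cons h h3⟩
      · exact Or.inr ⟨a :: l1, l2, z + z1, z2, by simpa [haA] using h1, h2, by omega,
          .cons h h4, h5⟩

variable {rk : Fin n → ℕ} {ord : ℕ → Fin n} {θ : ℤ} {w : Fin n → Fin n → WithTop ℤ}

/-- What holds after `k` eliminations. -/
structure ElimInv (rk : Fin n → ℕ) (θ : ℤ) (w : Fin n → Fin n → WithTop ℤ) (k : ℕ) (E : EL n) :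
    Prop where
  sound : ∀ x y z, rk x + k < n → rk y + k < n → E.d x y = (z : ℤ) →
    ∃ l, (∀ a ∈ l, n ≤ rk a + k ∧ ¬ E.bad a) ∧ Wk w x l y z
  complete : ∀ x y l z, rk x + k < n → rk y + k < n → (∀ a ∈ l, n ≤ rk a + k ∧ ¬ E.bad a) →
    Wk w x l y z → E.d x y ≤ z
  closed : ∀ a l z, (∀ b ∈ a :: l, n ≤ rk b + k ∧ ¬ E.bad b) → Wk w a l a z → θ ≤ z
  rch : ∀ x y, E.d x y ≠ ⊤ → Rch w x y
  bad : ∀ x, E.bad x → Bad w θ x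

theorem Bad.of_rch {x y : Fin n} (h : Bad w θ y) (hxy : Rch w x y) : Bad w θ x := by
  obtain ⟨a, l, z, h1, h2⟩ := h
  exact ⟨a, l, z, hxy.trans h1, h2⟩

/-- If `v` is bad, the set of admissible inner vertices stays the same. Otherwise `v` joins it, and
closed walks through `v` are no lighter than `θ` because `d v v` is not. -/
theorem elim_inv_step (hθ : 0 ≤ θ) (hinj : Function.Injective rk) {k : ℕ} {v : Fin n}
    (hv : rk v + k + 1 = n) {E : EL n} (h : ElimInv rk θ w k E) :
    ElimInv rk θ w (k + 1) (E.elim rk θ v) := by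
  have hvlt : rk v + k < n := by omega
  have hfro : ∀ a, n ≤ rk a + k → ((E.elim rk θ v).bad a ↔ E.bad a) := by
    intro a ha
    have h1 : a ≠ v := by rintro rfl; omega
    have h2 : ¬ rk a < rk v := by omega
    simp [EL.elim, h1, h2]
  have hcase : ∀ a, n ≤ rk a + (k + 1) → n ≤ rk a + k ∨ a = v := by
    intro a ha
    rcases Nat.lt_or_ge (rk a + k) n with h1 | h1
    · right; apply hinj; omega
    · exact Or.inl h1
  have hbadv : (E.elim rk θ v).bad v ↔ E.at θ v := by
    simp only [EL.elim, EL.at, lt_irrefl, false_and, and_false, or_false, true_and]; tauto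
  have hatBad : E.at θ v → Bad w θ v := by
    rintro (h1 | h1)
    · exact h.bad v h1
    · obtain ⟨z, hz⟩ := WithTop.ne_top_iff_exists.1 (ne_top_of_lt h1)
      obtain ⟨l, -, hl⟩ := h.sound v v z hvlt hvlt hz.symm
      rw [← hz] at h1
      exact ⟨v, l, z, .refl, hl, by exact_mod_cast h1⟩
  have hrch : ∀ x y, (E.elim rk θ v).d x y ≠ ⊤ → Rch w x y := by
    intro x y hxy
    simp only [EL.elim] at hxy
    split_ifs at hxy with hc
    · by_cases h1 : E.d x y = ⊤
      · rw [h1, min_eq_right le_top, ne_eq, WithTop.add_eq_top, not_or] at hxy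
        exact (h.rch _ _ hxy.1).trans (h.rch _ _ hxy.2)
      · exact h.rch _ _ h1
    · exact h.rch _ _ hxy
  have hbad : ∀ x, (E.elim rk θ v).bad x → Bad w θ x := by
    rintro x (h1 | ⟨rfl, h1⟩ | ⟨h1, -, h2⟩)
    · exact h.bad x h1
    · exact hatBad h1
    · exact (hatBad h1).of_rch (h.rch _ _ h2)
  by_cases hat : E.at θ v
  · have hA : ∀ a, (n ≤ rk a + (k + 1) ∧ ¬ (E.elim rk θ v).bad a) → n ≤ rk a + k ∧ ¬ E.bad a := by
      rintro a ⟨h1, h2⟩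
      rcases hcase a h1 with h3 | rfl
      · exact ⟨h3, fun h4 => h2 ((hfro a h3).2 h4)⟩
      · exact absurd (hbadv.2 hat) h2
    have hd : ∀ x y, (E.elim rk θ v).d x y = E.d x y := fun x y => by simp [EL.elim, hat]
    refine ⟨fun x y z hx hy hz => ?_, fun x y l z hx hy hl hw => ?_, fun a l z hl hw => ?_,
      hrch, hbad⟩
    · rw [hd] at hz
      obtain ⟨l, h1, h2⟩ := h.sound x y z (by omega) (by omega) hz
      exact ⟨l, fun a ha => ⟨by have := (h1 a ha).1; omega, fun h4 =>
        (h1 a ha).2 ((hfro a (h1 a ha).1).1 h4)⟩, h2⟩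
    · rw [hd]
      exact h.complete x y l z (by omega) (by omega) (fun a ha => hA a (hl a ha)) hw
    · exact h.closed a l z (fun b hb => hA b (hl b hb)) hw
  · have hA : ∀ a, (n ≤ rk a + (k + 1) ∧ ¬ (E.elim rk θ v).bad a) →
        (n ≤ rk a + k ∧ ¬ E.bad a) ∨ a = v := by
      rintro a ⟨h1, h2⟩
      rcases hcase a h1 with h3 | rfl
      · exact Or.inl ⟨h3, fun h4 => h2 ((hfro a h3).2 h4)⟩
      · exact Or.inr rfl
    have hA' : ∀ a, (n ≤ rk a + k ∧ ¬ E.bad a) →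
        (n ≤ rk a + (k + 1) ∧ ¬ (E.elim rk θ v).bad a) :=
      fun a ha => ⟨by omega, fun h4 => ha.2 ((hfro a ha.1).1 h4)⟩
    have hvA : n ≤ rk v + (k + 1) ∧ ¬ (E.elim rk θ v).bad v :=
      ⟨by omega, fun h => hat (hbadv.1 h)⟩
    have hlow : ∀ x, rk x + (k + 1) < n → rk x < rk v := fun x hx => by omega
    have hd : ∀ x y, rk x + (k + 1) < n → rk y + (k + 1) < n →
        (E.elim rk θ v).d x y = min (E.d x y) (E.d x v + E.d v y) :=
      fun x y hx hy => by simp [EL.elim, hat, hlow x hx, hlow y hy]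
    have hvv : ∀ l z, (∀ b ∈ l, n ≤ rk b + k ∧ ¬ E.bad b) → Wk w v l v z → θ ≤ z := by
      intro l z hl hw
      have h1 := h.complete v v l z hvlt hvlt hl hw
      have h2 : (θ : WithTop ℤ) ≤ E.d v v := not_lt.1 fun h => hat (Or.inr h)
      exact_mod_cast h2.trans h1
    have hins := fun x y l z => Wk.insert (A := fun b => n ≤ rk b + k ∧ ¬ E.bad b) (v := v)
      (fun l z h1 h2 => hθ.trans (hvv l z h1 h2)) (x := x) (y := y) (l := l) (z := z)
    -- A closed walk at `v` that returns to `v` splits into two, each of weight at least `θ`; their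
    -- sum is at least `θ` since `θ ≥ 0`.
    have hvv' : ∀ l z, (∀ b ∈ l, n ≤ rk b + (k + 1) ∧ ¬ (E.elim rk θ v).bad b) → Wk w v l v z →
        θ ≤ z := by
      intro l z hl hw
      rcases hins _ _ _ _ hw (fun b hb => hA b (hl b hb)) with
        ⟨l', z', h1, h2, h3⟩ | ⟨l1, l2, z1, z2, h1, h2, h3, h4, h5⟩
      · exact (hvv l' z' h1 h3).trans h2
      · have := hvv l1 z1 h1 h4
        have := hvv l2 z2 h2 h5
        omega
    refine ⟨fun x y z hx hy hz => ?_, fun x y l z hx hy hl hw => ?_, fun a l z hl hw => ?_,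
      hrch, hbad⟩
    · rw [hd x y hx hy] at hz
      rcases min_choice (E.d x y) (E.d x v + E.d v y) with hm | hm <;> rw [hm] at hz
      · obtain ⟨l, h1, h2⟩ := h.sound x y z (by omega) (by omega) hz
        exact ⟨l, fun a ha => hA' a (h1 a ha), h2⟩
      · obtain ⟨z1, z2, h1, h2, rfl⟩ : ∃ z1 z2 : ℤ, E.d x v = z1 ∧ E.d v y = z2 ∧ z = z1 + z2 := by
          have h0 : E.d x v + E.d v y ≠ ⊤ := by rw [hz]; exact WithTop.coe_ne_top
          rw [ne_eq, WithTop.add_eq_top, not_or] at h0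
          obtain ⟨z1, h1⟩ := WithTop.ne_top_iff_exists.1 h0.1
          obtain ⟨z2, h2⟩ := WithTop.ne_top_iff_exists.1 h0.2
          refine ⟨z1, z2, h1.symm, h2.symm, ?_⟩
          rw [← h1, ← h2] at hz
          exact_mod_cast hz.symm
        obtain ⟨l1, h3, h4⟩ := h.sound x v z1 (by omega) hvlt h1
        obtain ⟨l2, h5, h6⟩ := h.sound v y z2 hvlt (by omega) h2
        refine ⟨l1 ++ v :: l2, fun a ha => ?_, h4.append h6⟩
        rcases List.mem_append.1 ha with ha | ha
        · exact hA' a (h3 a ha)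
        · rcases List.mem_cons.1 ha with rfl | ha
          · exact hvA
          · exact hA' a (h5 a ha)
    · rw [hd x y hx hy]
      rcases hins _ _ _ _ hw (fun b hb => hA b (hl b hb)) with
        ⟨l', z', h1, h2, h3⟩ | ⟨l1, l2, z1, z2, h1, h2, h3, h4, h5⟩
      · refine (min_le_left _ _).trans ((h.complete x y l' z' (by omega) (by omega) h1 h3).trans ?_)
        exact_mod_cast h2
      · refine (min_le_right _ _).trans ((add_le_add
          (h.complete x v l1 z1 (by omega) hvlt h1 h4)
          (h.complete v y l2 z2 hvlt (by omega) h2 h5)).trans ?_)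
        exact_mod_cast h3
    · by_cases hva : v = a
      · subst hva; exact hvv' l z (fun b hb => hl b (List.mem_cons_of_mem _ hb)) hw
      by_cases hvl : v ∈ l
      · obtain ⟨p, q, rfl⟩ := List.append_of_mem hvl
        obtain ⟨z1, z2, h1, h2, rfl⟩ := hw.split
        -- Rotate the closed walk so that it starts at `v`.
        have := hvv' (q ++ a :: p) (z2 + z1) (fun b hb => hl b (by simp at hb ⊢; tauto))
          (h2.append h1)
        omega
      · refine h.closed a l z (fun b hb => (hA b (hl b hb)).resolve_right ?_) hw
        rintro rfl
        rcases List.mem_cons.1 hb with h1 | h1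
        · exact hva h1
        · exact hvl h1

variable (hθ : 0 ≤ θ) (hord : ∀ j < n, rk (ord j) = j) (hrk : ∀ x, rk x < n)
  (hinj : Function.Injective rk)

include hθ hord hinj in
theorem elims_inv (k : ℕ) (hk : k ≤ n) : ElimInv rk θ w k (elims rk ord θ w k) := by
  induction k with
  | zero =>
    refine ⟨fun x y z _ _ hz => ⟨[], by simp, .edge hz⟩, fun x y l z _ _ hl hw => ?_,
      fun a l z hl hw => ?_, fun x y h => .single h, fun x h => h.elim⟩
    · cases hw with
      | edge h => exact h.le
      | @cons _ a _ _ _ _ h h' =>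
        have := (hl a List.mem_cons_self).1
        have h2 : rk a < n := by
          rcases Nat.lt_or_ge (rk a) n with h | h
          · exact h
          · exfalso
            -- `ord` is injective on `Fin n`, hence onto, so every rank is below `n` and nothing
            -- counts as eliminated at the start.
            have hsurj : Function.Injective fun j : Fin n => ord j := by
              intro i j hij
              have := congrArg rk hij
              simp only at this
              rw [hord _ i.2, hord _ j.2] at this
              exact Fin.ext this
            obtain ⟨j, hj⟩ := (Finite.injective_iff_surjective.1 hsurj) a
            have := hord j j.2
            simp only at hj
            rw [hj] at this
            omega
        omega
    · have hsurj : Function.Injective fun j : Fin n => ord j := by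
        intro i j hij
        have := congrArg rk hij
        simp only at this
        rw [hord _ i.2, hord _ j.2] at this
        exact Fin.ext this
      obtain ⟨j, hj⟩ := (Finite.injective_iff_surjective.1 hsurj) a
      have h1 := hord j j.2
      simp only at hj
      rw [hj] at h1
      have := (hl a List.mem_cons_self).1
      omega
  | succ k ih =>
    exact elim_inv_step hθ hinj (by rw [hord _ (by omega)]; omega) (ih (by omega))

theorem elim_d_le (E : EL n) (v x y : Fin n) : (E.elim rk θ v).d x y ≤ E.d x y := by
  simp only [EL.elim]
  split_ifs
  · exact min_le_left _ _
  · exact le_rfl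

theorem elims_d_anti {k m : ℕ} (hkm : k ≤ m) (x y : Fin n) :
    (elims rk ord θ w m).d x y ≤ (elims rk ord θ w k).d x y := by
  induction m, hkm using Nat.le_induction with
  | base => exact le_rfl
  | succ m _ ih => exact (elim_d_le _ _ _ _).trans ih

theorem elims_bad_mono {k m : ℕ} (hkm : k ≤ m) (x : Fin n) (h : (elims rk ord θ w k).bad x) :
    (elims rk ord θ w m).bad x := by
  induction m, hkm using Nat.le_induction with
  | base => exact h
  | succ m _ ih => exact Or.inl ih

include hord in
/-- Nothing about a vertex changes after its elimination. -/
theorem elims_frozen {k m : ℕ} (hkm : k ≤ m) (hm : m ≤ n) {x : Fin n} (hx : n ≤ rk x + k) :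
    ((elims rk ord θ w m).bad x ↔ (elims rk ord θ w k).bad x) ∧
      ∀ y, (elims rk ord θ w m).d x y = (elims rk ord θ w k).d x y := by
  induction m, hkm using Nat.le_induction with
  | base => simp
  | succ m hle ih =>
    obtain ⟨h1, h2⟩ := ih (by omega)
    have h3 := hord (n - 1 - m) (by omega)
    have h4 : x ≠ ord (n - 1 - m) := by rintro rfl; omega
    have h5 : ¬ rk x < rk (ord (n - 1 - m)) := by omega
    refine ⟨?_, fun y => ?_⟩
    · rw [← h1]; simp [elims, EL.elim, h4, h5]
    · rw [← h2]; simp [elims, EL.elim, h5]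

include hθ hord hinj hrk in
/-- The result of the elimination and of the final pass over the vertices by increasing rank. -/
theorem elims_correct {fb : Fin n → Prop} (hfb : ∀ v, fb v ↔ (elims rk ord θ w n).bad v ∨
      ∃ y, rk y < rk v ∧ (elims rk ord θ w n).d v y ≠ ⊤ ∧ fb y) (u : Fin n) :
    fb u ↔ Bad w θ u := by
  have hI := elims_inv (w := w) hθ hord hinj n le_rfl
  constructor
  · induction hu : rk u using Nat.strong_induction_on generalizing u with
    | _ r ih =>
      intro h
      rcases (hfb u).1 h with h | ⟨y, h1, h2, h3⟩
      · exact hI.bad u h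
      · exact (ih (rk y) (by omega) y rfl h3).of_rch (hI.rch _ _ h2)
  -- A finite distance at any stage carries badness backwards. The induction runs from the last
  -- stage to the first and looks at the vertex `v` eliminated next.
  · have claim : ∀ j k, k + j = n → ∀ x y, rk x + k < n → rk y + k < n →
        (elims rk ord θ w k).d x y ≠ ⊤ → fb y → fb x := by
      intro j
      induction j with
      | zero => intro k hk x y hx; omega
      | succ j ih =>
        intro k hk x y hx hy hd hy'
        have IH := ih (k + 1) (by omega)
        have hvr := hord (n - 1 - k) (by omega)
        set v := ord (n - 1 - k) with hvdef
        have hstep : elims rk ord θ w (k + 1) = (elims rk ord θ w k).elim rk θ v := rfl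
        have hnot : ∀ a : Fin n, a ≠ v → rk a + k < n → rk a + (k + 1) < n := by
          intro a ha h1
          have : rk a ≠ rk v := fun h => ha (hinj h)
          omega
        by_cases hxv : x = v
        · by_cases hyv : y = v
          · rwa [hxv, ← hyv]
          · refine (hfb x).2 (Or.inr ⟨y, ?_, ?_, hy'⟩)
            · have := hnot y hyv hy; rw [hxv]; omega
            · exact ne_top_of_le_ne_top hd (elims_d_anti (by omega) _ _)
        · have hx' := hnot x hxv hx
          by_cases hyv : y = v
          · rw [hyv] at hd hy'
            by_cases hat : (elims rk ord θ w k).at θ v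
            · refine (hfb x).2 (Or.inl (elims_bad_mono (k := k + 1) (by omega) x ?_))
              exact Or.inr (Or.inr ⟨hat, by change rk x < rk v; omega, hd⟩)
            -- Not being bad when eliminated, `v` is never marked later. So its badness comes from
            -- some lower `y'`, to which eliminating `v` gives `x` a finite distance.
            · rcases (hfb v).1 hy' with h1 | ⟨y', h1, h2, h3⟩
              · rw [(elims_frozen hord (k := k + 1) (by omega) le_rfl (by omega)).1, hstep] at h1
                exfalso
                simp only [EL.elim, lt_irrefl, false_and, and_false, or_false, true_and] at h1
                rcases h1 with h1 | h1
                · exact hat (Or.inl h1)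
                · exact hat h1
              · rw [(elims_frozen hord (k := k + 1) (by omega) le_rfl (by omega)).2, hstep] at h2
                have h2' : (elims rk ord θ w k).d v y' ≠ ⊤ := by
                  simpa only [EL.elim, lt_irrefl, false_and, and_false, if_false, ite_false] using h2
                refine IH x y' hx' (by omega) ?_ h3
                rw [hstep]
                simp only [EL.elim]
                rw [if_pos ⟨hat, by omega, h1⟩]
                refine ne_top_of_le_ne_top ?_ (min_le_right _ _)
                rw [ne_eq, WithTop.add_eq_top, not_or]
                exact ⟨hd, h2'⟩
          · exact IH x y hx' (hnot y hyv hy)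
              (ne_top_of_le_ne_top hd (elims_d_anti (by omega) _ _)) hy'
    have hrch : ∀ {x y}, Rch w x y → fb y → fb x := by
      intro x y h
      induction h with
      | refl => exact id
      | tail _ h ih => exact fun hy => ih (claim n 0 (by omega) _ _ (hrk _) (hrk _) h hy)
    rintro ⟨y, l, z, huy, hw, hz⟩
    refine hrch huy ?_
    -- A closed walk through unmarked vertices only would have weight at least `θ` once all vertices
    -- are eliminated.
    obtain ⟨x, hx, hxb⟩ : ∃ x ∈ y :: l, (elims rk ord θ w n).bad x := by
      by_contra hcon
      push Not at hcon
      have := hI.closed y l z (fun b hb => ⟨by omega, hcon b hb⟩) hw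
      omega
    have hxf : fb x := (hfb x).2 (Or.inl hxb)
    rcases List.mem_cons.1 hx with rfl | hx
    · exact hxf
    · exact hrch (hw.rch_mem hx).1 hxf

include hθ hord hinj in
-- Stored numbers do not grow with the number of eliminations: between remaining vertices a distance
-- is attained by a walk with distinct inner vertices, hence with at most `n + 1` edges.
theorem elims_abs_le {M : ℤ} (hM0 : 0 ≤ M) (hM : ∀ x y z, w x y = (z : ℤ) → |z| ≤ M) (k : ℕ)
    (hk : k ≤ n) (x y : Fin n) (z : ℤ) (hz : (elims rk ord θ w k).d x y = z) :
    |z| ≤ (n + 1) * M := by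
  induction k with
  | zero => have := hM x y z hz; nlinarith
  | succ k ih =>
    have hI := elims_inv (w := w) hθ hord hinj (k + 1) hk
    have hvr := hord (n - 1 - k) (by omega)
    by_cases hc : rk x < n - 1 - k ∧ rk y < n - 1 - k
    · obtain ⟨l, hl, hw⟩ := hI.sound x y z (by omega) (by omega) hz
      obtain ⟨l', z', hw', hle, hnd, hl'⟩ := hw.exists_nodup
        (A := {a | n ≤ rk a + (k + 1) ∧ ¬ (elims rk ord θ w (k + 1)).bad a})
        (fun a l z ha hl hw => hθ.trans (hI.closed a l z (by
          intro b hb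
          rcases List.mem_cons.1 hb with rfl | hb
          · exact ha
          · exact hl b hb) hw)) hl
      have h1 := hI.complete x y l' z' (by omega) (by omega) hl' hw'
      rw [hz] at h1
      have h2 : z ≤ z' := by exact_mod_cast h1
      obtain rfl : z = z' := le_antisymm h2 hle
      have h3 := hw'.abs_le hM
      have h4 : l'.length ≤ n := by simpa using hnd.length_le_card
      have h5 : ((l'.length : ℤ) + 1) * M ≤ (n + 1) * M :=
        mul_le_mul_of_nonneg_right (by exact_mod_cast Nat.succ_le_succ h4) hM0
      linarith
    -- Entries with an eliminated endpoint have not been altered by the last step.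
    · refine ih (by omega) ?_
      rw [← hz]
      simp only [elims, EL.elim]
      rw [if_neg]
      rw [hvr]; tauto

end Elim

/-! ## Reading the input and the tree decomposition -/

section Blocks

variable {α β : Type*} (f : α → List β) (l : List α)

/-- The position where the block of the `i`-th element starts in `l.flatMap f`. -/
def blockPos (i : ℕ) : ℕ := ((l.take i).flatMap f).length

@[simp] theorem blockPos_zero : blockPos f l 0 = 0 := by simp [blockPos]

theorem blockPos_succ {i : ℕ} (hi : i < l.length) :
    blockPos f l (i + 1) = blockPos f l i + (f l[i]).length := by
  rw [blockPos, List.take_succ_eq_append_getElem hi, List.flatMap_append, List.length_append,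
    List.flatMap_singleton, blockPos]

theorem blockPos_length : blockPos f l l.length = (l.flatMap f).length := by
  simp [blockPos]

theorem getD_flatMap {i j : ℕ} (hi : i < l.length) (hj : j < (f l[i]).length) (d : β) :
    (l.flatMap f).getD (blockPos f l i + j) d = (f l[i])[j] := by
  have h1 : l.flatMap f = (l.take i).flatMap f ++ (f l[i] ++ (l.drop (i + 1)).flatMap f) := by
    conv_lhs => rw [← List.take_append_drop i l, List.drop_eq_getElem_cons hi]
    rw [List.flatMap_append, List.flatMap_cons]
  rw [h1, blockPos, List.getD_append_right _ _ _ _ (by omega), Nat.add_sub_cancel_left,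
    List.getD_append _ _ _ _ hj, List.getD_eq_getElem _ _ hj]

theorem blockPos_le {i : ℕ} (hi : i < l.length) :
    blockPos f l i + (f l[i]).length ≤ (l.flatMap f).length := by
  rw [← blockPos_succ f l hi]
  have : l.flatMap f = (l.take (i + 1)).flatMap f ++ (l.drop (i + 1)).flatMap f := by
    rw [← List.flatMap_append, List.take_append_drop]
  rw [this, List.length_append, blockPos]
  omega

end Blocks

/-! ### The words of a tree decomposition and connectedness of bags. -/

namespace BagTree

variable {n : ℕ} {T : BagTree n} {G : WGraph n}

/-- The position of the words that present bag `i`. -/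
def pos (T : BagTree n) (i : ℕ) : ℕ :=
  1 + blockPos (fun i => ((T.parent i).val : ℤ) :: ((T.bag i).length : ℤ) ::
    (T.bag i).map fun u => (u.val : ℤ)) (List.finRange T.size) i

theorem pos_zero : T.pos 0 = 1 := by simp [pos]

theorem pos_succ (i : Fin T.size) : T.pos (i + 1) = T.pos i + 2 + (T.bag i).length := by
  rw [pos, pos, blockPos_succ _ _ (by simp)]
  simp; omega

theorem pos_le (i : Fin T.size) : T.pos i + 2 + (T.bag i).length ≤ T.encode.length := by
  have := blockPos_le (fun i => ((T.parent i).val : ℤ) :: ((T.bag i).length : ℤ) ::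
    (T.bag i).map fun u => (u.val : ℤ)) (List.finRange T.size) (i := i) (by simp)
  simp [pos, encode] at this ⊢
  omega

theorem encode_size : T.encode.getD 0 0 = T.size := rfl

theorem encode_parent (i : Fin T.size) : T.encode.getD (T.pos i) 0 = (T.parent i : ℕ) := by
  have := getD_flatMap (fun i => ((T.parent i).val : ℤ) :: ((T.bag i).length : ℤ) ::
    (T.bag i).map fun u => (u.val : ℤ)) (List.finRange T.size) (i := i) (j := 0) (by simp)
    (by simp) 0
  rw [pos, encode, Nat.add_comm 1]
  simpa using this

theorem encode_len (i : Fin T.size) : T.encode.getD (T.pos i + 1) 0 = (T.bag i).length := by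
  have := getD_flatMap (fun i => ((T.parent i).val : ℤ) :: ((T.bag i).length : ℤ) ::
    (T.bag i).map fun u => (u.val : ℤ)) (List.finRange T.size) (i := i) (j := 1) (by simp)
    (by simp) 0
  rw [pos, encode, Nat.add_comm 1, Nat.add_right_comm]
  simpa using this

theorem encode_bag (i : Fin T.size) {j : ℕ} (hj : j < (T.bag i).length) :
    T.encode.getD (T.pos i + 2 + j) 0 = ((T.bag i)[j] : ℕ) := by
  have := getD_flatMap (fun i => ((T.parent i).val : ℤ) :: ((T.bag i).length : ℤ) ::
    (T.bag i).map fun u => (u.val : ℤ)) (List.finRange T.size) (i := i) (j := j + 2) (by simp)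
    (by simpa using hj) 0
  have h2 : T.pos i + 2 + j = blockPos (fun i => ((T.parent i).val : ℤ) ::
      ((T.bag i).length : ℤ) :: (T.bag i).map fun u => (u.val : ℤ)) (List.finRange T.size) i
      + (j + 2) + 1 := by rw [pos]; omega
  rw [h2, encode]
  simpa using this

theorem encode_length_le {K : ℕ} (hK : ∀ i, (T.bag i).length ≤ K) :
    T.encode.length ≤ 1 + T.size * (K + 2) := by
  have h : ∀ i ≤ T.size, T.pos i ≤ 1 + i * (K + 2) := by
    intro i
    induction i with
    | zero => simp [pos_zero]
    | succ i ih =>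
      intro hi
      have h1 := T.pos_succ ⟨i, hi⟩
      have h2 := hK ⟨i, hi⟩
      have h3 := ih (by omega)
      simp only at h1
      rw [h1, Nat.add_mul]; omega
  have h1 := h T.size le_rfl
  have h2 : T.pos T.size = T.encode.length := by
    have := blockPos_length (fun i => ((T.parent i).val : ℤ) :: ((T.bag i).length : ℤ) ::
      (T.bag i).map fun u => (u.val : ℤ)) (List.finRange T.size)
    rw [List.length_finRange] at this
    rw [pos, this, encode, List.length_cons, Nat.add_comm]
  omega

namespace IsTreeDecomposition

theorem parent_eq_iff (h : T.IsTreeDecomposition G) (i : Fin T.size) :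
    T.parent i = i ↔ i = T.root := by
  constructor
  · intro hi
    by_contra hne
    have := h.level_parent i hne
    rw [hi] at this; omega
  · rintro rfl; exact h.parent_root

/-- The bags that contain a given node are connected. -/
theorem mem_parent (h : T.IsTreeDecomposition G) {b j : Fin T.size} {S : Set (Fin T.size)}
    (hS : ∀ i ∈ S, T.parent i ∈ S) (hb : b ∉ S) (hj : j ∈ S) {u : Fin n} (hub : u ∈ T.bag b)
    (huj : u ∈ T.bag j) : u ∈ T.bag (T.parent b) := by
  classical
  obtain ⟨p⟩ := h.isTree.connected.preconnected b j
  refine h.contiguous b j p.bypass p.bypass_isPath _ ?_ u hub huj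
  -- A path from `b` to `j` must leave the subtree below `b`, and the only edge that leaves it joins
  -- `b` to its parent. So the parent is on the path and contiguity applies.
  have hjA : j ∉ {i | ∃ k, T.parent^[k] i = b} := by
    rintro ⟨k, hk⟩
    have : ∀ k, T.parent^[k] j ∈ S := by
      intro k
      induction k with
      | zero => exact hj
      | succ k ih => rw [Function.iterate_succ_apply']; exact hS _ ih
    exact hb (hk ▸ this k)
  obtain ⟨d, hd, hd1, hd2⟩ := p.bypass.exists_boundary_dart {i | ∃ k, T.parent^[k] i = b}
    ⟨0, rfl⟩ hjA
  obtain ⟨k, hk⟩ := hd1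
  have hadj := d.adj
  simp only [BagTree.tree, SimpleGraph.fromRel_adj] at hadj
  rcases hadj.2 with h1 | h1
  · cases k with
    | zero =>
      rw [Function.iterate_zero, id] at hk
      have h2 : T.parent b = d.toProd.2 := by rw [← h1, hk]
      rw [h2]
      exact p.bypass.dart_snd_mem_support_of_mem_darts hd
    | succ k => exact absurd ⟨k, by rwa [Function.iterate_succ_apply, h1] at hk⟩ hd2
  · exact absurd ⟨k + 1, by rwa [Function.iterate_succ_apply, h1]⟩ hd2

end IsTreeDecomposition

end BagTree

/-- The bags in `S` have been visited, which has put the nodes `l` in order; the node `u` has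
first been seen in the bag `top u`. -/
structure Visited {n : ℕ} (T : BagTree n) (S : Finset (Fin T.size)) (l : List (Fin n))
    (top : Fin n → Fin T.size) : Prop where
  root : T.root ∈ S
  parent : ∀ i ∈ S, T.parent i ∈ S
  nodup : l.Nodup
  mem : ∀ u, u ∈ l ↔ ∃ i ∈ S, u ∈ T.bag i
  -- The fact behind the elimination order: every predecessor `y` of `x` that shares some bag with
  -- it lies in the bag where `x` was first seen.
  common : ∀ i ∈ S, ∀ x y, x ∈ T.bag i → y ∈ T.bag i → l.idxOf y ≤ l.idxOf x → y ∈ T.bag (top x)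

/-- The nodes of `m` that are not in `l` are put at the end of `l`. -/
def addNew {n : ℕ} (l m : List (Fin n)) : List (Fin n) := l ++ m.filter (· ∉ l)

/-- Nodes of `b` that were seen before also lie in the visited parent bag, by connectedness, so for
them `common` is inherited from the parent. New nodes have `b` itself as their first bag. -/
theorem Visited.visit {n : ℕ} {T : BagTree n} {G : WGraph n} (hT : T.IsTreeDecomposition G)
    {S : Finset (Fin T.size)} {l : List (Fin n)} {top : Fin n → Fin T.size}
    (h : Visited T S l top) {b : Fin T.size} (hb : b ∉ S) (hpb : T.parent b ∈ S) :
    Visited T (insert b S) (addNew l (T.bag b)) (fun u => if u ∈ l then top u else b) := by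
  have hidx : ∀ x ∈ l, (addNew l (T.bag b)).idxOf x = l.idxOf x := fun x hx =>
    List.idxOf_append_of_mem hx
  have hidx' : ∀ x, x ∉ l → l.length ≤ (addNew l (T.bag b)).idxOf x := fun x hx => by
    rw [addNew, List.idxOf_append_of_notMem hx]; omega
  have hold : ∀ x y, x ∈ l → (addNew l (T.bag b)).idxOf y ≤ (addNew l (T.bag b)).idxOf x →
      y ∈ l := by
    intro x y hx hle
    by_contra hy
    have h1 := hidx' y hy
    have h2 := hidx x hx
    have h3 := List.idxOf_lt_length_of_mem hx
    omega
  refine ⟨Finset.mem_insert_of_mem h.root, ?_, ?_, ?_, ?_⟩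
  · intro i hi
    rcases Finset.mem_insert.1 hi with rfl | hi
    · exact Finset.mem_insert_of_mem hpb
    · exact Finset.mem_insert_of_mem (h.parent i hi)
  · refine List.nodup_append.2 ⟨h.nodup, (hT.nodup b).filter _, ?_⟩
    rintro a ha _ hb' rfl
    simp at hb'
    exact hb'.2 ha
  · intro u
    simp only [addNew, List.mem_append, List.mem_filter, Finset.mem_insert, exists_eq_or_imp,
      ← h.mem u, decide_not, Bool.not_eq_true', decide_eq_false_iff_not]
    tauto
  · intro i hi x y hx hy hle
    by_cases hxl : x ∈ l
    · have hyl := hold x y hxl hle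
      rw [hidx x hxl, hidx y hyl] at hle
      simp only [hxl, if_true]
      rcases Finset.mem_insert.1 hi with rfl | hi
      · obtain ⟨j, hj, hxj⟩ := (h.mem x).1 hxl
        obtain ⟨j', hj', hyj⟩ := (h.mem y).1 hyl
        exact h.common _ hpb x y (hT.mem_parent (S := S) h.parent hb hj hx hxj)
          (hT.mem_parent (S := S) h.parent hb hj' hy hyj) hle
      · exact h.common i hi x y hx hy hle
    · simp only [hxl, if_false]
      rcases Finset.mem_insert.1 hi with rfl | hi
      · exact hy
      · exact absurd ((h.mem x).2 ⟨i, hi, hx⟩) hxl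

theorem Visited.init {n : ℕ} {T : BagTree n} {G : WGraph n} (hT : T.IsTreeDecomposition G) :
    Visited T {T.root} (addNew [] (T.bag T.root)) (fun _ => T.root) := by
  refine ⟨by simp, by simp [hT.parent_root], ?_, by simp [addNew], ?_⟩
  · simpa [addNew] using hT.nodup _
  · intro i hi x y hx hy _
    rw [Finset.mem_singleton.1 hi] at hy; exact hy

/-- An order of the nodes, and for each node `v` a list `nb v 0, nb v 1, …` with gaps of the nodes
of rank at most that of `v` that are adjacent to `v` when `v` is eliminated. -/
structure Slots {n : ℕ} (G : WGraph n) (K : ℕ) where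
  rk : Fin n → ℕ
  ord : ℕ → Fin n
  nb : Fin n → ℕ → Option (Fin n)
  rk_ord : ∀ j < n, rk (ord j) = j
  rk_lt : ∀ u, rk u < n
  rk_inj : Function.Injective rk
  nb_rk : ∀ v j y, nb v j = some y → rk y ≤ rk v
  nb_self : ∀ v, ∃ j < K, nb v j = some v
  -- Closure under fill-in: two nodes joined by eliminating `v` already share a slot, so elimination
  -- never needs new ones.
  nb_trans : ∀ v i j x y, nb v i = some x → nb v j = some y → rk y ≤ rk x →
    ∃ k < K, nb x k = some y
  nb_adj : ∀ x y, G.Adj x y ∨ G.Adj y x → rk y ≤ rk x → ∃ k < K, nb x k = some y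

open Classical in
/-- The order in which a visit of all the bags sees the nodes. -/
noncomputable def Visited.slots {n : ℕ} {T : BagTree n} {G : WGraph n} {l : List (Fin n)}
    {top : Fin n → Fin T.size} (h : Visited T Finset.univ l top) (hT : T.IsTreeDecomposition G)
    {K : ℕ} (hK : ∀ i, (T.bag i).length ≤ K) (hn : 0 < n) : Slots G K where
  rk := l.idxOf
  ord j := l.getD j ⟨0, hn⟩
  nb v j := (T.bag (top v))[j]?.filter fun y => l.idxOf y ≤ l.idxOf v
  rk_ord j hj := by
    have hlen : l.length = n := by
      have : l.toFinset = Finset.univ := by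
        ext u; simp [h.mem, hT.node_covered u]
      rw [← List.toFinset_card_of_nodup h.nodup, this]; simp
    rw [List.getD_eq_getElem _ _ (by omega)]
    exact h.nodup.idxOf_getElem _ _
  rk_lt u := by
    have h1 : u ∈ l := (h.mem u).2 (by simpa using hT.node_covered u)
    exact (List.idxOf_lt_length_of_mem h1).trans_le (by simpa using h.nodup.length_le_card)
  rk_inj x y hxy := by
    have h1 : ∀ u, u ∈ l := fun u => (h.mem u).2 (by simpa using hT.node_covered u)
    exact (List.idxOf_inj (h1 x)).1 hxy
  nb_rk v j y hy := by
    rw [Option.filter_eq_some_iff] at hy; simpa using hy.2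
  nb_self v := by
    obtain ⟨i, hi⟩ := hT.node_covered v
    obtain ⟨j, hj, hj'⟩ := List.getElem_of_mem (h.common i (Finset.mem_univ _) v v hi hi le_rfl)
    exact ⟨j, hj.trans_le (hK _), by rw [List.getElem?_eq_getElem hj, hj']; simp⟩
  nb_trans v i j x y hx hy hxy := by
    rw [Option.filter_eq_some_iff] at hx hy
    obtain ⟨j, hj, hj'⟩ := List.getElem_of_mem (h.common (top v) (Finset.mem_univ _) x y
      (List.mem_of_getElem? hx.1) (List.mem_of_getElem? hy.1) hxy)
    exact ⟨j, hj.trans_le (hK _), by rw [List.getElem?_eq_getElem hj, hj']; simp [hxy]⟩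
  nb_adj x y hadj hxy := by
    obtain ⟨i, hi, hi'⟩ : ∃ i, x ∈ T.bag i ∧ y ∈ T.bag i := by
      rcases hadj with hadj | hadj
      · exact hT.edge_covered x y hadj
      · obtain ⟨i, h1, h2⟩ := hT.edge_covered y x hadj; exact ⟨i, h2, h1⟩
    obtain ⟨j, hj, hj'⟩ := List.getElem_of_mem (h.common i (Finset.mem_univ _) x y hi hi' hxy)
    exact ⟨j, hj.trans_le (hK _), by rw [List.getElem?_eq_getElem hj, hj']; simp [hxy]⟩

open Cmd

/-! ### Visiting the bags on the machine. -/

section Visit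

variable {n : ℕ} {T : BagTree n} {G : WGraph n} {Γ : Ctx}

/-- What the machine needs for dealing with the words that present `T`. -/
structure Fits (Γ : Ctx) (T : BagTree n) : Prop where
  node : (n : ℤ) ≤ Γ.E
  size : (T.size : ℤ) ≤ Γ.E
  len : (T.encode.length : ℤ) ≤ Γ.E
  level : ∀ i, (T.level i : ℤ) ≤ Γ.E
  bound : Γ.E + 10 ≤ Γ.B

/-- The words that present `T` are in array `0`, and the positions of the bags in array `1`. -/
structure BagMem (T : BagTree n) (s : St) : Prop where
  buf : ∀ k : ℕ, s.arr 0 k = T.encode.getD k 0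
  size : s.var 4 = T.size
  off : ∀ i : Fin T.size, s.arr 1 (i : ℕ) = T.pos i

theorem BagMem.par {s : St} (h : BagMem T s) (i : Fin T.size) :
    s.arr 0 (T.pos i) = (T.parent i : ℕ) := by
  rw [h.buf, BagTree.encode_parent]

theorem BagMem.len {s : St} (h : BagMem T s) (i : Fin T.size) :
    s.arr 0 ((T.pos i : ℤ) + 1) = (T.bag i).length := by
  rw [← BagTree.encode_len, ← h.buf]; rfl

theorem BagMem.bag {s : St} (h : BagMem T s) (i : Fin T.size) {j : ℕ}
    (hj : j < (T.bag i).length) : s.arr 0 ((T.pos i : ℤ) + 2 + j) = ((T.bag i)[j] : ℕ) := by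
  rw [← BagTree.encode_bag i hj, ← h.buf]; rfl

theorem BagMem.congr {s s' : St} (h : BagMem T s) (h0 : s'.arr 0 = s.arr 0)
    (h1 : s'.arr 1 = s.arr 1) (h4 : s'.var 4 = s.var 4) : BagMem T s' :=
  ⟨by rw [h0]; exact h.buf, by rw [h4]; exact h.size, by rw [h1]; exact h.off⟩

/-- The results of the visit so far: marks of the bags in array `2`, ranks of the nodes in
array `4`, nodes by rank in array `5`, positions of the bags `top u` in array `6`. -/
structure VisMem (T : BagTree n) (S : Finset (Fin T.size)) (l : List (Fin n))
    (top : Fin n → Fin T.size) (s : St) : Prop where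
  cnt : s.var 12 = l.length
  vis : ∀ i : Fin T.size, s.arr 2 (i : ℕ) = if i ∈ S then 1 else 0
  -- Ranks are shifted by one, so that `0` means unseen.
  rank : ∀ u : Fin n, s.arr 4 (u : ℕ) = if u ∈ l then (l.idxOf u : ℤ) + 1 else 0
  ord : ∀ j (hj : j < l.length), s.arr 5 (j : ℕ) = (l[j] : ℕ)
  top : ∀ u ∈ l, s.arr 6 (u : ℕ) = T.pos (top u)

theorem VisMem.congr {S : Finset (Fin T.size)} {l : List (Fin n)} {top : Fin n → Fin T.size}
    {s s' : St} (h : VisMem T S l top s) (hv : s'.var 12 = s.var 12)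
    (h2 : s'.arr 2 = s.arr 2) (h4 : s'.arr 4 = s.arr 4) (h5 : s'.arr 5 = s.arr 5)
    (h6 : s'.arr 6 = s.arr 6) : VisMem T S l top s' :=
  ⟨by rw [hv]; exact h.cnt, by rw [h2]; exact h.vis, by rw [h4]; exact h.rank,
    by rw [h5]; exact h.ord, by rw [h6]; exact h.top⟩

/-- Number the new nodes in the bag with the index in variable `6`. -/
def visitBag : Cmd :=
  asg 8 (.A 1 (.V 6)) ;; sto 2 (.V 6) (.C 1) ;;
  loopTo 10 (.A 0 (.V 8 + .C 1)) (
    asg 11 (.A 0 (.V 8 + .C 2 + .V 10)) ;;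
    ite (.lt (.A 4 (.V 11)) (.C 1))
      (sto 5 (.V 12) (.V 11) ;; asg 12 (.V 12 + .C 1) ;; sto 4 (.V 11) (.V 12) ;;
        sto 6 (.V 11) (.V 8))
      skip)

theorem visitBag_wp (hΓ : Fits Γ T) (hT : T.IsTreeDecomposition G) {S : Finset (Fin T.size)}
    {l : List (Fin n)} {top : Fin n → Fin T.size} {b : Fin T.size} {s : St} (hm : BagMem T s)
    (hl : l.Nodup) (hv : VisMem T S l top s) (h6 : s.var 6 = (b : ℕ)) {K : ℕ}
    (hK : ∀ i, (T.bag i).length ≤ K) :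
    visitBag.wp Γ (fun t s' => t ≤ 70 * K + 40 ∧
      VisMem T (insert b S) (addNew l (T.bag b)) (fun u => if u ∈ l then top u else b) s') s := by
  have hone := Γ.one_le
  obtain ⟨e1, e2, e3, -, e4⟩ := hΓ
  have hbs := b.isLt
  have hpl := T.pos_le b
  have hlen := hm.len b
  rw [visitBag]
  simp only [wp_seq, wp_asg, wp_sto, Ex.ok_A, Ex.ok_V, Ex.ok_C, Ex.eval_A, Ex.eval_V, Ex.eval_C,
    St.set_var, St.set_arr]
  norm_num
  rw [h6, hm.off]
  refine ⟨⟨by omega, by omega⟩, ⟨by omega, by omega⟩, by omega, by omega, ?_⟩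
  refine wp_loopTo (T.bag b).length 48 (fun j s' => VisMem T (insert b S)
    (addNew l ((T.bag b).take j)) (fun u => if u ∈ l then top u else b) s') (by norm_num) (by decide)
    (by omega) ?_ ?_ ?_ ?_
  · intro s' hf
    have h0 := hf.arr 0 (by decide)
    have h8 := hf.var 8 (by decide)
    simp at h0 h8
    simp [h0, h8, hlen]
    norm_num
    omega
  · refine ⟨by simpa [addNew] using hv.cnt, fun i => ?_, fun u => ?_, fun j hj => ?_, fun u hu => ?_⟩
    · simp [hv.vis, Fin.ext_iff]
      split_ifs <;> simp_all
    · simpa [addNew] using hv.rank u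
    · simp [addNew] at hj ⊢; simpa using hv.ord j hj
    · simp [addNew] at hu ⊢; simpa [hu] using hv.top u hu
  · intro j s' hj hf h10 hI
    have h0 := hf.arr 0 (by decide)
    have h8 := hf.var 8 (by decide)
    simp at h0 h8
    have hbag := hm.bag b hj
    obtain ⟨u, hu⟩ : ∃ u, u = (T.bag b)[j] := ⟨_, rfl⟩
    rw [← hu] at hbag
    have hun := u.isLt
    set l' := addNew l ((T.bag b).take j) with hl'
    have hutake : u ∉ (T.bag b).take j := by
      intro hmem
      obtain ⟨i, hi, hi'⟩ := List.getElem_of_mem hmem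
      rw [List.length_take] at hi
      rw [List.getElem_take, hu, (hT.nodup b).getElem_inj_iff] at hi'
      omega
    have hul : u ∈ l' ↔ u ∈ l := by simp [hl', addNew, hutake]
    have hnd : l'.Nodup := by
      refine List.nodup_append.2 ⟨hl, ((hT.nodup b).sublist (List.take_sublist _ _)).filter _, ?_⟩
      rintro a ha _ hb' rfl
      simp at hb'
      exact hb'.2 ha
    have hsucc : addNew l ((T.bag b).take (j + 1)) = l' ++ if u ∈ l then [] else [u] := by
      rw [addNew, List.take_succ_eq_append_getElem hj, List.filter_append, ← List.append_assoc]
      congr 1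
      by_cases h : u ∈ l <;> simp [h, ← hu]
    have hrank := hI.rank u
    simp only [wp_seq, wp_asg, wp_sto, wp_ite, wp_skip, Ex.ok_A, Ex.ok_V, Ex.ok_C, Ex.eval_A, Ex.ok_add, Ex.ok_lt, Ex.eval_lt,
      Ex.eval_V, Ex.eval_C, St.set_var, St.set_arr, Ex.eval_add, h0, h8, h10]
    norm_num
    rw [hbag, hrank]
    constructorm* _ ∧ _
    any_goals first | omega | intro hneg
    · have hul' : u ∉ l' := by
        intro h; rw [if_pos h] at hneg; omega
      have hlt : l'.length < n := by
        have : (u :: l').Nodup := List.nodup_cons.2 ⟨hul', hnd⟩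
        simpa using this.length_le_card
      rw [hsucc, if_neg (by rwa [← hul])]
      have hcnt := hI.cnt
      constructorm* _ ∧ _
      any_goals omega
      refine ⟨by simp [hI.cnt], fun i => ?_, fun x => ?_, fun i hi => ?_, fun x hx => ?_⟩
      · simpa using hI.vis i
      · have hx := hI.rank x
        by_cases hxu : x = u
        · subst hxu; simp [hI.cnt, List.idxOf_append_of_notMem hul']
        · have : (x : ℕ) ≠ u := fun h => hxu (Fin.ext h)
          simp [this, hx, hxu]
          by_cases hxl : x ∈ l' <;> simp [hxl, List.idxOf_append_of_mem]
      · rw [List.length_append] at hi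
        by_cases hi' : i < l'.length
        · have h1 : (i : ℤ) ≠ l'.length := by omega
          simp [hI.cnt, hi', hI.ord i hi', List.getElem_append]
          omega
        · have h1 : i = l'.length := by simp at hi; omega
          subst h1
          simp [hI.cnt]
      · by_cases hxu : x = u
        · subst hxu; simp [hul.not.1 hul', h8]
        · have : (x : ℕ) ≠ u := fun h => hxu (Fin.ext h)
          have hx' : x ∈ l' := by simpa [hxu] using hx
          simp [this, hI.top x hx']
    · have hul' : u ∈ l' := by
        by_contra h; rw [if_neg h] at hneg; omega
      rw [hsucc, if_pos (by rwa [← hul])]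
      rw [List.append_nil]
      exact hI.congr rfl rfl rfl rfl rfl
  · intro τ s' hf _ hI hτ
    rw [List.take_length] at hI
    refine ⟨?_, hI⟩
    have := hK b
    simp at hτ ⊢
    omega

/-- Read the sizes, find the positions of the bags and the root. -/
def readBags : Cmd :=
  asg 2 (.R (.C 0)) ;; asg 3 (.R (.C 1)) ;; asg 4 (.A 0 (.C 0)) ;; asg 8 (.C 1) ;;
  loopTo 5 (.V 4) (sto 1 (.V 5) (.V 8) ;; asg 8 (.V 8 + .C 2 + .A 0 (.V 8 + .C 1))) ;;
  loopTo 5 (.V 4) (ite (.eq (.A 0 (.A 1 (.V 5))) (.V 5)) (asg 6 (.V 5)) skip)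

/-- Bag positions accumulate the lengths of the preceding blocks; the root is recognised as the only
bag that is its own parent. -/
theorem readBags_wp (hΓ : Fits Γ T) (hT : T.IsTreeDecomposition G) (hinp : Γ.inp = G.encode)
    (hcard : (G.edges.card : ℤ) ≤ Γ.B) {s : St}
    (hbuf : ∀ k : ℕ, s.arr 0 k = T.encode.getD k 0) :
    readBags.wp Γ (fun t s' => t ≤ 100 * T.size + 100 ∧ BagMem T s' ∧ s'.var 2 = n ∧
      s'.var 3 = G.edges.card ∧ s'.var 6 = (T.root : ℕ)) s := by
  have hone := Γ.one_le
  obtain ⟨e1, e2, e3, -, e4⟩ := hΓ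
  have i0 : inAt Γ.inp 0 = n := by rw [hinp]; rfl
  have i1 : inAt Γ.inp 1 = G.edges.card := by rw [hinp]; rfl
  have il : 2 ≤ Γ.inp.length := by rw [hinp, WGraph.encode]; simp
  have hlp : 1 ≤ T.encode.length := by simp [BagTree.encode]
  have hb0 := hbuf 0
  rw [BagTree.encode_size, Nat.cast_zero] at hb0
  rw [readBags]
  simp only [wp_seq, wp_asg, Ex.ok_A, Ex.ok_V, Ex.ok_C, Ex.eval_A, Ex.eval_V, Ex.eval_C,
    Ex.ok_R, Ex.eval_R, Ctx.bd, i0, i1,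
    St.set_var, St.set_arr, hb0]
  norm_num
  constructorm* _ ∧ _
  any_goals omega
  refine wp_loopTo T.size 40 (fun i s' => s'.var 8 = T.pos i ∧
    ∀ j : Fin T.size, (j : ℕ) < i → s'.arr 1 (j : ℕ) = T.pos j) (by norm_num) (by decide)
    (by omega) ?_ ?_ ?_ ?_
  · intro s' hf
    have h4 := hf.var 4 (by decide)
    simp at h4
    simp [h4]
  · simp [BagTree.pos_zero]
  · rintro i s' hi hf h5 ⟨h8, hI⟩
    have h0 := hf.arr 0 (by decide)
    simp at h0
    have hlen : s.arr 0 ((T.pos i : ℤ) + 1) = (T.bag ⟨i, hi⟩).length := by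
      rw [← BagTree.encode_len ⟨i, hi⟩, ← hbuf]; rfl
    have hle := T.pos_le ⟨i, hi⟩
    have hsucc := T.pos_succ ⟨i, hi⟩
    simp only at hle hsucc
    simp only [wp_seq, wp_asg, wp_sto, Ex.ok_A, Ex.ok_V, Ex.ok_C, Ex.eval_A, Ex.ok_add,
      Ex.eval_V, Ex.eval_C, St.set_var, St.set_arr, Ex.eval_add, h5, h8, St.put_var, St.put_arr]
    norm_num
    rw [h0, hlen, hsucc]
    constructorm* _ ∧ _
    any_goals omega
    · intro j hj
      have := hI j
      split_ifs with h
      · rw [← h]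
      · exact hI j (by omega)
  · rintro τ s1 hf h5 ⟨-, hI⟩ hτ
    have hf2 := hf.var 2 (by decide)
    have hf3 := hf.var 3 (by decide)
    have hf4 := hf.var 4 (by decide)
    have hfa := hf.arr 0 (by decide)
    simp at hf2 hf3 hf4 hfa
    have hm : BagMem T s1 := ⟨by rw [hfa]; exact hbuf, hf4, fun i => hI i i.isLt⟩
    refine wp_loopTo T.size 20 (fun i s' => (T.root : ℕ) < i → s'.var 6 = (T.root : ℕ))
      (by norm_num) (by decide) (by omega) ?_ ?_ ?_ ?_
    · intro s' hf
      have h4 := hf.var 4 (by decide)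
      simp [h4, hf4]
    · simp
    · intro i s2 hi hf h5 hI
      have hm2 := hm.congr (hf.arr 0 (by decide)) (hf.arr 1 (by decide)) (hf.var 4 (by decide))
      have h1 := hm2.par ⟨i, hi⟩
      have h2 := hm2.off ⟨i, hi⟩
      have h3 := hT.parent_eq_iff ⟨i, hi⟩
      have hle := T.pos_le ⟨i, hi⟩
      have hlt := (T.parent ⟨i, hi⟩).isLt
      simp only at h1 h2 hle
      simp only [wp_asg, wp_ite, wp_skip, Ex.ok_A, Ex.ok_V, Ex.ok_eq, Ex.eval_A, Ex.eval_eq,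
        Ex.eval_V, St.set_var, h5, h1, h2]
      norm_num
      constructorm* _ ∧ _
      any_goals omega
      · intro h hr
        have : (⟨i, hi⟩ : Fin T.size) = T.root := h3.1 (Fin.ext h)
        rw [← this]
      · intro h hr
        refine hI (lt_of_le_of_ne (by omega) fun hr' => h ?_)
        have : (⟨i, hi⟩ : Fin T.size) = T.root := Fin.ext hr'.symm
        rw [h3.2 this]
    · intro τ' s2 hf' _ hI hτ'
      refine ⟨?_, ?_, ?_, ?_, hI T.root.isLt⟩
      · simp at hτ hτ' ⊢; omega
      · exact hm.congr (hf'.arr 0 (by decide)) (hf'.arr 1 (by decide)) (hf'.var 4 (by decide))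
      · rw [hf'.var 2 (by decide), hf2]
      · rw [hf'.var 3 (by decide), hf3]

/-- Each step to the parent lowers the level by one as long as the visited set, which contains the
root, is not reached. This bounds the climb by the depth and makes the stacked ancestors distinct.
-/
theorem BagTree.IsTreeDecomposition.level_iterate (hT : T.IsTreeDecomposition G)
    {S : Finset (Fin T.size)} (hr : T.root ∈ S) (i : Fin T.size) (k : ℕ)
    (h : ∀ j < k, T.parent^[j] i ∉ S) : T.level (T.parent^[k] i) + k = T.level i := by
  induction k with
  | zero => rfl
  | succ k ih =>
    have h1 := ih fun j hj => h j (by omega)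
    have h2 := hT.level_parent (T.parent^[k] i) fun hk => h k (by omega) (hk ▸ hr)
    rw [Function.iterate_succ_apply']
    omega

/-- Push the unvisited ancestors of the bag in variable `6`. -/
def climb : Cmd :=
  whl (.lt (.A 2 (.V 6)) (.C 1))
    (sto 3 (.V 7) (.V 6) ;; asg 7 (.V 7 + .C 1) ;; asg 6 (.A 0 (.A 1 (.V 6))))

theorem climb_wp (hΓ : Fits Γ T) (hT : T.IsTreeDecomposition G) {S : Finset (Fin T.size)}
    {l : List (Fin n)} {top : Fin n → Fin T.size} {s : St} (hm : BagMem T s)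
    (hv : VisMem T S l top s) (hr : T.root ∈ S) (i : Fin T.size) (h6 : s.var 6 = (i : ℕ))
    (h7 : s.var 7 = 0) :
    climb.wp Γ (fun t s' => ∃ k : ℕ, t ≤ 40 * k + 10 ∧ s'.var 7 = k ∧ T.parent^[k] i ∈ S ∧
      ∀ j < k, T.parent^[j] i ∉ S ∧ s'.arr 3 j = (T.parent^[j] i : ℕ)) s := by
  have hone := Γ.one_le
  obtain ⟨e1, e2, e3, e5, e4⟩ := hΓ
  refine wp_whl (fun left τ s' => ∃ k : ℕ, τ ≤ 40 * k ∧ left = T.level (T.parent^[k] i) ∧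
    s'.var 7 = k ∧ s'.var 6 = (T.parent^[k] i : ℕ) ∧
      ∀ j < k, T.parent^[j] i ∉ S ∧ s'.arr 3 j = (T.parent^[j] i : ℕ)) (T.level i)
    ⟨0, by simp, rfl, by simpa using h7, by simpa using h6, by simp⟩ ?_ ?_
  · rintro left τ s1 hf ⟨k, hτ, hleft, h7, h6, hk⟩
    have hm1 := hm.congr (hf.arr 0 (by decide)) (hf.arr 1 (by decide)) (hf.var 4 (by decide))
    have hv1 := hv.congr (hf.var 12 (by decide)) (hf.arr 2 (by decide)) (hf.arr 4 (by decide))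
      (hf.arr 5 (by decide)) (hf.arr 6 (by decide))
    have hlev := hT.level_iterate hr i k fun j hj => (hk j hj).1
    obtain ⟨x, hx⟩ : ∃ x, x = T.parent^[k] i := ⟨_, rfl⟩
    rw [← hx] at h6 hlev hleft
    have hxlt := x.isLt
    have h1 := hm1.par x
    have h2 := hm1.off x
    have hle := T.pos_le x
    have hlt := (T.parent x).isLt
    have hvis := hv1.vis x
    have hei := e5 i
    simp only [wp_seq, wp_asg, wp_sto, Ex.ok_A, Ex.ok_V, Ex.ok_C, Ex.eval_A, Ex.ok_add, Ex.ok_lt,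
      Ex.eval_lt, Ex.eval_V, Ex.eval_C, St.set_var, St.set_arr, Ex.eval_add, h6, h7, hvis,
      St.put_var, St.put_arr]
    norm_num
    rw [h2]
    constructorm* _ ∧ _
    any_goals omega
    intro hxS
    have hxS' : x ∉ S := by
      intro h; rw [if_pos h] at hxS; omega
    have hlx := hT.level_parent x fun h => hxS' (h ▸ hr)
    refine ⟨T.level (T.parent x), by omega, ?_⟩
    rw [h1]
    constructorm* _ ∧ _
    any_goals omega
    refine ⟨k + 1, by omega, by rw [Function.iterate_succ_apply', hx], by simp,
      by rw [Function.iterate_succ_apply', hx], fun j hj => ?_⟩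
    rcases Nat.lt_succ_iff_lt_or_eq.1 hj with hj | rfl
    · have := hk j hj
      refine ⟨this.1, ?_⟩
      rw [if_neg (by omega)]
      exact this.2
    · rw [← hx]
      exact ⟨hxS', by simp⟩
  · rintro left τ s1 hf ⟨k, hτ, hleft, h7, h6, hk⟩ hneg
    have hv1 := hv.congr (hf.var 12 (by decide)) (hf.arr 2 (by decide)) (hf.arr 4 (by decide))
      (hf.arr 5 (by decide)) (hf.arr 6 (by decide))
    refine ⟨k, by simp; omega, h7, ?_, hk⟩
    simp only [Ex.eval_lt, Ex.eval_V, Ex.eval_C, Ex.eval_A, h6, hv1.vis] at hneg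
    by_contra hc
    simp [hc] at hneg

/-- Visit the bags on the stack. -/
def popVisit : Cmd := whl (.V 7) (asg 7 (.V 7 - .C 1) ;; asg 6 (.A 3 (.V 7)) ;; visitBag)

/-- The stack is popped from the highest ancestor downwards, so the parent of every bag has been
visited before it, as `Visited.visit` requires. -/
theorem popVisit_wp (hΓ : Fits Γ T) (hT : T.IsTreeDecomposition G) {S : Finset (Fin T.size)}
    {l : List (Fin n)} {top : Fin n → Fin T.size} {s : St} (hm : BagMem T s)
    (hV : Visited T S l top) (hv : VisMem T S l top s) (i : Fin T.size) {k : ℕ}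
    (h7 : s.var 7 = k) (hkS : T.parent^[k] i ∈ S)
    (hk : ∀ j < k, T.parent^[j] i ∉ S ∧ s.arr 3 j = (T.parent^[j] i : ℕ)) {K : ℕ}
    (hK : ∀ i, (T.bag i).length ≤ K) :
    popVisit.wp Γ (fun t s' => t ≤ (70 * K + 60) * k + 10 ∧ ∃ S' l' top', Visited T S' l' top' ∧
      VisMem T S' l' top' s' ∧ S ⊆ S' ∧ i ∈ S' ∧ S'.card = S.card + k) s := by
  have hone := Γ.one_le
  have hΓ' := hΓ
  obtain ⟨e1, e2, e3, e5, e4⟩ := hΓ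
  have hlev := hT.level_iterate hV.root i k fun j hj => (hk j hj).1
  have hei := e5 i
  refine wp_whl (fun left τ s' => left ≤ k ∧ τ ≤ (70 * K + 60) * (k - left) ∧ s'.var 7 = left ∧
    ∃ S' l' top', Visited T S' l' top' ∧ VisMem T S' l' top' s' ∧ S ⊆ S' ∧ 
      T.parent^[left] i ∈ S' ∧ (∀ j < left, T.parent^[j] i ∉ S') ∧ S'.card + left = S.card + k) k
    ⟨le_rfl, by simp, h7, S, l, top, hV, hv, subset_rfl, hkS, fun j hj => (hk j hj).1, rfl⟩ ?_ ?_
  · rintro left τ s1 hf ⟨hl, hτ, h7, S', l', top', hV', hv', hSS, hleft, hj, hcard⟩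
    refine ⟨by simp, fun hpos => ?_⟩
    simp only [Ex.eval_V, h7] at hpos
    obtain ⟨r, rfl⟩ : ∃ r, left = r + 1 := ⟨left - 1, by omega⟩
    refine ⟨r, rfl, ?_⟩
    have hm1 := hm.congr (hf.arr 0 (by decide)) (hf.arr 1 (by decide)) (hf.var 4 (by decide))
    have h3 := (hk r (by omega)).2
    rw [← hf.arr 3 (by decide)] at h3
    have h7' : s1.var 7 - 1 = r := by rw [h7]; push_cast; ring
    simp only [wp_seq, wp_asg, Ex.ok_A, Ex.ok_V, Ex.ok_C, Ex.eval_A, Ex.ok_sub,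
      Ex.eval_V, Ex.eval_C, St.set_var, St.set_arr, Ex.eval_sub, h7', h3]
    norm_num
    constructorm* _ ∧ _
    any_goals omega
    refine wp_use (visitBag_wp hΓ' hT (hm1.congr (by rfl) (by rfl) (by simp)) hV'.nodup
      (hv'.congr (by simp) (by rfl) (by rfl) (by rfl) (by rfl)) (b := T.parent^[r] i) (by simp [h3]) hK) ?_
    rintro t s2 ⟨ht, hv2⟩ hf2
    have hr := hj r (by omega)
    refine ⟨by omega, ?_, by rw [hf2.var 7 (by decide)]; simp, _, _, _,
      hV'.visit hT hr (by rw [← Function.iterate_succ_apply' T.parent]; exact hleft), hv2,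
      hSS.trans (Finset.subset_insert _ _), Finset.mem_insert_self _ _, fun j hjr => ?_, ?_⟩
    · have h1 : k - r = k - (r + 1) + 1 := by omega
      rw [h1, Nat.mul_add]; omega
    · rw [Finset.mem_insert, not_or]
      refine ⟨fun heq => ?_, hj j (by omega)⟩
      have l1 := hT.level_iterate hV'.root i j fun m hm => hj m (by omega)
      have l2 := hT.level_iterate hV'.root i r fun m hm => hj m (by omega)
      rw [heq] at l1; omega
    · rw [Finset.card_insert_of_notMem hr]; omega
  · rintro left τ s1 hf ⟨hl, hτ, h7, S', l', top', hV', hv', hSS, hleft, hj, hcard⟩ hneg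
    simp only [Ex.eval_V, h7] at hneg
    obtain rfl : left = 0 := by omega
    exact ⟨by simp at hτ ⊢; omega, S', l', top', hV', hv', hSS, hleft, by omega⟩

/-- Visit all the bags. -/
def visitAll : Cmd :=
  visitBag ;; loopTo 5 (.V 4) (asg 6 (.V 5) ;; asg 7 (.C 0) ;; climb ;; popVisit)

theorem visitAll_wp (hΓ : Fits Γ T) (hT : T.IsTreeDecomposition G) {s : St} (hm : BagMem T s)
    (h6 : s.var 6 = (T.root : ℕ)) (h12 : s.var 12 = 0) (h2 : ∀ k, s.arr 2 k = 0)
    (h4 : ∀ k, s.arr 4 k = 0) {K : ℕ} (hK : ∀ i, (T.bag i).length ≤ K) :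
    visitAll.wp Γ (fun t s' => t ≤ (70 * K + 180) * (T.size + 1) ∧
      ∃ l top, Visited T Finset.univ l top ∧ VisMem T Finset.univ l top s') s := by
  have hone := Γ.one_le
  have hΓ' := hΓ
  obtain ⟨e1, e2, e3, e5, e4⟩ := hΓ
  have hv0 : VisMem T ∅ [] (fun _ => T.root) s :=
    ⟨by simpa using h12, by simp [h2], by simp [h4], by simp, by simp⟩
  rw [visitAll, wp_seq]
  refine wp_use (visitBag_wp hΓ' hT hm List.nodup_nil hv0 h6 hK) ?_
  rintro t1 s1 ⟨ht1, hv1⟩ hf1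
  have hm1 := hm.congr (hf1.arr 0 (by decide)) (hf1.arr 1 (by decide)) (hf1.var 4 (by decide))
  refine wp_loopTo' T.size (fun i τ s' => ∃ S l top, Visited T S l top ∧ VisMem T S l top s' ∧
    -- Amortised time: each bag is stacked and visited only once, so the work is charged to the
    -- number of visited bags plus a constant per loop iteration. The root was paid for before the
    -- loop.
    (∀ j : Fin T.size, (j : ℕ) < i → j ∈ S) ∧ τ + (70 * K + 100) ≤ (70 * K + 100) * S.card + 50 * i)
    (by norm_num) (by decide) (by omega) ?_ ?_ ?_ ?_
  · intro s' hf
    have h4 := hf.var 4 (by decide)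
    simp [h4, hm1.size]
  · refine ⟨_, _, _, Visited.init hT, ?_, by simp, by simp⟩
    have : (fun u : Fin n => if u ∈ ([] : List (Fin n)) then T.root else T.root)
      = fun _ => T.root := by simp
    rw [this] at hv1
    exact hv1.congr (by simp) rfl rfl rfl rfl
  · rintro i τ s2 hi hf h5 ⟨S, l, top, hV, hv, hS, hτ⟩
    have hm2 := hm1.congr (hf.arr 0 (by decide)) (hf.arr 1 (by decide)) (hf.var 4 (by decide))
    rw [wp_seq, wp_asg]
    refine ⟨by norm_num, by simp, ?_⟩
    rw [wp_seq, wp_asg]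
    refine ⟨by norm_num, by simp; omega, ?_⟩
    rw [wp_seq]
    refine wp_use (climb_wp hΓ' hT (hm2.congr (by rfl) (by rfl) (by simp))
      (hv.congr (by simp) (by rfl) (by rfl) (by rfl) (by rfl)) hV.root ⟨i, hi⟩ (by simp [h5]) (by simp)) ?_
    rintro t3 s3 ⟨k, ht3, h7, hkS, hk⟩ hf3
    refine wp_use (popVisit_wp hΓ' hT (hm2.congr (hf3.arr 0 (by decide)) (hf3.arr 1 (by decide))
      ((hf3.var 4 (by decide)).trans (by simp))) hV
      (hv.congr ((hf3.var 12 (by decide)).trans (by simp)) (hf3.arr 2 (by decide))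
        (hf3.arr 4 (by decide)) (hf3.arr 5 (by decide)) (hf3.arr 6 (by decide)))
      ⟨i, hi⟩ h7 hkS hk hK) ?_
    rintro t4 s4 ⟨ht4, S', l', top', hV', hv', hSS, hiS, hcard⟩ hf4
    refine ⟨S', l', top', hV', hv'.congr (by simp) rfl rfl rfl rfl, fun j hj => ?_, ?_⟩
    · rcases Nat.lt_succ_iff_lt_or_eq.1 hj with hj | hj
      · exact hSS (hS j hj)
      · have : j = ⟨i, hi⟩ := Fin.ext hj
        rw [this]; exact hiS
    · rw [hcard]
      simp only [Ex.cost_V, Ex.cost_C]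
      nlinarith
  · rintro τ s2 hf _ ⟨S, l, top, hV, hv, hS, hτ⟩
    obtain rfl : S = Finset.univ := by
      ext j; simp [hS j j.isLt]
    refine ⟨?_, l, top, hV, hv⟩
    simp only [Finset.card_univ, Fintype.card_fin, Ex.cost_V] at hτ ⊢
    nlinarith

end Visit

open Cmd

/-! ### The slots of the nodes in memory. -/

/-- How an optional node is stored. -/
def slotVal {n : ℕ} : Option (Fin n) → ℤ
  | none => 0
  | some y => (y : ℕ) + 1

@[simp] theorem slotVal_none {n : ℕ} : slotVal (none : Option (Fin n)) = 0 := rfl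

@[simp] theorem slotVal_some {n : ℕ} (y : Fin n) : slotVal (some y) = (y : ℕ) + 1 := rfl

theorem slotVal_nonneg {n : ℕ} (o : Option (Fin n)) : 0 ≤ slotVal o ∧ slotVal o ≤ n := by
  cases o with
  | none => simp
  | some y => have := y.isLt; simp; omega

theorem slotVal_eq {n : ℕ} {o : Option (Fin n)} {y : Fin n} :
    slotVal o = (y : ℕ) + 1 ↔ o = some y := by
  cases o with
  | none => simp; omega
  | some x => simp [Fin.ext_iff]

theorem slot_lt {n K u j : ℕ} (hu : u < n) (hj : j < K) : (u : ℤ) * K + j < n * K := by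
  have : (u + 1 : ℤ) * K ≤ n * K := mul_le_mul_of_nonneg_right (by omega) (by omega)
  nlinarith

theorem slot_inj {K u u' j j' : ℕ} (hj : j < K) (hj' : j' < K)
    (h : (u : ℤ) * K + j = u' * K + j') : u = u' ∧ j = j' := by
  have h : u * K + j = u' * K + j' := by exact_mod_cast h
  have h1 : (u * K + j) / K = u := by
    rw [Nat.add_comm, Nat.add_mul_div_right _ _ (by omega), Nat.div_eq_of_lt hj, Nat.zero_add]
  have h2 : (u' * K + j') / K = u' := by
    rw [Nat.add_comm, Nat.add_mul_div_right _ _ (by omega), Nat.div_eq_of_lt hj', Nat.zero_add]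
  have h3 : u = u' := by rw [← h1, h, h2]
  subst h3
  exact ⟨rfl, by omega⟩

/-- The sizes of the graph are in variables `2` and `3`, the ranks in array `4`, the nodes by
rank in array `5`, and the slots of the nodes in array `7`. -/
structure SlotMem {n : ℕ} {G : WGraph n} {K : ℕ} (L : Slots G K) (s : St) : Prop where
  nodes : s.var 2 = n
  edges : s.var 3 = G.edges.card
  rank : ∀ u : Fin n, s.arr 4 (u : ℕ) = L.rk u + 1
  ord : ∀ j < n, s.arr 5 (j : ℕ) = (L.ord j : ℕ)
  nb : ∀ (u : Fin n) (j : ℕ), j < K → s.arr 7 ((u : ℕ) * K + j) = slotVal (L.nb u j)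

theorem SlotMem.congr {n : ℕ} {G : WGraph n} {K : ℕ} {L : Slots G K} {s s' : St}
    (h : SlotMem L s) (h2 : s'.var 2 = s.var 2) (h3 : s'.var 3 = s.var 3)
    (h4 : s'.arr 4 = s.arr 4) (h5 : s'.arr 5 = s.arr 5) (h7 : s'.arr 7 = s.arr 7) :
    SlotMem L s' :=
  ⟨by rw [h2]; exact h.nodes, by rw [h3]; exact h.edges, by rw [h4]; exact h.rank,
    by rw [h5]; exact h.ord, by rw [h7]; exact h.nb⟩

/-- Store the slots of all nodes. -/
def mkSlots (K : ℕ) : Cmd :=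
  loopTo 5 (.V 2) (
    asg 8 (.A 6 (.V 5)) ;; asg 9 (.A 0 (.V 8 + .C 1)) ;; asg 13 (.A 4 (.V 5)) ;;
    loopTo 10 (.C K) (
      asg 11 (.C 0) ;;
      ite (.lt (.V 10) (.V 9))
        (asg 14 (.A 0 (.V 8 + .C 2 + .V 10)) ;;
          ite (.lt (.V 13) (.A 4 (.V 14))) skip (asg 11 (.V 14 + .C 1)))
        skip ;;
      sto 7 (.V 5 * .C K + .V 10) (.V 11)))

/-- The bag `top u` is copied into `K` consecutive cells reserved for `u`; positions beyond the bag
and nodes of larger rank become gaps. -/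
theorem mkSlots_wp {n : ℕ} {T : BagTree n} {G : WGraph n} {Γ : Ctx} (hΓ : Fits Γ T)
    (hT : T.IsTreeDecomposition G) {s : St} (hm : BagMem T s) {l : List (Fin n)}
    {top : Fin n → Fin T.size} (hV : Visited T Finset.univ l top)
    (hv : VisMem T Finset.univ l top s) {K : ℕ} (hK : ∀ i, (T.bag i).length ≤ K)
    (h2 : s.var 2 = n) (h3 : s.var 3 = G.edges.card) (hn : 0 < n) (hnK : (n * K : ℤ) ≤ Γ.E) 
    (hKB : (K : ℤ) ≤ Γ.B) :
    (mkSlots K).wp Γ (fun t s' => t ≤ n * (100 * K + 100) + 100 ∧ ∃ L : Slots G K, SlotMem L s')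
      s := by
  have hone := Γ.one_le
  obtain ⟨e1, e2, e3, e5, e4⟩ := hΓ
  set L := hV.slots hT hK hn with hL
  have hmem : ∀ u, u ∈ l := fun u => (hV.mem u).2 (by simpa using hT.node_covered u)
  have hlen : l.length = n := by
    have : l.toFinset = Finset.univ := by ext u; simp [hmem]
    rw [← List.toFinset_card_of_nodup hV.nodup, this]; simp
  have hLrk : ∀ u, L.rk u = l.idxOf u := fun u => rfl
  refine wp_loopTo n (80 * K + 60) (fun i s' => ∀ (u : Fin n) (j : ℕ), (u : ℕ) < i → j < K →
    s'.arr 7 ((u : ℕ) * K + j) = slotVal (L.nb u j)) (by norm_num) (by rfl) (by omega) ?_ ?_ ?_ ?_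
  · intro s' hf
    have h2' := hf.var 2 (by rfl)
    simp [h2', h2]
  · simp
  · intro i s1 hi hf h5 hI
    obtain ⟨u, hu⟩ : ∃ u : Fin n, (u : ℕ) = i := ⟨⟨i, hi⟩, rfl⟩
    rw [← hu] at h5
    have ha0 := hf.arr 0 (by rfl)
    have ha4 := hf.arr 4 (by rfl)
    have ha6 := hf.arr 6 (by rfl)
    have hb := T.pos_le (top u)
    have hlen' := hm.len (top u)
    have hr := hv.rank u
    rw [if_pos (hmem u)] at hr
    have hun := u.isLt
    simp only [wp_seq, wp_asg, Ex.ok_A, Ex.ok_V, Ex.ok_C, Ex.eval_A, Ex.ok_add,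
      Ex.eval_V, Ex.eval_C, St.set_var, St.set_arr, Ex.eval_add, ha0, ha4, ha6, h5,
      hv.top u (hmem u), hr]
    norm_num
    simp only [hlen', hr]
    constructorm* _ ∧ _
    any_goals omega
    refine wp_loopTo K 60 (fun m s' => ∀ (x : Fin n) (j : ℕ), ((x : ℕ) < i ∨ x = u ∧ j < m) →
      j < K → s'.arr 7 ((x : ℕ) * K + j) = slotVal (L.nb x j)) (by norm_num) (by rfl) hKB ?_ ?_ ?_ ?_
    · intro s' hf
      simp; omega
    · intro x j hx hj
      simp only [St.set_arr]
      refine hI x j ?_ hj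
      rcases hx with hx | hx
      · exact hx
      · omega
    · intro m s2 hmK hf' h10 hI'
      have h0 := hf'.arr 0 (by rfl)
      have h4 := hf'.arr 4 (by rfl)
      have h5' := hf'.var 5 (by rfl)
      have h8 := hf'.var 8 (by rfl)
      have h9 := hf'.var 9 (by rfl)
      have h13 := hf'.var 13 (by rfl)
      simp [ha0, ha4, h5] at h0 h4 h5' h8 h9 h13
      have hsl := slot_lt u.isLt hmK
      have hsl0 : (0 : ℤ) ≤ (u : ℕ) * K := by positivity
      have key : ∀ z : ℤ, (L.nb u m = none → z = 0) → (∀ y, L.nb u m = some y → z = (y : ℕ) + 1) →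
          ∀ (x : Fin n) (j : ℕ), ((x : ℕ) < i ∨ x = u ∧ j ≤ m) → j < K →
          (if (x : ℤ) * K + j = (u : ℕ) * K + m then z else s2.arr 7 ((x : ℕ) * K + j))
            = slotVal (L.nb x j) := by
        intro z hz1 hz2 x j hx hj
        split_ifs with hc
        · obtain ⟨h1, rfl⟩ := slot_inj hj hmK hc
          obtain rfl := Fin.ext h1
          cases hL' : L.nb x j with
          | none => exact hz1 hL'
          | some y => exact hz2 y hL'
        · refine hI' x j ?_ hj
          rcases hx with hx | ⟨rfl, hx⟩
          · exact Or.inl hx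
          · refine Or.inr ⟨rfl, lt_of_le_of_ne (by omega) ?_⟩
            rintro rfl; exact hc rfl
      simp only [wp_seq, wp_asg, wp_sto, wp_ite, wp_skip, Ex.ok_A, Ex.ok_V, Ex.ok_C, Ex.eval_A,
        Ex.ok_add, Ex.ok_lt, Ex.ok_mul, Ex.eval_lt, Ex.eval_mul, Ex.eval_V, Ex.eval_C, St.set_var,
        St.set_arr, Ex.eval_add, h0, h4, h5', h8, h9, h10, h13, zero_lt_ite_one, St.put_arr]
      norm_num
      constructorm* _ ∧ _
      any_goals omega
      · intro hlt
        have hbag := hm.bag (top u) hlt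
        obtain ⟨y, hy⟩ : ∃ y, y = (T.bag (top u))[m] := ⟨_, rfl⟩
        rw [← hy] at hbag
        have hry := hv.rank y
        rw [if_pos (hmem y)] at hry
        have hyn := y.isLt
        have hnb : L.nb u m = if l.idxOf y ≤ l.idxOf u then some y else none := by
          change ((T.bag (top u))[m]?.filter fun y => l.idxOf y ≤ l.idxOf u) = _
          rw [List.getElem?_eq_getElem hlt, ← hy, Option.filter_some]
          simp
        rw [hbag, hry]
        constructorm* _ ∧ _
        any_goals omega
        · intro hlt2
          constructorm* _ ∧ _
          any_goals omega
          refine key 0 (fun _ => rfl) fun y' hy' => ?_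
          rw [hnb, if_neg (by omega)] at hy'; simp at hy'
        · intro hge
          constructorm* _ ∧ _
          any_goals omega
          rw [if_pos (by omega)] at hnb
          refine key ((y : ℕ) + 1) (fun h => ?_) fun y' hy' => ?_
          · rw [hnb] at h; simp at h
          · rw [hnb] at hy'; simp at hy'; rw [hy']
      · intro hge
        have hnb : L.nb u m = none := by
          change ((T.bag (top u))[m]?.filter fun y => l.idxOf y ≤ l.idxOf u) = _
          rw [List.getElem?_eq_none hge]; rfl
        constructorm* _ ∧ _
        any_goals omega
        refine key 0 (fun _ => rfl) fun y' hy' => ?_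
        rw [hnb] at hy'; simp at hy'
    · intro τ s2 hf' _ hI' hτ
      refine ⟨?_, fun x j hx hj => ?_⟩
      · simp at hτ ⊢; omega
      · refine hI' x j ?_ hj
        rcases Nat.lt_or_ge (x : ℕ) i with hx' | hx'
        · exact Or.inl hx'
        · exact Or.inr ⟨Fin.ext (by omega), hj⟩
  · intro τ s1 hf _ hI hτ
    refine ⟨?_, L, ?_, ?_, fun u => ?_, fun j hj => ?_, fun u j hj => hI u j u.isLt hj⟩
    · simp at hτ; nlinarith
    · rw [hf.var 2 (by rfl), h2]
    · rw [hf.var 3 (by rfl), h3]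
    · rw [hf.arr 4 (by rfl), hv.rank, if_pos (hmem u)]; rfl
    · rw [hf.arr 5 (by rfl), hv.ord j (by omega)]
      change _ = ((l.getD j ⟨0, hn⟩ : ℕ) : ℤ)
      rw [List.getD_eq_getElem]

/-- Order the nodes and store their slots. -/
def setup (K : ℕ) : Cmd := readBags ;; visitAll ;; mkSlots K

theorem setup_wp {n : ℕ} {T : BagTree n} {G : WGraph n} {Γ : Ctx} (hΓ : Fits Γ T)
    (hT : T.IsTreeDecomposition G) (hinp : Γ.inp = G.encode) (hcard : (G.edges.card : ℤ) ≤ Γ.B)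
    {s : St} (hbuf : ∀ k : ℕ, s.arr 0 k = T.encode.getD k 0) (h12 : s.var 12 = 0)
    (h2 : ∀ k, s.arr 2 k = 0) (h4 : ∀ k, s.arr 4 k = 0) {K : ℕ}
    (hK : ∀ i, (T.bag i).length ≤ K) (hn : 0 < n) (hnK : (n * K : ℤ) ≤ Γ.E) 
    (hKB : (K : ℤ) ≤ Γ.B) :
    (setup K).wp Γ (fun t s' => t ≤ (70 * K + 280) * (T.size + 1) + n * (100 * K + 100) + 100 ∧
      ∃ L : Slots G K, SlotMem L s') s := by
  rw [setup, wp_seq]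
  refine wp_use (readBags_wp hΓ hT hinp hcard hbuf) ?_
  rintro t1 s1 ⟨ht1, hm1, h12', h13, h16⟩ hf1
  rw [wp_seq]
  refine wp_use (visitAll_wp hΓ hT hm1 h16 (by rw [hf1.var 12 (by rfl), h12])
    (by rw [hf1.arr 2 (by rfl)]; exact h2) (by rw [hf1.arr 4 (by rfl)]; exact h4) hK) ?_
  rintro t2 s2 ⟨ht2, l, top, hV, hv⟩ hf2
  refine wp_mono _ (mkSlots_wp hΓ hT (hm1.congr (hf2.arr 0 (by rfl)) (hf2.arr 1 (by rfl))
    (hf2.var 4 (by rfl))) hV hv hK (by rw [hf2.var 2 (by rfl), h12'])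
    (by rw [hf2.var 3 (by rfl), h13]) hn hnK hKB) ?_
  rintro t3 s3 ⟨ht3, hL⟩
  refine ⟨?_, hL⟩
  nlinarith

open Cmd

/-! ## Elimination on the machine -/

/-- The flag `f` and the value `z` represent `w`. -/
def Holds (f z : ℤ) (w : WithTop ℤ) : Prop := f = 0 ∧ w = ⊤ ∨ f = 1 ∧ w = (z : WithTop ℤ)

/-- The flag `z` represents the proposition `p`. -/
def Flag (z : ℤ) (p : Prop) : Prop := z = 1 ∧ p ∨ z = 0 ∧ ¬ p

theorem Flag.pos_iff {z : ℤ} {p : Prop} (h : Flag z p) : 0 < z ↔ p := by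
  rcases h with ⟨rfl, h⟩ | ⟨rfl, h⟩ <;> simp [h]

theorem Flag.congr {z : ℤ} {p q : Prop} (h : Flag z p) (hpq : p ↔ q) : Flag z q := by
  rw [← propext hpq]; exact h

theorem Holds.pos_iff {f z : ℤ} {w : WithTop ℤ} (h : Holds f z w) : 0 < f ↔ w ≠ ⊤ := by
  rcases h with ⟨rfl, rfl⟩ | ⟨rfl, rfl⟩ <;> simp

theorem Holds.eq {f z : ℤ} {w : WithTop ℤ} (h : Holds f z w) (hw : w ≠ ⊤) : w = z := by
  rcases h with ⟨-, h⟩ | ⟨-, h⟩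
  · exact absurd h hw
  · exact h

theorem Holds.min_pos {f z c : ℤ} {w : WithTop ℤ} (h : Holds f z w) (hc : f < 1 ∨ c < z) :
    Holds 1 c (min w c) := by
  refine Or.inr ⟨rfl, ?_⟩
  rcases h with ⟨rfl, rfl⟩ | ⟨rfl, rfl⟩
  · simp
  · have : c ≤ z := by omega
    rw [min_eq_right (by exact_mod_cast this)]

theorem Holds.min_neg {f z c : ℤ} {w : WithTop ℤ} (h : Holds f z w) (hc : ¬ (f < 1 ∨ c < z)) :
    Holds f z (min w c) := by
  rcases h with ⟨rfl, rfl⟩ | ⟨rfl, rfl⟩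
  · exact absurd (Or.inl zero_lt_one) hc
  · have : z ≤ c := by omega
    exact Or.inr ⟨rfl, by rw [min_eq_left (by exact_mod_cast this)]⟩

section Oracle

variable {n : ℕ} {G : WGraph n} {K : ℕ} {Γ : Ctx} {L : Slots G K}

/-- What the machine needs for the elimination. -/
structure Room (Γ : Ctx) (G : WGraph n) (K : ℕ) : Prop where
  inp : Γ.inp = G.encode
  node : (n : ℤ) ≤ Γ.E
  slot : (n * K : ℤ) ≤ Γ.E
  deg : (K : ℤ) ≤ Γ.B
  edge : 4 * (G.edges.card : ℤ) + 10 ≤ Γ.B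
  weight : (G.maxWeight : ℤ) ≤ Γ.B
  bound : Γ.E + 10 ≤ Γ.B

/-- Arrays `f` and `a` hold the flags and the values of `g` for the slots. -/
def SideMem (L : Slots G K) (f a : ℕ) (g : Fin n → Fin n → WithTop ℤ) (s : St) : Prop :=
  ∀ v j y, j < K → L.nb v j = some y →
    Holds (s.arr f ((v : ℕ) * K + j)) (s.arr a ((v : ℕ) * K + j)) (g v y)

theorem SideMem.congr {f a : ℕ} {g g' : Fin n → Fin n → WithTop ℤ} {s s' : St}
    (h : SideMem L f a g s) (hf : s'.arr f = s.arr f) (ha : s'.arr a = s.arr a)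
    (hg : ∀ v j y, L.nb v j = some y → g' v y = g v y) : SideMem L f a g' s' := by
  intro v j y hj hy
  rw [hf, ha, hg v j y hy]
  exact h v j y hj hy

/-- Update the slots of the node in variable `lo` that contain the node in variable `hi` with the
value in variable `32`. -/
def scan (K f a lo hi : ℕ) : Cmd :=
  loopTo 33 (.C K) (
    asg 34 (.V lo * .C K + .V 33) ;;
    ite (.eq (.A 7 (.V 34)) (.V hi + .C 1))
      (ite (.or (.lt (.A f (.V 34)) (.C 1)) (.lt (.V 32) (.A a (.V 34))))
        (sto f (.V 34) (.C 1) ;; sto a (.V 34) (.V 32)) skip)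
      skip)

theorem scan_wp (hR : Room Γ G K) {f a lo hi : ℕ} (hfa : f = 8 ∧ a = 9 ∨ f = 21 ∧ a = 22)
    (hlh : lo = 30 ∧ hi = 31 ∨ lo = 31 ∧ hi = 30) {s : St} (hL : SlotMem L s)
    {g : Fin n → Fin n → WithTop ℤ} (hg : SideMem L f a g s) {v w : Fin n}
    (hlo : s.var lo = (v : ℕ)) (hhi : s.var hi = (w : ℕ)) :
    (scan K f a lo hi).wp Γ (fun t s' => t ≤ 80 * K + 20 ∧
      SideMem L f a (fun u y => if u = v ∧ y = w then min (g v w) (s.var 32 : ℤ) else g u y) s')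
      s := by
  have hone := Γ.one_le
  obtain ⟨-, e1, e2, e3, -, -, e4⟩ := hR
  have hvn := v.isLt
  have hwn := w.isLt
  have hlh' : lo < 100 ∧ hi < 100 ∧ lo ≠ 34 ∧ hi ≠ 34 := by omega
  have hf7 : a < 100 ∧ f < 100 ∧ f ≠ 7 ∧ a ≠ 7 ∧ a ≠ f ∧ f ≠ a := by omega
  have hfr : ∀ s', Fr (scan K f a lo hi) s s' → s'.arr 7 = s.arr 7 ∧ s'.var lo = s.var lo ∧
      s'.var hi = s.var hi ∧ s'.var 32 = s.var 32 := by
    intro s' h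
    rcases hfa with ⟨rfl, rfl⟩ | ⟨rfl, rfl⟩ <;> rcases hlh with ⟨rfl, rfl⟩ | ⟨rfl, rfl⟩ <;>
      exact ⟨h.arr 7 (by rfl), h.var _ (by rfl), h.var _ (by rfl), h.var 32 (by rfl)⟩
  refine wp_loopTo K 60 (fun i s' => ∀ u j y, j < K → L.nb u j = some y →
    Holds (s'.arr f ((u : ℕ) * K + j)) (s'.arr a ((u : ℕ) * K + j))
      (if (u = v ∧ y = w) ∧ j < i then min (g v w) (s.var 32 : ℤ) else g u y)) (by norm_num)
    (by rfl) e3 ?_ ?_ ?_ ?_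
  · intro s' hf
    simp; omega
  · intro u j y hj hy
    simpa using hg u j y hj hy
  · intro i s1 hiK hf h33 hI
    obtain ⟨h7, hlo1, hhi1, h32⟩ := hfr s1 hf
    rw [hlo] at hlo1
    rw [hhi] at hhi1
    have hsl := slot_lt hvn hiK
    have hsl0 : (0 : ℤ) ≤ (v : ℕ) * K := by positivity
    have hnb := hL.nb v i hiK
    have hval := slotVal_nonneg (L.nb v i)
    simp only [wp_seq, wp_asg, wp_sto, wp_ite, wp_skip, Ex.ok_A, Ex.ok_V, Ex.ok_C, Ex.eval_A,
      Ex.ok_add, Ex.ok_lt, Ex.ok_eq, Ex.ok_or, Ex.ok_mul, Ex.eval_lt, Ex.eval_eq, Ex.eval_or,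
      Ex.eval_mul, Ex.eval_V, Ex.eval_C, St.set_var, St.set_arr, Ex.eval_add, h7, hlo1, hhi1, h33,
      zero_lt_ite_one, St.put_arr, St.put_var, hnb, h32]
    norm_num [hf7, hlh', hhi1, hlo1]
    -- At most the cell of slot `i` of `v` is written; by `slot_inj` no other slot uses that cell.
    have key : ∀ F D : ℤ → ℤ, (∀ x : ℤ, x ≠ (v : ℕ) * K + i → F x = s1.arr f x) →
        (∀ x : ℤ, x ≠ (v : ℕ) * K + i → D x = s1.arr a x) →
        (∀ y, L.nb v i = some y → Holds (F ((v : ℕ) * K + i)) (D ((v : ℕ) * K + i))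
          (if y = w then min (g v w) (s.var 32 : ℤ) else g v y)) →
        ∀ u j y, j < K → L.nb u j = some y →
          Holds (F ((u : ℕ) * K + j)) (D ((u : ℕ) * K + j))
            (if (u = v ∧ y = w) ∧ j ≤ i then min (g v w) (s.var 32 : ℤ) else g u y) := by
      intro F D hF hD hc u j y hj hy
      by_cases hcell : ((u : ℕ) * K + j : ℤ) = (v : ℕ) * K + i
      · obtain ⟨h1, rfl⟩ := slot_inj hj hiK hcell
        obtain rfl := Fin.ext h1
        simpa using hc y hy
      · rw [hF _ hcell, hD _ hcell]
        have hne : u = v → j ≠ i := by rintro rfl rfl; exact hcell rfl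
        convert hI u j y hj hy using 2
        refine and_congr_right fun h => ?_
        have := hne h.1
        omega
    have hold : ∀ y, L.nb v i = some y → Holds (s1.arr f ((v : ℕ) * K + i))
        (s1.arr a ((v : ℕ) * K + i)) (g v y) := fun y hy => by simpa using hI v i y hiK hy
    rw [hnb, slotVal_eq]
    constructorm* _ ∧ _
    any_goals omega
    · intro hw
      have hw' := hold w hw
      constructorm* _ ∧ _
      any_goals omega
      · intro hc
        constructorm* _ ∧ _
        any_goals omega
        refine key (fun x => if x = (v : ℕ) * K + i then 1 else s1.arr f x)
          (fun x => if x = (v : ℕ) * K + i then s.var 32 else s1.arr a x)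
          (fun x hx => if_neg hx) (fun x hx => if_neg hx) fun y hy => ?_
        obtain rfl : w = y := by rw [hw] at hy; exact Option.some.inj hy
        simpa using hw'.min_pos hc
      · intro h1 h2
        refine key _ _ (fun _ _ => rfl) (fun _ _ => rfl) fun y hy => ?_
        obtain rfl : w = y := by rw [hw] at hy; exact Option.some.inj hy
        simpa using hw'.min_neg (by omega)
    · intro hw
      refine key _ _ (fun _ _ => rfl) (fun _ _ => rfl) fun y hy => ?_
      rw [if_neg (by rintro rfl; exact hw hy)]
      exact hold y hy
  · intro τ s1 hf _ hI hτ
    refine ⟨?_, fun u j y hj hy => ?_⟩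
    · simp at hτ; omega
    · have := hI u j y hj hy
      simpa [hj] using this

/-- The slots hold the distances `d`. -/
def Tab (L : Slots G K) (d : Fin n → Fin n → WithTop ℤ) (s : St) : Prop :=
  -- A pair is kept at its endpoint of larger rank: distances from that node in arrays `8`, `9`,
  -- distances to it in arrays `21`, `22`. The diagonal is kept in the former only.
  SideMem L 8 9 d s ∧ SideMem L 21 22 (fun v y => if y = v then ⊤ else d y v) s

theorem Tab.congr {d : Fin n → Fin n → WithTop ℤ} {s s' : St} (h : Tab L d s)
    (h8 : s'.arr 8 = s.arr 8) (h9 : s'.arr 9 = s.arr 9) (h21 : s'.arr 21 = s.arr 21)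
    (h22 : s'.arr 22 = s.arr 22) : Tab L d s' :=
  ⟨h.1.congr h8 h9 fun _ _ _ _ => rfl, h.2.congr h21 h22 fun _ _ _ _ => rfl⟩

/-- Update the distance from the node in variable `30` to the node in variable `31` with the value
in variable `32`. -/
def relax (K : ℕ) : Cmd :=
  ite (.lt (.A 4 (.V 30)) (.A 4 (.V 31))) (scan K 21 22 31 30) (scan K 8 9 30 31)

/-- Comparing the ranks selects the table that holds the pair; the other table has no entry for it.
-/
theorem relax_wp (hR : Room Γ G K) {s : St} (hL : SlotMem L s) {d : Fin n → Fin n → WithTop ℤ}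
    (hd : Tab L d s) {x y : Fin n} (hx : s.var 30 = (x : ℕ)) (hy : s.var 31 = (y : ℕ)) :
    (relax K).wp Γ (fun t s' => t ≤ 80 * K + 40 ∧
      Tab L (fun a b => if a = x ∧ b = y then min (d x y) (s.var 32 : ℤ) else d a b) s') s := by
  have e1 := hR.node
  have hxn := x.isLt
  have hyn := y.isLt
  rw [relax, wp_ite]
  simp only [Ex.ok_lt, Ex.ok_A, Ex.ok_V, Ex.eval_lt, Ex.eval_A, Ex.eval_V, hx, hy, hL.rank,
    zero_lt_ite_one, Ex.cost_lt, Ex.cost_A, Ex.cost_V]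
  norm_num
  constructorm* _ ∧ _
  any_goals omega
  · intro hlt
    refine wp_use (scan_wp hR (Or.inr ⟨rfl, rfl⟩) (Or.inr ⟨rfl, rfl⟩) hL hd.2 hy hx) ?_
    rintro t s' ⟨ht, hs⟩ hf
    have hxy : x ≠ y := by rintro rfl; omega
    refine ⟨by omega, hd.1.congr (hf.arr 8 (by rfl)) (hf.arr 9 (by rfl)) fun v j w hw => ?_,
      hs.congr rfl rfl fun v j w hw => ?_⟩
    · rw [if_neg]
      rintro ⟨rfl, rfl⟩
      have := L.nb_rk _ _ _ hw
      omega
    · by_cases h : v = y ∧ w = x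
      · obtain ⟨rfl, rfl⟩ := h
        simp [hxy]
      · have h' : ¬ (w = x ∧ v = y) := fun h' => h h'.symm
        simp only [h, h', if_false]
  · intro hge
    refine wp_use (scan_wp hR (Or.inl ⟨rfl, rfl⟩) (Or.inl ⟨rfl, rfl⟩) hL hd.1 hx hy) ?_
    rintro t s' ⟨ht, hs⟩ hf
    refine ⟨by omega, hs, hd.2.congr (hf.arr 21 (by rfl)) (hf.arr 22 (by rfl)) fun v j w hw => ?_⟩
    by_cases h1 : w = v
    · simp only [h1, if_true]
    · have h2 : ¬ (w = x ∧ v = y) := by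
        rintro ⟨rfl, rfl⟩
        have := L.nb_rk _ _ _ hw
        exact h1 (L.rk_inj (by omega))
      simp only [h1, h2, if_false]

/-- Clear the slots and the marks of the nodes. -/
def clearAll (K : ℕ) : Cmd :=
  loopTo 35 (.V 2 * .C K) (sto 8 (.V 35) (.C 0) ;; sto 21 (.V 35) (.C 0)) ;;
  loopTo 35 (.V 2) (sto 10 (.V 35) (.C 0))

theorem clearAll_wp (hR : Room Γ G K) {s : St} (hL : SlotMem L s) :
    (clearAll K).wp Γ (fun t s' => t ≤ n * K * 30 + n * 20 + 30 ∧ Tab L (fun _ _ => ⊤) s' ∧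
      ∀ u : Fin n, s'.arr 10 (u : ℕ) = 0) s := by
  have hone := Γ.one_le
  obtain ⟨-, e1, e2, e3, -, -, e4⟩ := hR
  have h2 := hL.nodes
  rw [clearAll, wp_seq]
  refine wp_loopTo (n * K) 8 (fun i s' => ∀ j < i, s'.arr 8 (j : ℕ) = 0 ∧ s'.arr 21 (j : ℕ) = 0)
    (by norm_num) (by rfl) (by push_cast; omega) ?_ (by simp) ?_ ?_
  · intro s' hf
    have := hf.var 2 (by rfl)
    have h0 : (0 : ℤ) ≤ n * K := by positivity
    simp [this, h2]
    omega
  · intro i s1 hi hf h35 hI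
    have hi' : (i : ℤ) < n * K := by exact_mod_cast hi
    simp [h35]
    constructorm* _ ∧ _
    any_goals omega
    intro j hj
    exact ⟨fun h => (hI j (by omega)).1, fun h => (hI j (by omega)).2⟩
  · intro τ s1 hf _ hI hτ
    refine wp_loopTo n 5 (fun i s' => ∀ j < i, s'.arr 10 (j : ℕ) = 0)
      (by norm_num) (by rfl) (by omega) ?_ (by simp) ?_ ?_
    · intro s' hf'
      have := hf.var 2 (by rfl)
      have := hf'.var 2 (by rfl)
      simp_all
    · intro i s2 hi hf' h35 hI'
      simp [h35]
      constructorm* _ ∧ _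
      any_goals omega
      intro j hj
      exact fun h => hI' j (by omega)
    · intro τ' s2 hf' _ hI' hτ'
      have key : ∀ (v : Fin n) (j : ℕ), j < K → s2.arr 8 ((v : ℕ) * K + j) = 0 ∧
          s2.arr 21 ((v : ℕ) * K + j) = 0 := by
        intro v j hj
        have := slot_lt v.isLt hj
        rw [hf'.arr 8 (by rfl), hf'.arr 21 (by rfl)]
        exact_mod_cast hI (v * K + j) (by exact_mod_cast this)
      refine ⟨?_, ⟨fun v j y hj _ => Or.inl ⟨(key v j hj).1, rfl⟩, fun v j y hj _ =>
        Or.inl ⟨(key v j hj).2, by simp⟩⟩, fun u => hI' u u.isLt⟩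
      simp at hτ hτ'
      nlinarith

end Oracle

open Cmd

/-! ### The edges in the input. -/

namespace WGraph

variable {n : ℕ} (G : WGraph n)

theorem mem_edgeList {e : Fin n × Fin n} : e ∈ G.edgeList ↔ e ∈ G.edges := by
  obtain ⟨x, y⟩ := e
  simp [edgeList, List.pair_mem_product]

theorem edgeList_length : G.edgeList.length = G.edges.card := by
  have hnd : G.edgeList.Nodup :=
    ((List.nodup_finRange n).product (List.nodup_finRange n)).filter _
  rw [← List.toFinset_card_of_nodup hnd]
  congr 1
  ext e
  simp [mem_edgeList]

theorem encode_edge {e : ℕ} (he : e < G.edgeList.length) :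
    inAt G.encode (4 * e + 2) = (G.edgeList[e].1 : ℕ) ∧
    inAt G.encode (4 * e + 2 + 1) = (G.edgeList[e].2 : ℕ) ∧
    inAt G.encode (4 * e + 2 + 2) = G.wt G.edgeList[e] ∧
    inAt G.encode (4 * e + 2 + 3) = (G.wt' G.edgeList[e] : ℕ) ∧
    4 * e + 2 + 3 < G.encode.length := by
  set f : Fin n × Fin n → List ℤ := fun e =>
    [(e.1.val : ℤ), (e.2.val : ℤ), G.wt e, ((G.wt' e : ℕ) : ℤ)] with hf
  have hpos : ∀ i ≤ G.edgeList.length, blockPos f G.edgeList i = 4 * i := by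
    intro i
    induction i with
    | zero => simp
    | succ i ih =>
      intro hi
      rw [blockPos_succ _ _ (by omega), ih (by omega)]
      simp [hf]; omega
  have key : ∀ j : ℕ, j < 4 → inAt G.encode (4 * e + 2 + j) = (f G.edgeList[e]).getD j 0 := by
    intro j hj
    have h1 := getD_flatMap f G.edgeList he (j := j) hj 0
    rw [hpos e he.le] at h1
    rw [List.getD_eq_getElem _ _ hj, ← h1, inAt, show (4 * e + 2 + j : ℤ).toNat = 4 * e + j + 1 + 1 by omega]
    rfl
  have hle := blockPos_le f G.edgeList he
  rw [hpos e he.le] at hle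
  refine ⟨?_, ?_, ?_, ?_, ?_⟩
  · have := key 0 (by norm_num)
    rwa [Nat.cast_zero, add_zero] at this
  · exact key 1 (by norm_num)
  · exact key 2 (by norm_num)
  · exact key 3 (by norm_num)
  · have h4 : (f G.edgeList[e]).length = 4 := rfl
    have : G.encode.length = (G.edgeList.flatMap f).length + 2 := rfl
    omega

end WGraph

section Oracle

variable {n : ℕ} {G : WGraph n} {K : ℕ} {Γ : Ctx} {L : Slots G K}

/-- The thresholds are in arrays `19` and `20`. -/
def ThMem (th : Fin n → ℤ × ℤ) (s : St) : Prop :=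
  ∀ u : Fin n, s.arr 19 (u : ℕ) = (th u).1 ∧ s.arr 20 (u : ℕ) = (th u).2

/-- Bounds for the weights with respect to the thresholds. -/
structure ThBound (Γ : Ctx) (G : WGraph n) (th : Fin n → ℤ × ℤ) (M : ℤ) : Prop where
  nonneg : 0 ≤ M
  left : ∀ u, ∀ e ∈ G.edges, |(th u).2 * G.wt e| ≤ M
  right : ∀ u, ∀ e ∈ G.edges, |(th u).1 * (G.wt' e : ℕ)| ≤ M
  -- Edges weigh at most `2 * M`, distances at most `(n + 1) * (2 * M)`, and a relaxation adds two
  -- of them.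
  bound : 4 * ((n : ℤ) + 1) * M + 10 ≤ Γ.B

/-- Enter the edges between nodes with equal thresholds. -/
def enterEdges (K : ℕ) : Cmd :=
  loopTo 35 (.V 3) (
    asg 36 (.C 4 * .V 35 + .C 2) ;; asg 30 (.R (.V 36)) ;; asg 31 (.R (.V 36 + .C 1)) ;;
    ite (.and (.eq (.A 19 (.V 30)) (.A 19 (.V 31))) (.eq (.A 20 (.V 30)) (.A 20 (.V 31))))
      (asg 32 (.A 20 (.V 30) * .R (.V 36 + .C 2) - .A 19 (.V 30) * .R (.V 36 + .C 3)) ;; relax K)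
      skip)

-- Entering an edge is a relaxation from `⊤`. Edges between different thresholds have weight `⊤` in
-- `cw` and are skipped.
open Classical in
theorem enterEdges_wp (hR : Room Γ G K) {th : Fin n → ℤ × ℤ} {M : ℤ} (hM : ThBound Γ G th M)
    {s : St} (hL : SlotMem L s) (hth : ThMem th s) (hd : Tab L (fun _ _ => ⊤) s) :
    (enterEdges K).wp Γ (fun t s' => t ≤ G.edges.card * (80 * K + 150) + 30 ∧ Tab L (G.cw th) s')
      s := by
  have hone := Γ.one_le
  have hR' := hR
  obtain ⟨hinp, e1, e2, e3, e5, e6, e4⟩ := hR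
  refine wp_loopTo G.edges.card (80 * K + 130) (fun i s' => Tab L
    (fun x y => if (x, y) ∈ G.edgeList.take i then G.cw th x y else ⊤) s')
    (by norm_num) (by rfl) (by omega) ?_ ?_ ?_ ?_
  · intro s' hf
    have := hf.var 3 (by rfl)
    simp [this, hL.edges]
  · simpa using hd.congr (s' := s.set 35 0) rfl rfl rfl rfl
  · intro i s1 hi hf h35 hI
    rw [← G.edgeList_length] at hi
    have hlen := G.edgeList_length
    obtain ⟨w1, w2, w3, w4, w5⟩ := G.encode_edge hi
    have hmem := (G.mem_edgeList).1 (List.getElem_mem hi)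
    have htake : G.edgeList.take (i + 1) = G.edgeList.take i ++ [G.edgeList[i]] :=
      List.take_succ_eq_append_getElem hi
    obtain ⟨x, y, hxy⟩ : ∃ x y, G.edgeList[i] = (x, y) := ⟨_, _, rfl⟩
    rw [hxy] at w1 w2 w3 w4 hmem htake
    have hxn := x.isLt
    have hyn := y.isLt
    have hwt := WGraph.weight_le hmem
    rw [abs_le] at hwt
    have hth1 : ThMem th s1 := by
      intro u; rw [hf.arr 19 (by rfl), hf.arr 20 (by rfl)]; exact hth u
    have t1 := hth1 x
    have t2 := hth1 y
    have b1 := hM.left x _ hmem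
    have b2 := hM.right x _ hmem
    have b3 := hM.bound
    have b0 := hM.nonneg
    rw [abs_le] at b1 b2
    have b4 : 4 * M ≤ 4 * ((n : ℤ) + 1) * M := by nlinarith
    rw [← hinp] at w1 w2 w3 w4 w5
    have hLs := hL.congr (hf.var 2 (by rfl)) (hf.var 3 (by rfl)) (hf.arr 4 (by rfl))
      (hf.arr 5 (by rfl)) (hf.arr 7 (by rfl))
    simp only [wp_seq, wp_asg, wp_ite, wp_skip, Ex.ok_A, Ex.ok_V, Ex.ok_C, Ex.eval_A, Ex.ok_R,
      Ex.ok_add, Ex.ok_sub, Ex.ok_eq, Ex.ok_and, Ex.ok_mul, Ex.eval_eq, Ex.eval_and, Ex.eval_sub,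
      Ex.eval_R, Ctx.bd, Ex.eval_mul, Ex.eval_V, Ex.eval_C, St.set_var, St.set_arr, Ex.eval_add,
      h35, zero_lt_ite_one]
    norm_num
    simp only [w1, w2, w3, w4, t1, t2]
    constructorm* _ ∧ _
    any_goals omega
    · intro h1 h2
      constructorm* _ ∧ _
      any_goals omega
      refine wp_mono _ (relax_wp hR' (hLs.congr (by simp) (by simp) (by rfl) (by rfl) (by rfl))
        (hI.congr (by rfl) (by rfl) (by rfl) (by rfl)) (x := x) (y := y) (by simp) (by simp)) ?_
      rintro t s2 ⟨ht, hs2⟩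
      refine ⟨by omega, ?_⟩
      have hcw : G.cw th x y =
          (((th x).2 * G.wt (x, y) - (th x).1 * (G.wt' (x, y) : ℕ) : ℤ) : WithTop ℤ) :=
        WGraph.cw_eq.2 ⟨hmem, Prod.ext h1 h2, rfl⟩
      have : (fun a b => if (a, b) ∈ G.edgeList.take (i + 1) then G.cw th a b else ⊤) =
          fun a b => if a = x ∧ b = y then min (if (x, y) ∈ G.edgeList.take i then G.cw th x y
            else ⊤) (G.cw th x y) else if (a, b) ∈ G.edgeList.take i then G.cw th a b else ⊤ := by
        funext a b
        rw [htake]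
        by_cases hab : a = x ∧ b = y
        · obtain ⟨rfl, rfl⟩ := hab
          by_cases h : (a, b) ∈ G.edgeList.take i <;> simp [h]
        · simp [hab]
      rw [this, hcw]
      simp only [St.set_var, if_true] at hs2
      rw [hcw] at hs2
      exact hs2.congr rfl rfl rfl rfl
    · intro h
      have hcw : G.cw th x y = ⊤ := by
        by_contra hne
        have := (WGraph.cw_ne_top.1 hne).2
        exact h (by rw [this]) (by rw [this])
      have : (fun a b => if (a, b) ∈ G.edgeList.take (i + 1) then G.cw th a b else ⊤) =
          fun a b => if (a, b) ∈ G.edgeList.take i then G.cw th a b else ⊤ := by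
        funext a b
        rw [htake]
        by_cases hab : a = x ∧ b = y
        · obtain ⟨rfl, rfl⟩ := hab
          simp [hcw]
        · simp [hab]
      rw [this]
      exact hI.congr rfl rfl rfl rfl
  · intro τ s1 hf _ hI hτ
    refine ⟨by simp at hτ; nlinarith, ?_⟩
    rw [← G.edgeList_length, List.take_length] at hI
    convert hI using 4 with x y
    split_ifs with h
    · rfl
    · by_contra hne
      exact h (G.mem_edgeList.2 (WGraph.cw_ne_top.1 hne).1)

end Oracle

open Cmd

section Oracle

variable {n : ℕ} {G : WGraph n} {K : ℕ} {Γ : Ctx} {L : Slots G K}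

/-- Finite distances occur only between nodes that share a slot. -/
def Supp (L : Slots G K) (d : Fin n → Fin n → WithTop ℤ) : Prop :=
  ∀ x y, d x y ≠ ⊤ → (L.rk y ≤ L.rk x → ∃ k < K, L.nb x k = some y) ∧
    (L.rk x ≤ L.rk y → ∃ k < K, L.nb y k = some x)

theorem supp_cw (th : Fin n → ℤ × ℤ) : Supp L (G.cw th) := by
  intro x y h
  have hadj := (WGraph.cw_ne_top.1 h).1
  exact ⟨L.nb_adj x y (Or.inl hadj), L.nb_adj y x (Or.inr hadj)⟩

/-- A new finite entry joins two neighbours of `v`, for which `nb_trans` provides the slots. -/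
theorem Supp.elim {E : EL n} (h : Supp L E.d) (θ : ℤ) (v : Fin n) :
    Supp L (E.elim L.rk θ v).d := by
  intro x y hxy
  by_cases hd : E.d x y = ⊤
  · simp only [EL.elim] at hxy
    split_ifs at hxy with hc
    · rw [hd, min_eq_right le_top, ne_eq, WithTop.add_eq_top, not_or] at hxy
      obtain ⟨i, hi, hi'⟩ := (h x v hxy.1).2 hc.2.1.le
      obtain ⟨j, hj, hj'⟩ := (h v y hxy.2).1 hc.2.2.le
      exact ⟨L.nb_trans v i j x y hi' hj', L.nb_trans v j i y x hj' hi'⟩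
    · exact absurd hd hxy
  · exact h x y hd

/-- The marks in array `10`. -/
def BadMem (b : Fin n → Prop) (s : St) : Prop := ∀ u : Fin n, Flag (s.arr 10 (u : ℕ)) (b u)

/-- Decide into variable `38` whether the node in variable `37` is bad. -/
def checkAt (K : ℕ) : Cmd :=
  asg 38 (.A 10 (.V 37)) ;;
  loopTo 36 (.C K) (
    asg 39 (.V 37 * .C K + .V 36) ;;
    ite (.and (.eq (.A 7 (.V 39)) (.V 37 + .C 1))
      (.and (.A 8 (.V 39)) (.lt (.A 9 (.V 39)) (.V 40)))) (asg 38 (.C 1)) skip)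

theorem checkAt_wp (hR : Room Γ G K) {s : St} (hL : SlotMem L s) {E : EL n} (hd : Tab L E.d s)
    (hb : BadMem E.bad s) {v : Fin n} (h37 : s.var 37 = (v : ℕ)) :
    (checkAt K).wp Γ (fun t s' => t ≤ 70 * K + 20 ∧ Flag (s'.var 38) (E.at (s.var 40) v)) s := by
  have hone := Γ.one_le
  obtain ⟨hinp, e1, e2, e3, e5, e6, e4⟩ := hR
  have hvn := v.isLt
  rw [checkAt, wp_seq, wp_asg]
  refine ⟨by norm_num, by simp [h37]; omega, ?_⟩
  refine wp_loopTo K 50 (fun i s' => Flag (s'.var 38) (E.bad v ∨ ∃ j < i, L.nb v j = some v ∧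
    E.d v v < s.var 40)) (by norm_num) (by rfl) e3 ?_ ?_ ?_ ?_
  · intro s' hf
    simp; omega
  · simpa [h37] using hb v
  · intro i s1 hi hf h36 hI
    have h7 := hf.arr 7 (by rfl)
    have h8 := hf.arr 8 (by rfl)
    have h9 := hf.arr 9 (by rfl)
    have h37' := hf.var 37 (by rfl)
    have h40 := hf.var 40 (by rfl)
    simp only [St.set_arr] at h7 h8 h9
    simp [h37] at h37' h40
    have hsl := slot_lt hvn hi
    have hsl0 : (0 : ℤ) ≤ (v : ℕ) * K := by positivity
    have hnb := hL.nb v i hi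
    simp only [wp_seq, wp_asg, wp_ite, wp_skip, Ex.ok_A, Ex.ok_V, Ex.ok_C, Ex.eval_A,
      Ex.ok_add, Ex.ok_lt, Ex.ok_eq, Ex.ok_and, Ex.ok_mul, Ex.eval_lt, Ex.eval_eq, Ex.eval_and,
      Ex.eval_mul, Ex.eval_V, Ex.eval_C, St.set_var, St.set_arr, Ex.eval_add, h7, h8, h9, h36, h37',
      h40, zero_lt_ite_one]
    norm_num
    rw [hnb, slotVal_eq]
    have hex : ∀ p : Prop, (L.nb v i = some v → (p ↔ E.d v v < s.var 40)) →
        ((E.bad v ∨ ∃ j ≤ i, L.nb v j = some v ∧ E.d v v < s.var 40) ↔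
        (E.bad v ∨ ∃ j < i, L.nb v j = some v ∧ E.d v v < s.var 40) ∨
          L.nb v i = some v ∧ p) := by
      intro p hp
      constructor
      · rintro (h | ⟨j, hj, h1, h2⟩)
        · exact Or.inl (Or.inl h)
        · rcases Nat.lt_or_eq_of_le hj with hj | rfl
          · exact Or.inl (Or.inr ⟨j, hj, h1, h2⟩)
          · exact Or.inr ⟨h1, (hp h1).2 h2⟩
      · rintro ((h | ⟨j, hj, h1, h2⟩) | ⟨h1, h2⟩)
        · exact Or.inl h
        · exact Or.inr ⟨j, hj.le, h1, h2⟩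
        · exact Or.inr ⟨i, le_rfl, h1, (hp h1).1 h2⟩
    have hval : L.nb v i = some v → ((0 < s.arr 8 ((v : ℕ) * K + i) ∧
        s.arr 9 ((v : ℕ) * K + i) < s.var 40) ↔ E.d v v < s.var 40) := by
      intro h
      rcases hd.1 v i v hi h with ⟨h1, h2⟩ | ⟨h1, h2⟩
      · rw [h1, h2]; simp
      · rw [h1, h2]; simp
    have hex := hex _ hval
    constructorm* _ ∧ _
    any_goals omega
    · intro h1 h2 h3
      exact ⟨by omega, Or.inl ⟨rfl, hex.2 (Or.inr ⟨h1, h2, h3⟩)⟩⟩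
    · intro h
      refine hI.congr ?_
      rw [hex]
      refine ⟨Or.inl, fun h' => h'.resolve_right ?_⟩
      rintro ⟨h1, h2, h3⟩
      have := h h1 h2
      omega
  · intro τ s1 hf _ hI hτ
    refine ⟨by simp at hτ ⊢; omega, hI.congr (or_congr_right (Iff.intro ?_ ?_))⟩
    · rintro ⟨_, _, _, h⟩; exact h
    · intro h
      -- The diagonal entry is stored in the slot that `v` has for itself.
      obtain ⟨j, hj, hj'⟩ := L.nb_self v
      exact ⟨j, hj, hj', h⟩

/-- Mark the nodes of lower rank from which the node in variable `37` is reachable. -/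
def markPreds (K : ℕ) : Cmd :=
  sto 10 (.V 37) (.C 1) ;;
  loopTo 36 (.C K) (
    asg 39 (.V 37 * .C K + .V 36) ;;
    ite (.A 7 (.V 39)) (ite (.A 21 (.V 39)) (sto 10 (.A 7 (.V 39) - .C 1) (.C 1)) skip) skip)

/-- By `Supp`, every lower node with a finite distance to `v` occupies a slot of `v`, so scanning
those slots finds all predecessors to be marked. -/
theorem markPreds_wp (hR : Room Γ G K) {s : St} (hL : SlotMem L s) {E : EL n} (hd : Tab L E.d s)
    (hb : BadMem E.bad s) (hsupp : Supp L E.d) {v : Fin n} (h37 : s.var 37 = (v : ℕ)) {θ : ℤ}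
    (hat : E.at θ v) :
    (markPreds K).wp Γ (fun t s' => t ≤ 60 * K + 20 ∧ BadMem (E.elim L.rk θ v).bad s') s := by
  have hone := Γ.one_le
  obtain ⟨hinp, e1, e2, e3, e5, e6, e4⟩ := hR
  have hvn := v.isLt
  rw [markPreds, wp_seq, wp_sto]
  refine ⟨by norm_num, by simp, by simp; omega, by simp [h37], by simp [h37]; omega, ?_⟩
  refine wp_loopTo K 40 (fun i s' => BadMem (fun x => E.bad x ∨ x = v ∨ ∃ j < i,
    L.nb v j = some x ∧ x ≠ v ∧ E.d x v ≠ ⊤) s') (by norm_num) (by rfl) e3 ?_ ?_ ?_ ?_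
  · intro s' hf
    simp; omega
  · intro u
    have := hb u
    by_cases huv : u = v
    · subst huv
      simp [h37]
      exact Or.inl ⟨rfl, by simp⟩
    · have h' : (u : ℕ) ≠ v := fun h => huv (Fin.ext h)
      simpa [h37, huv, h'] using this
  · intro i s1 hi hf h36 hI
    have h7 := hf.arr 7 (by rfl)
    have h21 := hf.arr 21 (by rfl)
    have h37' := hf.var 37 (by rfl)
    simp at h7 h21
    simp [h37] at h37'
    have hsl := slot_lt hvn hi
    have hsl0 : (0 : ℤ) ≤ (v : ℕ) * K := by positivity
    have hnb := hL.nb v i hi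
    have hval := slotVal_nonneg (L.nb v i)
    simp only [wp_seq, wp_asg, wp_ite, wp_sto, wp_skip, Ex.ok_A, Ex.ok_V, Ex.ok_C, Ex.eval_A,
      Ex.ok_add, Ex.ok_sub, Ex.eval_sub, Ex.ok_mul, 
      Ex.eval_mul, Ex.eval_V, Ex.eval_C, St.set_var, St.set_arr, Ex.eval_add, h7, h21, h36, h37']
    norm_num
    rw [hnb]
    have hother : (∀ x, L.nb v i = some x → ¬ (x ≠ v ∧ E.d x v ≠ ⊤)) → BadMem (fun x => E.bad x ∨
        x = v ∨ ∃ j ≤ i, L.nb v j = some x ∧ x ≠ v ∧ E.d x v ≠ ⊤) s1 := by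
      intro h u
      refine (hI u).congr (or_congr_right (or_congr_right ⟨?_, ?_⟩))
      · rintro ⟨j, hj, h1⟩; exact ⟨j, hj.le, h1⟩
      · rintro ⟨j, hj, h1⟩
        rcases Nat.lt_or_eq_of_le hj with hj | rfl
        · exact ⟨j, hj, h1⟩
        · exact absurd h1.2 (h u h1.1)
    constructorm* _ ∧ _
    any_goals omega
    · intro hpos
      obtain ⟨x, hx⟩ : ∃ x, L.nb v i = some x := by
        cases h : L.nb v i with
        | none => rw [h] at hpos; simp at hpos
        | some x => exact ⟨x, rfl⟩
      have hxn := x.isLt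
      have hside := hd.2 v i x hi hx
      rw [hx, slotVal_some]
      have hpi := hside.pos_iff
      constructorm* _ ∧ _
      any_goals omega
      · intro h21
        rw [hpi] at h21
        simp only [ne_eq, ite_eq_left_iff, not_forall] at h21
        obtain ⟨hxv, hne⟩ := h21
        constructorm* _ ∧ _
        any_goals omega
        intro u
        by_cases hux : u = x
        · subst hux
          simp
          exact Or.inl ⟨rfl, Or.inr (Or.inr ⟨i, le_rfl, hx, hxv, hne⟩)⟩
        · have h' : (u : ℕ) ≠ x := fun h => hux (Fin.ext h)
          have := hI u
          simp [h']
          refine this.congr (or_congr_right (or_congr_right ⟨?_, ?_⟩))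
          · rintro ⟨j, hj, h1⟩; exact ⟨j, hj.le, h1⟩
          · rintro ⟨j, hj, h1⟩
            rcases Nat.lt_or_eq_of_le hj with hj | rfl
            · exact ⟨j, hj, h1⟩
            · rw [hx] at h1; exact absurd (Option.some.inj h1.1).symm hux
      · intro h21
        refine hother fun y hy => ?_
        obtain rfl : x = y := by rw [hx] at hy; exact Option.some.inj hy
        rintro ⟨h1, h2⟩
        have : (0 : ℤ) < s.arr 21 ((v : ℕ) * K + i) := by
          rw [hpi]; simpa [h1] using h2
        omega
    · intro hneg
      refine hother fun x hx => ?_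
      rw [hx] at hneg; simp at hneg; omega
  · intro τ s1 hf _ hI hτ
    refine ⟨by simp at hτ ⊢; omega, fun u => (hI u).congr ?_⟩
    simp only [EL.elim, hat, and_true, true_and]
    refine or_congr_right (or_congr_right ⟨?_, ?_⟩)
    · rintro ⟨j, hj, h1, h2, h3⟩
      have := L.nb_rk v j u h1
      have h4 : L.rk u ≠ L.rk v := fun h => h2 (L.rk_inj h)
      exact ⟨by omega, h3⟩
    · rintro ⟨h1, h2⟩
      obtain ⟨j, hj, h3⟩ := (hsupp u v h2).2 h1.le
      exact ⟨j, hj, h3, by rintro rfl; omega, h2⟩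

end Oracle

open Cmd

section Oracle

variable {n : ℕ} {G : WGraph n} {K : ℕ} {Γ : Ctx} {L : Slots G K}

/-- Update the distances between the neighbours of the node in variable `37`. -/
def relaxAll (K : ℕ) : Cmd :=
  loopTo 36 (.C K) (loopTo 41 (.C K) (
    asg 39 (.V 37 * .C K + .V 36) ;; asg 42 (.V 37 * .C K + .V 41) ;;
    asg 30 (.A 7 (.V 39) - .C 1) ;; asg 31 (.A 7 (.V 42) - .C 1) ;;
    ite (.and (.and (.lt (.C 0) (.A 7 (.V 39))) (.lt (.C 0) (.A 7 (.V 42))))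
        -- The second node must differ from `v`; for the first this is automatic, since the incoming
        -- table has no diagonal.
        (.and (.and (.A 21 (.V 39)) (.A 8 (.V 42))) (.or (.lt (.V 31) (.V 37)) (.lt (.V 37) (.V 31)))))
      (asg 32 (.A 22 (.V 39) + .A 9 (.V 42)) ;; relax K)
      skip))

/-- The pairs of neighbours of `v` dealt with in the first `i` rounds and `m` steps of the next
round. -/
def Dealt (L : Slots G K) (v : Fin n) (i m : ℕ) (x y : Fin n) : Prop :=
  (x ≠ v ∧ y ≠ v) ∧ ∃ a b, b < K ∧ (a < i ∨ a = i ∧ b < m) ∧ L.nb v a = some x ∧ L.nb v b = some y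

open Classical in
/-- The distances `d` after relaxing the pairs in `P` over `v`. -/
noncomputable def relaxed (d : Fin n → Fin n → WithTop ℤ) (v : Fin n) (P : Fin n → Fin n → Prop)
    (x y : Fin n) : WithTop ℤ :=
  if P x y then min (d x y) (d x v + d v y) else d x y

theorem relaxed_congr {d : Fin n → Fin n → WithTop ℤ} {v : Fin n} {P P' : Fin n → Fin n → Prop}
    (h : ∀ x y, d x v + d v y ≠ ⊤ → (P x y ↔ P' x y)) : relaxed d v P = relaxed d v P' := by
  funext x y
  by_cases hd : d x v + d v y = ⊤
  · simp [relaxed, hd]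
  · have h' := h x y hd
    by_cases hP : P x y
    · simp [relaxed, hP, h'.1 hP]
    · simp [relaxed, hP, mt h'.2 hP]

theorem dealt_succ {v : Fin n} {i m : ℕ} (hm : m < K) {x y : Fin n} : Dealt L v i (m + 1) x y ↔
    Dealt L v i m x y ∨ (x ≠ v ∧ y ≠ v) ∧ L.nb v i = some x ∧ L.nb v m = some y := by
  constructor
  · rintro ⟨hxy, a, b, hb, hab, h1, h2⟩
    by_cases h : a = i ∧ b = m
    · obtain ⟨rfl, rfl⟩ := h
      exact Or.inr ⟨hxy, h1, h2⟩
    · exact Or.inl ⟨hxy, a, b, hb, by omega, h1, h2⟩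
  · rintro (⟨hxy, a, b, hb, hab, h1, h2⟩ | ⟨hxy, h1, h2⟩)
    · exact ⟨hxy, a, b, hb, by omega, h1, h2⟩
    · exact ⟨hxy, i, m, hm, by omega, h1, h2⟩

/-- Pairs that involve `v` are left out, so the row and column of `v` stay fixed during the
relaxations and the result does not depend on their order. `Supp` ensures that all relevant pairs
occur among the slots. -/
theorem relaxAll_wp (hR : Room Γ G K) {s : St} (hL : SlotMem L s) {E : EL n} (hd : Tab L E.d s)
    (hsupp : Supp L E.d) {v : Fin n} (h37 : s.var 37 = (v : ℕ)) {θ : ℤ} (hat : ¬ E.at θ v)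
    {M : ℤ} (hM : ∀ x y (z : ℤ), E.d x y = z → |z| ≤ M) (hMB : 2 * M ≤ Γ.B) :
    (relaxAll K).wp Γ (fun t s' => t ≤ K * (K * (80 * K + 200) + 30) + 10 ∧
      Tab L (E.elim L.rk θ v).d s') s := by
  have hone := Γ.one_le
  have hR' := hR
  obtain ⟨hinp, e1, e2, e3, e5, e6, e4⟩ := hR
  have hvn := v.isLt
  refine wp_loopTo K (K * (80 * K + 200) + 10) (fun i s' => Tab L (relaxed E.d v (Dealt L v i 0)) s')
    (by norm_num) (by rfl) e3 ?_ ?_ ?_ ?_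
  · intro s' hf
    simp; omega
  · have : relaxed E.d v (Dealt L v 0 0) = E.d := by
      funext x y; simp [relaxed, Dealt]
    rw [this]
    exact hd.congr rfl rfl rfl rfl
  · intro i s1 hi hf h36 hI
    refine wp_loopTo K (80 * K + 180) (fun m s' => Tab L (relaxed E.d v (Dealt L v i m)) s')
      (by norm_num) (by rfl) e3 ?_ (hI.congr (by rfl) (by rfl) (by rfl) (by rfl)) ?_ ?_
    · intro s' hf'
      simp; omega
    · intro m s2 hm hf' h41 hI'
      have h7 := (hf'.arr 7 (by rfl)).trans (hf.arr 7 (by rfl))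
      have h37' := (hf'.var 37 (by rfl)).trans ((hf.var 37 (by rfl)).trans h37)
      have h36' := (hf'.var 36 (by rfl)).trans h36
      have hLs := (hL.congr (hf.var 2 (by rfl)) (hf.var 3 (by rfl)) (hf.arr 4 (by rfl))
        (hf.arr 5 (by rfl)) (hf.arr 7 (by rfl))).congr (hf'.var 2 (by rfl)) (hf'.var 3 (by rfl))
        (hf'.arr 4 (by rfl)) (hf'.arr 5 (by rfl)) (hf'.arr 7 (by rfl))
      have hsl := slot_lt hvn hi
      have hsl' := slot_lt hvn hm
      have hsl0 : (0 : ℤ) ≤ (v : ℕ) * K := by positivity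
      have hnb := hL.nb v i hi
      have hnb' := hL.nb v m hm
      have hval := slotVal_nonneg (L.nb v i)
      have hval' := slotVal_nonneg (L.nb v m)
      simp only [wp_seq, wp_asg, wp_ite, wp_skip, Ex.ok_A, Ex.ok_V, Ex.ok_C, Ex.eval_A,
        Ex.ok_add, Ex.ok_sub, Ex.eval_sub, Ex.ok_mul, Ex.ok_lt, Ex.ok_and, Ex.ok_or, Ex.eval_lt,
        Ex.eval_and, Ex.eval_or, Ex.eval_mul, Ex.eval_V, Ex.eval_C, St.set_var, St.set_arr,
        Ex.eval_add, h7, h36', h37', h41, zero_lt_ite_one]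
      norm_num
      rw [hnb, hnb']
      have key : ∀ x y, L.nb v i = some x → L.nb v m = some y → x ≠ v → y ≠ v →
          (0 < s2.arr 21 ((v : ℕ) * K + i) ↔ E.d x v ≠ ⊤) ∧
          (0 < s2.arr 8 ((v : ℕ) * K + m) ↔ E.d v y ≠ ⊤) ∧
          (E.d x v ≠ ⊤ → E.d x v = s2.arr 22 ((v : ℕ) * K + i)) ∧
          (E.d v y ≠ ⊤ → E.d v y = s2.arr 9 ((v : ℕ) * K + m)) := by
        intro x y hx hy hxv hyv
        have h1 := hI'.2 v i x hi hx
        have h2 := hI'.1 v m y hm hy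
        -- Entries from and to `v` still have their original values.
        have e1 : relaxed E.d v (Dealt L v i m) x v = E.d x v := by simp [relaxed, Dealt]
        have e2 : relaxed E.d v (Dealt L v i m) v y = E.d v y := by simp [relaxed, Dealt]
        simp only [hxv, if_false, e1] at h1
        rw [e2] at h2
        exact ⟨h1.pos_iff, h2.pos_iff, h1.eq, h2.eq⟩
      constructorm* _ ∧ _
      any_goals omega
      · intro p1 p2 p3 p4 p5
        obtain ⟨x, hx⟩ : ∃ x, L.nb v i = some x := by
          cases h : L.nb v i with
          | none => rw [h] at p1; simp at p1
          | some x => exact ⟨x, rfl⟩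
        obtain ⟨y, hy⟩ : ∃ y, L.nb v m = some y := by
          cases h : L.nb v m with
          | none => rw [h] at p2; simp at p2
          | some x => exact ⟨x, rfl⟩
        rw [hy, slotVal_some] at p5
        rw [hx, hy, slotVal_some, slotVal_some]
        have hyv : y ≠ v := by rintro rfl; omega
        have hxv : x ≠ v := by
          rintro rfl
          have := (hI'.2 x i x hi hx).pos_iff
          simp at this
          omega
        obtain ⟨k1, k2, k3, k4⟩ := key x y hx hy hxv hyv
        have k5 := k3 (k1.1 p3)
        have k6 := k4 (k2.1 p4)
        have b1 := abs_le.1 (hM _ _ _ k5)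
        have b2 := abs_le.1 (hM _ _ _ k6)
        have hxn := x.isLt
        have hyn := y.isLt
        constructorm* _ ∧ _
        any_goals omega
        refine wp_mono _ (relax_wp hR' (hLs.congr (by simp) (by simp) (by rfl) (by rfl) (by rfl))
          (hI'.congr (by rfl) (by rfl) (by rfl) (by rfl)) (x := x) (y := y) (by simp) (by simp)) ?_
        rintro t s3 ⟨ht, hs3⟩
        refine ⟨by omega, ?_⟩
        have : relaxed E.d v (Dealt L v i (m + 1)) = fun a b => if a = x ∧ b = y then
            min (relaxed E.d v (Dealt L v i m) x y) (E.d x v + E.d v y)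
            else relaxed E.d v (Dealt L v i m) a b := by
          funext a b
          by_cases hab : a = x ∧ b = y
          · obtain ⟨rfl, rfl⟩ := hab
            have : Dealt L v i (m + 1) a b := (dealt_succ hm).2 (Or.inr ⟨⟨hxv, hyv⟩, hx, hy⟩)
            simp only [relaxed, this, if_true, and_self]
            split_ifs
            -- A pair may come up again through repeated slots; relaxing twice changes nothing.
            · rw [min_assoc, min_self]
            · rfl
          · have : Dealt L v i (m + 1) a b ↔ Dealt L v i m a b := by
              rw [dealt_succ hm]
              refine or_iff_left ?_
              rintro ⟨-, h1, h2⟩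
              rw [hx] at h1; rw [hy] at h2
              exact hab ⟨(Option.some.inj h1).symm, (Option.some.inj h2).symm⟩
            by_cases hD : Dealt L v i m a b
            · simp only [relaxed, this.2 hD, hD, hab, if_false, if_true]
            · simp only [relaxed, mt this.1 hD, hD, hab, if_false]
        rw [this, k5, k6]
        simp only [St.set_var, if_true] at hs3
        exact hs3.congr rfl rfl rfl rfl
      · intro hneg
        have : relaxed E.d v (Dealt L v i (m + 1)) = relaxed E.d v (Dealt L v i m) := by
          refine relaxed_congr fun x y hxy => ?_
          rw [dealt_succ hm]
          refine or_iff_left ?_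
          rintro ⟨⟨hxv, hyv⟩, hx, hy⟩
          rw [ne_eq, WithTop.add_eq_top, not_or] at hxy
          obtain ⟨k1, k2, -, -⟩ := key x y hx hy hxv hyv
          have p3 := k1.2 hxy.1
          have p4 := k2.2 hxy.2
          rw [hx, hy] at hneg
          simp only [slotVal_some] at hneg
          have := hneg (by omega) (by omega) p3 p4
          exact hyv (Fin.ext (by omega))
        rw [this]
        exact hI'.congr rfl rfl rfl rfl
    · intro τ s2 hf' _ hI' hτ
      refine ⟨by simp at hτ ⊢; nlinarith, ?_⟩
      have : Dealt L v (i + 1) 0 = Dealt L v i K := by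
        funext x y
        refine propext (and_congr_right fun _ => exists_congr fun a => exists_congr fun b => ?_)
        constructor
        · rintro ⟨h1, h2, h3⟩; exact ⟨h1, by omega, h3⟩
        · rintro ⟨h1, h2, h3⟩; exact ⟨h1, by omega, h3⟩
      rw [this]
      exact hI'.congr rfl rfl rfl rfl
  · intro τ s1 hf _ hI hτ
    refine ⟨by simp at hτ ⊢; nlinarith, ?_⟩
    have : (E.elim L.rk θ v).d = relaxed E.d v (fun x y => L.rk x < L.rk v ∧ L.rk y < L.rk v) := by
      funext x y
      simp [EL.elim, relaxed, hat]
    rw [this]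
    convert hI using 1
    refine relaxed_congr fun x y hxy => ?_
    rw [ne_eq, WithTop.add_eq_top, not_or] at hxy
    constructor
    · rintro ⟨h1, h2⟩
      obtain ⟨a, ha, ha'⟩ := (hsupp x v hxy.1).2 h1.le
      obtain ⟨b, hb, hb'⟩ := (hsupp v y hxy.2).1 h2.le
      exact ⟨⟨by rintro rfl; omega, by rintro rfl; omega⟩, a, b, hb, Or.inl ha, ha', hb'⟩
    · rintro ⟨⟨h1, h2⟩, a, b, -, -, h3, h4⟩
      have h5 := L.nb_rk _ _ _ h3
      have h6 := L.nb_rk _ _ _ h4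
      have h7 : L.rk x ≠ L.rk v := fun h => h1 (L.rk_inj h)
      have h8 : L.rk y ≠ L.rk v := fun h => h2 (L.rk_inj h)
      omega

/-- Eliminate the node in variable `37`. -/
def elimNode (K : ℕ) : Cmd := checkAt K ;; ite (.V 38) (markPreds K) (relaxAll K)

/-- The state of the elimination. -/
def ElimMem (L : Slots G K) (E : EL n) (s : St) : Prop := Tab L E.d s ∧ BadMem E.bad s

theorem elimNode_wp (hR : Room Γ G K) {s : St} (hL : SlotMem L s) {E : EL n} (hE : ElimMem L E s)
    (hsupp : Supp L E.d) {v : Fin n} (h37 : s.var 37 = (v : ℕ))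
    {M : ℤ} (hM : ∀ x y (z : ℤ), E.d x y = z → |z| ≤ M) (hMB : 2 * M ≤ Γ.B) :
    (elimNode K).wp Γ (fun t s' => t ≤ K * (K * (80 * K + 200) + 160) + 60 ∧
      ElimMem L (E.elim L.rk (s.var 40) v) s') s := by
  have hmul : K * (K * (80 * K + 200) + 160) = K * (K * (80 * K + 200)) + K * 160 :=
    Nat.mul_add _ _ _
  have hmul' : K * (K * (80 * K + 200) + 30) = K * (K * (80 * K + 200)) + K * 30 :=
    Nat.mul_add _ _ _
  rw [elimNode, wp_seq]
  refine wp_use (checkAt_wp hR hL hE.1 hE.2 h37) ?_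
  rintro t s1 ⟨ht, hflag⟩ hf
  have hL1 := hL.congr (hf.var 2 (by rfl)) (hf.var 3 (by rfl)) (hf.arr 4 (by rfl))
    (hf.arr 5 (by rfl)) (hf.arr 7 (by rfl))
  have hd1 := hE.1.congr (hf.arr 8 (by rfl)) (hf.arr 9 (by rfl)) (hf.arr 21 (by rfl))
    (hf.arr 22 (by rfl))
  have hb1 : BadMem E.bad s1 := by intro u; rw [hf.arr 10 (by rfl)]; exact hE.2 u
  have h37' := (hf.var 37 (by rfl)).trans h37
  rw [wp_ite]
  refine ⟨by norm_num, fun hpos => ?_, fun hneg => ?_⟩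
  · rw [Ex.eval_V, hflag.pos_iff] at hpos
    refine wp_use (markPreds_wp hR hL1 hd1 hb1 hsupp h37' hpos) ?_
    rintro t2 s2 ⟨ht2, hb2⟩ hf2
    refine ⟨by simp only [Ex.cost_V]; omega, ?_, hb2⟩
    have : (E.elim L.rk (s.var 40) v).d = E.d := by funext x y; simp [EL.elim, hpos]
    rw [this]
    exact hd1.congr (hf2.arr 8 (by rfl)) (hf2.arr 9 (by rfl)) (hf2.arr 21 (by rfl))
      (hf2.arr 22 (by rfl))
  · rw [Ex.eval_V, hflag.pos_iff] at hneg
    refine wp_use (relaxAll_wp hR hL1 hd1 hsupp h37' hneg hM hMB) ?_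
    rintro t2 s2 ⟨ht2, hd2⟩ hf2
    refine ⟨by simp only [Ex.cost_V]; omega, hd2, ?_⟩
    intro u
    rw [hf2.arr 10 (by rfl)]
    refine (hb1 u).congr ?_
    simp [EL.elim, hneg]

end Oracle

open Cmd

/-! ### The complete oracle. -/

section Oracle

variable {n : ℕ} {G : WGraph n} {K : ℕ} {Γ : Ctx} {L : Slots G K}

theorem ThBound.cw_le {th : Fin n → ℤ × ℤ} {M : ℤ} (hM : ThBound Γ G th M) (x y : Fin n) (z : ℤ)
    (hz : G.cw th x y = z) : |z| ≤ 2 * M := by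
  obtain ⟨h1, h2, rfl⟩ := WGraph.cw_eq.1 hz
  have b1 := hM.left x _ h1
  have b2 := hM.right x _ h1
  have := abs_sub ((th x).2 * G.wt (x, y)) ((th x).1 * (G.wt' (x, y) : ℕ))
  omega

/-- Eliminate all nodes, by decreasing rank. -/
def elimAll (K : ℕ) : Cmd :=
  loopTo 35 (.V 2) (asg 37 (.A 5 (.V 2 - .C 1 - .V 35)) ;; elimNode K)

theorem elimAll_wp (hR : Room Γ G K) {th : Fin n → ℤ × ℤ} {M : ℤ} (hM : ThBound Γ G th M) {s : St}
    (hL : SlotMem L s) (hd : Tab L (G.cw th) s) (hb : ∀ u : Fin n, s.arr 10 (u : ℕ) = 0)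
    (hθ : 0 ≤ s.var 40) :
    (elimAll K).wp Γ (fun t s' => t ≤ n * (K * (K * (80 * K + 200) + 160) + 100) + 20 ∧
      ElimMem L (elims L.rk L.ord (s.var 40) (G.cw th) n) s' ∧
        Supp L (elims L.rk L.ord (s.var 40) (G.cw th) n).d) s := by
  have hone := Γ.one_le
  have hR' := hR
  obtain ⟨hinp, e1, e2, e3, e5, e6, e4⟩ := hR
  refine wp_loopTo n (K * (K * (80 * K + 200) + 160) + 80) (fun i s' =>
    ElimMem L (elims L.rk L.ord (s.var 40) (G.cw th) i) s' ∧
      Supp L (elims L.rk L.ord (s.var 40) (G.cw th) i).d) (by norm_num) (by rfl) (by omega) ?_ ?_ ?_ ?_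
  · intro s' hf
    have := hf.var 2 (by rfl)
    simp [this, hL.nodes]
  · refine ⟨⟨hd.congr rfl rfl rfl rfl, fun u => Or.inr ⟨by simpa using hb u, by simp [elims]⟩⟩,
      supp_cw th⟩
  · rintro i s1 hi hf h35 ⟨hE, hsupp⟩
    have hL1 := hL.congr (hf.var 2 (by rfl)) (hf.var 3 (by rfl)) (hf.arr 4 (by rfl))
      (hf.arr 5 (by rfl)) (hf.arr 7 (by rfl))
    have hidx : (n : ℤ) - 1 - i = ((n - 1 - i : ℕ) : ℤ) := by omega
    have hord := hL1.ord (n - 1 - i) (by omega)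
    have h40 := hf.var 40 (by rfl)
    rw [wp_seq, wp_asg]
    simp only [Ex.ok_A, Ex.ok_sub, Ex.ok_V, Ex.ok_C, Ex.eval_sub, Ex.eval_A, Ex.eval_V, Ex.eval_C,
      hL1.nodes, h35, hidx, hord]
    norm_num
    constructorm* _ ∧ _
    any_goals omega
    -- The bound is uniform in the number of eliminations, so sums of two distances fit at every
    -- stage.
    have hMn := elims_abs_le (ord := L.ord) hθ L.rk_ord L.rk_inj (M := 2 * M)
      (by have := hM.nonneg; omega) hM.cw_le i hi.le
    have hb := hM.bound
    refine wp_mono _ (elimNode_wp hR' (s := s1.set 37 (L.ord (n - 1 - i) : ℕ)) (hL1.congr (by rfl) (by rfl) (by rfl) (by rfl) (by rfl))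
      (E := elims L.rk L.ord (s.var 40) (G.cw th) i)
      ⟨hE.1.congr (by rfl) (by rfl) (by rfl) (by rfl), hE.2⟩ hsupp
      (v := L.ord (n - 1 - i)) (by simp) hMn (by linarith)) ?_
    rintro t s2 ⟨ht, hE2⟩
    simp only [St.set_var, h40] at hE2
    refine ⟨by omega, ⟨hE2.1.congr rfl rfl rfl rfl, hE2.2⟩, hsupp.elim _ _⟩
  · rintro τ s1 hf _ ⟨hE, hsupp⟩ hτ
    refine ⟨?_, hE, hsupp⟩
    simp only [Ex.cost_V] at hτ
    generalize K * (K * (80 * K + 200) + 160) = a at hτ ⊢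
    have : n * (a + 80 + 2 + 12) ≤ n * (a + 100) := Nat.mul_le_mul_left _ (by omega)
    omega

/-- The nodes that are bad after the backward pass. -/
inductive FinalBad (rk : Fin n → ℕ) (E : EL n) : Fin n → Prop
  | bad {v : Fin n} (h : E.bad v) : FinalBad rk E v
  | step {v y : Fin n} (hrk : rk y < rk v) (hd : E.d v y ≠ ⊤) (h : FinalBad rk E y) :
      FinalBad rk E v

/-- Mark the nodes that reach a marked node, and count the marks. -/
def backPass (K : ℕ) : Cmd :=
  loopTo 35 (.V 2) (
    asg 37 (.A 5 (.V 35)) ;;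
    loopTo 36 (.C K) (
      asg 39 (.V 37 * .C K + .V 36) ;;
      ite (.A 7 (.V 39)) (ite (.and (.A 8 (.V 39)) (.A 10 (.A 7 (.V 39) - .C 1)))
        (sto 10 (.V 37) (.C 1)) skip) skip) ;;
    sto 11 (.V 37) (.A 11 (.V 37) + .A 10 (.V 37)))

-- By increasing rank, the marks of all lower nodes are final when `v` is treated. Array `11` is
-- increased rather than overwritten, so two runs of the oracle add up.
open Classical in
theorem backPass_wp (hR : Room Γ G K) {s : St} (hL : SlotMem L s) {E : EL n} (hE : ElimMem L E s)
    (hsupp : Supp L E.d) (h11 : ∀ u : Fin n, |s.arr 11 (u : ℕ)| < Γ.B) :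
    (backPass K).wp Γ (fun t s' => t ≤ n * (60 * K + 60) + 20 ∧ ∀ u : Fin n, s'.arr 11 (u : ℕ) =
      s.arr 11 (u : ℕ) + if FinalBad L.rk E u then 1 else 0) s := by
  have hone := Γ.one_le
  obtain ⟨hinp, e1, e2, e3, e5, e6, e4⟩ := hR
  refine wp_loopTo n (60 * K + 40) (fun i s' => (∀ u : Fin n, Flag (s'.arr 10 (u : ℕ))
    (E.bad u ∨ L.rk u < i ∧ FinalBad L.rk E u)) ∧ ∀ u : Fin n, s'.arr 11 (u : ℕ) =
      s.arr 11 (u : ℕ) + if L.rk u < i ∧ FinalBad L.rk E u then 1 else 0)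
    (by norm_num) (by rfl) (by omega) ?_ ?_ ?_ ?_
  · intro s' hf
    have := hf.var 2 (by rfl)
    simp [this, hL.nodes]
  · exact ⟨fun u => by simpa using hE.2 u, by simp⟩
  · rintro i s1 hi hf h35 ⟨hI, hI11⟩
    have hL1 := hL.congr (hf.var 2 (by rfl)) (hf.var 3 (by rfl)) (hf.arr 4 (by rfl))
      (hf.arr 5 (by rfl)) (hf.arr 7 (by rfl))
    have hord := hL1.ord i hi
    have hrk := L.rk_ord i hi
    obtain ⟨v, hv⟩ : ∃ v, v = L.ord i := ⟨_, rfl⟩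
    rw [← hv] at hord hrk
    have hvn := v.isLt
    have h8' := hf.arr 8 (by rfl)
    have hpre : ∀ u : Fin n, u ≠ v → (L.rk u < i + 1 ↔ L.rk u < i) := by
      intro u hu
      have : L.rk u ≠ L.rk v := fun h => hu (L.rk_inj h)
      omega
    rw [wp_seq, wp_asg]
    simp only [Ex.ok_A, Ex.ok_V, Ex.eval_A, Ex.eval_V, h35, hord]
    norm_num
    constructorm* _ ∧ _
    any_goals omega
    refine wp_loopTo K 40 (fun m s' => (∀ u : Fin n, u ≠ v → Flag (s'.arr 10 (u : ℕ))
      (E.bad u ∨ L.rk u < i ∧ FinalBad L.rk E u)) ∧ Flag (s'.arr 10 (v : ℕ)) (E.bad v ∨ ∃ j < m,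
        ∃ y, L.nb v j = some y ∧ y ≠ v ∧ E.d v y ≠ ⊤ ∧ FinalBad L.rk E y))
      (by norm_num) (by rfl) e3 ?_ ?_ ?_ ?_
    · intro s' hf'
      simp; omega
    · refine ⟨fun u _ => hI u, (hI v).congr ?_⟩
      simp [hrk]
    · rintro m s2 hm hf' h36 ⟨hJ, hJv⟩
      have h7 := (hf'.arr 7 (by rfl)).trans (hf.arr 7 (by rfl))
      have h8 := (hf'.arr 8 (by rfl)).trans h8'
      have h37 := hf'.var 37 (by rfl)
      simp at h37
      have hsl := slot_lt hvn hm
      have hsl0 : (0 : ℤ) ≤ (v : ℕ) * K := by positivity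
      have hnb := hL.nb v m hm
      have hval := slotVal_nonneg (L.nb v m)
      simp only [wp_seq, wp_asg, wp_ite, wp_sto, wp_skip, Ex.ok_A, Ex.ok_V, Ex.ok_C, Ex.eval_A,
        Ex.ok_add, Ex.ok_sub, Ex.eval_sub, Ex.ok_mul, Ex.ok_and, Ex.eval_and, Ex.eval_mul,
        Ex.eval_V, Ex.eval_C, St.set_var, St.set_arr, Ex.eval_add, h7, h8, h37, h36,
        zero_lt_ite_one]
      norm_num
      rw [hnb]
      have hstep : ∀ s' : St, s'.arr 10 = s2.arr 10 → (∀ y, L.nb v m = some y →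
          ¬ (y ≠ v ∧ E.d v y ≠ ⊤ ∧ FinalBad L.rk E y)) → (∀ u : Fin n, u ≠ v →
          Flag (s'.arr 10 (u : ℕ)) (E.bad u ∨ L.rk u < i ∧ FinalBad L.rk E u)) ∧
          Flag (s'.arr 10 (v : ℕ)) (E.bad v ∨ ∃ j ≤ m,
        ∃ y, L.nb v j = some y ∧ y ≠ v ∧ E.d v y ≠ ⊤ ∧ FinalBad L.rk E y) := by
        intro s' hs' hno
        rw [hs']
        refine ⟨hJ, hJv.congr (or_congr_right ⟨?_, ?_⟩)⟩
        · rintro ⟨j, hj, h1⟩; exact ⟨j, hj.le, h1⟩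
        · rintro ⟨j, hj, y, h1, h2⟩
          rcases Nat.lt_or_eq_of_le hj with hj | rfl
          · exact ⟨j, hj, y, h1, h2⟩
          · exact absurd h2 (hno y h1)
      constructorm* _ ∧ _
      any_goals omega
      · intro hpos
        obtain ⟨y, hy⟩ : ∃ y, L.nb v m = some y := by
          cases h : L.nb v m with
          | none => rw [h] at hpos; simp at hpos
          | some x => exact ⟨x, rfl⟩
        have hyn := y.isLt
        have hside := (hE.1.1 v m y hm hy).pos_iff
        rw [hy, slotVal_some, add_sub_cancel_right]
        constructorm* _ ∧ _
        any_goals omega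
        · intro p1 p2
          constructorm* _ ∧ _
          any_goals omega
          · intro u hu
            have : (u : ℕ) ≠ v := fun h => hu (Fin.ext h)
            simpa [this] using hJ u hu
          · refine Or.inl ⟨rfl, ?_⟩
            -- A slot in which `v` finds itself can only confirm a mark that `v` already has.
            by_cases hyv : y = v
            · subst hyv
              rcases hJv.pos_iff.1 p2 with h | ⟨j, hj, h⟩
              · exact Or.inl h
              · exact Or.inr ⟨j, hj.le, h⟩
            · refine Or.inr ⟨m, le_rfl, y, hy, hyv, hside.1 p1, ?_⟩
              rcases (hJ y hyv).pos_iff.1 p2 with h | h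
              · exact .bad h
              · exact h.2
        · intro p
          refine hstep _ rfl fun y' hy' => ?_
          obtain rfl : y = y' := by rw [hy] at hy'; exact Option.some.inj hy'
          rintro ⟨h1, h2, h3⟩
          have h4 := L.nb_rk v m y hy
          have h5 : L.rk y ≠ L.rk v := fun h => h1 (L.rk_inj h)
          have := p (hside.2 h2)
          have h6 := (hJ y h1).pos_iff.2 (Or.inr ⟨by omega, h3⟩)
          omega
      · intro hneg
        refine hstep _ rfl fun y hy => ?_
        rw [hy] at hneg; simp at hneg; omega
    · rintro τ s2 hf' _ ⟨hJ, hJv⟩ hτ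
      have h37 := hf'.var 37 (by rfl)
      have h11' := hf'.arr 11 (by rfl)
      simp at h37 h11'
      have hfin : E.bad v ∨ (∃ j < K, ∃ y, L.nb v j = some y ∧ y ≠ v ∧ E.d v y ≠ ⊤ ∧
          FinalBad L.rk E y) ↔ FinalBad L.rk E v := by
        constructor
        · rintro (h | ⟨j, hj, y, h1, h2, h3, h4⟩)
          · exact .bad h
          · have h5 := L.nb_rk v j y h1
            have h6 : L.rk y ≠ L.rk v := fun h => h2 (L.rk_inj h)
            exact .step (by omega) h3 h4
        · rintro (h | ⟨h1, h2, h3⟩)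
          · exact Or.inl h
          · rename_i y
            obtain ⟨j, hj, hj'⟩ := (hsupp v y h2).1 h1.le
            exact Or.inr ⟨j, hj, y, hj', by rintro rfl; omega, h2, h3⟩
      have hJv := hJv.congr hfin
      have b11 := abs_lt.1 (h11 v)
      have hv11 := hI11 v
      rw [if_neg (by omega), add_zero] at hv11
      have hval : s2.arr 10 (v : ℕ) = if FinalBad L.rk E v then 1 else 0 := by
        rcases hJv with ⟨h1, h2⟩ | ⟨h1, h2⟩ <;> simp [h1, h2]
      have hval' : 0 ≤ s2.arr 10 (v : ℕ) ∧ s2.arr 10 (v : ℕ) ≤ 1 := by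
        rw [hval]; split_ifs <;> simp
      simp only [wp_sto, Ex.ok_A, Ex.ok_V, Ex.eval_A, Ex.ok_add, Ex.eval_V, Ex.eval_add, h37, h11']
      norm_num
      rw [hv11]
      constructorm* _ ∧ _
      any_goals omega
      · simp at hτ; omega
      · intro u
        by_cases huv : u = v
        · subst huv
          refine hJv.congr ?_
          have : L.rk u ≤ i := by omega
          simp only [this, true_and]
          exact ⟨Or.inr, fun h => h.elim .bad id⟩
        · refine (hJ u huv).congr ?_
          have := hpre u huv
          rw [← Nat.lt_succ_iff (n := i)]
          rw [this]
      · intro u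
        by_cases huv : u = v
        · subst huv
          have : L.rk u ≤ i := by omega
          simp [this, hval]
        · have h' : (u : ℕ) ≠ v := fun h => huv (Fin.ext h)
          have := hpre u huv
          rw [Nat.lt_succ_iff] at this
          simp only [h', if_false, this]
          exact hI11 u
  · rintro τ s1 hf _ ⟨-, hI⟩ hτ
    refine ⟨by simp at hτ; nlinarith, fun u => ?_⟩
    rw [hI u]
    simp [L.rk_lt u]

/-- Add one to the entry in array `11` of each node that reaches a cycle with weight less than the
value of variable `40`. -/
def oracle (K : ℕ) : Cmd := clearAll K ;; enterEdges K ;; elimAll K ;; backPass K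

-- The marks after elimination and backward pass satisfy the recursion in `elims_correct`, which
-- identifies them with reaching a light closed walk.
open Classical in
theorem oracle_wp (hR : Room Γ G K) {th : Fin n → ℤ × ℤ} {M : ℤ} (hM : ThBound Γ G th M) {s : St}
    (hL : SlotMem L s) (hth : ThMem th s) (hθ : 0 ≤ s.var 40)
    (h11 : ∀ u : Fin n, |s.arr 11 (u : ℕ)| < Γ.B) :
    (oracle K).wp Γ (fun t s' => t ≤ (n + G.edges.card + 1) *
      (K * (K * (80 * K + 200) + 160) + 170 * K + 400) ∧ ∀ u : Fin n, s'.arr 11 (u : ℕ) =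
      s.arr 11 (u : ℕ) + if Bad (G.cw th) (s.var 40) u then 1 else 0) s := by
  rw [oracle, wp_seq]
  refine wp_use (clearAll_wp hR hL) ?_
  rintro t1 s1 ⟨ht1, hd1, hb1⟩ hf1
  have hL1 := hL.congr (hf1.var 2 (by rfl)) (hf1.var 3 (by rfl)) (hf1.arr 4 (by rfl))
    (hf1.arr 5 (by rfl)) (hf1.arr 7 (by rfl))
  rw [wp_seq]
  refine wp_use (enterEdges_wp hR hM hL1 (fun u => by
    rw [hf1.arr 19 (by rfl), hf1.arr 20 (by rfl)]; exact hth u) hd1) ?_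
  rintro t2 s2 ⟨ht2, hd2⟩ hf2
  have hL2 := hL1.congr (hf2.var 2 (by rfl)) (hf2.var 3 (by rfl)) (hf2.arr 4 (by rfl))
    (hf2.arr 5 (by rfl)) (hf2.arr 7 (by rfl))
  have h40 := (hf2.var 40 (by rfl)).trans (hf1.var 40 (by rfl))
  rw [wp_seq]
  refine wp_use (elimAll_wp hR hM hL2 hd2 (by rw [hf2.arr 10 (by rfl)]; exact hb1)
    (by rw [h40]; exact hθ)) ?_
  rintro t3 s3 ⟨ht3, hE3, hsupp⟩ hf3
  have hL3 := hL2.congr (hf3.var 2 (by rfl)) (hf3.var 3 (by rfl)) (hf3.arr 4 (by rfl))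
    (hf3.arr 5 (by rfl)) (hf3.arr 7 (by rfl))
  have h11' := (hf3.arr 11 (by rfl)).trans ((hf2.arr 11 (by rfl)).trans (hf1.arr 11 (by rfl)))
  refine wp_mono _ (backPass_wp hR hL3 hE3 hsupp (by rw [h11']; exact h11)) ?_
  rintro t4 s4 ⟨ht4, h4⟩
  refine ⟨?_, fun u => ?_⟩
  · generalize K * (K * (80 * K + 200) + 160) = a at ht3 ⊢
    have e1 : n * K * 30 = n * (30 * K) := by ring
    have e2 : n * (30 * K) + n * 20 + n * (a + 100) + n * (60 * K + 60) ≤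
        n * (a + 170 * K + 400) := by
      rw [← Nat.mul_add, ← Nat.mul_add, ← Nat.mul_add]
      exact Nat.mul_le_mul_left _ (by omega)
    have e3 : G.edges.card * (80 * K + 150) ≤ G.edges.card * (a + 170 * K + 400) :=
      Nat.mul_le_mul_left _ (by omega)
    rw [Nat.add_mul, Nat.add_mul]
    omega
  rw [h4, h11', h40]
  rw [h40] at *
  have := elims_correct (fb := FinalBad L.rk (elims L.rk L.ord (s.var 40) (G.cw th) n))
    hθ L.rk_ord L.rk_lt L.rk_inj (fun v => ⟨fun h => by
      cases h with
      | bad h => exact Or.inl h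
      | step h1 h2 h3 => exact Or.inr ⟨_, h1, h2, h3⟩, fun h => by
      rcases h with h | ⟨y, h1, h2, h3⟩
      · exact .bad h
      · exact .step h1 h2 h3⟩) u
  rw [propext this]

end Oracle

open Cmd

/-! ## Simultaneous search for the ratio values -/

section Search

variable {n : ℕ} {G : WGraph n} {K : ℕ} {Γ : Ctx} {L : Slots G K}

/-- Variables `53, …, 59` hold the search state `x`. -/
structure VarNS (x : NS) (s : St) : Prop where
  xp : s.var 53 = x.xp
  xq : s.var 54 = x.xq
  yp : s.var 55 = x.yp
  yq : s.var 56 = x.yq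
  g : s.var 57 = x.g
  md : s.var 58 = x.md
  sg : s.var 59 = x.sg

/-- One search step on variables; variable `52` holds the result of the comparison. -/
def stepVar : Cmd :=
  ite (.eq (.V 52) (.C 1)) skip (
    ite (.eq (.V 58) (.C 2))
      (ite (.eq (.V 52) (.C 0)) (asg 55 (.C 1) ;; asg 58 (.C 1) ;; asg 59 (.C 0))
        (asg 55 (.C (-1)) ;; asg 58 (.C 1) ;; asg 59 (.C 2)))
      (ite (.eq (.V 52) (.V 59))
        (asg 53 (.V 53 + .V 57 * .V 55) ;; asg 54 (.V 54 + .V 57 * .V 56) ;;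
          ite (.eq (.V 58) (.C 1)) (asg 57 (.C 2 * .V 57)) (asg 57 (.V 57 / .C 2)))
        (asg 58 (.C 0) ;; asg 57 (.V 57 / .C 2)) ;;
      ite (.eq (.V 57) (.C 0)) (asg 60 (.V 53) ;; asg 53 (.V 55) ;; asg 55 (.V 60) ;;
        asg 60 (.V 54) ;; asg 54 (.V 56) ;; asg 56 (.V 60) ;; asg 57 (.C 1) ;; asg 58 (.C 1) ;;
        asg 59 (.C 2 - .V 59)) skip))

theorem stepVar_wp {N : ℤ} {x : NS} (hx : x.Small N) (hN : 1 ≤ N) (hB : 4 * N + 10 ≤ Γ.B) {s : St}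
    (hs : VarNS x s) :
    stepVar.wp Γ (fun t s' => t ≤ 150 ∧ VarNS (x.step (s.var 52)) s') s := by
  obtain ⟨h53, h54, h55, h56, h57, h58, h59⟩ := hs
  obtain ⟨b1, b2, b3, b4, b5, b6, b7, b8, b9, -⟩ := hx
  rw [abs_le] at b1 b3 b5
  have hdiv : 0 ≤ x.g / 2 ∧ x.g / 2 ≤ 2 * N := by omega
  generalize hc : s.var 52 = c
  simp only [stepVar, wp_ite, wp_seq, wp_asg, wp_skip, Ex.ok_eq, Ex.ok_V, Ex.ok_C, Ex.ok_add,
    Ex.ok_mul, Ex.ok_div, Ex.ok_sub, Ex.eval_eq, Ex.eval_V, Ex.eval_C, Ex.eval_add, Ex.eval_mul,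
    Ex.eval_div, Ex.eval_sub, St.set_var, zero_lt_ite_one, h53, h54, h55, h56, h57, h58, h59, hc]
  norm_num
  have key : ∀ y : NS, ∀ s' : St, x.step c = y → VarNS y s' → VarNS (x.step c) s' :=
    fun y s' h h' => h ▸ h'
  constructorm* _ ∧ _
  any_goals omega
  · intro h1
    refine key x _ (by simp [NS.step, h1]) ⟨h53, h54, h55, h56, h57, h58, h59⟩
  · intro h1
    constructorm* _ ∧ _
    any_goals omega
    · intro h2
      constructorm* _ ∧ _
      any_goals omega
      · intro h3
        constructorm* _ ∧ _
        any_goals omega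
        refine key { x with yp := 1, md := 1, sg := 0 } _ (by simp [NS.step, h2, h3])
          ⟨?_, ?_, ?_, ?_, ?_, ?_, ?_⟩ <;> simp [*]
      · intro h3
        constructorm* _ ∧ _
        any_goals omega
        refine key { x with yp := -1, md := 1, sg := 2 } _ (by simp [NS.step, h1, h2, h3])
          ⟨?_, ?_, ?_, ?_, ?_, ?_, ?_⟩ <;> simp [*]
    · intro h2
      constructorm* _ ∧ _
      · intro h3
        have h1' : x.sg ≠ 1 := h3 ▸ h1
        constructorm* _ ∧ _
        any_goals omega
        · intro h4
          constructorm* _ ∧ _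
          any_goals omega
          intro h5
          have : x.g ≠ 0 := by omega
          refine key _ _ (by simp only [NS.step, h1, h2, h3, h4, NS.turn]; simp [this, h1']; rfl)
            ⟨?_, ?_, ?_, ?_, ?_, ?_, ?_⟩ <;> simp [*]
        · intro h4
          constructorm* _ ∧ _
          any_goals omega
          · intro h5
            constructorm* _ ∧ _
            any_goals omega
            refine key _ _ (by simp only [NS.step, h1, h2, h3, h4, NS.turn]; simp [h5, h1']; rfl)
              ⟨?_, ?_, ?_, ?_, ?_, ?_, ?_⟩ <;> simp [*]
          · intro h5
            refine key _ _ (by simp only [NS.step, h1, h2, h3, h4, NS.turn]; simp [h5, h1']; rfl)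
              ⟨?_, ?_, ?_, ?_, ?_, ?_, ?_⟩ <;> simp [*]
      · intro h3
        constructorm* _ ∧ _
        any_goals omega
        · intro h5
          constructorm* _ ∧ _
          any_goals omega
          refine key _ _ (by simp only [NS.step, h1, h2, h3, NS.turn]; simp [h5]; rfl)
            ⟨?_, ?_, ?_, ?_, ?_, ?_, ?_⟩ <;> simp [*]
        · intro h5
          refine key _ _ (by simp only [NS.step, h1, h2, h3, NS.turn]; simp [h5]; rfl)
            ⟨?_, ?_, ?_, ?_, ?_, ?_, ?_⟩ <;> simp [*]

/-- Arrays `12, …, 18` hold the search states of the nodes. -/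
structure NodeMem (σ : Fin n → NS) (s : St) : Prop where
  xp : ∀ u : Fin n, s.arr 12 (u : ℕ) = (σ u).xp
  xq : ∀ u : Fin n, s.arr 13 (u : ℕ) = (σ u).xq
  yp : ∀ u : Fin n, s.arr 14 (u : ℕ) = (σ u).yp
  yq : ∀ u : Fin n, s.arr 15 (u : ℕ) = (σ u).yq
  g : ∀ u : Fin n, s.arr 16 (u : ℕ) = (σ u).g
  md : ∀ u : Fin n, s.arr 17 (u : ℕ) = (σ u).md
  sg : ∀ u : Fin n, s.arr 18 (u : ℕ) = (σ u).sg

theorem NodeMem.congr {σ : Fin n → NS} {s s' : St} (h : NodeMem σ s)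
    (ha : ∀ a, 12 ≤ a → a ≤ 18 → s'.arr a = s.arr a) : NodeMem σ s' :=
  ⟨by rw [ha 12 (by norm_num) (by norm_num)]; exact h.xp,
    by rw [ha 13 (by norm_num) (by norm_num)]; exact h.xq,
    by rw [ha 14 (by norm_num) (by norm_num)]; exact h.yp,
    by rw [ha 15 (by norm_num) (by norm_num)]; exact h.yq,
    by rw [ha 16 (by norm_num) (by norm_num)]; exact h.g,
    by rw [ha 17 (by norm_num) (by norm_num)]; exact h.md,
    by rw [ha 18 (by norm_num) (by norm_num)]; exact h.sg⟩

theorem NodeMem.of_fr {σ : Fin n → NS} {s s' : St} (h : NodeMem σ s) {p : Cmd} (hf : p.Fr s s')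
    (ha : (p.keepsA 12 && p.keepsA 13 && p.keepsA 14 && p.keepsA 15 && p.keepsA 16 && p.keepsA 17 &&
      p.keepsA 18) = true) : NodeMem σ s' := by
  simp only [Bool.and_eq_true] at ha
  refine h.congr fun a h1 h2 => hf.arr a ?_
  interval_cases a <;> tauto

/-- Initial search states. -/
def initSearch : Cmd :=
  loopTo 50 (.V 2) (sto 13 (.V 50) (.C 1) ;; sto 16 (.V 50) (.C 1) ;; sto 17 (.V 50) (.C 2))

theorem initSearch_wp (hn : (n : ℤ) ≤ Γ.E) (hB : Γ.E + 10 ≤ Γ.B) {s : St} (h2 : s.var 2 = n)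
    (h0 : ∀ a, 12 ≤ a → a ≤ 18 → ∀ k, s.arr a k = 0) :
    initSearch.wp Γ (fun t s' => t ≤ n * 40 + 20 ∧ NodeMem (fun _ : Fin n => NS.init) s') s := by
  refine wp_loopTo n 20 (fun i s' => NodeMem (fun u : Fin n => if (u : ℕ) < i then NS.init else
    ⟨0, 0, 0, 0, 0, 0, 0⟩) s') (by norm_num) (by rfl) (by omega) ?_ ?_ ?_ ?_
  · intro s' hf
    simp [hf.var 2 (by rfl), h2]
  · constructor <;> intro u <;> simp <;> exact h0 _ (by norm_num) (by norm_num) _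
  · rintro i s1 hi hf h50 hI
    simp only [wp_seq, wp_sto, Ex.ok_V, Ex.ok_C, Ex.eval_V, Ex.eval_C, St.put_var, h50]
    norm_num
    constructorm* _ ∧ _
    any_goals omega
    constructor <;> intro u
    · have := hI.xp u; simp at this ⊢; rw [this]; split_ifs <;> simp [NS.init]
    · have := hI.xq u; simp at this ⊢; rw [this]; split_ifs <;> simp [NS.init] <;> omega
    · have := hI.yp u; simp at this ⊢; rw [this]; split_ifs <;> simp [NS.init]
    · have := hI.yq u; simp at this ⊢; rw [this]; split_ifs <;> simp [NS.init]
    · have := hI.g u; simp at this ⊢; rw [this]; split_ifs <;> simp [NS.init] <;> omega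
    · have := hI.md u; simp at this ⊢; rw [this]; split_ifs <;> simp [NS.init] <;> omega
    · have := hI.sg u; simp at this ⊢; rw [this]; split_ifs <;> simp [NS.init]
  · intro τ s1 hf _ hI hτ
    refine ⟨by simp at hτ; omega, ?_⟩
    constructor <;> intro u
    · simpa using hI.xp u
    · simpa using hI.xq u
    · simpa using hI.yp u
    · simpa using hI.yq u
    · simpa using hI.g u
    · simpa using hI.md u
    · simpa using hI.sg u

/-- Thresholds for the next comparison. -/
def setCands : Cmd :=
  loopTo 50 (.V 2) (sto 19 (.V 50) (.A 12 (.V 50) + .A 16 (.V 50) * .A 14 (.V 50)) ;;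
    sto 20 (.V 50) (.A 13 (.V 50) + .A 16 (.V 50) * .A 15 (.V 50)) ;; sto 11 (.V 50) (.C 0))

theorem setCands_wp (hn : (n : ℤ) ≤ Γ.E) (hB : Γ.E + 10 ≤ Γ.B) {s : St} (h2 : s.var 2 = n)
    {σ : Fin n → NS} (hs : NodeMem σ s) {N : ℤ} (hσ : ∀ u, (σ u).Small N)
    (hN : 4 * N + 10 ≤ Γ.B) :
    setCands.wp Γ (fun t s' => t ≤ n * 60 + 20 ∧ ThMem (fun u => (σ u).cand) s' ∧
      ∀ u : Fin n, s'.arr 11 (u : ℕ) = 0) s := by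
  refine wp_loopTo n 40 (fun i s' => ∀ u : Fin n, (u : ℕ) < i →
    (s'.arr 19 (u : ℕ) = (σ u).cand.1 ∧ s'.arr 20 (u : ℕ) = (σ u).cand.2) ∧ s'.arr 11 (u : ℕ) = 0)
    (by norm_num) (by rfl) (by omega) ?_ ?_ ?_ ?_
  · intro s' hf
    simp [hf.var 2 (by rfl), h2]
  · simp
  · rintro i s1 hi hf h50 hI
    obtain ⟨v, rfl⟩ : ∃ v : Fin n, i = v := ⟨⟨i, hi⟩, rfl⟩
    obtain ⟨b1, b2, b3, b4, b5, b6, b7, b8, b9, -⟩ := hσ v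
    rw [abs_le] at b1 b3 b5
    have e1 := hs.xp v
    have e2 := hs.xq v
    have e3 := hs.yp v
    have e4 := hs.yq v
    have e5 := hs.g v
    rw [← hf.arr 12 (by rfl)] at e1
    rw [← hf.arr 13 (by rfl)] at e2
    rw [← hf.arr 14 (by rfl)] at e3
    rw [← hf.arr 15 (by rfl)] at e4
    rw [← hf.arr 16 (by rfl)] at e5
    simp only [wp_seq, wp_sto, Ex.ok_V, Ex.ok_C, Ex.ok_A, Ex.ok_add, Ex.ok_mul, Ex.eval_V,
      Ex.eval_C, Ex.eval_A, Ex.eval_add, Ex.eval_mul, St.put_var, St.put_arr, h50]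
    norm_num
    rw [e1, e2, e3, e4, e5]
    constructorm* _ ∧ _
    any_goals omega
    intro u hu
    by_cases huv : u = v
    · subst huv; simp [NS.cand]
    · have h' : (u : ℕ) ≠ v := fun h => huv (Fin.ext h)
      simpa [h'] using hI u (by omega)
  · intro τ s1 hf _ hI hτ
    exact ⟨by simp at hτ; omega, fun u => (hI u u.2).1, fun u => (hI u u.2).2⟩

/-- One search step for every node; variable `51` becomes `1` unless all nodes are finished. -/
def stepAll : Cmd :=
  asg 51 (.C 0) ;; loopTo 50 (.V 2) (
    asg 52 (.A 11 (.V 50)) ;; ite (.eq (.V 52) (.C 1)) skip (asg 51 (.C 1)) ;;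
    asg 53 (.A 12 (.V 50)) ;; asg 54 (.A 13 (.V 50)) ;; asg 55 (.A 14 (.V 50)) ;;
    asg 56 (.A 15 (.V 50)) ;; asg 57 (.A 16 (.V 50)) ;; asg 58 (.A 17 (.V 50)) ;;
    asg 59 (.A 18 (.V 50)) ;; stepVar ;;
    sto 12 (.V 50) (.V 53) ;; sto 13 (.V 50) (.V 54) ;; sto 14 (.V 50) (.V 55) ;;
    sto 15 (.V 50) (.V 56) ;; sto 16 (.V 50) (.V 57) ;; sto 17 (.V 50) (.V 58) ;;
    sto 18 (.V 50) (.V 59))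

theorem stepAll_wp (hn : (n : ℤ) ≤ Γ.E) (hB : Γ.E + 10 ≤ Γ.B) {s : St} (h2 : s.var 2 = n)
    {σ : Fin n → NS} (hs : NodeMem σ s) {N : ℤ} (hσ : ∀ u, (σ u).Small N) (hN1 : 1 ≤ N)
    (hN : 4 * N + 10 ≤ Γ.B) {c : Fin n → ℤ} (hc : ∀ u : Fin n, s.arr 11 (u : ℕ) = c u) :
    stepAll.wp Γ (fun t s' => t ≤ n * 300 + 30 ∧ NodeMem (fun u => (σ u).step (c u)) s' ∧
      (s'.var 51 = 0 ∧ (∀ u, c u = 1) ∨ s'.var 51 = 1 ∧ ∃ u, c u ≠ 1)) s := by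
  rw [stepAll, wp_seq, wp_asg]
  refine ⟨by norm_num, by simp; omega, ?_⟩
  refine wp_loopTo n 250 (fun i s' => NodeMem (fun u : Fin n => if (u : ℕ) < i then
    (σ u).step (c u) else σ u) s' ∧ (s'.var 51 = 0 ∧ (∀ u : Fin n, (u : ℕ) < i → c u = 1) ∨
      s'.var 51 = 1 ∧ ∃ u, c u ≠ 1)) (by norm_num) (by rfl) (by omega) ?_ ?_ ?_ ?_
  · intro s' hf
    have := hf.var 2 (by rfl)
    simp at this
    simp [this, h2]
  · refine ⟨⟨?_, ?_, ?_, ?_, ?_, ?_, ?_⟩, by simp⟩ <;> intro u <;> simp [hs.xp, hs.xq, hs.yp, hs.yq,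
      hs.g, hs.md, hs.sg]
  · rintro i s1 hi hf h50 ⟨hI, h51⟩
    obtain ⟨v, rfl⟩ : ∃ v : Fin n, i = v := ⟨⟨i, hi⟩, rfl⟩
    have e1 := hI.xp v
    have e2 := hI.xq v
    have e3 := hI.yp v
    have e4 := hI.yq v
    have e5 := hI.g v
    have e6 := hI.md v
    have e7 := hI.sg v
    simp only [lt_irrefl, if_false] at e1 e2 e3 e4 e5 e6 e7
    have h11 := hf.arr 11 (by rfl)
    simp only [St.set_arr] at h11
    have hcv := hc v
    rw [← h11] at hcv
    rw [wp_seq]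
    refine wp_use (Q := fun t s' => t ≤ 5 ∧ s'.var 52 = c v) ?_ ?_
    · simp only [wp_asg, Ex.ok_A, Ex.ok_V, Ex.eval_A, Ex.eval_V, h50]
      norm_num
      exact ⟨by omega, hcv⟩
    rintro t1 s2 ⟨ht1, h52⟩ hf2
    rw [wp_seq]
    refine wp_use (Q := fun t s' => t ≤ 20 ∧ (s'.var 51 = 0 ∧ (∀ u : Fin n, (u : ℕ) < v + 1 → c u = 1) ∨
      s'.var 51 = 1 ∧ ∃ u, c u ≠ 1)) ?_ ?_
    · simp only [wp_ite, wp_skip, wp_asg, Ex.ok_eq, Ex.ok_V, Ex.ok_C, Ex.eval_eq, Ex.eval_V,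
        Ex.eval_C, zero_lt_ite_one, h52, St.set_var, hf2.var 51 (by rfl)]
      norm_num
      refine ⟨by omega, fun h1 => ?_, fun h1 => ⟨by omega, v, h1⟩⟩
      rcases h51 with ⟨h, h'⟩ | h
      · refine Or.inl ⟨h, fun u hu => ?_⟩
        by_cases huv : u = v
        · rw [huv, h1]
        · exact h' u (lt_of_le_of_ne hu fun h => huv (Fin.ext h))
      · exact Or.inr h
    rintro t2 s3 ⟨ht2, h51'⟩ hf3
    have ha : s3.arr = s1.arr := by
      funext a
      rw [hf3.arr a (by rfl), hf2.arr a (by rfl)]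
    have h50' := (hf3.var 50 (by rfl)).trans ((hf2.var 50 (by rfl)).trans h50)
    have h52' := (hf3.var 52 (by rfl)).trans h52
    simp only [wp_seq, wp_asg, Ex.ok_A, Ex.ok_V, Ex.eval_A, Ex.eval_V, St.set_var, St.set_arr, h50',
      ha, e1]
    norm_num
    constructorm* _ ∧ _
    any_goals omega
    rw [e2, e3, e4, e5, e6, e7]
    refine wp_use (stepVar_wp (hσ v) hN1 hN (s := (((((((s3.set 53 (σ v).xp).set 54
      (σ v).xq).set 55 (σ v).yp).set 56 (σ v).yq).set 57 (σ v).g).set 58 (σ v).md).set 59 (σ v).sg)) (by constructor <;> simp)) ?_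
    rintro t3 s4 ⟨ht3, h4⟩ hf4
    have h50'' := hf4.var 50 (by rfl)
    have h51'' := hf4.var 51 (by rfl)
    have ha4 : s4.arr = s1.arr := by
      funext a
      rw [hf4.arr a (by rfl)]; simp [ha]
    simp [h52'] at h4
    simp at h50'' h51''
    rw [h50'] at h50''
    obtain ⟨g1, g2, g3, g4, g5, g6, g7⟩ := h4
    simp only [wp_sto, Ex.ok_V, Ex.eval_V, St.put_var, h50'', g1, g2, g3, g4, g5, g6, g7]
    norm_num
    constructorm* _ ∧ _
    any_goals omega
    · refine ⟨?_, ?_, ?_, ?_, ?_, ?_, ?_⟩ <;> intro u <;> by_cases huv : u = v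
      any_goals (subst huv; simp)
      all_goals
        have h' : (u : ℕ) ≠ v := fun h => huv (Fin.ext h)
        have h'' : u ≤ v ↔ (u : ℕ) < v := by omega
        simp only [St.set_arr, St.put_arr, Nat.cast_inj, h', h'', and_false, if_false, ha4]
      exacts [hI.xp u, hI.xq u, hI.yp u, hI.yq u, hI.g u, hI.md u, hI.sg u]
    · rw [h51'']
      simpa [Nat.lt_succ_iff] using h51'
  · rintro τ s1 hf _ ⟨hI, h51⟩ hτ
    refine ⟨by simp at hτ ⊢; omega, ⟨?_, ?_, ?_, ?_, ?_, ?_, ?_⟩, by simpa using h51⟩ <;> intro u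
    exacts [by simpa using hI.xp u, by simpa using hI.xq u, by simpa using hI.yp u,
      by simpa using hI.yq u, by simpa using hI.g u, by simpa using hI.md u, by simpa using hI.sg u]

end Search

open Cmd

section Search

variable {n : ℕ} {G : WGraph n} {K : ℕ} {Γ : Ctx} {L : Slots G K}

/-- A factor in the bounds for the running time. -/
def rate (K : ℕ) : ℕ := 2 * (K * (K * (80 * K + 200) + 160) + 170 * K + 400) + 600

/-- One round of the search. -/
def round (K : ℕ) : Cmd :=
  setCands ;; asg 40 (.C 0) ;; oracle K ;; asg 40 (.C 1) ;; oracle K ;; stepAll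

/-- The numbers that occur in the search fit into the bound. -/
structure SearchBound (Γ : Ctx) (G : WGraph n) (ν : Fin n → ℚ) (N : ℤ) : Prop where
  one_le : 1 ≤ N
  num : ∀ u, |(ν u).num| ≤ N
  den : ∀ u, ((ν u).den : ℤ) ≤ N
  bound : 4 * ((n : ℤ) + 1) * (3 * N * G.maxWeight) + 10 ≤ Γ.B
  bound' : 4 * N + 10 ≤ Γ.B

/-- A candidate is `X + g Y` with `X` at most `N` and `g Y` at most `2 * N` in absolute value,
whence the factor `3`. -/
theorem SearchBound.thBound {ν : Fin n → ℚ} {N : ℤ} (h : SearchBound Γ G ν N) (r : ℕ) :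
    ThBound Γ G (fun u => (NS.run (ν u) r).cand) (3 * N * G.maxWeight) := by
  have hN := h.one_le
  have hc : ∀ u, |(NS.run (ν u) r).cand.1| ≤ 3 * N ∧ |(NS.run (ν u) r).cand.2| ≤ 3 * N := by
    intro u
    obtain ⟨b1, b2, b3, b4, b5, b6, -⟩ := NS.run_small (h.num u) (h.den u) r
    simp only [abs_le] at b1 b3 b5 ⊢
    simp only [NS.cand]
    constructor <;> constructor <;> omega
  refine ⟨by positivity, fun u e he => ?_, fun u e he => ?_, h.bound⟩
  · rw [abs_mul]
    exact mul_le_mul (hc u).2 (WGraph.weight_le he).1 (abs_nonneg _) (by omega)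
  · rw [abs_mul, Nat.abs_cast]
    exact mul_le_mul (hc u).1 (by exact_mod_cast (WGraph.weight_le he).2) (by positivity) (by omega)

-- The runs with `θ = 0` and `θ = 1` contribute the two summands of `NS.cmp`, so one round performs
-- one search step at every node.
open Classical in
theorem round_wp (hR : Room Γ G K) {ν : Fin n → ℚ} (hν : ∀ u, G.IsRatioValue u (ν u)) {N : ℤ}
    (hN : SearchBound Γ G ν N) {s : St} (hL : SlotMem L s) {r : ℕ}
    (hs : NodeMem (fun u => NS.run (ν u) r) s) :
    (round K).wp Γ (fun t s' => t + 3 ≤ (n + G.edges.card + 1) * rate K ∧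
      NodeMem (fun u => NS.run (ν u) (r + 1)) s' ∧ ThMem (fun u => (NS.run (ν u) r).cand) s' ∧
      (s'.var 51 = 0 ∧ (∀ u, NS.cmp (ν u) (NS.run (ν u) r).cand = 1) ∨
        s'.var 51 = 1 ∧ ∃ u, NS.cmp (ν u) (NS.run (ν u) r).cand ≠ 1)) s := by
  have hone := Γ.one_le
  have hN' := hN.bound'
  have hN1 := hN.one_le
  have hsm : ∀ u, (NS.run (ν u) r).Small N := fun u => NS.run_small (hN.num u) (hN.den u) r
  rw [round, wp_seq]
  refine wp_use (setCands_wp hR.node hR.bound hL.nodes hs hsm hN') ?_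
  rintro t1 s1 ⟨ht1, hth, h11⟩ hf1
  rw [wp_seq, wp_asg]
  refine ⟨by norm_num, by simp; omega, ?_⟩
  have hL1 := hL.congr (s' := s1.set 40 0) (hf1.var 2 (by rfl)) (hf1.var 3 (by rfl))
    (hf1.arr 4 (by rfl)) (hf1.arr 5 (by rfl)) (hf1.arr 7 (by rfl))
  have hs1 := hs.of_fr hf1 (by rfl)
  rw [wp_seq]
  refine wp_use (oracle_wp hR (hN.thBound r) (s := s1.set 40 0) hL1 hth (by simp)
    (fun u => by simp [h11]; omega)) ?_
  rintro t2 s2 ⟨ht2, h11'⟩ hf2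
  rw [wp_seq, wp_asg]
  refine ⟨by norm_num, by simp; omega, ?_⟩
  have hL2 := hL1.congr (s' := s2.set 40 1) (hf2.var 2 (by rfl)) (hf2.var 3 (by rfl))
    (hf2.arr 4 (by rfl)) (hf2.arr 5 (by rfl)) (hf2.arr 7 (by rfl))
  have hs2 := NodeMem.of_fr (s := s1.set 40 0) ⟨hs1.1, hs1.2, hs1.3, hs1.4, hs1.5, hs1.6, hs1.7⟩
    hf2 (by rfl)
  have hth2 : ThMem (fun u => (NS.run (ν u) r).cand) s2 := fun u => by
    rw [hf2.arr 19 (by rfl), hf2.arr 20 (by rfl)]; exact hth u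
  have hl : ∀ u : Fin n, |s2.arr 11 (u : ℕ)| < Γ.B := by
    intro u
    rw [h11', abs_lt]
    simp only [St.set_arr, h11]
    split_ifs <;> omega
  rw [wp_seq]
  refine wp_use (oracle_wp hR (hN.thBound r) (s := s2.set 40 1) hL2 hth2 (by simp) hl) ?_
  rintro t3 s3 ⟨ht3, h11''⟩ hf3
  have hL3 := hL2.congr (s' := s3) (hf3.var 2 (by rfl)) (hf3.var 3 (by rfl))
    (hf3.arr 4 (by rfl)) (hf3.arr 5 (by rfl)) (hf3.arr 7 (by rfl))
  have hs3 := NodeMem.of_fr (s := s2.set 40 1) ⟨hs2.1, hs2.2, hs2.3, hs2.4, hs2.5, hs2.6, hs2.7⟩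
    hf3 (by rfl)
  have hc : ∀ u : Fin n, s3.arr 11 (u : ℕ) = NS.cmp (ν u) (NS.run (ν u) r).cand := by
    intro u
    rw [h11'']
    simp only [St.set_arr, h11', h11, zero_add, St.set_var, if_true]
    rw [NS.cmp]
    have hpos : ∀ u, 0 < (NS.run (ν u) r).cand.2 := fun u => (hsm u).pos
    congr 1
    -- The current candidate is obtained from `ν u` by the function `fun q => (NS.run q r).cand`,
    -- the same for all nodes; hence equal values have equal thresholds.
    · exact if_congr (WGraph.bad_cw_iff hν (f := fun q => (NS.run q r).cand) (fun _ => rfl) hpos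
        (Or.inl ⟨rfl, rfl⟩) u) rfl rfl
    · exact if_congr (WGraph.bad_cw_iff hν (f := fun q => (NS.run q r).cand) (fun _ => rfl) hpos
        (Or.inr ⟨rfl, rfl⟩) u) rfl rfl
  refine wp_use (stepAll_wp hR.node hR.bound hL3.nodes hs3 hsm hN1 hN' hc) ?_
  rintro t4 s4 ⟨ht4, h4, h51⟩ hf4
  refine ⟨?_, h4, fun u => ?_, h51⟩
  · rw [rate, Nat.mul_add, Nat.mul_left_comm]
    simp only [Ex.cost_C]
    omega
  · rw [hf4.arr 19 (by rfl), hf4.arr 20 (by rfl), hf3.arr 19 (by rfl), hf3.arr 20 (by rfl)]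
    exact hth2 u

/-- Search for the ratio values of all nodes and write them. -/
def search (K : ℕ) : Cmd :=
  initSearch ;; asg 51 (.C 1) ;; whl (.V 51) (round K) ;;
  loopTo 50 (.V 2) (wr (.A 19 (.V 50)) ;; wr (.A 20 (.V 50)))

theorem take_finRange_flatMap {α : Type*} (f : Fin n → List α) (v : Fin n) :
    ((List.finRange n).take (v + 1)).flatMap f = ((List.finRange n).take v).flatMap f ++ f v := by
  rw [List.take_succ_eq_append_getElem (by simp)]
  simp

/-- Every node is found within `3 * Nat.log 2 (lam ν) + 5` moves, and one more round observes that
all comparisons give equality. Initialisation and output are paid by the seventh unit. The final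
thresholds are the ratio values in lowest terms. -/
theorem search_wp (hR : Room Γ G K) {ν : Fin n → ℚ} (hν : ∀ u, G.IsRatioValue u (ν u)) {N : ℤ}
    (hN : SearchBound Γ G ν N) {s : St} (hL : SlotMem L s)
    (h0 : ∀ a, 12 ≤ a → a ≤ 18 → ∀ k, s.arr a k = 0) (ho : s.out = []) :
    (search K).wp Γ (fun t s' =>
      t ≤ (3 * Nat.log 2 (lam ν) + 7) * ((n + G.edges.card + 1) * rate K) ∧
      s'.out = encodeValues ν) s := by
  have hone := Γ.one_le
  have hlog : ∀ u, Nat.log 2 ((ν u).num.natAbs * (ν u).den) ≤ Nat.log 2 (lam ν) := fun u =>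
    Nat.log_mono_right (Finset.le_sup (f := fun u => (ν u).num.natAbs * (ν u).den)
      (Finset.mem_univ u))
  rw [search, wp_seq]
  refine wp_use (initSearch_wp hR.node hR.bound hL.nodes h0) ?_
  rintro t1 s1 ⟨ht1, hs1⟩ hf1
  rw [wp_seq, wp_asg]
  refine ⟨by norm_num, by simp; omega, ?_⟩
  rw [wp_seq]
  have ho1 : s1.out = [] := (hf1.out (by rfl)).trans ho
  have hL1 := hL.congr (s' := s1.set 51 1) (hf1.var 2 (by rfl)) (hf1.var 3 (by rfl))
    (hf1.arr 4 (by rfl)) (hf1.arr 5 (by rfl)) (hf1.arr 7 (by rfl))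
  refine wp_whl (fun i τ s' => ∃ r, i + r = 3 * Nat.log 2 (lam ν) + 6 ∧
    τ ≤ r * ((n + G.edges.card + 1) * rate K) ∧
    (s'.var 51 = 1 ∧ 1 ≤ i ∧ NodeMem (fun u => NS.run (ν u) r) s' ∨
      s'.var 51 = 0 ∧ ThMem (fun u => ((ν u).num, ((ν u).den : ℤ))) s'))
    (3 * Nat.log 2 (lam ν) + 6) ⟨0, rfl, by simp, Or.inl ⟨by simp, by omega, ⟨hs1.1, hs1.2, hs1.3,
      hs1.4, hs1.5, hs1.6, hs1.7⟩⟩⟩ ?_ ?_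
  · rintro i τ s2 hf2 ⟨r, hir, hτ, h⟩
    refine ⟨by norm_num, fun hpos => ?_⟩
    simp only [Ex.eval_V] at hpos
    rcases h with ⟨h51, hi, hs⟩ | ⟨h51, -⟩
    swap
    · omega
    refine ⟨i - 1, by omega, ?_⟩
    have hL2 := hL1.congr (s' := s2) (hf2.var 2 (by rfl)) (hf2.var 3 (by rfl))
      (hf2.arr 4 (by rfl)) (hf2.arr 5 (by rfl)) (hf2.arr 7 (by rfl))
    refine wp_mono _ (round_wp hR hν hN hL2 hs) ?_
    rintro t s3 ⟨ht, hs3, hth3, h51'⟩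
    refine ⟨r + 1, by omega, ?_, ?_⟩
    · rw [Nat.add_mul, Nat.one_mul]
      simp only [Ex.cost_V]; omega
    · rcases h51' with ⟨h51', hc⟩ | ⟨h51', u, hu⟩
      · refine Or.inr ⟨h51', fun u => ?_⟩
        have := hth3 u
        simp only [NS.run_cand (hc u)] at this
        exact this
      · have := mt (NS.run_cmp (ν := ν u) (r := r)) hu
        have := hlog u
        exact Or.inl ⟨h51', by omega, hs3⟩
  · rintro i τ s2 hf2 ⟨r, hir, hτ, h⟩ hneg
    simp only [Ex.eval_V] at hneg
    rcases h with ⟨h51, -⟩ | ⟨-, hth⟩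
    · omega
    have ho2 : s2.out = [] := (hf2.out (by rfl)).trans ho1
    have hL2 := hL1.congr (s' := s2) (hf2.var 2 (by rfl)) (hf2.var 3 (by rfl))
      (hf2.arr 4 (by rfl)) (hf2.arr 5 (by rfl)) (hf2.arr 7 (by rfl))
    have hnE := hR.node
    have hEB := hR.bound
    refine wp_loopTo n 10 (fun i s' => s'.out = ((List.finRange n).take i).flatMap fun u =>
      [(ν u).num, ((ν u).den : ℤ)]) (by norm_num) (by rfl) (by omega) ?_ ?_ ?_ ?_
    · intro s' hf
      simp [hf.var 2 (by rfl), hL2.nodes]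
    · simp [ho2]
    · rintro i s3 hi hf h50 hI
      obtain ⟨v, rfl⟩ : ∃ v : Fin n, i = v := ⟨⟨i, hi⟩, rfl⟩
      have h19 := (congrFun (hf.arr 19 (by rfl)) _).trans (hth v).1
      have h20 := (congrFun (hf.arr 20 (by rfl)) _).trans (hth v).2
      simp only [wp_seq, wp_wr, Ex.ok_A, Ex.ok_V, Ex.eval_A, Ex.eval_V, St.emit_var, St.emit_arr, h50,
        h19, h20]
      norm_num
      constructorm* _ ∧ _
      any_goals omega
      rw [hI, take_finRange_flatMap]
    · rintro τ' s3 hf _ hI hτ'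
      constructor
      · have hrate : (n + G.edges.card + 1) * 600 ≤ (n + G.edges.card + 1) * rate K :=
          Nat.mul_le_mul_left _ (by rw [rate]; omega)
        generalize (n + G.edges.card + 1) * rate K = a at *
        have h1 : r * a ≤ (3 * Nat.log 2 (lam ν) + 6) * a := Nat.mul_le_mul_right _ (by omega)
        rw [show 3 * Nat.log 2 (lam ν) + 7 = 3 * Nat.log 2 (lam ν) + 6 + 1 from rfl, Nat.add_mul _ 1]
        simp only [Ex.cost_V, Ex.cost_C] at hτ' ⊢
        omega
      · rw [hI, encodeValues, List.take_of_length_le (by simp)]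

end Search

open Cmd

/-! ## The fast program -/

theorem Exec.length_out_le {inp : List ℤ} {p : Program} {s s' : Config} {t : ℕ}
    (h : Exec inp p s t s') : s'.out.length ≤ s.out.length + t := by
  induction h with
  | seq => omega
  | cond_pos => omega
  | cond_neg => omega
  | loop_pos => omega
  | loop_neg => omega
  | _ => simp [Config.setVar, Config.touch, Config.setArr]

theorem Runs.length_le {p : Program} {inp out : List ℤ} {t s m : ℕ} (h : Runs p inp t s m out) :
    out.length ≤ t := by
  obtain ⟨f, hx, rfl, -⟩ := h
  simpa [Config.init] using hx.length_out_le

/-- Every program names a variable. This lets the space of `D` absorb additive constants even when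
`log n = 0`. -/
theorem Runs.space_pos {p : Program} {inp out : List ℤ} {t s m : ℕ} (h : Runs p inp t s m out) :
    1 ≤ s := by
  obtain ⟨f, -, -, rfl, -⟩ := h
  have : p.vars.Nonempty := by
    induction p with
    | seq p q ihp _ => exact ihp.mono Finset.subset_union_left
    | _ => simp [Program.vars]
  have := this.card_pos
  omega

section Fast

variable {n : ℕ} {G : WGraph n} {T : BagTree n}

theorem BagTree.length_bag_le {w : ℕ} (h : T.width ≤ w) (i : Fin T.size) :
    (T.bag i).length ≤ w + 1 := by
  have := Finset.le_sup (f := fun i => (T.bag i).length) (Finset.mem_univ i)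
  simp only [BagTree.width] at h this
  omega

/-- Every node is written in some bag. As an operation writes at most one word, `n` is at most the
time of `D`, which absorbs the linear cost of the setup. -/
theorem BagTree.IsTreeDecomposition.le_length (hT : T.IsTreeDecomposition G) :
    n ≤ T.encode.length := by
  have hsub : Finset.univ.image (fun u : Fin n => ((u : ℕ) : ℤ)) ⊆ T.encode.toFinset := by
    intro z hz
    obtain ⟨u, -, rfl⟩ := Finset.mem_image.1 hz
    obtain ⟨i, hi⟩ := hT.node_covered u
    rw [List.mem_toFinset, BagTree.encode, List.mem_cons, List.mem_flatMap]
    refine Or.inr ⟨i, List.mem_finRange i, ?_⟩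
    rw [List.mem_cons, List.mem_cons, List.mem_map]
    exact Or.inr (Or.inr ⟨u, hi, rfl⟩)
  have h1 := Finset.card_le_card hsub
  rw [Finset.card_image_of_injective _ (fun a b h => Fin.ext (by simpa using h))] at h1
  simpa using h1.trans (List.toFinset_card_le _)

/-- Every edge lies inside a bag, so bounded width makes the number of edges linear. -/
theorem BagTree.IsTreeDecomposition.card_edges_le (hT : T.IsTreeDecomposition G) {K : ℕ}
    (hK : ∀ i, (T.bag i).length ≤ K) : G.edges.card ≤ T.size * (K * K) := by
  have hsub : G.edges ⊆ Finset.univ.biUnion fun i =>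
      (T.bag i).toFinset ×ˢ (T.bag i).toFinset := by
    rintro ⟨u, v⟩ he
    obtain ⟨i, h1, h2⟩ := hT.edge_covered u v he
    simp only [Finset.mem_biUnion, Finset.mem_univ, true_and, Finset.mem_product,
      List.mem_toFinset]
    exact ⟨i, h1, h2⟩
  refine (Finset.card_le_card hsub).trans (Finset.card_biUnion_le.trans ?_)
  refine (Finset.sum_le_card_nsmul _ _ (K * K) fun i _ => ?_).trans (by simp)
  rw [Finset.card_product]
  have := (List.toFinset_card_le (T.bag i)).trans (hK i)
  exact Nat.mul_le_mul this this

theorem BagTree.abs_le_of_mem_encode {K : ℕ} (hK : ∀ i, (T.bag i).length ≤ K) {z : ℤ}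
    (hz : z ∈ T.encode) : 0 ≤ z ∧ (z ≤ T.size ∨ z ≤ K ∨ z ≤ n) := by
  rw [encode, List.mem_cons, List.mem_flatMap] at hz
  rcases hz with rfl | ⟨i, -, hz⟩
  · exact ⟨by positivity, Or.inl le_rfl⟩
  · rw [List.mem_cons, List.mem_cons, List.mem_map] at hz
    rcases hz with rfl | rfl | ⟨u, -, rfl⟩
    · exact ⟨by positivity, Or.inl (by have := (T.parent i).isLt; omega)⟩
    · exact ⟨by positivity, Or.inr (Or.inl (by exact_mod_cast hK i))⟩
    · exact ⟨by positivity, Or.inr (Or.inr (by have := u.isLt; omega))⟩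

/-- The program that computes the ratio values from the captured tree decomposition. -/
def fast (K : ℕ) : Cmd := setup K ;; search K

theorem fast_small (K : ℕ) : (fast K).comp.small 120 30 = true := by rfl

theorem fast_runs (K c : ℕ) : ∃ a : ℕ, ∀ {n : ℕ} {G : WGraph n} {T : BagTree n} {D : Program}
    {tD sD mD : ℕ} {ν : Fin n → ℚ}, 0 < n → T.IsTreeDecomposition G →
    (∀ i, (T.bag i).length ≤ K) → T.IsBalanced c → T.size ≤ c * n →
    (∀ u, G.IsRatioValue u (ν u)) → Runs D G.encode tD sD mD T.encode →
    ∃ t s m, Runs (.seq D.capture (fast K).comp) G.encode t s m (encodeValues ν) ∧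
      t ≤ a * (tD + n * Nat.log 2 (lam ν)) ∧ s ≤ a * (sD + n) ∧
      m ≤ a * (n * G.maxWeight + mD + 1) ^ 2 := by
  -- Per node: `c * c` for the stack of bags, `c * (K + 2)` for the words of the decomposition, `K`
  -- for the slots. `β` serves for the bound on values, `a1` for the setup time, `a2` for a round of
  -- the search.
  set e0 := c * c + c * (K + 2) + K + 2 with he0
  set β := e0 + 4 * (c * (K * K)) + K + 100 with hβ
  set a1 := (70 * K + 280) * (c + 1) + 100 * K + 200 with ha1
  set a2 := (c * (K * K) + 2) * rate K with ha2
  refine ⟨3 + a1 + 7 * a2 + 3 * a2 + (150 + 30 * e0) + (2 * β + 49), ?_⟩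
  clear_value e0 β a1 a2
  intro n G T D tD sD mD ν hn hT hK hbal hsize hν hD
  have hlen := T.encode_length_le hK
  have hnlen := hT.le_length
  have htD := hD.length_le
  have hcard := (hT.card_edges_le hK).trans (Nat.mul_le_mul_right _ hsize)
  set W := G.maxWeight with hW
  have hbd := fun u => (hν u).bounds
  have hnW : 1 ≤ n * W := (ν ⟨0, hn⟩).den_pos.trans_le (hbd ⟨0, hn⟩).2
  have hW1 : 1 ≤ W := Nat.pos_of_mul_pos_left hnW
  have hnnW : n ≤ n * W := Nat.le_mul_of_pos_right n hW1
  set X := n * W + mD + 1 with hX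
  have hXX : X ≤ X ^ 2 := Nat.le_self_pow (by norm_num) _
  have hcn : c * n * (K + 2) = n * (c * (K + 2)) := by ring
  have hE0 : n * e0 = n * (c * c) + n * (c * (K + 2)) + n * K + n * 2 := by rw [he0]; ring
  -- Balance is used only through this crude bound on the stack.
  have hlev : ∀ i, T.level i ≤ n * (c * c) := by
    intro i
    calc T.level i ≤ c * Nat.log 2 T.size := hbal i
      _ ≤ c * (c * n) := Nat.mul_le_mul_left _ ((Nat.log_le_self _ _).trans hsize)
      _ = n * (c * c) := by ring
  have hlen' : T.encode.length ≤ 1 + n * (c * (K + 2)) := by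
    rw [← hcn]; exact hlen.trans (Nat.add_le_add_left (Nat.mul_le_mul_right _ hsize) _)
  have hcnK : c * n ≤ n * (c * (K + 2)) := by
    rw [← hcn]; exact Nat.le_mul_of_pos_right _ (by omega)
  have hcard' : G.edges.card ≤ n * (c * (K * K)) := hcard.trans (by ring_nf; rfl)
  have hB1 : n * e0 + 4 * (n * (c * (K * K))) + K + 100 + 24 * X ^ 2 ≤ (β + 24) * X ^ 2 := by
    have h1 : n * e0 ≤ X ^ 2 * e0 := Nat.mul_le_mul_right _ (by omega)
    have h2 : n * (c * (K * K)) ≤ X ^ 2 * (c * (K * K)) := Nat.mul_le_mul_right _ (by omega)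
    have h3 : (K + 100) * 1 ≤ (K + 100) * X ^ 2 := Nat.mul_le_mul_left _ (by omega)
    have h4 : (β + 24) * X ^ 2 = X ^ 2 * e0 + 4 * (X ^ 2 * (c * (K * K))) + (K + 100) * X ^ 2
        + 24 * X ^ 2 := by rw [hβ]; ring
    omega
  have hnX : n * W ≤ X := by omega
  -- Numerators and denominators are at most `N = n * W`, so weights with respect to candidates are
  -- of order `N * W` and distances of order `n * N * W`, which is quadratic in `n * W`.
  have hsearch : 4 * (n + 1) * (3 * (n * W) * W) ≤ 24 * X ^ 2 := by
    calc 4 * (n + 1) * (3 * (n * W) * W) = 12 * (n * W + W) * (n * W) := by ring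
      _ ≤ 24 * (n * W) * (n * W) := Nat.mul_le_mul_right _ (by
          have : W ≤ n * W := Nat.le_mul_of_pos_left W hn
          omega)
      _ = 24 * (n * W) ^ 2 := by ring
      _ ≤ 24 * X ^ 2 := Nat.mul_le_mul_left _ (Nat.pow_le_pow_left hnX 2)
  have hX2 : 1 ≤ X ^ 2 := by omega
  have hBone : (1 : ℤ) ≤ (((β + 24) * X ^ 2 : ℕ) : ℤ) := by omega
  have hWX : W ≤ n * W := Nat.le_mul_of_pos_left W hn
  obtain ⟨t, s, m, hr, ht, hs, hm⟩ := runs_capture_of_wp hD (main := fast K) (m := 30)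
    (T := ((70 * K + 280) * (T.size + 1) + n * (100 * K + 100) + 100) +
      (3 * Nat.log 2 (lam ν) + 7) * ((n + G.edges.card + 1) * rate K)) (O := encodeValues ν)
    (by norm_num) (by norm_num) (fast_small K) hBone (E := ((n * e0 : ℕ) : ℤ)) (by omega)
    (fun z hz => by
      obtain ⟨h1, h2⟩ := T.abs_le_of_mem_encode hK hz
      omega) (by omega) (by omega) (by
      intro ext0 s0 h0 hv hbuf harr hout
      set Γ : Ctx := ⟨G.encode, (((β + 24) * X ^ 2 : ℕ) : ℤ), ((n * e0 : ℕ) : ℤ), ext0, hBone⟩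
        with hΓ
      have hcardB : 4 * (G.edges.card : ℤ) + 10 ≤ Γ.B := by simp only [hΓ]; omega
      have hnK : (n * K : ℤ) ≤ Γ.E := by simp only [hΓ]; norm_cast; omega
      have hKB : (K : ℤ) ≤ Γ.B := by simp only [hΓ]; omega
      have hEB : Γ.E + 10 ≤ Γ.B := by simp only [hΓ]; omega
      have hnE : (n : ℤ) ≤ Γ.E := by simp only [hΓ]; omega
      have hF : Fits Γ T := ⟨hnE, by simp only [hΓ]; omega, by simp only [hΓ]; omega,
        fun i => by have := hlev i; simp only [hΓ]; omega, hEB⟩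
      have hRoom : Room Γ G K := ⟨rfl, hnE, hnK, hKB, hcardB, by simp only [hΓ]; omega, hEB⟩
      have hSB : SearchBound Γ G ν ((n * W : ℕ) : ℤ) := by
        refine ⟨by exact_mod_cast hnW, fun u => by exact_mod_cast (hbd u).1,
          fun u => by exact_mod_cast (hbd u).2, ?_, by simp only [hΓ]; omega⟩
        have : 4 * (n + 1) * (3 * (n * W) * W) + 10 ≤ (β + 24) * X ^ 2 := by omega
        simp only [hΓ]
        exact_mod_cast this
      rw [fast, wp_seq]
      refine wp_use (setup_wp hF hT rfl (by omega) hbuf (hv 12 (by norm_num))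
        (harr 2 (by norm_num)) (harr 4 (by norm_num)) hK hn hnK hKB) ?_
      rintro t1 s1 ⟨ht1, L, hL⟩ hf1
      refine wp_mono _ (search_wp hRoom hν hSB hL (fun a h1 h2 k => ?_)
        ((hf1.out (by rfl)).trans hout)) ?_
      · have : (setup K).keepsA a = true := by interval_cases a <;> rfl
        rw [hf1.arr a this]
        exact harr a (by omega) k
      · rintro t2 s2 ⟨ht2, ho⟩
        exact ⟨by omega, ho⟩)
  refine ⟨t, s, m, hr, ht.trans ?_, hs.trans ?_, ?_⟩
  · have h1 : (70 * K + 280) * (T.size + 1) + n * (100 * K + 100) + 100 ≤ n * a1 := by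
      have h2 : (70 * K + 280) * (T.size + 1) ≤ (70 * K + 280) * (n * (c + 1)) :=
        Nat.mul_le_mul_left _ (by rw [Nat.mul_add, mul_comm n c]; omega)
      have h3 : n * a1 = (70 * K + 280) * (n * (c + 1)) + n * (100 * K + 100) + n * 100 := by
        rw [ha1]; ring
      omega
    have h2 : (n + G.edges.card + 1) * rate K ≤ n * a2 := by
      rw [ha2, ← Nat.mul_assoc]
      exact Nat.mul_le_mul_right _ (by rw [Nat.mul_add]; omega)
    have h3 := Nat.mul_le_mul_left (3 * Nat.log 2 (lam ν) + 7) h2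
    have h4 : n * a1 ≤ tD * a1 := Nat.mul_le_mul_right _ (by omega)
    have h5 : n * a2 ≤ tD * a2 := Nat.mul_le_mul_right _ (by omega)
    calc _ ≤ 3 * tD + (n * a1 + (3 * Nat.log 2 (lam ν) + 7) * (n * a2)) := by omega
      _ = 3 * tD + n * a1 + 7 * (n * a2) + 3 * a2 * (n * Nat.log 2 (lam ν)) := by ring
      _ ≤ 3 * tD + tD * a1 + 7 * (tD * a2) + 3 * a2 * (n * Nat.log 2 (lam ν)) := by omega
      _ = (3 + a1 + 7 * a2) * tD + 3 * a2 * (n * Nat.log 2 (lam ν)) := by ring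
      _ ≤ _ := by
        rw [Nat.mul_add]
        exact Nat.add_le_add (Nat.mul_le_mul_right _ (by omega)) (Nat.mul_le_mul_right _ (by omega))
  · rw [Int.toNat_natCast]
    calc sD + 120 + 30 * (n * e0 + 1) ≤ 1 * sD + (150 + 30 * e0) * n := by
          rw [Nat.add_mul, show 30 * e0 * n = 30 * (n * e0) by ring]; omega
      _ ≤ _ := by
        rw [Nat.mul_add]
        exact Nat.add_le_add (Nat.mul_le_mul_right _ (by omega)) (Nat.mul_le_mul_right _ (by omega))
  · have : m ≤ (2 * β + 49) * X ^ 2 := by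
      rw [show (2 * β + 49) * X ^ 2 = 2 * ((β + 24) * X ^ 2) + X ^ 2 by ring]
      omega
    exact this.trans (Nat.mul_le_mul_right _ (by omega))

end Fast

/-! ## Distances by repeated squaring -/

section Squaring

variable {n : ℕ}

/-- Least weight of a walk with at most `2 ^ j` edges. -/
def dist2 (w : Fin n → Fin n → WithTop ℤ) : ℕ → Fin n → Fin n → WithTop ℤ
  | 0, u, v => min (w u v) (if u = v then 0 else ⊤)
  | j + 1, u, v => Finset.univ.inf fun x => dist2 w j u x + dist2 w j x v

variable {w : Fin n → Fin n → WithTop ℤ}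

/-- The minimum in the recursion restricted to the first `k` nodes. -/
def best (w : Fin n → Fin n → WithTop ℤ) (j : ℕ) (u v : Fin n) (k : ℕ) : WithTop ℤ :=
  (Finset.univ.filter fun x : Fin n => (x : ℕ) < k).inf fun x => dist2 w j u x + dist2 w j x v

theorem best_zero (j : ℕ) (u v : Fin n) : best w j u v 0 = ⊤ := by simp [best]

theorem best_succ (j : ℕ) (u v x : Fin n) :
    best w j u v (x + 1) = min (best w j u v x) (dist2 w j u x + dist2 w j x v) := by
  have : (Finset.univ.filter fun y : Fin n => (y : ℕ) < x + 1) =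
      insert x (Finset.univ.filter fun y : Fin n => (y : ℕ) < x) := by
    ext y
    simp only [Finset.mem_filter, Finset.mem_univ, true_and, Finset.mem_insert, Fin.ext_iff]
    omega
  rw [best, this, Finset.inf_insert, inf_comm]; rfl

theorem best_all (j : ℕ) (u v : Fin n) : best w j u v n = dist2 w (j + 1) u v := by
  simp [best, dist2]

theorem best_eq_coe {j k : ℕ} {u v : Fin n} {z : ℤ} (h : best w j u v k = z) :
    ∃ x z1 z2 : _, dist2 w j u x = (z1 : ℤ) ∧ dist2 w j x v = (z2 : ℤ) ∧ z = z1 + z2 := by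
  rcases (Finset.univ.filter fun x : Fin n => (x : ℕ) < k).eq_empty_or_nonempty with he | hne
  · rw [best, he] at h; simp at h
  · obtain ⟨x, -, hx⟩ := Finset.exists_mem_eq_inf _ hne fun x => dist2 w j u x + dist2 w j x v
    rw [best, hx] at h
    obtain ⟨z1, z2, h1, h2, h3⟩ := WithTop.add_eq_coe.1 h
    exact ⟨x, z1, z2, h1.symm, h2.symm, h3.symm⟩

theorem dist2_abs_le {M : ℤ} (h0 : 0 ≤ M) (hM : ∀ x y z, w x y = (z : ℤ) → |z| ≤ M) (j : ℕ) :
    ∀ {u v : Fin n} {z : ℤ}, dist2 w j u v = z → |z| ≤ 2 ^ j * M := by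
  induction j with
  | zero =>
    intro u v z h
    rw [dist2] at h
    rcases min_choice (w u v) (if u = v then 0 else ⊤) with h' | h' <;> rw [h'] at h
    · simpa using hM _ _ _ h
    · split_ifs at h with huv
      · have : z = 0 := by exact_mod_cast h.symm
        simpa [this] using h0
      · simp at h
  | succ j ih =>
    intro u v z h
    rw [← best_all] at h
    obtain ⟨x, z1, z2, h1, h2, rfl⟩ := best_eq_coe h
    have := ih h1
    have := ih h2
    refine (abs_add_le _ _).trans ?_
    rw [pow_succ]; linarith

theorem exists_wk_of_dist2 (j : ℕ) : ∀ {u v : Fin n} {z : ℤ}, dist2 w j u v = z →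
    (u = v ∧ z = 0) ∨ ∃ l, Wk w u l v z := by
  induction j with
  | zero =>
    intro u v z h
    rw [dist2] at h
    rcases min_choice (w u v) (if u = v then 0 else ⊤) with h' | h' <;> rw [h'] at h
    · exact Or.inr ⟨[], .edge h⟩
    · split_ifs at h with huv
      · exact Or.inl ⟨huv, by exact_mod_cast h.symm⟩
      · simp at h
  | succ j ih =>
    intro u v z h
    rw [← best_all] at h
    obtain ⟨x, z1, z2, h1, h2, rfl⟩ := best_eq_coe h
    rcases ih h1 with ⟨rfl, rfl⟩ | ⟨l, hl⟩ <;> rcases ih h2 with ⟨rfl, rfl⟩ | ⟨l', hl'⟩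
    · exact Or.inl ⟨rfl, rfl⟩
    · exact Or.inr ⟨l', by simpa using hl'⟩
    · exact Or.inr ⟨l, by simpa using hl⟩
    · exact Or.inr ⟨_, hl.append hl'⟩

theorem dist2_self_le (j : ℕ) (u : Fin n) : dist2 w j u u ≤ 0 := by
  induction j with
  | zero => simp [dist2]
  | succ j ih =>
    refine (Finset.inf_le (Finset.mem_univ u)).trans ?_
    simpa using add_le_add ih ih

/-- A walk with more than `2 ^ j` edges is cut after exactly `2 ^ j` of them, that is after `2 ^ j -
1` inner vertices; a shorter one uses its endpoint as middle node. -/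
theorem dist2_le (j : ℕ) : ∀ {u v : Fin n} {l : List (Fin n)} {z : ℤ}, Wk w u l v z →
    l.length + 1 ≤ 2 ^ j → dist2 w j u v ≤ z := by
  induction j with
  | zero =>
    intro u v l z h hl
    obtain rfl : l = [] := List.eq_nil_of_length_eq_zero (by omega)
    cases h with
    | edge h => rw [dist2, h]; exact min_le_left _ _
  | succ j ih =>
    intro u v l z h hl
    rw [pow_succ] at hl
    by_cases hj : l.length + 1 ≤ 2 ^ j
    · refine (Finset.inf_le (Finset.mem_univ v)).trans ?_
      simpa using add_le_add (ih h hj) (dist2_self_le j v)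
    · obtain ⟨a, q, hq⟩ : ∃ a q, l.drop (2 ^ j - 1) = a :: q := by
        cases hd : l.drop (2 ^ j - 1) with
        | nil =>
          have := List.drop_eq_nil_iff.1 hd
          omega
        | cons a q => exact ⟨a, q, rfl⟩
      have hpos : 0 < 2 ^ j := by positivity
      have hlen := congrArg List.length hq
      simp only [List.length_drop, List.length_cons] at hlen
      rw [← List.take_append_drop (2 ^ j - 1) l, hq] at h
      obtain ⟨z1, z2, h1, h2, rfl⟩ := h.split
      refine (Finset.inf_le (Finset.mem_univ a)).trans ?_
      push_cast
      refine add_le_add (ih h1 ?_) (ih h2 (by omega))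
      rw [List.length_take]; omega

/-- With all weights replaced by `0`, walks can be shortened to distinct inner vertices although
negative closed walks may exist. This serves reachability. -/
theorem Wk.const {u v : Fin n} {l : List (Fin n)} {z : ℤ} (h : Wk w u l v z) :
    Wk (fun x y => if w x y = ⊤ then ⊤ else 0) u l v 0 := by
  induction h with
  | edge h => exact .edge (by simp [h])
  | cons h _ ih => exact .cons (z := 0) (z' := 0) (by simp [h]) ih

theorem Wk.of_const {u v : Fin n} {l : List (Fin n)} {z : ℤ}
    (h : Wk (fun x y => if w x y = ⊤ then ⊤ else 0) u l v z) : ∃ z', Wk w u l v z' ∧ z = 0 := by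
  induction h with
  | @edge x y z h =>
    cases hw : w x y with
    | top => simp [hw] at h
    | coe z' => exact ⟨z', .edge hw, by simp [hw] at h; exact_mod_cast h⟩
  | @cons x a y l z _ h _ ih =>
    obtain ⟨z2, h2, rfl⟩ := ih
    cases hw : w x a with
    | top => simp [hw] at h
    | coe z' => exact ⟨_, .cons hw h2, by simp [hw] at h; simpa using (by exact_mod_cast h)⟩

/-- A reachable node is reached by a walk with at most `n` inner vertices, hence `n + 1` edges;
weights do not matter for this. -/
theorem dist2_ne_top_iff {j : ℕ} (hj : n + 1 ≤ 2 ^ j) {u v : Fin n} :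
    dist2 w j u v ≠ ⊤ ↔ Rch w u v := by
  constructor
  · intro h
    obtain ⟨z, hz⟩ := WithTop.ne_top_iff_exists.1 h
    rcases exists_wk_of_dist2 j hz.symm with ⟨rfl, -⟩ | ⟨l, hl⟩
    · exact .refl
    · exact hl.rch
  · intro h
    have : u = v ∨ ∃ l z, Wk w u l v z := by
      induction h with
      | refl => exact Or.inl rfl
      | @tail b c _ h ih =>
        obtain ⟨z, hz⟩ := WithTop.ne_top_iff_exists.1 h
        rcases ih with rfl | ⟨l, z', h'⟩
        · exact Or.inr ⟨[], z, .edge hz.symm⟩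
        · exact Or.inr ⟨_, _, h'.append (.edge hz.symm)⟩
    rcases this with rfl | ⟨l, z, h⟩
    · exact ne_top_of_le_ne_top (by simp) (dist2_self_le j u)
    · obtain ⟨l', z', h1, -, h2, -⟩ := Wk.exists_nodup (A := Set.univ)
        (fun a l z _ _ h => (Wk.of_const h).choose_spec.2.ge) h.const (by simp)
      obtain ⟨z'', h3, -⟩ := Wk.of_const h1
      have := h2.length_le_card
      rw [Fintype.card_fin] at this
      exact ne_top_of_le_ne_top (by simp) (dist2_le j h3 (by omega))

/-- Short closed walks are found by looking at all edges. -/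
theorem bad_iff_dist2 {j : ℕ} (hj : n + 1 ≤ 2 ^ j) {θ : ℤ} (hθ : 0 ≤ θ) {u : Fin n} :
    Bad w θ u ↔ ∃ y x, dist2 w j u y ≠ ⊤ ∧ w y x + dist2 w j x y < θ := by
  constructor
  · rintro ⟨y, l, z, h1, h2, h3⟩
    obtain ⟨y', l', z', hy', h4, h5, h6⟩ := Wk.exists_cycle hθ _ rfl h2 h3
    have hr : Rch w u y' := by
      rcases List.mem_cons.1 hy' with rfl | hm
      · exact h1
      · exact h1.trans (h2.rch_mem hm).1
    have hlen := h6.length_le_card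
    simp only [List.length_append, List.length_singleton, Fintype.card_fin] at hlen
    have h5' : ((z' : ℤ) : WithTop ℤ) < (θ : ℤ) := by exact_mod_cast h5
    cases h4 with
    | edge h =>
      refine ⟨y', y', (dist2_ne_top_iff hj).2 hr, lt_of_le_of_lt ?_ h5'⟩
      rw [h]
      simpa using add_le_add_right (dist2_self_le j y') (z' : WithTop ℤ)
    -- The first edge of the simple cycle is split off; the walk back is short enough for `dist2`.
    | @cons _ a _ q z1 z2 h h' =>
      refine ⟨y', a, (dist2_ne_top_iff hj).2 hr, lt_of_le_of_lt ?_ h5'⟩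
      rw [h]
      push_cast
      simp only [List.length_cons] at hlen
      exact add_le_add le_rfl (dist2_le j h' (by omega))
  · rintro ⟨y, x, h1, h2⟩
    have hne : w y x + dist2 w j x y ≠ ⊤ := ne_top_of_lt h2
    obtain ⟨z, hz⟩ := WithTop.ne_top_iff_exists.1 hne
    obtain ⟨z1, z2, h3, h4, h5⟩ := WithTop.add_eq_coe.1 hz.symm
    rw [← hz] at h2
    have h2 : z < θ := by exact_mod_cast h2
    have hr := (dist2_ne_top_iff hj).1 h1
    rcases exists_wk_of_dist2 j h4.symm with ⟨rfl, rfl⟩ | ⟨l, hl⟩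
    · exact ⟨x, [], z1, hr, .edge h3.symm, by omega⟩
    · exact ⟨y, _, _, hr, .cons h3.symm hl, by omega⟩

end Squaring

open Cmd

/-! ## Distances in logarithmic space -/

namespace Cmd

theorem iter_exists {Γ : Ctx} {e : Ex} {p : Cmd}
    (ihp : ∀ {Q : ℕ → ℕ → St → Prop} {s : St}, p.wp Γ (fun t s' => ∃ i, Q i t s') s →
      ∃ i, p.wp Γ (Q i) s) (k : ℕ) : ∀ {Q : ℕ → ℕ → St → Prop} {s : St},
    iter Γ e (p.wp Γ) k (fun t s' => ∃ i, Q i t s') s → ∃ i, iter Γ e (p.wp Γ) k (Q i) s := by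
  induction k with
  | zero =>
    rintro Q s ⟨h1, h2, i, h3⟩
    exact ⟨i, h1, h2, h3⟩
  | succ k ih =>
    rintro Q s ⟨h1, h2, h3⟩
    by_cases hp : 0 < e.eval Γ s
    · obtain ⟨i, hi⟩ := ihp (wp_mono p (h3 hp) fun t s' h' => ih h')
      exact ⟨i, h1, fun hn => absurd hp hn, fun _ => hi⟩
    · obtain ⟨i, hi⟩ := h2 hp
      exact ⟨i, h1, fun _ => hi, fun h => absurd h hp⟩

/-- Programs are deterministic. -/
theorem wp_exists {Γ : Ctx} (p : Cmd) : ∀ {Q : ℕ → ℕ → St → Prop} {s : St},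
    p.wp Γ (fun t s' => ∃ i, Q i t s') s → ∃ i, p.wp Γ (Q i) s := by
  induction p with
  | skip => exact fun ⟨i, h⟩ => ⟨i, h⟩
  | asg x e => exact fun ⟨h1, h2, i, h⟩ => ⟨i, h1, h2, h⟩
  | sto a e f => exact fun ⟨h1, h2, h3, h4, h5, i, h⟩ => ⟨i, h1, h2, h3, h4, h5, h⟩
  | wr e => exact fun ⟨h1, i, h⟩ => ⟨i, h1, h⟩
  | seq p q ihp ihq => exact fun h => ihp (wp_mono p h fun t s' h' => ihq h')
  | ite e p q ihp ihq =>
    rintro Q s ⟨h1, h2, h3⟩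
    by_cases hp : 0 < e.eval Γ s
    · obtain ⟨i, hi⟩ := ihp (h2 hp)
      exact ⟨i, h1, fun _ => hi, fun h => absurd hp h⟩
    · obtain ⟨i, hi⟩ := ihq (h3 hp)
      exact ⟨i, h1, fun h => absurd h hp, fun _ => hi⟩
  | whl e p ihp =>
    rintro Q s ⟨k, hk⟩
    obtain ⟨i, hi⟩ := iter_exists ihp k hk
    exact ⟨i, k, hi⟩

/-- Execute one iteration of a loop; the time is ignored. -/
theorem wp_whl_next {Γ : Ctx} {e : Ex} {p : Cmd} {Q : St → Prop} {s : St} (he : e.ok Γ s)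
    (hpos : 0 < e.eval Γ s) (h : p.wp Γ (fun _ s' => (whl e p).wp Γ (fun _ => Q) s') s) :
    (whl e p).wp Γ (fun _ => Q) s := by
  obtain ⟨k, hk⟩ := wp_exists p (Q := fun k _ s' => iter Γ e (p.wp Γ) k (fun _ => Q) s') h
  exact ⟨k + 1, he, fun hn => absurd hpos hn, fun _ => hk⟩

theorem wp_whl_stop {Γ : Ctx} {e : Ex} {p : Cmd} {Q : St → Prop} {s : St} (he : e.ok Γ s)
    (hneg : ¬ 0 < e.eval Γ s) (h : Q s) : (whl e p).wp Γ (fun _ => Q) s :=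
  ⟨0, he, hneg, h⟩

end Cmd

section Machine

variable {n : ℕ} {G : WGraph n} {Γ : Ctx}

/-- Weights with respect to the fraction `a / b` at all nodes. -/
noncomputable def cwAt (G : WGraph n) (a b : ℤ) : Fin n → Fin n → WithTop ℤ :=
  G.cw fun _ => (a, b)

/-- Variables `2, 3, 4, 51, 52` hold the numbers of nodes and edges, the recursion depth, and the
denominator and numerator of the threshold. -/
structure Env (G : WGraph n) (J : ℕ) (a b : ℤ) (s : St) : Prop where
  nodes : s.var 2 = n
  edges : s.var 3 = G.edges.card
  depth : s.var 4 = J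
  den : s.var 51 = b
  num : s.var 52 = a

theorem Env.of_fr {J : ℕ} {a b : ℤ} {s s' : St} (h : Env G J a b s) {p : Cmd} (hf : p.Fr s s')
    (ha : (p.keeps 2 && p.keeps 3 && p.keeps 4 && p.keeps 51 && p.keeps 52) = true) :
    Env G J a b s' := by
  simp only [Bool.and_eq_true] at ha
  obtain ⟨⟨⟨⟨h2, h3⟩, h4⟩, h5⟩, h6⟩ := ha
  exact ⟨(hf.var _ h2).trans h.1, (hf.var _ h3).trans h.2, (hf.var _ h4).trans h.3,
    (hf.var _ h5).trans h.4, (hf.var _ h6).trans h.5⟩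

/-- What the machine needs; `M` bounds the weights of the edges. -/
structure Space (Γ : Ctx) (G : WGraph n) (J : ℕ) (a b M : ℤ) : Prop where
  inp : Γ.inp = G.encode
  edge : 4 * (G.edges.card : ℤ) + 10 ≤ Γ.B
  weight : (G.maxWeight : ℤ) ≤ Γ.B
  depth : (J : ℤ) + 1 ≤ Γ.E
  bound : Γ.E + 10 ≤ Γ.B
  node : (n : ℤ) + 10 ≤ Γ.B
  nonneg : 0 ≤ M
  left : ∀ e ∈ G.edges, |b * G.wt e| ≤ M
  right : ∀ e ∈ G.edges, |a * (G.wt' e : ℕ)| ≤ M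
  value : (2 ^ J + 1) * (2 * M) ≤ Γ.B

theorem Space.abs_le {J : ℕ} {a b M : ℤ} (h : Space Γ G J a b M) (x y : Fin n) (z : ℤ)
    (hz : cwAt G a b x y = z) : |z| ≤ 2 * M := by
  obtain ⟨h1, -, rfl⟩ := WGraph.cw_eq.1 hz
  have b1 := h.left _ h1
  have b2 := h.right _ h1
  have := abs_sub (b * G.wt (x, y)) (a * (G.wt' (x, y) : ℕ))
  simp only
  omega

theorem Space.two_le {J : ℕ} {a b M : ℤ} (h : Space Γ G J a b M) {j : ℕ} (hj : j ≤ J) :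
    2 ^ j * (2 * M) + 2 * M ≤ Γ.B := by
  have h1 := h.value
  have h2 : (2 : ℤ) ^ j ≤ 2 ^ J := pow_le_pow_right₀ (by norm_num) hj
  have h3 := h.nonneg
  nlinarith

/-- Put the least weight of an edge from node `61` to node `62`, or `0` if they are equal, into
variable `65`. -/
def base : Cmd :=
  asg 64 (.eq (.V 61) (.V 62)) ;; asg 65 (.C 0) ;;
  loopTo 70 (.V 3) (
    asg 71 (.C 4 * .V 70 + .C 2) ;;
    ite (.and (.eq (.R (.V 71)) (.V 61)) (.eq (.R (.V 71 + .C 1)) (.V 62)))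
      (asg 72 (.V 51 * .R (.V 71 + .C 2) - .V 52 * .R (.V 71 + .C 3)) ;;
        ite (.or (.lt (.V 64) (.C 1)) (.lt (.V 72) (.V 65))) (asg 64 (.C 1) ;; asg 65 (.V 72)) skip)
      skip)

theorem base_wp {J : ℕ} {a b M : ℤ} (hS : Space Γ G J a b M) {s : St} (hE : Env G J a b s)
    {u v : Fin n} (hu : s.var 61 = (u : ℕ)) (hv : s.var 62 = (v : ℕ)) :
    base.wp Γ (fun _ s' => Holds (s'.var 64) (s'.var 65) (dist2 (cwAt G a b) 0 u v)) s := by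
  have hone := Γ.one_le
  have hb4 := hS.two_le (Nat.zero_le J)
  have hM := hS.abs_le
  obtain ⟨hinp, e1, e2, e3, e4, e5, e0, e6, e7, e8⟩ := hS
  simp only [base, wp_seq, wp_asg, Ex.ok_eq, Ex.ok_V, Ex.ok_C, Ex.eval_eq, Ex.eval_V, Ex.eval_C]
  norm_num
  constructorm* _ ∧ _
  any_goals omega
  refine wp_loopTo G.edges.card 200 (fun i s' => Holds (s'.var 64) (s'.var 65)
    (min (if (u, v) ∈ G.edgeList.take i then cwAt G a b u v else ⊤) (if u = v then 0 else ⊤)))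
    (by norm_num) (by rfl) (by omega) ?_ ?_ ?_ ?_
  · intro s' hf
    have := hf.var 3 (by rfl)
    simp at this
    simp [this, hE.edges]
  · simp only [hu, hv, List.take_zero]
    by_cases huv : u = v
    · subst huv; simp [Holds]
    · have : (u : ℕ) ≠ v := fun h => huv (Fin.ext h)
      simp [Holds, huv, this]
  · intro i s1 hi hf h70 hI
    rw [← G.edgeList_length] at hi
    have hlen := G.edgeList_length
    obtain ⟨w1, w2, w3, w4, w5⟩ := G.encode_edge hi
    have hmem := (G.mem_edgeList).1 (List.getElem_mem hi)
    have htake : G.edgeList.take (i + 1) = G.edgeList.take i ++ [G.edgeList[i]] :=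
      List.take_succ_eq_append_getElem hi
    obtain ⟨x, y, hxy⟩ : ∃ x y, G.edgeList[i] = (x, y) := ⟨_, _, rfl⟩
    rw [hxy] at w1 w2 w3 w4 hmem htake
    have hwt := WGraph.weight_le hmem
    have b1 := e6 _ hmem
    have b2 := e7 _ hmem
    rw [abs_le] at b1 b2 hwt
    rw [← hinp] at w1 w2 w3 w4 w5
    have h61 := (hf.var 61 (by rfl))
    have h62 := (hf.var 62 (by rfl))
    have h51 := (hf.var 51 (by rfl))
    have h52 := (hf.var 52 (by rfl))
    simp at h61 h62 h51 h52
    rw [hu] at h61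
    rw [hv] at h62
    rw [hE.den] at h51
    rw [hE.num] at h52
    have hxn := x.isLt
    have hyn := y.isLt
    have hcw : cwAt G a b x y =
        ((b * G.wt (x, y) - a * (G.wt' (x, y) : ℕ) : ℤ) : WithTop ℤ) :=
      WGraph.cw_eq.2 ⟨hmem, rfl, rfl⟩
    simp only [wp_seq, wp_asg, wp_ite, wp_skip, Ex.ok_V, Ex.ok_C, Ex.ok_R,
      Ex.ok_add, Ex.ok_sub, Ex.ok_eq, Ex.ok_lt, Ex.ok_or, Ex.ok_and, Ex.ok_mul, Ex.eval_eq,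
      Ex.eval_and, Ex.eval_or, Ex.eval_lt, Ex.eval_sub,
      Ex.eval_R, Ctx.bd, Ex.eval_mul, Ex.eval_V, Ex.eval_C, St.set_var, St.set_arr, Ex.eval_add,
      h70, zero_lt_ite_one]
    norm_num
    simp only [w1, w2, w3, w4, h61, h62, h51, h52]
    constructorm* _ ∧ _
    any_goals omega
    · intro h1 h2
      obtain rfl : x = u := Fin.ext (by exact_mod_cast h1)
      obtain rfl : y = v := Fin.ext (by exact_mod_cast h2)
      have hmin : min (if (x, y) ∈ G.edgeList.take (i + 1) then cwAt G a b x y else ⊤)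
          (if x = y then 0 else ⊤) = min (min (if (x, y) ∈ G.edgeList.take i then cwAt G a b x y
            else ⊤) (if x = y then 0 else ⊤))
          ((b * G.wt (x, y) - a * (G.wt' (x, y) : ℕ) : ℤ) : WithTop ℤ) := by
        rw [htake, ← hcw]
        by_cases h : (x, y) ∈ G.edgeList.take i
        · simp [h]
        · simp [h, min_comm]
      constructorm* _ ∧ _
      any_goals omega
      · intro h
        constructorm* _ ∧ _
        any_goals omega
        have h := hI.min_pos (c := b * G.wt (x, y) - a * (G.wt' (x, y) : ℕ)) (by omega)
        rw [hmin]
        simpa using h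
      · intro h1 h2
        have h := hI.min_neg (c := b * G.wt (x, y) - a * (G.wt' (x, y) : ℕ)) (by omega)
        rw [hmin]
        simpa using h
    · intro h
      have : ((u, v) ∈ G.edgeList.take (i + 1)) ↔ (u, v) ∈ G.edgeList.take i := by
        rw [htake, List.mem_append, List.mem_singleton]
        refine or_iff_left fun h' => ?_
        obtain ⟨rfl, rfl⟩ := Prod.mk.inj h'
        exact h rfl rfl
      simp only [this]
      exact hI
  · intro τ s1 hf _ hI hτ
    rw [← G.edgeList_length, List.take_length] at hI
    convert hI using 2
    rw [dist2]
    congr 1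
    split_ifs with h
    · rfl
    · by_contra hne
      exact h (G.mem_edgeList.2 (WGraph.cw_ne_top.1 hne).1)

end Machine

open Cmd

/-! ### The recursion with an explicit stack. -/

section Machine

variable {n : ℕ} {G : WGraph n} {Γ : Ctx}

/-- Proceed to the next middle node. -/
def nextMid : Cmd :=
  sto 3 (.V 60) (.A 3 (.V 60) + .C 1) ;;
  ite (.lt (.A 3 (.V 60)) (.V 2))
    (sto 7 (.V 60) (.C 0) ;; asg 61 (.A 1 (.V 60)) ;; asg 62 (.A 3 (.V 60)) ;; asg 63 (.C 1) ;;
      asg 60 (.V 60 - .C 1))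
    (asg 64 (.A 6 (.V 60)) ;; asg 65 (.A 5 (.V 60)))

/-- Start the computation of a distance at level `60`. -/
def callStep : Cmd :=
  ite (.V 60)
    (sto 1 (.V 60) (.V 61) ;; sto 2 (.V 60) (.V 62) ;; sto 3 (.V 60) (.C 0) ;;
      sto 6 (.V 60) (.C 0) ;; sto 7 (.V 60) (.C 0) ;; asg 62 (.C 0) ;; asg 60 (.V 60 - .C 1))
    (base ;; asg 63 (.C 0))

/-- Use the first distance. -/
def retFst : Cmd :=
  ite (.V 64)
    (sto 4 (.V 60) (.V 65) ;; sto 7 (.V 60) (.C 1) ;; asg 61 (.A 3 (.V 60)) ;;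
      asg 62 (.A 2 (.V 60)) ;; asg 63 (.C 1) ;; asg 60 (.V 60 - .C 1))
    nextMid

/-- Use the second distance. -/
def retSnd : Cmd :=
  ite (.V 64)
    (asg 67 (.A 4 (.V 60) + .V 65) ;;
      ite (.or (.lt (.A 6 (.V 60)) (.C 1)) (.lt (.V 67) (.A 5 (.V 60))))
        (sto 6 (.V 60) (.C 1) ;; sto 5 (.V 60) (.V 67)) skip)
    skip ;;
  nextMid

/-- The frame of a level keeps the ends and the middle node in arrays `1`, `2`, `3`, the first half
in `4`, the minimum so far and its flag in `5` and `6`. Array `7` tells which half is returning. A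
return at the top level ends the loop. -/
def retStep : Cmd :=
  ite (.lt (.V 60) (.V 4)) (asg 60 (.V 60 + .C 1) ;; ite (.A 7 (.V 60)) retSnd retFst)
    (asg 66 (.C 0))

/-- The recursion, with an explicit stack. -/
def recur : Cmd := whl (.V 66) (ite (.V 63) callStep retStep)

/-- The distance from node `61` to node `62`. -/
def dist : Cmd := asg 60 (.V 4) ;; asg 63 (.C 1) ;; asg 66 (.C 1) ;; recur

/-- State of the recursion at level `L + 1`, where `k` middle nodes are finished. -/
structure Frame (G : WGraph n) (J : ℕ) (a b : ℤ) (L : ℕ) (u v x : Fin n) (k : ℕ) (s0 s : St) :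
    Prop where
  env : Env G J a b s
  run : s.var 66 = 1
  fst : s.arr 1 ((L : ℤ) + 1) = (u : ℕ)
  snd : s.arr 2 ((L : ℤ) + 1) = (v : ℕ)
  mid : s.arr 3 ((L : ℤ) + 1) = (x : ℕ)
  best : Holds (s.arr 6 ((L : ℤ) + 1)) (s.arr 5 ((L : ℤ) + 1)) (best (cwAt G a b) L u v k)
  above : ∀ c (i : ℤ), (L : ℤ) + 1 < i → s.arr c i = s0.arr c i

variable {J : ℕ} {a b M : ℤ}

theorem Frame.of_above {L : ℕ} {u v x : Fin n} {k : ℕ} {s0 s s' : St}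
    (h : Frame G J a b L u v x k s0 s) (hE : Env G J a b s') (hr : s'.var 66 = 1)
    (ha : ∀ c (i : ℤ), (L : ℤ) < i → s'.arr c i = s.arr c i) : Frame G J a b L u v x k s0 s' := by
  have hl : (L : ℤ) < L + 1 := by omega
  refine ⟨hE, hr, ?_, ?_, ?_, ?_, fun c i hi => ?_⟩
  · rw [ha _ _ hl]; exact h.fst
  · rw [ha _ _ hl]; exact h.snd
  · rw [ha _ _ hl]; exact h.mid
  · rw [ha _ _ hl, ha _ _ hl]; exact h.best
  · rw [ha _ _ (by omega)]; exact h.above c i hi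

/-- After a return at level `L` from `s0`, with the given distance, the recursion leads to `Q`. -/
def Returns (Γ : Ctx) (G : WGraph n) (J : ℕ) (a b : ℤ) (L : ℕ) (u v : Fin n) (Q : St → Prop)
    (s0 : St) : Prop :=
  ∀ s', Env G J a b s' → s'.var 60 = L → s'.var 63 = 0 → s'.var 66 = 1 →
    Holds (s'.var 64) (s'.var 65) (dist2 (cwAt G a b) L u v) →
    (∀ c (i : ℤ), (L : ℤ) < i → s'.arr c i = s0.arr c i) → recur.wp Γ (fun _ => Q) s'

/-- The recursion at level `L` works. -/
def Works (Γ : Ctx) (G : WGraph n) (J : ℕ) (a b : ℤ) (L : ℕ) : Prop :=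
  ∀ (Q : St → Prop) (s : St) (u v : Fin n), Env G J a b s → s.var 60 = L → s.var 61 = (u : ℕ) →
    s.var 62 = (v : ℕ) → s.var 63 = 1 → s.var 66 = 1 → Returns Γ G J a b L u v Q s →
    recur.wp Γ (fun _ => Q) s

theorem recur_call {Q : St → Prop} {s : St} (h63 : s.var 63 = 1) (h66 : s.var 66 = 1)
    (h : callStep.wp Γ (fun _ s' => recur.wp Γ (fun _ => Q) s') s) :
    recur.wp Γ (fun _ => Q) s :=
  wp_whl_next (by norm_num) (by simp [h66])
    ((wp_ite _ _ _ _ _ _).2 ⟨by norm_num, fun _ => h, fun h' => by simp [h63] at h'⟩)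

theorem recur_return {Q : St → Prop} {s : St} (h63 : s.var 63 = 0) (h66 : s.var 66 = 1)
    (h : retStep.wp Γ (fun _ s' => recur.wp Γ (fun _ => Q) s') s) :
    recur.wp Γ (fun _ => Q) s :=
  wp_whl_next (by norm_num) (by simp [h66])
    ((wp_ite _ _ _ _ _ _).2 ⟨by norm_num, fun h' => by simp [h63] at h', fun _ => h⟩)

theorem retStep_wp {L : ℕ} (hS : Space Γ G J a b M) (hLJ : L < J) {Q : St → Prop} {s : St}
    (hE : Env G J a b s) (h60 : s.var 60 = L)
    (h : (0 < s.arr 7 ((L : ℤ) + 1) → retSnd.wp Γ (fun _ => Q) (s.set 60 ((L : ℤ) + 1))) ∧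
      (¬ 0 < s.arr 7 ((L : ℤ) + 1) → retFst.wp Γ (fun _ => Q) (s.set 60 ((L : ℤ) + 1)))) :
    retStep.wp Γ (fun _ => Q) s := by
  have hone := Γ.one_le
  have e1 := hS.depth
  have e2 := hS.bound
  simp only [retStep, wp_ite, wp_seq, wp_asg, Ex.ok_V, Ex.ok_A, Ex.ok_lt, Ex.ok_add, Ex.ok_C,
    Ex.eval_V, Ex.eval_A, Ex.eval_lt, Ex.eval_add, Ex.eval_C, zero_lt_ite_one, St.set_var,
    St.set_arr, h60, hE.depth]
  norm_num
  exact ⟨fun _ => ⟨⟨⟨by omega, by omega⟩, by omega, by omega⟩, ⟨by omega, by omega⟩, h.1,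
    fun h' => h.2 (by omega)⟩, fun h' => absurd hLJ (by omega)⟩

theorem works_zero (hS : Space Γ G J a b M) : Works Γ G J a b 0 := by
  intro Q s u v hE h60 h61 h62 h63 h66 hQ
  have hone := Γ.one_le
  refine recur_call h63 h66 ?_
  simp only [callStep, wp_ite, wp_seq, Ex.ok_V, Ex.eval_V, h60]
  norm_num
  refine wp_use (base_wp hS hE h61 h62) ?_
  rintro t s1 h hf
  refine ⟨by omega, ?_⟩
  refine hQ _ (Env.of_fr (p := base ;; asg 63 (.C 0)) hE ?_ (by rfl)) ?_ ?_ ?_ ?_ ?_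
  · refine ⟨fun x hx => ?_, fun c hc => ?_, fun _ => hf.out (by rfl)⟩
    · simp only [keeps, Bool.and_eq_true] at hx
      rw [St.set_var, if_neg (by have := hx.2; simp at this; omega), hf.var x hx.1]
    · rw [St.set_arr]; exact hf.arr c (by simpa [keepsA] using hc)
  · simp [hf.var 60 (by rfl), h60]
  · simp
  · simp [hf.var 66 (by rfl), h66]
  · simpa using h
  · intro c i _
    have : base.keepsA c = true := rfl
    rw [St.set_arr, hf.arr c this]

/-- Either the next middle node is started with a fresh first half, or all `n` middle nodes are done
and the minimum is the value returned at level `L + 1`. -/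
theorem nextMid_wp {L : ℕ} (hS : Space Γ G J a b M) (hLJ : L < J) {Q : St → Prop} {s0 s : St}
    {u v x : Fin n} (hF : Frame G J a b L u v x (x + 1) s0 s) (h60 : s.var 60 = (L : ℤ) + 1)
    (h63 : s.var 63 = 0)
    (hnext : ∀ y : Fin n, (y : ℕ) = x + 1 → ∀ s', Frame G J a b L u v y y s0 s' →
      s'.var 60 = L → s'.var 61 = (u : ℕ) → s'.var 62 = (y : ℕ) → s'.var 63 = 1 →
      s'.arr 7 ((L : ℤ) + 1) = 0 → recur.wp Γ (fun _ => Q) s')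
    (hret : Returns Γ G J a b (L + 1) u v Q s0) :
    nextMid.wp Γ (fun _ s' => recur.wp Γ (fun _ => Q) s') s := by
  have hone := Γ.one_le
  have e1 := hS.depth
  have e2 := hS.node
  have e3 := hS.bound
  have hxn := x.isLt
  obtain ⟨hE, hr, hfst, hsnd, hmid, hbest, habove⟩ := hF
  simp only [nextMid, wp_ite, wp_seq, wp_sto, wp_asg, Ex.ok_V, Ex.ok_C, Ex.ok_A, Ex.ok_lt, Ex.ok_add,
    Ex.ok_sub, Ex.eval_sub, Ex.eval_V, Ex.eval_C, Ex.eval_A, Ex.eval_lt, Ex.eval_add,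
    zero_lt_ite_one, St.put_var, St.put_arr, St.set_var, St.set_arr, h60, hE.nodes]
  norm_num
  rw [hmid]
  constructorm* _ ∧ _
  any_goals omega
  · intro hlt
    constructorm* _ ∧ _
    any_goals omega
    have hlt' : (x : ℕ) + 1 < n := by exact_mod_cast hlt
    refine hnext ⟨x + 1, hlt'⟩ rfl _ ⟨?_, ?_, ?_, ?_, ?_, ?_, ?_⟩ ?_ ?_ ?_ ?_ ?_
    · exact ⟨by simpa using hE.nodes, by simpa using hE.edges, by simpa using hE.depth,
        by simpa using hE.den, by simpa using hE.num⟩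
    · simpa using hr
    · simpa using hfst
    · simpa using hsnd
    · simp
    · simpa using hbest
    · intro c i hi
      have : i ≠ (L : ℤ) + 1 := by omega
      simpa [this] using habove c i hi
    · simp
    · simpa using hfst
    · simp
    · simp
    · simp
  · intro hge
    constructorm* _ ∧ _
    any_goals omega
    refine hret _ ⟨by simpa using hE.nodes, by simpa using hE.edges, by simpa using hE.depth,
        by simpa using hE.den, by simpa using hE.num⟩ (by simp [h60]) (by simpa using h63)
        (by simpa using hr) ?_ ?_
    · have hx : (x : ℕ) + 1 = n := by omega
      rw [hx, best_all] at hbest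
      simpa using hbest
    · intro c i hi
      push_cast at hi
      have : i ≠ (L : ℤ) + 1 := by omega
      simpa [this] using habove c i hi

/-- Induction on the number `m` of middle nodes left. Each needs at most two calls at level `L`;
these leave the frames above `L` intact, so the data of the pending minimum survive them. -/
theorem works_mid {L : ℕ} (hS : Space Γ G J a b M) (hLJ : L < J) (ih : Works Γ G J a b L)
    {Q : St → Prop} {s0 : St} {u v : Fin n} (hret : Returns Γ G J a b (L + 1) u v Q s0) (m : ℕ) :
    ∀ (x : Fin n) (s : St), n = x + m → Frame G J a b L u v x x s0 s →
      s.var 60 = L → s.var 61 = (u : ℕ) → s.var 62 = (x : ℕ) → s.var 63 = 1 →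
      s.arr 7 ((L : ℤ) + 1) = 0 → recur.wp Γ (fun _ => Q) s := by
  have hone := Γ.one_le
  have e1 := hS.depth
  have e2 := hS.bound
  have habs := fun {j u v z} => dist2_abs_le (w := cwAt G a b)
    (by have := hS.nonneg; omega : 0 ≤ 2 * M) hS.abs_le j (u := u) (v := v) (z := z)
  induction m with
  | zero => intro x s hm; have := x.isLt; omega
  | succ m ihm =>
    intro x s hm hF h60 h61 h62 h63 h7
    have hxn := x.isLt
    have hl : (L : ℤ) < L + 1 := by omega
    refine ih Q s u x hF.env h60 h61 h62 h63 hF.run ?_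
    intro s1 hE1 h60 h63 h66 hd1 ha1
    have hF1 := hF.of_above hE1 h66 ha1
    have h7' := (ha1 7 _ hl).trans h7
    refine recur_return h63 h66 (retStep_wp hS hLJ hE1 h60 ⟨fun h => by omega, fun _ => ?_⟩)
    simp only [retFst, wp_ite, wp_seq, wp_asg, wp_sto, Ex.ok_V, Ex.ok_A, Ex.ok_sub, Ex.eval_sub,
      Ex.ok_C, Ex.eval_V, Ex.eval_A, Ex.eval_C, St.set_var, St.set_arr, St.put_var, St.put_arr]
    norm_num
    constructorm* _ ∧ _
    · intro hpos
      constructorm* _ ∧ _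
      any_goals omega
      have hne := hd1.pos_iff.1 hpos
      refine ih Q _ x v ?_ ?_ ?_ ?_ ?_ ?_ ?_
      · exact ⟨by simpa using hE1.nodes, by simpa using hE1.edges, by simpa using hE1.depth,
          by simpa using hE1.den, by simpa using hE1.num⟩
      · simp
      · simpa using hF1.mid
      · simpa using hF1.snd
      · simp
      · simpa using h66
      intro s2 hE2 g60 g63 g66 hd2 ha2
      have hF2 : Frame G J a b L u v x x s0 s2 := by
        refine Frame.of_above (s := _) ⟨?_, ?_, ?_, ?_, ?_, ?_, ?_⟩ hE2 g66 ha2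
        · exact ⟨by simpa using hE1.nodes, by simpa using hE1.edges, by simpa using hE1.depth,
            by simpa using hE1.den, by simpa using hE1.num⟩
        · simpa using h66
        · simpa using hF1.fst
        · simpa using hF1.snd
        · simpa using hF1.mid
        · simpa using hF1.best
        · intro c i hi
          have : i ≠ (L : ℤ) + 1 := by omega
          simpa [this] using hF1.above c i hi
      have g7 := ha2 7 _ hl
      have g4 := ha2 4 _ hl
      simp at g7 g4
      have hz1 := hd1.eq hne
      refine recur_return g63 g66 (retStep_wp hS hLJ hE2 g60 ⟨fun _ => ?_, fun h => by omega⟩)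
      simp only [retSnd, wp_ite, wp_seq, wp_asg, wp_sto, wp_skip, Ex.ok_V, Ex.ok_A, Ex.ok_lt,
        Ex.ok_add, Ex.ok_or, Ex.eval_or, Ex.ok_C, Ex.eval_V, Ex.eval_A, Ex.eval_lt, Ex.eval_add,
        Ex.eval_C, zero_lt_ite_one, St.set_var, St.set_arr, St.put_var, St.put_arr]
      norm_num
      rw [g4]
      have hfin : ∀ s3 : St, Frame G J a b L u v x (x + 1) s0 s3 → s3.var 60 = (L : ℤ) + 1 →
          s3.var 63 = 0 → nextMid.wp Γ (fun _ s' => recur.wp Γ (fun _ => Q) s') s3 :=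
        fun s3 h h' h'' => nextMid_wp hS hLJ h h' h'' (fun y hy s' => ihm y s' (by omega)) hret
      constructorm* _ ∧ _
      · intro hpos2
        have hz2 := hd2.eq (hd2.pos_iff.1 hpos2)
        have hB := hS.two_le (Nat.succ_le_of_lt hLJ)
        have b1 := habs hz1
        have b2 := habs hz2
        have b3 := hS.nonneg
        have hB' : 2 * (2 ^ L * (2 * M)) ≤ Γ.B := by rw [pow_succ] at hB; linarith
        rw [abs_le] at b1 b2
        have hbs : best (cwAt G a b) L u v (x + 1) = min (best (cwAt G a b) L u v x)
            ((s1.var 65 + s2.var 65 : ℤ) : WithTop ℤ) := by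
          rw [best_succ, hz1, hz2]; rfl
        constructorm* _ ∧ _
        any_goals omega
        · intro h
          constructorm* _ ∧ _
          any_goals omega
          refine hfin _ ⟨?_, ?_, ?_, ?_, ?_, ?_, ?_⟩ (by simp) (by simpa using g63)
          · exact ⟨by simpa using hE2.nodes, by simpa using hE2.edges, by simpa using hE2.depth,
              by simpa using hE2.den, by simpa using hE2.num⟩
          · simpa using g66
          · simpa using hF2.fst
          · simpa using hF2.snd
          · simpa using hF2.mid
          · rw [hbs]
            have := hF2.best.min_pos (c := s1.var 65 + s2.var 65) (by omega)
            simpa using this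
          · intro c i hi
            have : i ≠ (L : ℤ) + 1 := by omega
            simpa [this] using hF2.above c i hi
        · intro h1 h2
          refine hfin _ ⟨?_, ?_, ?_, ?_, ?_, ?_, ?_⟩ (by simp) (by simpa using g63)
          · exact ⟨by simpa using hE2.nodes, by simpa using hE2.edges, by simpa using hE2.depth,
              by simpa using hE2.den, by simpa using hE2.num⟩
          · simpa using g66
          · simpa using hF2.fst
          · simpa using hF2.snd
          · simpa using hF2.mid
          · rw [hbs]
            have := hF2.best.min_neg (c := s1.var 65 + s2.var 65) (by omega)
            simpa using this
          · intro c i hi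
            simpa using hF2.above c i hi
      · intro hneg2
        have htop : dist2 (cwAt G a b) L x v = ⊤ := by
          by_contra h
          have := hd2.pos_iff.2 h
          omega
        refine hfin _ ⟨?_, ?_, ?_, ?_, ?_, ?_, ?_⟩ (by simp) (by simpa using g63)
        · exact ⟨by simpa using hE2.nodes, by simpa using hE2.edges, by simpa using hE2.depth,
            by simpa using hE2.den, by simpa using hE2.num⟩
        · simpa using g66
        · simpa using hF2.fst
        · simpa using hF2.snd
        · simpa using hF2.mid
        · have := hF2.best
          rw [best_succ, htop]
          simpa using this
        · intro c i hi
          simpa using hF2.above c i hi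
    · intro hneg
      have htop : dist2 (cwAt G a b) L u x = ⊤ := by
        by_contra h
        have := hd1.pos_iff.2 h
        omega
      refine nextMid_wp hS hLJ (u := u) (v := v) (x := x) (s0 := s0) ⟨?_, ?_, ?_, ?_, ?_, ?_, ?_⟩
        (by simp) (by simpa using h63) (fun y hy s' => ihm y s' (by omega)) hret
      · exact ⟨by simpa using hE1.nodes, by simpa using hE1.edges, by simpa using hE1.depth,
          by simpa using hE1.den, by simpa using hE1.num⟩
      · simpa using h66
      · simpa using hF1.fst
      · simpa using hF1.snd
      · simpa using hF1.mid
      · have := hF1.best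
        rw [best_succ, htop]
        simpa using this
      · intro c i hi
        simpa using hF1.above c i hi

/-- Calls and returns all happen inside one flat loop, so a call is specified by continuation: if
the loop leads to `Q` from every proper return, it leads to `Q` from the call. In this form the
induction on the level goes through. -/
theorem works (hS : Space Γ G J a b M) (L : ℕ) (hL : L ≤ J) : Works Γ G J a b L := by
  induction L with
  | zero => exact works_zero hS
  | succ L ih =>
    intro Q s u v hE h60 h61 h62 h63 h66 hQ
    have hone := Γ.one_le
    have e1 := hS.depth
    have e2 := hS.bound
    have hn := u.pos
    push_cast at h60
    refine recur_call h63 h66 ?_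
    simp only [callStep, wp_ite, wp_seq, wp_asg, wp_sto, Ex.ok_V, Ex.ok_sub, Ex.ok_C, Ex.eval_V,
      Ex.eval_sub, Ex.eval_C, St.set_var, St.set_arr, St.put_var, h60]
    norm_num
    constructorm* _ ∧ _
    any_goals omega
    refine works_mid hS (by omega) (ih (by omega)) (s0 := s) hQ n ⟨0, hn⟩ _ (by simp)
      ⟨?_, ?_, ?_, ?_, ?_, ?_, ?_⟩ ?_ ?_ ?_ ?_ ?_
    · exact ⟨by simpa using hE.nodes, by simpa using hE.edges, by simpa using hE.depth,
        by simpa using hE.den, by simpa using hE.num⟩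
    · simpa using h66
    · simpa using h61
    · simpa using h62
    · simp
    · simp [best_zero, Holds]
    · intro c i hi
      have : i ≠ (L : ℤ) + 1 := by omega
      simp [this]
    · simp
    · simpa using h61
    · simp
    · simpa using h63
    · simp

theorem dist_wp (hS : Space Γ G J a b M) {s : St} (hE : Env G J a b s) {u v : Fin n}
    (hu : s.var 61 = (u : ℕ)) (hv : s.var 62 = (v : ℕ)) :
    dist.wp Γ (fun _ s' => Holds (s'.var 64) (s'.var 65) (dist2 (cwAt G a b) J u v)) s := by
  have hone := Γ.one_le
  simp only [dist, wp_seq, wp_asg, Ex.ok_V, Ex.ok_C, Ex.eval_V, Ex.eval_C, St.set_var, hE.depth]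
  norm_num
  refine ⟨by omega, works hS J le_rfl _ _ u v ?_ (by simp) (by simpa using hu) (by simpa using hv)
    (by simp) (by simp) ?_⟩
  · exact ⟨by simpa using hE.nodes, by simpa using hE.edges, by simpa using hE.depth,
      by simpa using hE.den, by simpa using hE.num⟩
  · intro s' hE' h60 h63 h66 hd _
    refine recur_return h63 h66 ?_
    simp only [retStep, wp_ite, wp_asg, Ex.ok_V, Ex.ok_lt, Ex.ok_C, Ex.eval_V, Ex.eval_lt, Ex.eval_C,
      h60, hE'.depth]
    norm_num
    refine ⟨by omega, wp_whl_stop (by norm_num) (by simp) (by simpa using hd)⟩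

end Machine

open Cmd

/-! ## The program for logarithmic space -/

section Slow

variable {n : ℕ} {G : WGraph n} {Γ : Ctx} {J : ℕ} {a b M : ℤ}

/-- The edge from `e.1` to `e.2` lies on a short closed walk reachable from `u` that has weight less
than `θ`. -/
def Closes (G : WGraph n) (J : ℕ) (a b θ : ℤ) (u : Fin n) (e : Fin n × Fin n) : Prop :=
  dist2 (cwAt G a b) J u e.1 ≠ ⊤ ∧ cwAt G a b e.1 e.2 + dist2 (cwAt G a b) J e.2 e.1 < θ

/-- A constant threshold is trivially a function of the ratio value, so `WGraph.bad_cw_iff` applies;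
only edges can have finite weight, so scanning the edge list suffices. -/
theorem exists_closes_iff {ν : Fin n → ℚ} (hν : ∀ u, G.IsRatioValue u (ν u)) (hb : 0 < b)
    (hJ : n + 1 ≤ 2 ^ J) {θ : ℤ} {R : ℚ → ℚ → Prop}
    (hR : (θ = 0 ∧ R = (· < ·)) ∨ (θ = 1 ∧ R = (· ≤ ·))) (u : Fin n) :
    (∃ e ∈ G.edgeList, Closes G J a b θ u e) ↔ R (ν u) ((a : ℚ) / b) := by
  rw [← WGraph.bad_cw_iff hν (th := fun _ => (a, b)) (f := fun _ => (a, b)) (fun _ => rfl)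
    (fun _ => hb) hR u]
  refine Iff.trans ?_ (bad_iff_dist2 hJ (by rcases hR with h | h <;> omega)).symm
  constructor
  · rintro ⟨⟨y, x⟩, -, h⟩
    exact ⟨y, x, h⟩
  · rintro ⟨y, x, h1, h2⟩
    refine ⟨(y, x), G.mem_edgeList.2 ?_, h1, h2⟩
    by_contra hne
    have : cwAt G a b y x = ⊤ := by
      by_contra h
      exact hne (WGraph.cw_ne_top.1 h).1
    change cwAt G a b y x + _ < _ at h2
    rw [this, top_add] at h2
    exact not_top_lt h2

/-- One of the first `i` edges lies on such a closed walk. -/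
def Found (G : WGraph n) (J : ℕ) (a b θ : ℤ) (u : Fin n) (i : ℕ) : Prop :=
  ∃ e ∈ G.edgeList.take i, Closes G J a b θ u e

/-- Compare the weight of the closed walk through the edge at `57` with the threshold. -/
def compare : Cmd :=
  asg 58 (.V 51 * .R (.V 57 + .C 2) - .V 52 * .R (.V 57 + .C 3) + .V 65) ;;
  ite (.lt (.V 58) (.C 0)) (asg 54 (.C 1)) skip ;;
  ite (.lt (.V 58) (.C 1)) (asg 55 (.C 1)) skip

/-- Look for a closed walk through the edge at `57`. -/
def closeWalk : Cmd :=
  asg 61 (.R (.V 57 + .C 1)) ;; asg 62 (.R (.V 57)) ;; dist ;; ite (.V 64) compare skip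

/-- Compare the ratio value of node `50` with the fraction of variables `52` and `51`. -/
def test : Cmd :=
  asg 54 (.C 0) ;; asg 55 (.C 0) ;;
  loopTo 56 (.V 3) (
    asg 57 (.C 4 * .V 56 + .C 2) ;; asg 61 (.V 50) ;; asg 62 (.R (.V 57)) ;; dist ;;
    ite (.V 64) closeWalk skip) ;;
  ite (.and (.V 55) (.lt (.V 54) (.C 1))) (asg 53 (.C 1)) skip

/-- Variables `54` and `55` record light closed walks for `θ = 0` and `θ = 1`; the ratio value
equals `a / b` exactly when the second is found and the first is not. -/
theorem test_wp (hS : Space Γ G J a b M) {ν : Fin n → ℚ} (hν : ∀ u, G.IsRatioValue u (ν u))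
    (hb : 0 < b) (hJ : n + 1 ≤ 2 ^ J) {s : St} (hE : Env G J a b s) {u : Fin n}
    (h50 : s.var 50 = (u : ℕ)) (h53 : s.var 53 = 0) :
    test.wp Γ (fun _ s' => s'.var 53 = if ν u = (a : ℚ) / b then 1 else 0) s := by
  have hone := Γ.one_le
  have e1 := hS.edge
  have e2 := hS.node
  have e3 := hS.two_le le_rfl
  have e4 := hS.nonneg
  have e5 := hS.weight
  simp only [test, wp_seq, wp_asg, Ex.ok_C, Ex.eval_C]
  norm_num
  refine ⟨by omega, ?_⟩
  refine wp_loopTo' G.edges.card (fun i _ s' =>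
    Flag (s'.var 54) (Found G J a b 0 u i) ∧
    Flag (s'.var 55) (Found G J a b 1 u i))
    (by norm_num) (by rfl) (by omega) ?_ ?_ ?_ ?_
  · intro s' hf
    have := hf.var 3 (by rfl)
    simp at this
    simp [this, hE.edges]
  · simp [Flag, Found]
  · rintro i - s1 hi hf h56 ⟨hI0, hI1⟩
    rw [← G.edgeList_length] at hi
    have hlen := G.edgeList_length
    obtain ⟨w1, w2, w3, w4, w5⟩ := G.encode_edge hi
    have hmem := (G.mem_edgeList).1 (List.getElem_mem hi)
    have htake : G.edgeList.take (i + 1) = G.edgeList.take i ++ [G.edgeList[i]] :=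
      List.take_succ_eq_append_getElem hi
    obtain ⟨y, x, hxy⟩ : ∃ y x, G.edgeList[i] = (y, x) := ⟨_, _, rfl⟩
    rw [hxy] at w1 w2 w3 w4 hmem htake
    have hwt := WGraph.weight_le hmem
    have b1 := hS.left _ hmem
    have b2 := hS.right _ hmem
    rw [abs_le] at b1 b2 hwt
    rw [← hS.inp] at w1 w2 w3 w4 w5
    have hxn := x.isLt
    have hyn := y.isLt
    have hE1 : Env G J a b s1 := Env.of_fr (s := (s.set 54 0).set 55 0)
      ⟨hE.1, hE.2, hE.3, hE.4, hE.5⟩ hf (by rfl)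
    have h50' := hf.var 50 (by rfl)
    simp [h50] at h50'
    have hcw : cwAt G a b y x =
        ((b * G.wt (y, x) - a * (G.wt' (y, x) : ℕ) : ℤ) : WithTop ℤ) :=
      WGraph.cw_eq.2 ⟨hmem, rfl, rfl⟩
    have hno : ∀ s' : St, s'.var 54 = s1.var 54 → s'.var 55 = s1.var 55 →
        (∀ θ : ℤ, ¬ Closes G J a b θ u (y, x)) →
        Flag (s'.var 54) (Found G J a b 0 u (i + 1)) ∧
        Flag (s'.var 55) (Found G J a b 1 u (i + 1)) := by
      intro s' h4 h5 h
      rw [h4, h5]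
      simp only [Found, htake]
      refine ⟨hI0.congr ?_, hI1.congr ?_⟩
      all_goals
        constructor
        · rintro ⟨e, he, h'⟩; exact ⟨e, List.mem_append_left _ he, h'⟩
        · rintro ⟨e, he, h'⟩
          rcases List.mem_append.1 he with he | he
          · exact ⟨e, he, h'⟩
          · rw [List.mem_singleton.1 he] at h'; exact absurd h' (h _)
    simp only [wp_seq, wp_asg, Ex.ok_V, Ex.ok_C, Ex.ok_R, Ex.ok_add, Ex.ok_mul, Ctx.bd, Ex.eval_R,
      Ex.eval_mul, Ex.eval_V, Ex.eval_C, Ex.eval_add, St.set_var, h56]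
    norm_num
    rw [w1]
    constructorm* _ ∧ _
    any_goals omega
    refine wp_use (dist_wp hS (s := ((s1.set 57 (4 * (i : ℤ) + 2)).set 61 (s1.var 50)).set 62
      ((y : ℕ) : ℤ)) (u := u) (v := y) ⟨hE1.1, hE1.2, hE1.3, hE1.4, hE1.5⟩
      (by simpa using h50') (by simp)) ?_
    rintro - s2 hd1 hf2
    have hE2 : Env G J a b s2 := Env.of_fr (s := ((s1.set 57 (4 * (i : ℤ) + 2)).set 61
      (s1.var 50)).set 62 ((y : ℕ) : ℤ)) ⟨hE1.1, hE1.2, hE1.3, hE1.4, hE1.5⟩ hf2 (by rfl)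
    have g57 := hf2.var 57 (by rfl)
    have g54 := hf2.var 54 (by rfl)
    have g55 := hf2.var 55 (by rfl)
    simp at g57 g54 g55
    refine ⟨fun hpos => ?_, fun hneg => ?_⟩
    swap
    · refine hno s2 g54 g55 fun θ h => ?_
      have := hd1.pos_iff.2 h.1
      omega
    have hne := hd1.pos_iff.1 hpos
    simp only [closeWalk, wp_seq, wp_asg, Ex.ok_V, Ex.ok_C, Ex.ok_R, Ex.ok_add, Ctx.bd, Ex.eval_R,
      Ex.eval_V, Ex.eval_C, Ex.eval_add, St.set_var, g57]
    norm_num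
    rw [w1, w2]
    constructorm* _ ∧ _
    any_goals omega
    refine wp_use (dist_wp hS (s := (s2.set 61 ((x : ℕ) : ℤ)).set 62 ((y : ℕ) : ℤ)) (u := x)
      (v := y) ⟨hE2.1, hE2.2, hE2.3, hE2.4, hE2.5⟩ (by simp) (by simp)) ?_
    rintro - s3 hd2 hf3
    have hE3 : Env G J a b s3 := Env.of_fr (s := (s2.set 61 ((x : ℕ) : ℤ)).set 62 ((y : ℕ) : ℤ))
      ⟨hE2.1, hE2.2, hE2.3, hE2.4, hE2.5⟩ hf3 (by rfl)
    have k57 := hf3.var 57 (by rfl)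
    have k54 := hf3.var 54 (by rfl)
    have k55 := hf3.var 55 (by rfl)
    simp [g57, g54, g55] at k57 k54 k55
    refine ⟨fun hpos2 => ?_, fun hneg => ?_⟩
    swap
    · refine hno s3 k54 k55 fun θ h => ?_
      have htop : dist2 (cwAt G a b) J x y = ⊤ := by
        by_contra h'
        have := hd2.pos_iff.2 h'
        omega
      have := h.2
      simp only [htop, add_top] at this
      exact not_top_lt this
    have hz := hd2.eq (hd2.pos_iff.1 hpos2)
    have habs := dist2_abs_le (by omega : 0 ≤ 2 * M) hS.abs_le J hz
    rw [abs_le] at habs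
    have hcl : ∀ θ : ℤ, Closes G J a b θ u (y, x) ↔
        b * G.wt (y, x) - a * (G.wt' (y, x) : ℕ) + s3.var 65 < θ := by
      intro θ
      simp only [Closes, hz, hcw, hne, ne_eq, not_false_eq_true, true_and]
      norm_cast
    have hflag : ∀ (z z' θ : ℤ), Flag z (Found G J a b θ u i) →
        (b * G.wt (y, x) - a * (G.wt' (y, x) : ℕ) + s3.var 65 < θ → z' = 1) →
        (¬ b * G.wt (y, x) - a * (G.wt' (y, x) : ℕ) + s3.var 65 < θ → z' = z) →
        Flag z' (Found G J a b θ u (i + 1)) := by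
      intro z z' θ hz h1 h2
      simp only [Found, htake]
      by_cases h : b * G.wt (y, x) - a * (G.wt' (y, x) : ℕ) + s3.var 65 < θ
      · exact Or.inl ⟨h1 h, _, List.mem_append_right _ (List.mem_singleton_self _), (hcl θ).2 h⟩
      · rw [h2 h]
        refine hz.congr ⟨?_, ?_⟩
        · rintro ⟨e, he, h'⟩; exact ⟨e, List.mem_append_left _ he, h'⟩
        · rintro ⟨e, he, h'⟩
          rcases List.mem_append.1 he with he | he
          · exact ⟨e, he, h'⟩
          · rw [List.mem_singleton.1 he] at h'; exact absurd ((hcl θ).1 h') h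
    simp only [compare, wp_seq, wp_asg, wp_ite, wp_skip, Ex.ok_V, Ex.ok_C, Ex.ok_R, Ex.ok_add,
      Ex.ok_mul, Ex.ok_sub, Ex.ok_lt, Ex.eval_lt, Ex.eval_sub, Ctx.bd, Ex.eval_R, Ex.eval_mul, Ex.eval_V,
      Ex.eval_C, Ex.eval_add, St.set_var, k57, hE3.den, hE3.num, zero_lt_ite_one]
    norm_num
    rw [w3, w4]
    constructorm* _ ∧ _
    any_goals omega
    · intro h0
      constructorm* _ ∧ _
      any_goals omega
      · intro h1
        constructorm* _ ∧ _
        any_goals omega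
        · exact hflag _ _ _ hI0 (fun _ => rfl) (fun h => absurd h0 h)
        · exact hflag _ _ _ hI1 (fun _ => rfl) (fun h => absurd h (by omega))
    · intro h0
      constructorm* _ ∧ _
      any_goals omega
      · intro h1
        constructorm* _ ∧ _
        any_goals omega
        · exact hflag _ _ _ hI0 (fun h => by omega) (fun _ => by simpa using k54)
        · exact hflag _ _ _ hI1 (fun _ => rfl) (fun h => absurd h (by omega))
      · intro h1
        constructorm* _ ∧ _
        · exact hflag _ _ _ hI0 (fun h => by omega) (fun _ => by simpa using k54)
        · exact hflag _ _ _ hI1 (fun h => by omega) (fun _ => by simpa using k55)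
  · rintro τ s1 hf - ⟨hI0, hI1⟩
    rw [← G.edgeList_length, Found, List.take_length] at hI0 hI1
    have hI0 := hI0.congr (exists_closes_iff hν hb hJ (Or.inl ⟨rfl, rfl⟩) u)
    have hI1 := hI1.congr (exists_closes_iff hν hb hJ (Or.inr ⟨rfl, rfl⟩) u)
    have h53' := hf.var 53 (by rfl)
    simp [h53] at h53'
    simp only [wp_ite, wp_asg, wp_skip, Ex.ok_and, Ex.ok_V, Ex.ok_lt, Ex.ok_C, Ex.eval_and,
      Ex.eval_V, Ex.eval_lt, Ex.eval_C, zero_lt_ite_one, hI1.pos_iff, St.set_var]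
    have h0 : s1.var 54 < 1 ↔ ¬ ν u < (a : ℚ) / b := by
      rw [← hI0.pos_iff]; omega
    simp only [h0]
    norm_num
    refine ⟨by omega, fun h1 h2 => ⟨by omega, le_antisymm h1 h2⟩, fun h => ?_⟩
    rw [h53', if_neg]
    intro heq
    simp [heq] at h

/-- A representation of `q` is a multiple of the one in lowest terms, and a denominator not
exceeding the least one leaves only the factor `1`. -/
theorem eq_num_den_of_eq_div {q : ℚ} (hb : 0 < b) (hbq : b ≤ q.den) (h : q = (a : ℚ) / b) :
    a = q.num ∧ b = q.den := by
  obtain ⟨c, h1, h2⟩ := Rat.exists_eq_mul_div_num_and_eq_mul_div_den a (d := b) hb.ne'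
  rw [← h] at h1 h2
  have hq : (0 : ℤ) < q.den := by exact_mod_cast q.den_pos
  have hc : c = 1 := by nlinarith
  rw [hc, one_mul] at h1 h2
  exact ⟨h1, h2⟩

/-- Try all numerators. -/
def tryNums : Cmd :=
  asg 52 (.C 0 - .V 6) ;;
  whl (.and (.lt (.V 53) (.C 1)) (.lt (.V 52) (.V 6 + .C 1)))
    (test ;; ite (.V 53) skip (asg 52 (.V 52 + .C 1)))

/-- Enough room for all thresholds that occur. -/
structure Rooms (Γ : Ctx) (G : WGraph n) (J N : ℕ) (M : ℤ) : Prop where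
  space : ∀ a b : ℤ, |a| ≤ N → 0 ≤ b → b ≤ N → Space Γ G J a b M
  bound : (N : ℤ) + 10 ≤ Γ.B
  depth : n + 1 ≤ 2 ^ J

variable {N : ℕ}

/-- Since `b` does not exceed the true denominator, a hit must be in lowest terms; for the true
denominator, the numerator is met before the scan of `-N, …, N` ends. -/
theorem tryNums_wp (hS : Rooms Γ G J N M) {ν : Fin n → ℚ} (hν : ∀ u, G.IsRatioValue u (ν u))
    {s : St} {u : Fin n} (hnum : |(ν u).num| ≤ N) (hden : (ν u).den ≤ N) (h2 : s.var 2 = n)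
    (h3 : s.var 3 = G.edges.card) (h4 : s.var 4 = J) (h6 : s.var 6 = N) (hb : 0 < b)
    (hbν : b ≤ (ν u).den) (h51 : s.var 51 = b) (h50 : s.var 50 = (u : ℕ)) (h53 : s.var 53 = 0) :
    tryNums.wp Γ (fun _ s' => s'.var 53 = 0 ∧ b ≠ (ν u).den ∨
      s'.var 53 = 1 ∧ s'.var 52 = (ν u).num ∧ b = (ν u).den) s := by
  have hone := Γ.one_le
  have hB := hS.bound
  rw [abs_le] at hnum
  rw [tryNums, wp_seq, wp_asg]
  refine ⟨by norm_num, ?_, ?_⟩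
  · simp [h6]; omega
  simp only [Ex.eval_sub, Ex.eval_C, Ex.eval_V, h6, zero_sub]
  refine wp_whl (fun i _ s' =>
    s'.var 53 = 0 ∧ -(N : ℤ) ≤ s'.var 52 ∧ s'.var 52 + i = N + 1 ∧
      (b = (ν u).den → s'.var 52 ≤ (ν u).num) ∨
    s'.var 53 = 1 ∧ s'.var 52 = (ν u).num ∧ b = (ν u).den) (2 * N + 1) ?_ ?_ ?_
  · refine Or.inl ⟨by simpa using h53, by simp, by simp; omega, fun _ => by simp; omega⟩
  · rintro i - s1 hf hI
    have g6 := hf.var 6 (by rfl)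
    have g51 := hf.var 51 (by rfl)
    have g50 := hf.var 50 (by rfl)
    simp [h6, h51, h50] at g6 g51 g50
    refine ⟨by simp [g6]; omega, fun hpos => ?_⟩
    simp only [Ex.eval_and, Ex.eval_lt, Ex.eval_V, Ex.eval_C, Ex.eval_add, zero_lt_ite_one, g6] at hpos
    rcases hI with ⟨g53, ha1, ha2, ha3⟩ | ⟨g53, -⟩
    swap
    · omega
    refine ⟨i - 1, by omega, ?_⟩
    have hSp := hS.space (s1.var 52) b (abs_le.2 ⟨ha1, by omega⟩) hb.le (by omega)
    have hE : Env G J (s1.var 52) b s1 := by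
      have k2 := hf.var 2 (by rfl)
      have k3 := hf.var 3 (by rfl)
      have k4 := hf.var 4 (by rfl)
      simp [h2, h3, h4] at k2 k3 k4
      exact ⟨k2, k3, k4, g51, rfl⟩
    rw [wp_seq]
    refine wp_use (test_wp hSp hν hb hS.depth hE g50 g53) ?_
    rintro - s2 ht hf2
    have k52 := hf2.var 52 (by rfl)
    simp only [wp_ite, wp_skip, wp_asg, Ex.ok_V, Ex.eval_V, Ex.ok_add, Ex.ok_C, Ex.eval_add, Ex.eval_C,
      ht, k52, zero_lt_ite_one, St.set_var]
    norm_num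
    refine ⟨fun h => ?_, fun h => ?_⟩
    · obtain ⟨h1, h2⟩ := eq_num_den_of_eq_div hb hbν h
      exact Or.inr ⟨h, h1, h2⟩
    · constructorm* _ ∧ _
      any_goals omega
      refine Or.inl ⟨h, by omega, by omega, fun hb' => ?_⟩
      have := ha3 hb'
      rcases this.eq_or_lt with h' | h'
      · exfalso
        apply h
        rw [h', hb', Int.cast_natCast]
        exact (Rat.num_div_den _).symm
      · omega
  · rintro i - s1 hf hI hneg
    have g6 := hf.var 6 (by rfl)
    simp [h6] at g6
    simp only [Ex.eval_and, Ex.eval_lt, Ex.eval_V, Ex.eval_C, Ex.eval_add, zero_lt_ite_one, g6] at hneg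
    rcases hI with ⟨g53, ha1, ha2, ha3⟩ | h
    · refine Or.inl ⟨g53, fun hb' => ?_⟩
      have := ha3 hb'
      omega
    · exact Or.inr h

/-- Try all denominators. -/
def tryDens : Cmd :=
  asg 51 (.C 0) ;; asg 53 (.C 0) ;; whl (.lt (.V 53) (.C 1)) (asg 51 (.V 51 + .C 1) ;; tryNums)

/-- All smaller denominators fail, so the loop stops exactly at the denominator of the ratio value,
which serves as the variant. -/
theorem tryDens_wp (hS : Rooms Γ G J N M) {ν : Fin n → ℚ} (hν : ∀ u, G.IsRatioValue u (ν u))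
    {s : St} {u : Fin n} (hnum : |(ν u).num| ≤ N) (hden : (ν u).den ≤ N) (h2 : s.var 2 = n)
    (h3 : s.var 3 = G.edges.card) (h4 : s.var 4 = J) (h6 : s.var 6 = N)
    (h50 : s.var 50 = (u : ℕ)) :
    tryDens.wp Γ (fun _ s' => s'.var 52 = (ν u).num ∧ s'.var 51 = (ν u).den) s := by
  have hone := Γ.one_le
  have hB := hS.bound
  have hpos := (ν u).den_pos
  simp only [tryDens, wp_seq, wp_asg, Ex.ok_C, Ex.eval_C]
  norm_num
  refine ⟨by omega, ?_⟩
  refine wp_whl (fun i _ s' =>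
    (s'.var 53 = 0 ∧ 0 ≤ s'.var 51 ∧ s'.var 51 + i = (ν u).den ∧ 1 ≤ i) ∨
    s'.var 53 = 1 ∧ s'.var 52 = (ν u).num ∧ s'.var 51 = (ν u).den) (ν u).den ?_ ?_ ?_
  · exact Or.inl ⟨by simp, by simp, by simp, hpos⟩
  · rintro i - s1 hf hI
    refine ⟨by simp; omega, fun hp => ?_⟩
    simp only [Ex.eval_lt, Ex.eval_V, Ex.eval_C, zero_lt_ite_one] at hp
    rcases hI with ⟨g53, hb0, hb1, hi⟩ | ⟨g53, -⟩
    swap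
    · omega
    refine ⟨i - 1, by omega, ?_⟩
    rw [wp_seq, wp_asg]
    refine ⟨by norm_num, ?_, ?_⟩
    · simp; omega
    have k2 := hf.var 2 (by rfl)
    have k3 := hf.var 3 (by rfl)
    have k4 := hf.var 4 (by rfl)
    have k6 := hf.var 6 (by rfl)
    have k50 := hf.var 50 (by rfl)
    simp [h2, h3, h4, h6, h50] at k2 k3 k4 k6 k50
    refine wp_use (tryNums_wp hS hν hnum hden (s := s1.set 51 (s1.var 51 + 1)) (b := s1.var 51 + 1)
      (by simpa using k2) (by simpa using k3) (by simpa using k4) (by simpa using k6) (by omega)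
      (by omega) (by simp) (by simpa using k50) (by simpa using g53)) ?_
    rintro - s2 h hf2
    have k51 := hf2.var 51 (by rfl)
    simp at k51
    rcases h with ⟨h, h'⟩ | ⟨h, h', h''⟩
    · exact Or.inl ⟨h, by omega, by omega, by omega⟩
    · exact Or.inr ⟨h, h', by omega⟩
  · rintro i - s1 hf hI hneg
    simp only [Ex.eval_lt, Ex.eval_V, Ex.eval_C, zero_lt_ite_one] at hneg
    rcases hI with ⟨g53, -⟩ | h
    · omega
    · exact h.2

end Slow

open Cmd

/-! ### Parameters and assembly of the program for small space. -/

section Slow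

variable {n : ℕ} {G : WGraph n} {Γ : Ctx}

/-- Put the least `j` such that `2 ^ j` is beyond the number of nodes into variable `4`. -/
def findDepth : Cmd :=
  asg 4 (.C 0) ;; asg 5 (.C 1) ;;
  whl (.lt (.V 5) (.V 2 + .C 1)) (asg 5 (.C 2 * .V 5) ;; asg 4 (.V 4 + .C 1))

theorem findDepth_wp (hn : 0 < n) (hB : 2 * (n : ℤ) + 10 ≤ Γ.B) {s : St} (h2 : s.var 2 = n) :
    findDepth.wp Γ (fun _ s' => ∃ j : ℕ, s'.var 4 = j ∧ n + 1 ≤ 2 ^ j ∧ 2 ^ j ≤ 2 * n) s := by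
  simp only [findDepth, wp_seq, wp_asg, Ex.ok_C, Ex.eval_C]
  norm_num
  constructorm* _ ∧ _
  any_goals omega
  refine wp_whl (fun i _ s' => ∃ j : ℕ, i + j = n + 1 ∧ s'.var 4 = j ∧ s'.var 5 = (2 ^ j : ℕ) ∧
    2 ^ j ≤ 2 * n) (n + 1) ⟨0, rfl, by simp, by simp, by simp; omega⟩ ?_ ?_
  · rintro i - s1 hf ⟨j, hij, g4, g5, hj⟩
    have g2 := hf.var 2 (by rfl)
    simp [h2] at g2
    have := Nat.lt_two_pow_self (n := j)
    simp only [Ex.ok_lt, Ex.ok_V, Ex.ok_add, Ex.ok_C, Ex.eval_lt, Ex.eval_V, Ex.eval_add, Ex.eval_C,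
      g2, g5, zero_lt_ite_one, wp_seq, wp_asg, Ex.ok_mul, Ex.eval_mul, St.set_var, g4]
    refine ⟨by norm_num; omega, fun h => ⟨i - 1, by omega, ?_⟩⟩
    have h' : 2 ^ j ≤ n := by omega
    norm_num
    norm_cast
    constructorm* _ ∧ _
    any_goals omega
    exact ⟨j + 1, by omega, by norm_num, by rw [pow_succ]; ring, by rw [pow_succ]; omega⟩
  · rintro i - s1 hf ⟨j, hij, g4, g5, hj⟩ h
    have g2 := hf.var 2 (by rfl)
    simp [h2] at g2
    simp only [Ex.eval_lt, Ex.eval_V, Ex.eval_add, Ex.eval_C, g2, g5, zero_lt_ite_one] at h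
    exact ⟨j, g4, by omega, hj⟩

/-- Raise variable `6` to the value of an expression. -/
def raise (e : Ex) : Cmd := ite (.lt (.V 6) e) (asg 6 e) skip

theorem raise_wp {e : Ex} {Q : ℕ → St → Prop} {s : St} (he : e.ok Γ s)
    (h : ∀ t, Q t (s.set 6 (max (s.var 6) (e.eval Γ s)))) : (raise e).wp Γ Q s := by
  simp only [raise, wp_ite, wp_asg, wp_skip, Ex.ok_lt, Ex.ok_V, Ex.eval_lt, zero_lt_ite_one]
  refine ⟨⟨by norm_num, he⟩, fun hlt => ⟨by norm_num, he, ?_⟩, fun hge => ?_⟩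
  · rw [Ex.eval_V] at hlt
    rw [max_eq_right hlt.le] at h
    exact h _
  · rw [Ex.eval_V] at hge
    rw [max_eq_left (not_lt.1 hge)] at h
    have : s.set 6 (s.var 6) = s := by
      ext x
      · by_cases hx : x = 6 <;> simp [hx]
      · rfl
      · rfl
    rw [this] at h
    exact h _

/-- Put the largest absolute value of a weight into variable `6`. -/
def findWeight : Cmd :=
  asg 6 (.C 0) ;;
  loopTo 7 (.V 3) (
    asg 8 (.C 4 * .V 7 + .C 2) ;; raise (.R (.V 8 + .C 2)) ;; raise (.C 0 - .R (.V 8 + .C 2)) ;;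
    raise (.R (.V 8 + .C 3)))

theorem findWeight_wp (hinp : Γ.inp = G.encode) (hcard : 4 * (G.edges.card : ℤ) + 10 ≤ Γ.B)
    (hW : (G.maxWeight : ℤ) ≤ Γ.B) {s : St} (h3 : s.var 3 = G.edges.card) :
    findWeight.wp Γ (fun _ s' => s'.var 6 = G.maxWeight) s := by
  have hone := Γ.one_le
  simp only [findWeight, wp_seq, wp_asg, Ex.ok_C, Ex.eval_C]
  norm_num
  refine ⟨by omega, ?_⟩
  refine wp_loopTo' G.edges.card (fun i _ s' => 0 ≤ s'.var 6 ∧ s'.var 6 ≤ G.maxWeight ∧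
    ∀ e ∈ G.edgeList.take i, G.wt e ≤ s'.var 6 ∧ -G.wt e ≤ s'.var 6 ∧ (G.wt' e : ℕ) ≤ s'.var 6)
    (by norm_num) (by rfl) (by omega) ?_ ?_ ?_ ?_
  · intro s' hf
    have := hf.var 3 (by rfl)
    simp at this
    simp [this, h3]
  · simp
  · rintro i - s1 hi hf h7 ⟨ha, hb, hI⟩
    rw [← G.edgeList_length] at hi
    have hlen := G.edgeList_length
    obtain ⟨-, -, w3, w4, w5⟩ := G.encode_edge hi
    have hmem := (G.mem_edgeList).1 (List.getElem_mem hi)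
    have htake : G.edgeList.take (i + 1) = G.edgeList.take i ++ [G.edgeList[i]] :=
      List.take_succ_eq_append_getElem hi
    have hwt := WGraph.weight_le hmem
    generalize G.edgeList[i] = e at *
    rw [abs_le] at hwt
    rw [← hinp] at w3 w4 w5
    simp only [wp_seq, wp_asg, Ex.ok_V, Ex.ok_C, Ex.ok_add, Ex.ok_mul, Ex.eval_mul, Ex.eval_V,
      Ex.eval_C, Ex.eval_add, h7]
    norm_num
    constructorm* _ ∧ _
    any_goals omega
    refine raise_wp ?_ fun _ => raise_wp ?_ fun _ => raise_wp ?_ fun _ => ?_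
    all_goals
      simp only [Ex.ok_R, Ex.ok_V, Ex.ok_C, Ex.ok_add, Ex.ok_sub, Ex.eval_sub, Ex.eval_R, Ex.eval_V,
        Ex.eval_C, Ex.eval_add, St.set_var, Ctx.bd]
      norm_num
      simp only [w3, w4]
    · omega
    · omega
    · omega
    · refine ⟨by omega, by omega, fun x y hf => ?_⟩
      rw [htake, List.mem_append, List.mem_singleton] at hf
      rcases hf with hf | rfl
      · have := hI _ hf
        omega
      · omega
  · rintro τ s1 hf - ⟨ha, hb, hI⟩
    rw [← G.edgeList_length, List.take_length] at hI
    refine le_antisymm hb ?_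
    obtain ⟨z, hz⟩ := Int.eq_ofNat_of_zero_le ha
    rw [hz] at hI ⊢
    norm_cast
    refine Finset.sup_le fun e he => ?_
    have := hI e (G.mem_edgeList.2 he)
    exact max_le (by omega) (by omega)

/-- The program that computes the ratio values in logarithmic space. -/
def slow : Cmd :=
  asg 2 (.R (.C 0)) ;; asg 3 (.R (.C 1)) ;; findDepth ;; findWeight ;; asg 6 (.V 6 * .V 2) ;;
  loopTo 50 (.V 2) (tryDens ;; wr (.V 52) ;; wr (.V 51))

theorem slow_small : slow.comp.small 120 8 = true := by rfl

theorem slow_wp (hn : 0 < n) (hinp : Γ.inp = G.encode) (hcard : 4 * (G.edges.card : ℤ) + 10 ≤ Γ.B)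
    (hlog : (Nat.log 2 n : ℤ) + 2 ≤ Γ.E) (hE : Γ.E + 10 ≤ Γ.B)
    (hN : 2 * ((n * G.maxWeight : ℕ) : ℤ) + 10 ≤ Γ.B)
    (hV : (((2 * n + 1) * (2 * (n * G.maxWeight * G.maxWeight)) : ℕ) : ℤ) ≤ Γ.B)
    {ν : Fin n → ℚ} (hν : ∀ u, G.IsRatioValue u (ν u)) {s : St} (ho : s.out = []) :
    slow.wp Γ (fun _ s' => s'.out = encodeValues ν) s := by
  have hone := Γ.one_le
  have hbd := fun u => (hν u).bounds
  have hnW : 1 ≤ n * G.maxWeight := (ν ⟨0, hn⟩).den_pos.trans_le (hbd ⟨0, hn⟩).2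
  have hW1 : 1 ≤ G.maxWeight := Nat.pos_of_mul_pos_left hnW
  have hnnW : n ≤ n * G.maxWeight := Nat.le_mul_of_pos_right n hW1
  have hWnW : G.maxWeight ≤ n * G.maxWeight := Nat.le_mul_of_pos_left _ hn
  have i0 : inAt Γ.inp 0 = n := by rw [hinp]; rfl
  have i1 : inAt Γ.inp 1 = G.edges.card := by rw [hinp]; rfl
  have hl : 2 ≤ Γ.inp.length := by rw [hinp]; simp [WGraph.encode]
  simp only [slow, wp_seq, wp_asg, Ex.ok_R, Ex.ok_C, Ex.eval_R, Ex.eval_C, Ctx.bd, i0, i1]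
  norm_num
  constructorm* _ ∧ _
  any_goals omega
  refine wp_use (findDepth_wp hn (by omega) (by simp)) ?_
  rintro - s1 ⟨J, h4, hJ1, hJ2⟩ hf1
  have g3 := hf1.var 3 (by rfl)
  have g2 := hf1.var 2 (by rfl)
  simp at g3 g2
  refine wp_use (findWeight_wp hinp hcard (by omega) g3) ?_
  rintro - s2 h6 hf2
  have k2 := (hf2.var 2 (by rfl)).trans g2
  have k3 := (hf2.var 3 (by rfl)).trans g3
  have k4 := (hf2.var 4 (by rfl)).trans h4
  have ko : s2.out = [] := ((hf2.out (by rfl)).trans (hf1.out (by rfl))).trans ho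
  have hJlog : J ≤ Nat.log 2 n + 1 := by
    rcases J with _ | J
    · omega
    · have := Nat.le_log_of_pow_le (b := 2) (by norm_num) (by rw [pow_succ] at hJ2; omega : 2 ^ J ≤ n)
      omega
  -- Thresholds range up to `n * W`, so `M = n * W * W` bounds both products in the weight of an
  -- edge, and `2 ^ J ≤ 2 * n` bounds the growth of the distances.
  have hR : Rooms Γ G J (n * G.maxWeight) ((n * G.maxWeight * G.maxWeight : ℕ) : ℤ) := by
    refine ⟨fun a b ha hb0 hb => ⟨hinp, hcard, by omega, by omega, hE, by omega, by positivity,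
      fun e he => ?_, fun e he => ?_, ?_⟩, by omega, hJ1⟩
    · rw [abs_mul, abs_of_nonneg hb0]
      push_cast at hb ⊢
      exact mul_le_mul hb (WGraph.weight_le he).1 (abs_nonneg _) (by positivity)
    · rw [abs_mul, Nat.abs_cast]
      push_cast at ha ⊢
      exact mul_le_mul ha (by exact_mod_cast (WGraph.weight_le he).2) (by positivity) (by positivity)
    · refine le_trans ?_ hV
      norm_cast
      exact Nat.mul_le_mul_right _ (by omega)
  have hW2 : s2.var 6 * s2.var 2 = ((n * G.maxWeight : ℕ) : ℤ) := by
    rw [h6, k2]; push_cast; ring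
  rw [hW2]
  constructorm* _ ∧ _
  any_goals omega
  refine wp_loopTo' n (fun i _ s' => s'.out = ((List.finRange n).take i).flatMap fun u =>
    [(ν u).num, ((ν u).den : ℤ)]) (by norm_num) (by rfl) (by omega) ?_ ?_ ?_ ?_
  · intro s' hf
    have := hf.var 2 (by rfl)
    simp at this
    simp [this, k2]
  · simp [ko]
  · rintro i - s3 hi hf h50 hI
    obtain ⟨v, rfl⟩ : ∃ v : Fin n, i = v := ⟨⟨i, hi⟩, rfl⟩
    have l2 := hf.var 2 (by rfl)
    have l3 := hf.var 3 (by rfl)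
    have l4 := hf.var 4 (by rfl)
    have l6 := hf.var 6 (by rfl)
    simp [k2, k3, k4] at l2 l3 l4 l6
    rw [wp_seq]
    refine wp_use (tryDens_wp hR hν (u := v) (by exact_mod_cast (hbd v).1) (hbd v).2 l2 l3 l4
      (by push_cast; exact l6) h50) ?_
    rintro - s4 ⟨h52, h51⟩ hf4
    simp only [wp_seq, wp_wr, Ex.ok_V, Ex.eval_V, St.emit_var, h51, h52]
    norm_num
    rw [hf4.out (by rfl), hI, take_finRange_flatMap]
  · rintro τ s3 hf _ hI
    rw [hI, encodeValues, List.take_of_length_le (by simp)]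

theorem slow_runs : ∃ a : ℕ, ∀ {n : ℕ} {G : WGraph n} {ν : Fin n → ℚ}, 0 < n →
    (∀ u, G.IsRatioValue u (ν u)) → ∃ t s m, Runs slow.comp G.encode t s m (encodeValues ν) ∧
      s ≤ a * (Nat.log 2 n + 1) ∧ m ≤ a * (n * G.maxWeight + 1) ^ 2 := by
  refine ⟨200, ?_⟩
  intro n G ν hn hν
  have hnW : 1 ≤ n * G.maxWeight := (ν ⟨0, hn⟩).den_pos.trans_le (hν ⟨0, hn⟩).bounds.2
  have hnnW : n ≤ n * G.maxWeight :=
    Nat.le_mul_of_pos_right n (Nat.pos_of_mul_pos_left hnW)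
  have hcard : G.edges.card ≤ n * n := by
    simpa using Finset.card_le_univ G.edges
  have hlog := Nat.log_le_self 2 n
  have h1 : n * n ≤ (n * G.maxWeight) * (n * G.maxWeight) := Nat.mul_le_mul hnnW hnnW
  have h2 : (2 * n + 1) * (2 * (n * G.maxWeight * G.maxWeight)) ≤
      6 * ((n * G.maxWeight) * (n * G.maxWeight)) := by
    calc _ ≤ (3 * n) * (2 * (n * G.maxWeight * G.maxWeight)) := Nat.mul_le_mul_right _ (by omega)
      _ = _ := by ring
  have h3 : (n * G.maxWeight + 1) ^ 2 =
      (n * G.maxWeight) * (n * G.maxWeight) + 2 * (n * G.maxWeight) + 1 := by ring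
  have hB : (1 : ℤ) ≤ ((30 * (n * G.maxWeight + 1) ^ 2 : ℕ) : ℤ) := by omega
  have hwp := slow_wp (Γ := ⟨G.encode, _, ((Nat.log 2 n + 2 : ℕ) : ℤ), fun _ => 0, hB⟩) hn rfl
    (by simp only; omega) (by simp only; omega) (by simp only; omega) (by simp only; omega)
    (by simp only; exact_mod_cast (by omega)) hν (s := ⟨fun _ => 0, fun _ _ => 0, []⟩) rfl
  -- The time is not estimated: determinism turns termination from this state into some bound `T`.
  obtain ⟨T, hT⟩ := wp_exists slow (Q := fun i t s' => t ≤ i ∧ s'.out = encodeValues ν)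
    (wp_mono slow hwp fun t s' h => ⟨t, le_rfl, h⟩)
  obtain ⟨t, s, m, hr, -, hs, hm⟩ := runs_of_wp (by norm_num) slow_small hB (by positivity) hT
  refine ⟨t, s, m, hr, hs.trans ?_, ?_⟩
  · rw [Int.toNat_natCast]
    omega
  · omega

end Slow

/-! ### Constants of the main theorem. -/

/-- The factor `2` suffices because `log 2 > 1 / 2`. -/
theorem natLog_two_le (x : ℕ) : (Nat.log 2 x : ℝ) ≤ 2 * Real.log x := by
  have h1 := Real.natLog_le_logb x 2
  have h2 := Real.log_two_gt_d9
  have h3 := Real.log_natCast_nonneg x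
  rw [Real.logb, Nat.cast_ofNat] at h1
  refine h1.trans ?_
  rw [div_le_iff₀ (by linarith)]
  nlinarith

/-- A constant factor becomes part of the exponent, as `a ≤ 2 ^ a ≤ Y ^ a`. -/
theorem mul_sq_le_pow {a C Y : ℕ} (hY : 2 ≤ Y) (h : a + 2 ≤ C) : a * Y ^ 2 ≤ Y ^ C :=
  calc a * Y ^ 2 ≤ Y ^ a * Y ^ 2 :=
        Nat.mul_le_mul_right _ (Nat.lt_two_pow_self.le.trans (Nat.pow_le_pow_left hY a))
    _ = Y ^ (a + 2) := (pow_add _ _ _).symm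
    _ ≤ Y ^ C := Nat.pow_le_pow_right (by omega) h

end RatioCycle

open RatioCycle

theorem mainTheorem3 (k w c : ℕ) :
    ∃ C : ℕ, ∀ (D : Program) (T S M : (n : ℕ) → WGraph n → ℕ),
      ConstructsDecomposition D k w c T S M →
      (∃ P : Program, ∀ (n : ℕ) (G : WGraph n), 0 < n → G.treewidth ≤ k →
        ∃ ν : Fin n → ℚ, (∀ u, G.IsRatioValue u (ν u)) ∧
          ∃ t s m : ℕ, Runs P G.encode t s m (encodeValues ν) ∧
            (t : ℝ) ≤ C * ((T n G : ℝ) + n * Real.log (lam ν)) ∧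
            s ≤ C * (S n G + n) ∧
            m ≤ (n * G.maxWeight + M n G + 1) ^ C) ∧
      (∃ P : Program, ∀ (n : ℕ) (G : WGraph n), 0 < n → G.treewidth ≤ k →
        ∃ ν : Fin n → ℚ, (∀ u, G.IsRatioValue u (ν u)) ∧
          ∃ t s m : ℕ, Runs P G.encode t s m (encodeValues ν) ∧
            (s : ℝ) ≤ C * ((S n G : ℝ) + Real.log n) ∧
            m ≤ (n * G.maxWeight + M n G + 1) ^ C) := by
  obtain ⟨a, ha⟩ := fast_runs (w + 1) c
  obtain ⟨b, hb⟩ := slow_runs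
  -- The factors `2` come from `natLog_two_le`, the final `2` from the exponent in `mul_sq_le_pow`.
  -- Both `a` and `b` are chosen before `D`.
  refine ⟨2 * a + 2 * b + 2, fun D T S M hD => ⟨⟨.seq D.capture (fast (w + 1)).comp,
    fun n G hn hk => ?_⟩, ⟨slow.comp, fun n G hn hk => ?_⟩⟩⟩
  all_goals
    obtain ⟨B, hB, -, hbal, hw, hsize, hrun⟩ := hD n G hn hk
    choose ν hν using G.exists_isRatioValue
    -- This makes the base of the power at least `2`.
    have hnW : 1 ≤ n * G.maxWeight := (ν ⟨0, hn⟩).den_pos.trans_le (hν ⟨0, hn⟩).bounds.2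
    refine ⟨ν, hν, ?_⟩
  · obtain ⟨t, s, m, hr, ht, hs, hm⟩ := ha hn hB (B.length_bag_le hw) hbal hsize hν hrun
    refine ⟨t, s, m, hr, ?_, hs.trans (Nat.mul_le_mul_right _ (by omega)),
      hm.trans (mul_sq_le_pow (by omega) (by omega))⟩
    have h1 := natLog_two_le (lam ν)
    have h2 := Real.log_natCast_nonneg (lam ν)
    have h3 : (n : ℝ) * Nat.log 2 (lam ν) ≤ n * (2 * Real.log (lam ν)) := by gcongr
    calc (t : ℝ) ≤ a * (T n G + n * Nat.log 2 (lam ν)) := by exact_mod_cast ht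
      _ ≤ a * (2 * (T n G + n * Real.log (lam ν))) := by
        have : (0 : ℝ) ≤ T n G := by positivity
        gcongr
        linarith
      _ = (2 * a) * (T n G + n * Real.log (lam ν)) := by ring
      _ ≤ _ := by
        push_cast
        have : (0 : ℝ) ≤ b := by positivity
        gcongr
        linarith
  · obtain ⟨t, s, m, hr, hs, hm⟩ := hb hn hν
    refine ⟨t, s, m, hr, ?_, (hm.trans (mul_sq_le_pow (by omega) (by omega : b + 2 ≤ _))).trans
      (Nat.pow_le_pow_left (by omega) _)⟩
    have h1 := natLog_two_le n
    have h2 := Real.log_natCast_nonneg n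
    -- The space of `D` pays for the constant term, which `log n` cannot do when `n = 1`.
    have h3 : (1 : ℝ) ≤ S n G := by exact_mod_cast hrun.space_pos
    calc (s : ℝ) ≤ b * (Nat.log 2 n + 1) := by exact_mod_cast hs
      _ ≤ b * (2 * (S n G + Real.log n)) := by
        gcongr
        linarith
      _ = (2 * b) * (S n G + Real.log n) := by ring
      _ ≤ _ := by
        push_cast
        have : (0 : ℝ) ≤ a := by positivity
        gcongr
        linarith
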